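/- **Conventions.** All categories are small (with objects and morphisms in one fixed universe). For a profunctor $\mathbb V(\bullet;\bullet\lhd\bullet)\colon \mathbb V^{op}\times\mathbb V\times\mathbb V\to\mathbf{Set}$ and presheaves $F,G$ on $\mathbb V$ put $\mathbb V(A;F\lhd G)=\int^{X,Y}\mathbb V(A;X\lhd Y)\times F(X)\times G(Y)$; an object $B$ used as an expression stands for $\mathbb V(\bullet;B)$. A *produoidal category* is a category $\mathbb V$ with two promonoidal structures $(\otimes,I)$ and $(\lhd,N)$ (splits $\mathbb V(A;B\otimes C)$, $\mathbb V(A;B\lhd C)$ and units $\mathbb V(A;I)$, $\mathbb V(A;N)$, with natural invertible associators and unitors satisfying pentagon and triangle) and natural laxators $$\psi_2\colon\mathbb V(\bullet;(X\lhd Y)\otimes(Z\lhd W))\to\mathbb V(\bullet;(X\otimes Z)\lhd(Y\otimes W)),\quad \psi_0\colon\mathbb V(\bullet;I)\to\mathbb V(\bullet;I\lhd I),$$ $$\varphi_2\colon\mathbb V(\bullet;N\otimes N)\to\mathbb V(\bullet;N),\quad \varphi_0\colon\mathbb V(\bullet;I)\to\mathbb V(\bullet;N),$$ satisfying the coherence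 equations of a duoidal category. It is *symmetric* when it has a natural isomorphism $\sigma\colon\mathbb V(A;B\otimes C)\cong\mathbb V(A;C\otimes B)$ satisfying the symmetry and hexagon equations, and *normal* when $\varphi_0$ is invertible. A *symmetric produoidal functor* $F\colon\mathbb V\to\mathbb W$ is a functor with natural maps of $\otimes$-splits, $\lhd$-splits, $I$-units and $N$-units that preserve associators, unitors, laxators and symmetry. For a symmetric monoidal category $\mathbb C$, the *spliced monoidal arrows* $\mathcal S\mathbb C$ have as objects the pairs $\binom{A}{B}$ of objects of $\mathbb C$ and $$\mathcal S\mathbb C\left(\tbinom AB;\tbinom XY\right)=\mathbb C(A;X)\times\mathbb C(Y;B),$$ $$\mathcal S\mathbb C\left(\tbinom AB;\tbinom XY\lhd\tbinom{X'}{Y'}\right)=\mathbb C(A;X)\times\mathbb C(Y;X')\times\mathbb C(Y';B),$$ $$\mathcal S\mathbb C\left(\tbinom AB;\tbinom XY\otimes\tbinom{X'}{Y'}\right)=\mathbb C(A;X\otimes X')\times\mathbb C(Y\otimes Y';B),$$ $$\mathcal S\mathbb C\left(\tbinom AB;N\right)=\mathbb C(A;B),\qquad \mathcal S\mathbb C\left(\tbinom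 AB;I\right)=\mathbb C(A;I)\times\mathbb C(I;B).$$ The *monoidal lenses* $\mathcal L\mathbb C$ have the same objects, and $$\mathcal L\mathbb C\left(\tbinom AB;\tbinom XY\right)=\int^{M}\mathbb C(A;M\otimes X)\times\mathbb C(M\otimes Y;B),$$ $$\mathcal L\mathbb C\left(\tbinom AB;\tbinom XY\lhd\tbinom{X'}{Y'}\right)=\int^{M,M'}\mathbb C(A;M\otimes X)\times\mathbb C(M\otimes Y;M'\otimes X')\times\mathbb C(M'\otimes Y';B),$$ $$\mathcal L\mathbb C\left(\tbinom AB;\tbinom XY\otimes\tbinom{X'}{Y'}\right)=\int^{M}\mathbb C(A;M\otimes X\otimes X')\times\mathbb C(M\otimes Y\otimes Y';B),$$ $$\mathcal L\mathbb C\left(\tbinom AB;N\right)=\mathbb C(A;B),\qquad \mathcal L\mathbb C\left(\tbinom AB;I\right)=\int^M\mathbb C(A;M\otimes I)\times\mathbb C(M\otimes I;B).$$ In both cases the structure maps fill holes with arrows, splits and units, and combine holes with the tensor and the symmetry of $\mathbb C$. Let $\eta\colon\mathcal S\mathbb C\to\mathcal L\mathbb C$ be the inclusion of spliced arrows as lenses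 with trivial residuals. **Theorem.** Let $\mathbb C$ be a symmetric monoidal category. 1. (*$\mathcal S\mathbb C$ is the cofree symmetric produoidal category over $\mathbb C$.*) $\mathcal S\mathbb C$ is a symmetric produoidal category, every strict symmetric monoidal functor $K\colon\mathbb D\to\mathbb C$ induces a symmetric produoidal functor $\mathcal SK\colon\mathcal S\mathbb D\to\mathcal S\mathbb C$, and $\mathcal S$ has a left adjoint (the monoidal contour): for every symmetric produoidal category $\mathbb V$ there are a symmetric monoidal category $\mathcal D\mathbb V$ and a symmetric produoidal functor $\mathbb V\to\mathcal S\mathcal D\mathbb V$ such that, for every symmetric monoidal category $\mathbb E$, each symmetric produoidal functor $\mathbb V\to\mathcal S\mathbb E$ is the composite of it with $\mathcal SK$ for exactly one strict symmetric monoidal functor $K\colon\mathcal D\mathbb V\to\mathbb E$. 2. (*$\mathcal L\mathbb C$ is the free symmetric normalization of $\mathcal S\mathbb C$.*) $\mathcal L\mathbb C$ is a normal symmetric produoidal category, $\eta$ is a symmetric produoidal functor, and for every normal symmetric produoidal category $\mathbb W$ and every symmetric produoidal functor $F\colon\mathcal S\mathbb C\to\mathbb W$ there is exactly one symmetric produoidal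 functor $G\colon\mathcal L\mathbb C\to\mathbb W$ with $G\circ\eta=F$. 3. (*$\mathcal L\mathbb C$ is computed as $\mathcal N_\sigma\mathcal S\mathbb C$.*) The functor $\eta$ is bijective on objects, and the canonical maps out of the morphisms, splits and units of the symmetric normalization $\mathcal N_\sigma\mathcal S\mathbb C$, induced by $\eta$, $\varphi_0^{-1}$ and the left unitor of $\otimes$ in $\mathcal L\mathbb C$, are isomorphisms $$\mathcal S\mathbb C(\bullet;N\otimes B)\cong\mathcal L\mathbb C(\bullet;B),\qquad \mathcal S\mathbb C(\bullet;N\otimes B\otimes C)\cong\mathcal L\mathbb C(\bullet;B\otimes C),$$ $$\mathcal S\mathbb C(\bullet;(N\otimes B)\lhd(N\otimes C))\cong\mathcal L\mathbb C(\bullet;B\lhd C),\qquad \mathcal S\mathbb C(\bullet;N)\cong\mathcal L\mathbb C(\bullet;I),\qquad \mathcal S\mathbb C(\bullet;N)\cong\mathcal L\mathbb C(\bullet;N).$$ -/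

import Mathlib

open CategoryTheory MonoidalCategory Opposite

universe u

namespace Produo

/-- Presheaves on a small category: profunctors `𝕍(•; F)` with one contravariant argument. -/
abbrev Psh (V : Type u) [SmallCategory V] := Vᵒᵖ ⥤ Type u

/-- Profunctors `𝕍(•; • ◁ •) : 𝕍ᵒᵖ × 𝕍 × 𝕍 ⥤ Set`. -/
abbrev Split (V : Type u) [SmallCategory V] := Vᵒᵖ × V × V ⥤ Type u

section Profunctors

variable {V : Type u} [SmallCategory V]

/-- The set `𝕍(A; B ◁ C)`. -/
abbrev Split.el (P : Split V) (A B C : V) : Type u := P.obj (op A, B, C)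

/-- The joint action of morphisms, `f ≻ p ≺₁ g ≺₂ h`. -/
def Split.act (P : Split V) {A A' B B' C C' : V} (f : A' ⟶ A) (g : B ⟶ B') (h : C ⟶ C')
    (p : P.el A B C) : P.el A' B' C' :=
  P.map ((f.op, g, h) : (op A, B, C) ⟶ (op A', B', C')) p

theorem Split.act_id (P : Split V) {A B C : V} (p : P.el A B C) :
    P.act (𝟙 A) (𝟙 B) (𝟙 C) p = p :=
  P.map_id_apply _ p

theorem Split.act_act (P : Split V) {A A' A'' B B' B'' C C' C'' : V}
    (f : A' ⟶ A) (g : B ⟶ B') (h : C ⟶ C') (f' : A'' ⟶ A') (g' : B' ⟶ B'') (h' : C' ⟶ C'')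
    (p : P.el A B C) :
    P.act f' g' h' (P.act f g h p) = P.act (f' ≫ f) (g ≫ g') (h ≫ h') p :=
  (P.map_comp_apply ((f.op, g, h) : (op A, B, C) ⟶ (op A', B', C'))
    ((f'.op, g', h') : (op A', B', C') ⟶ (op A'', B'', C'')) p).symm

/-- Build a profunctor from a family of sets with a jointly functorial action. -/
def Split.ofAct (E : V → V → V → Type u)
    (act : ∀ {A A' B B' C C' : V}, (A' ⟶ A) → (B ⟶ B') → (C ⟶ C') → E A B C → E A' B' C')
    (act_id : ∀ {A B C : V} (p : E A B C), act (𝟙 A) (𝟙 B) (𝟙 C) p = p)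
    (act_act : ∀ {A A' A'' B B' B'' C C' C'' : V}
      (f : A' ⟶ A) (g : B ⟶ B') (h : C ⟶ C') (f' : A'' ⟶ A') (g' : B' ⟶ B'') (h' : C' ⟶ C'')
      (p : E A B C), act f' g' h' (act f g h p) = act (f' ≫ f) (g ≫ g') (h ≫ h') p) :
    Split V where
  obj T := E T.1.unop T.2.1 T.2.2
  map m := ↾fun p => act m.1.unop m.2.1 m.2.2 p
  map_id T := by ext p; exact act_id p
  map_comp m m' := by ext p; exact (act_act _ _ _ _ _ _ p).symm

/-- The presheaf `𝕍(•; B ◁ C)`. -/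
abbrev Split.psh (P : Split V) (B C : V) : Psh V where
  obj A := P.el A.unop B C
  map f := ↾fun p => P.act f.unop (𝟙 B) (𝟙 C) p
  map_id A := by ext p; exact P.act_id p
  map_comp f g := by
    ext p
    simp [P.act_act]

/-- `𝕍(•; B ◁ C)` is functorial in `B` and `C`. -/
def Split.atMap (P : Split V) {B B' C C' : V} (g : B ⟶ B') (h : C ⟶ C') :
    P.psh B C ⟶ P.psh B' C' where
  app A := ↾fun p => P.act (𝟙 A.unop) g h p
  naturality A A' f := by
    ext p
    refine (P.act_act _ _ _ _ _ _ p).trans (Eq.trans ?_ (P.act_act _ _ _ _ _ _ p).symm)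
    simp

/-- Representatives `(p ∣ x ∣ y)` of the elements of `𝕍(A; F ◁ G)`. -/
structure ConvRep (P : Split V) (F G : Psh V) (A : V) : Type u where
  {X Y : V}
  p : P.el A X Y
  x : F.obj (op X)
  y : G.obj (op Y)

/-- The generating dinaturality relation on representatives. -/
inductive ConvRel (P : Split V) (F G : Psh V) (A : V) :
    ConvRep P F G A → ConvRep P F G A → Prop
  | dinat {X X' Y Y' : V} (a : X ⟶ X') (b : Y ⟶ Y') (p : P.el A X Y)
      (x : F.obj (op X')) (y : G.obj (op Y')) :
      ConvRel P F G A ⟨P.act (𝟙 A) a b p, x, y⟩ ⟨p, F.map a.op x, G.map b.op y⟩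

/-- The profunctor composition
`𝕍(•; F ◁ G) = ∫^{X, Y} 𝕍(•; X ◁ Y) × 𝕍(X; F) × 𝕍(Y; G)`, a coend over both variables.  All
nested expressions such as `𝕍(•; (A ⊗ B) ◁ (C ⊗ D))` or `𝕍(•; N ⊗ B)` are instances of it,
where an object `B` stands for the presheaf `𝕍(•; B)`. -/
def conv (P : Split V) (F G : Psh V) : Psh V where
  obj A := Quot (ConvRel P F G A.unop)
  map {A A'} f := ↾(Quot.map (fun r => ⟨P.act f.unop (𝟙 _) (𝟙 _) r.p, r.x, r.y⟩) (by
    rintro _ _ ⟨a, b, p, x, y⟩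
    have h := ConvRel.dinat (F := F) (G := G) a b (P.act f.unop (𝟙 _) (𝟙 _) p) x y
    simp only [P.act_act, Category.id_comp, Category.comp_id] at h ⊢
    exact h))
  map_id A := by
    ext r
    induction r using Quot.ind with
    | mk r => exact congrArg (Quot.mk _) (by simp [P.act_id])
  map_comp f g := by
    ext r
    induction r using Quot.ind with
    | mk r => exact congrArg (Quot.mk _) (by simp [P.act_act])

/-- The class of `(p ∣ x ∣ y)` in `𝕍(A; F ◁ G)`. -/
def conv.mk {P : Split V} {F G : Psh V} {A X Y : V} (p : P.el A X Y)
    (x : F.obj (op X)) (y : G.obj (op Y)) : (conv P F G).obj (op A) :=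
  Quot.mk _ ⟨p, x, y⟩

theorem conv.ind {P : Split V} {F G : Psh V} {A : V}
    {motive : (conv P F G).obj (op A) → Prop}
    (h : ∀ {X Y : V} (p : P.el A X Y) (x : F.obj (op X)) (y : G.obj (op Y)),
      motive (conv.mk p x y)) (r : (conv P F G).obj (op A)) : motive r :=
  Quot.ind (fun r => h r.p r.x r.y) r

theorem conv.dinat {P : Split V} {F G : Psh V} {A X X' Y Y' : V} (a : X ⟶ X') (b : Y ⟶ Y')
    (p : P.el A X Y) (x : F.obj (op X')) (y : G.obj (op Y')) :
    (conv.mk (P.act (𝟙 A) a b p) x y : (conv P F G).obj (op A)) =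
      conv.mk p (F.map a.op x) (G.map b.op y) :=
  Quot.sound (ConvRel.dinat a b p x y)

theorem conv.map_mk {P : Split V} {F G : Psh V} {A A' X Y : V} (f : A' ⟶ A) (p : P.el A X Y)
    (x : F.obj (op X)) (y : G.obj (op Y)) :
    (conv P F G).map f.op (conv.mk p x y) = conv.mk (P.act f (𝟙 X) (𝟙 Y) p) x y :=
  rfl

/-- Maps out of a coend. -/
def conv.desc {P : Split V} {F G H : Psh V}
    (φ : ∀ {A X Y : V}, P.el A X Y → F.obj (op X) → G.obj (op Y) → H.obj (op A))
    (hφ : ∀ {A X X' Y Y' : V} (a : X ⟶ X') (b : Y ⟶ Y') (p : P.el A X Y)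
      (x : F.obj (op X')) (y : G.obj (op Y')),
      φ (P.act (𝟙 A) a b p) x y = φ p (F.map a.op x) (G.map b.op y))
    (hn : ∀ {A A' X Y : V} (f : A' ⟶ A) (p : P.el A X Y) (x : F.obj (op X)) (y : G.obj (op Y)),
      φ (P.act f (𝟙 X) (𝟙 Y) p) x y = H.map f.op (φ p x y)) :
    conv P F G ⟶ H where
  app A := ↾(Quot.lift (fun r => φ r.p r.x r.y) (by rintro _ _ ⟨a, b, p, x, y⟩; exact hφ a b p x y))
  naturality A A' f := by
    ext r
    induction r using Quot.ind with
    | mk r => exact hn f.unop r.p r.x r.y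

/-- `𝕍(•; F ◁ G)` is functorial in `F` and `G`. -/
def conv.map {P : Split V} {F F' G G' : Psh V} (s : F ⟶ F') (t : G ⟶ G') :
    conv P F G ⟶ conv P F' G' :=
  conv.desc (fun {_ X Y} p x y => conv.mk p (s.app (op X) x) (t.app (op Y) y))
    (fun a b p x y => by
      rw [conv.dinat]
      simp only [NatTrans.naturality_apply])
    (fun f p x y => by rw [conv.map_mk])

theorem conv.map_app_mk {P : Split V} {F F' G G' : Psh V} (s : F ⟶ F') (t : G ⟶ G')
    {A X Y : V} (p : P.el A X Y) (x : F.obj (op X)) (y : G.obj (op Y)) :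
    (conv.map s t).app (op A) (conv.mk p x y) =
      conv.mk p (s.app (op X) x) (t.app (op Y) y) :=
  rfl

theorem conv.map_comp {P : Split V} {F F' F'' G G' G'' : Psh V} (s : F ⟶ F') (s' : F' ⟶ F'')
    (t : G ⟶ G') (t' : G' ⟶ G'') :
    (conv.map (s ≫ s') (t ≫ t') : conv P F G ⟶ _) = conv.map s t ≫ conv.map s' t' := by
  ext ⟨A⟩ r
  induction r using conv.ind with
  | h p x y => rfl

/-- Maps out of `𝕍(•; (F ◁ G) ◁ H)`. -/
def conv.desc₂ {P Q : Split V} {F G H K : Psh V}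
    (φ : ∀ {A U Z X Y : V}, P.el A U Z → Q.el U X Y → F.obj (op X) → G.obj (op Y) →
      H.obj (op Z) → K.obj (op A))
    (h₁ : ∀ {A U Z X X' Y Y' : V} (a : X ⟶ X') (b : Y ⟶ Y') (p : P.el A U Z) (q : Q.el U X Y)
      (x : F.obj (op X')) (y : G.obj (op Y')) (z : H.obj (op Z)),
      φ p (Q.act (𝟙 U) a b q) x y z = φ p q (F.map a.op x) (G.map b.op y) z)
    (h₂ : ∀ {A A' U U' Z Z' X Y : V} (f : A' ⟶ A) (c : U ⟶ U') (d : Z ⟶ Z') (p : P.el A U Z)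
      (q : Q.el U' X Y) (x : F.obj (op X)) (y : G.obj (op Y)) (z : H.obj (op Z')),
      φ (P.act f c d p) q x y z =
        K.map f.op (φ p (Q.act c (𝟙 X) (𝟙 Y) q) x y (H.map d.op z))) :
    conv P (conv Q F G) H ⟶ K :=
  conv.desc
    (fun {_ _ _} p r z => Quot.lift (fun s : ConvRep Q F G _ => φ p s.p s.x s.y z)
      (by rintro _ _ ⟨a, b, q, x, y⟩; exact h₁ a b p q x y z) r)
    (fun c d p r z => by
      induction r using Quot.ind with
      | mk s =>
        have h := h₂ (𝟙 _) c d p s.p s.x s.y z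
        rw [op_id, K.map_id] at h
        exact h)
    (fun f p r z => by
      induction r using Quot.ind with
      | mk s => simpa [Q.act_id] using h₂ f (𝟙 _) (𝟙 _) p s.p s.x s.y z)

/-- Maps out of `𝕍(•; (F ◁ G) ⊗ (H ◁ K))`. -/
def conv.desc₃ {P Q R : Split V} {F G H K L : Psh V}
    (φ : ∀ {A U W X Y Z T : V}, P.el A U W → Q.el U X Y → R.el W Z T →
      F.obj (op X) → G.obj (op Y) → H.obj (op Z) → K.obj (op T) → L.obj (op A))
    (h₁ : ∀ {A U W X X' Y Y' Z Z' T T' : V} (a : X ⟶ X') (b : Y ⟶ Y') (c : Z ⟶ Z') (d : T ⟶ T')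
      (p : P.el A U W) (q : Q.el U X Y) (r : R.el W Z T)
      (x : F.obj (op X')) (y : G.obj (op Y')) (z : H.obj (op Z')) (t : K.obj (op T')),
      φ p (Q.act (𝟙 U) a b q) (R.act (𝟙 W) c d r) x y z t =
        φ p q r (F.map a.op x) (G.map b.op y) (H.map c.op z) (K.map d.op t))
    (h₂ : ∀ {A A' U U' W W' X Y Z T : V} (f : A' ⟶ A) (c : U ⟶ U') (d : W ⟶ W')
      (p : P.el A U W) (q : Q.el U' X Y) (r : R.el W' Z T)
      (x : F.obj (op X)) (y : G.obj (op Y)) (z : H.obj (op Z)) (t : K.obj (op T)),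
      φ (P.act f c d p) q r x y z t =
        L.map f.op (φ p (Q.act c (𝟙 X) (𝟙 Y) q) (R.act d (𝟙 Z) (𝟙 T) r) x y z t)) :
    conv P (conv Q F G) (conv R H K) ⟶ L :=
  conv.desc
    (fun {_ _ _} p m n => Quot.lift₂
      (fun (s : ConvRep Q F G _) (s' : ConvRep R H K _) => φ p s.p s'.p s.x s.y s'.x s'.y)
      (by
        rintro s _ _ ⟨c, d, r, z, t⟩
        have := h₁ (𝟙 _) (𝟙 _) c d p s.p r s.x s.y z t
        simpa [Q.act_id] using this)
      (by
        rintro _ _ s' ⟨a, b, q, x, y⟩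
        have := h₁ a b (𝟙 _) (𝟙 _) p q s'.p x y s'.x s'.y
        simpa [R.act_id] using this) m n)
    (fun c d p m n => by
      induction m using Quot.ind with
      | mk s =>
        induction n using Quot.ind with
        | mk s' =>
          have h := h₂ (𝟙 _) c d p s.p s'.p s.x s.y s'.x s'.y
          rw [op_id, L.map_id] at h
          exact h)
    (fun f p m n => by
      induction m using Quot.ind with
      | mk s =>
        induction n using Quot.ind with
        | mk s' =>
          simpa [Q.act_id, R.act_id] using h₂ f (𝟙 _) (𝟙 _) p s.p s'.p s.x s.y s'.x s'.y)

/-- An element `x ∈ 𝕍(X; F)` as a map `𝕍(•; X) ⟶ 𝕍(•; F)`. -/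
def pt {F : Psh V} {X : V} (x : F.obj (op X)) : yoneda.obj X ⟶ F :=
  yonedaEquiv.symm x

/-- Elements `x ∈ 𝕍(X; F)` and `y ∈ 𝕍(Y; G)` as a map `𝕍(•; X ◁ Y) ⟶ 𝕍(•; F ◁ G)`. -/
def pt₂ (P : Split V) {F G : Psh V} {X Y : V} (x : F.obj (op X)) (y : G.obj (op Y)) :
    P.psh X Y ⟶ conv P F G where
  app A := ↾fun p => conv.mk p x y
  naturality A A' f := by ext p; rfl

theorem map_comp_pt {F : Psh V} {X X' : V} (a : X ⟶ X') (x : F.obj (op X')) :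
    yoneda.map a ≫ pt x = pt (F.map a.op x) := by
  ext A f
  simp [pt, yonedaEquiv]

theorem atMap_comp_pt₂ (P : Split V) {F G : Psh V} {X X' Y Y' : V} (a : X ⟶ X') (b : Y ⟶ Y')
    (x : F.obj (op X')) (y : G.obj (op Y')) :
    P.atMap a b ≫ pt₂ P x y = pt₂ P (F.map a.op x) (G.map b.op y) := by
  ext A p
  exact conv.dinat a b p x y

end Profunctors


section Structures

variable {V : Type u} [SmallCategory V]

theorem app_congr {F G : Psh V} {s t : F ⟶ G} (h : s = t) {A : Vᵒᵖ} (x : F.obj A) :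
    s.app A x = t.app A x := by
  rw [h]

theorem conv.mk_act {P : Split V} {F G : Psh V} {A A' X X' Y Y' : V} (f : A' ⟶ A) (a : X ⟶ X')
    (b : Y ⟶ Y') (p : P.el A X Y) (x : F.obj (op X')) (y : G.obj (op Y')) :
    (conv.mk (P.act f a b p) x y : (conv P F G).obj (op A')) =
      (conv P F G).map f.op (conv.mk p (F.map a.op x) (G.map b.op y)) := by
  rw [conv.map_mk, ← conv.dinat, P.act_act]
  simp

/-- The data of a promonoidal structure on `V`: the splitting profunctor, the unit profunctor and
the associator and unitors, natural in all their arguments.  Its laws are `IsPromonoidal`. -/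
structure PromonoidalData (V : Type u) [SmallCategory V] where
  /-- `𝕍(A; B ◁ C)` -/
  split : Split V
  /-- `𝕍(A; N)` -/
  unit : Psh V
  /-- `𝕍(•; (B ◁ C) ◁ D) ⟶ 𝕍(•; B ◁ (C ◁ D))` -/
  assoc (B C D : V) : conv split (split.psh B C) (yoneda.obj D) ⟶
    conv split (yoneda.obj B) (split.psh C D)
  assoc_naturality {B B' C C' D D' : V} (f : B ⟶ B') (g : C ⟶ C') (h : D ⟶ D') :
    conv.map (split.atMap f g) (yoneda.map h) ≫ assoc B' C' D' =
      assoc B C D ≫ conv.map (yoneda.map f) (split.atMap g h)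
  /-- `𝕍(•; N ◁ B) ⟶ 𝕍(•; B)` -/
  leftUnitor (B : V) : conv split unit (yoneda.obj B) ⟶ yoneda.obj B
  leftUnitor_naturality {B B' : V} (f : B ⟶ B') :
    conv.map (𝟙 unit) (yoneda.map f) ≫ leftUnitor B' = leftUnitor B ≫ yoneda.map f
  /-- `𝕍(•; B ◁ N) ⟶ 𝕍(•; B)` -/
  rightUnitor (B : V) : conv split (yoneda.obj B) unit ⟶ yoneda.obj B
  rightUnitor_naturality {B B' : V} (f : B ⟶ B') :
    conv.map (yoneda.map f) (𝟙 unit) ≫ rightUnitor B' = rightUnitor B ≫ yoneda.map f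

namespace PromonoidalData

variable (P : PromonoidalData V)

theorem assoc_el {F G H : Psh V} {A U Z Z' X X' Y Y' : V} (a : X ⟶ X') (b : Y ⟶ Y') (c : Z ⟶ Z')
    (p : P.split.el A U Z) (q : P.split.el U X Y)
    (x : F.obj (op X')) (y : G.obj (op Y')) (z : H.obj (op Z')) :
    (conv.map (pt x) (pt₂ P.split y z)).app (op A)
        ((P.assoc X' Y' Z').app (op A) (conv.mk p (P.split.act (𝟙 U) a b q) c)) =
      (conv.map (pt (F.map a.op x)) (pt₂ P.split (G.map b.op y) (H.map c.op z))).app (op A)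
        ((P.assoc X Y Z).app (op A) (conv.mk p q (𝟙 Z))) := by
  have h : (conv.mk p (P.split.act (𝟙 U) a b q) c :
      (conv P.split (P.split.psh X' Y') (yoneda.obj Z')).obj (op A)) =
      (conv.map (P.split.atMap a b) (yoneda.map c)).app (op A) (conv.mk p q (𝟙 Z)) := by
    rw [conv.map_app_mk]
    exact congrArg (conv.mk p _) (Category.id_comp c).symm
  rw [h, ← map_comp_pt, ← atMap_comp_pt₂, conv.map_comp]
  exact congrArg ((conv.map (pt x) (pt₂ P.split y z)).app (op A))
    (app_congr (P.assoc_naturality a b c) (conv.mk p q (𝟙 Z)))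

theorem leftUnitor_el {F : Psh V} {A X Y Y' : V} (c : Y ⟶ Y') (p : P.split.el A X Y)
    (j : P.unit.obj (op X)) (x : F.obj (op Y')) :
    F.map ((P.leftUnitor Y').app (op A) (conv.mk p j c)).op x =
      F.map ((P.leftUnitor Y).app (op A) (conv.mk p j (𝟙 Y))).op (F.map c.op x) := by
  have h : (conv.mk p j c : (conv P.split P.unit (yoneda.obj Y')).obj (op A)) =
      (conv.map (𝟙 P.unit) (yoneda.map c)).app (op A) (conv.mk p j (𝟙 Y)) := by
    rw [conv.map_app_mk]
    exact congrArg (conv.mk p _) (Category.id_comp c).symm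
  rw [h, ← F.map_comp_apply, ← op_comp]
  exact congrArg (fun t : A ⟶ Y' => F.map t.op x)
    (app_congr (P.leftUnitor_naturality c) (conv.mk p j (𝟙 Y)))

theorem rightUnitor_el {F : Psh V} {A X X' Y : V} (c : X ⟶ X') (p : P.split.el A X Y)
    (j : P.unit.obj (op Y)) (x : F.obj (op X')) :
    F.map ((P.rightUnitor X').app (op A) (conv.mk p c j)).op x =
      F.map ((P.rightUnitor X).app (op A) (conv.mk p (𝟙 X) j)).op (F.map c.op x) := by
  have h : (conv.mk p c j : (conv P.split (yoneda.obj X') P.unit).obj (op A)) =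
      (conv.map (yoneda.map c) (𝟙 P.unit)).app (op A) (conv.mk p (𝟙 X) j) := by
    rw [conv.map_app_mk]
    exact congrArg (fun t => conv.mk p t j) (Category.id_comp c).symm
  rw [h, ← F.map_comp_apply, ← op_comp]
  exact congrArg (fun t : A ⟶ X' => F.map t.op x)
    (app_congr (P.rightUnitor_naturality c) (conv.mk p (𝟙 X) j))

/-- The associator `𝕍(•; (F ◁ G) ◁ H) ⟶ 𝕍(•; F ◁ (G ◁ H))` on arbitrary expressions, induced by
the associator on objects. -/
def assocExt (F G H : Psh V) :
    conv P.split (conv P.split F G) H ⟶ conv P.split F (conv P.split G H) :=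
  conv.desc₂
    (fun {A U Z X Y} p q x y z =>
      (conv.map (pt x) (pt₂ P.split y z)).app (op A)
        ((P.assoc X Y Z).app (op A) (conv.mk p q (𝟙 Z))))
    (fun {_ _ Z _ _ _ _} a b p q x y z => by
      rw [P.assoc_el a b (𝟙 Z), op_id, H.map_id_apply])
    (fun {_ _ _ U' Z _ X Y} f c d p q x y z => by
      rw [conv.mk_act, NatTrans.naturality_apply, NatTrans.naturality_apply]
      refine congrArg _ ?_
      refine Eq.trans ?_ ((P.assoc_el (𝟙 X) (𝟙 Y) d p (P.split.act c (𝟙 X) (𝟙 Y) q) x y z).trans ?_)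
      · rw [P.split.act_act]
        simp [Split.psh]
      · simp)

/-- The left unitor on an arbitrary expression. -/
def leftExt (F : Psh V) : conv P.split P.unit F ⟶ F :=
  conv.desc
    (fun {A X Y} p j x => F.map ((P.leftUnitor Y).app (op A) (conv.mk p j (𝟙 Y))).op x)
    (fun a b p j x => by
      rw [← P.leftUnitor_el, conv.mk_act, conv.map_mk, P.split.act_id]
      simp)
    (fun {_ _ X Y} f p j x => by
      rw [← F.map_comp_apply, ← op_comp, conv.mk_act, NatTrans.naturality_apply]
      simp)

/-- The right unitor on an arbitrary expression. -/
def rightExt (F : Psh V) : conv P.split F P.unit ⟶ F :=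
  conv.desc
    (fun {A X Y} p x j => F.map ((P.rightUnitor X).app (op A) (conv.mk p (𝟙 X) j)).op x)
    (fun a b p x j => by
      rw [← P.rightUnitor_el, conv.mk_act, conv.map_mk, P.split.act_id]
      simp)
    (fun {_ _ X Y} f p x j => by
      rw [← F.map_comp_apply, ← op_comp, conv.mk_act, NatTrans.naturality_apply]
      simp)

/-- The laws of a promonoidal category: invertible coherence maps, pentagon and triangle. -/
structure IsPromonoidal : Prop where
  assoc_iso (B C D : V) : IsIso (P.assoc B C D)
  leftUnitor_iso (B : V) : IsIso (P.leftUnitor B)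
  rightUnitor_iso (B : V) : IsIso (P.rightUnitor B)
  pentagon (F G H K : Psh V) :
    conv.map (P.assocExt F G H) (𝟙 K) ≫ P.assocExt F (conv P.split G H) K ≫
        conv.map (𝟙 F) (P.assocExt G H K) =
      P.assocExt (conv P.split F G) H K ≫ P.assocExt F G (conv P.split H K)
  triangle (F G : Psh V) :
    P.assocExt F P.unit G ≫ conv.map (𝟙 F) (P.leftExt G) = conv.map (P.rightExt F) (𝟙 G)

end PromonoidalData

/-- The data of a produoidal structure with a symmetry for its parallel part.  `par` is
`(⊗, I)` and `seq` is `(◁, N)`.  Its laws are `IsSymProduoidal`. -/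
structure SymProduoidalData (V : Type u) [SmallCategory V] where
  par : PromonoidalData V
  seq : PromonoidalData V
  /-- `𝕍(•; (X ◁ Y) ⊗ (Z ◁ W)) ⟶ 𝕍(•; (X ⊗ Z) ◁ (Y ⊗ W))` -/
  ψ₂ (X Y Z W : V) : conv par.split (seq.split.psh X Y) (seq.split.psh Z W) ⟶
    conv seq.split (par.split.psh X Z) (par.split.psh Y W)
  ψ₂_naturality {X X' Y Y' Z Z' W W' : V} (a : X ⟶ X') (b : Y ⟶ Y') (c : Z ⟶ Z') (d : W ⟶ W') :
    conv.map (seq.split.atMap a b) (seq.split.atMap c d) ≫ ψ₂ X' Y' Z' W' =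
      ψ₂ X Y Z W ≫ conv.map (par.split.atMap a c) (par.split.atMap b d)
  /-- `𝕍(•; I) ⟶ 𝕍(•; I ◁ I)` -/
  ψ₀ : par.unit ⟶ conv seq.split par.unit par.unit
  /-- `𝕍(•; N ⊗ N) ⟶ 𝕍(•; N)` -/
  φ₂ : conv par.split seq.unit seq.unit ⟶ seq.unit
  /-- `𝕍(•; I) ⟶ 𝕍(•; N)` -/
  φ₀ : par.unit ⟶ seq.unit
  /-- `𝕍(•; B ⊗ C) ⟶ 𝕍(•; C ⊗ B)` -/
  σ (B C : V) : par.split.psh B C ⟶ par.split.psh C B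
  σ_naturality {B B' C C' : V} (f : B ⟶ B') (g : C ⟶ C') :
    par.split.atMap f g ≫ σ B' C' = σ B C ≫ par.split.atMap g f

namespace SymProduoidalData

variable (P : SymProduoidalData V)

/-- The expression `𝕍(•; F ⊗ G)`. -/
abbrev T (F G : Psh V) : Psh V := conv P.par.split F G

/-- The expression `𝕍(•; F ◁ G)`. -/
abbrev S (F G : Psh V) : Psh V := conv P.seq.split F G

theorem ψ₂_el {F G H K : Psh V} {A U W X X' Y Y' Z Z' T T' : V} (a : X ⟶ X') (b : Y ⟶ Y')
    (c : Z ⟶ Z') (d : T ⟶ T') (p : P.par.split.el A U W)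
    (q : P.seq.split.el U X Y) (r : P.seq.split.el W Z T)
    (x : F.obj (op X')) (y : G.obj (op Y')) (z : H.obj (op Z')) (t : K.obj (op T')) :
    (conv.map (pt₂ P.par.split x z) (pt₂ P.par.split y t)).app (op A)
        ((P.ψ₂ X' Y' Z' T').app (op A)
          (conv.mk p (P.seq.split.act (𝟙 U) a b q) (P.seq.split.act (𝟙 W) c d r))) =
      (conv.map (pt₂ P.par.split (F.map a.op x) (H.map c.op z))
          (pt₂ P.par.split (G.map b.op y) (K.map d.op t))).app (op A)
        ((P.ψ₂ X Y Z T).app (op A) (conv.mk p q r)) := by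
  rw [← atMap_comp_pt₂, ← atMap_comp_pt₂, conv.map_comp]
  exact congrArg ((conv.map (pt₂ P.par.split x z) (pt₂ P.par.split y t)).app (op A))
    (app_congr (P.ψ₂_naturality a b c d) (conv.mk p q r))

/-- The laxator `𝕍(•; (F ◁ G) ⊗ (H ◁ K)) ⟶ 𝕍(•; (F ⊗ H) ◁ (G ⊗ K))` on arbitrary
expressions. -/
def ψ₂Ext (F G H K : Psh V) : P.T (P.S F G) (P.S H K) ⟶ P.S (P.T F H) (P.T G K) :=
  conv.desc₃
    (fun {A U W X Y Z T} p q r x y z t =>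
      (conv.map (pt₂ P.par.split x z) (pt₂ P.par.split y t)).app (op A)
        ((P.ψ₂ X Y Z T).app (op A) (conv.mk p q r)))
    (fun a b c d p q r x y z t => P.ψ₂_el a b c d p q r x y z t)
    (fun f c d p q r x y z t => by
      rw [conv.mk_act, NatTrans.naturality_apply, NatTrans.naturality_apply]
      rfl)

/-- The symmetry `𝕍(•; F ⊗ G) ⟶ 𝕍(•; G ⊗ F)` on arbitrary expressions. -/
def σExt (F G : Psh V) : P.T F G ⟶ P.T G F :=
  conv.desc
    (fun {A X Y} p x y => (pt₂ P.par.split y x).app (op A) ((P.σ X Y).app (op A) p))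
    (fun {A X X' Y Y'} a b p x y => by
      rw [← atMap_comp_pt₂]
      exact congrArg ((pt₂ P.par.split y x).app (op A)) (app_congr (P.σ_naturality a b) p))
    (fun {A A' X Y} f p x y => by
      rw [← NatTrans.naturality_apply]
      exact congrArg ((pt₂ P.par.split y x).app (op A'))
        (NatTrans.naturality_apply (P.σ X Y) f.op p))

/-- The laws of a symmetric produoidal category. -/
structure IsSymProduoidal : Prop where
  par_laws : P.par.IsPromonoidal
  seq_laws : P.seq.IsPromonoidal
  ψ₂_par_assoc (F G H K L M : Psh V) :
    conv.map (P.ψ₂Ext F G H K) (𝟙 (P.S L M)) ≫ P.ψ₂Ext (P.T F H) (P.T G K) L M ≫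
        conv.map (P.par.assocExt F H L) (P.par.assocExt G K M) =
      P.par.assocExt (P.S F G) (P.S H K) (P.S L M) ≫
        conv.map (𝟙 (P.S F G)) (P.ψ₂Ext H K L M) ≫ P.ψ₂Ext F G (P.T H L) (P.T K M)
  ψ₂_seq_assoc (F G H K L M : Psh V) :
    P.ψ₂Ext (P.S F G) H (P.S K L) M ≫ conv.map (P.ψ₂Ext F G K L) (𝟙 (P.T H M)) ≫
        P.seq.assocExt (P.T F K) (P.T G L) (P.T H M) =
      conv.map (P.seq.assocExt F G H) (P.seq.assocExt K L M) ≫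
        P.ψ₂Ext F (P.S G H) K (P.S L M) ≫ conv.map (𝟙 (P.T F K)) (P.ψ₂Ext G H L M)
  ψ₂_par_left (F G : Psh V) :
    conv.map P.ψ₀ (𝟙 (P.S F G)) ≫ P.ψ₂Ext P.par.unit P.par.unit F G ≫
        conv.map (P.par.leftExt F) (P.par.leftExt G) = P.par.leftExt (P.S F G)
  ψ₂_par_right (F G : Psh V) :
    conv.map (𝟙 (P.S F G)) P.ψ₀ ≫ P.ψ₂Ext F G P.par.unit P.par.unit ≫
        conv.map (P.par.rightExt F) (P.par.rightExt G) = P.par.rightExt (P.S F G)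
  ψ₂_seq_left (F G : Psh V) :
    P.ψ₂Ext P.seq.unit F P.seq.unit G ≫ conv.map P.φ₂ (𝟙 (P.T F G)) ≫ P.seq.leftExt (P.T F G) =
      conv.map (P.seq.leftExt F) (P.seq.leftExt G)
  ψ₂_seq_right (F G : Psh V) :
    P.ψ₂Ext F P.seq.unit G P.seq.unit ≫ conv.map (𝟙 (P.T F G)) P.φ₂ ≫
        P.seq.rightExt (P.T F G) =
      conv.map (P.seq.rightExt F) (P.seq.rightExt G)
  ψ₀_coassoc :
    P.ψ₀ ≫ conv.map P.ψ₀ (𝟙 P.par.unit) ≫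
        P.seq.assocExt P.par.unit P.par.unit P.par.unit =
      P.ψ₀ ≫ conv.map (𝟙 P.par.unit) P.ψ₀
  ψ₀_counit_left :
    P.ψ₀ ≫ conv.map P.φ₀ (𝟙 P.par.unit) ≫ P.seq.leftExt P.par.unit = 𝟙 P.par.unit
  ψ₀_counit_right :
    P.ψ₀ ≫ conv.map (𝟙 P.par.unit) P.φ₀ ≫ P.seq.rightExt P.par.unit = 𝟙 P.par.unit
  φ₂_assoc :
    conv.map P.φ₂ (𝟙 P.seq.unit) ≫ P.φ₂ =
      P.par.assocExt P.seq.unit P.seq.unit P.seq.unit ≫ conv.map (𝟙 P.seq.unit) P.φ₂ ≫ P.φ₂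
  φ₂_unit_left : conv.map P.φ₀ (𝟙 P.seq.unit) ≫ P.φ₂ = P.par.leftExt P.seq.unit
  φ₂_unit_right : conv.map (𝟙 P.seq.unit) P.φ₀ ≫ P.φ₂ = P.par.rightExt P.seq.unit
  symmetry (B C : V) : P.σ B C ≫ P.σ C B = 𝟙 (P.par.split.psh B C)
  hexagon (F G H : Psh V) :
    P.par.assocExt F G H ≫ P.σExt F (P.T G H) ≫ P.par.assocExt G H F =
      conv.map (P.σExt F G) (𝟙 H) ≫ P.par.assocExt G F H ≫ conv.map (𝟙 G) (P.σExt F H)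

/-- A produoidal category is normal when `φ₀ : I ⟶ N` is invertible. -/
def IsNormal : Prop := IsIso P.φ₀

end SymProduoidalData

end Structures

section Functors

variable {V W : Type u} [SmallCategory V] [SmallCategory W]

/-- A transformation `𝕍(A; B ◁ C) → 𝕎(F A; F B ◁ F C)` over a functor `F`. -/
@[ext]
structure SplitMap (F : V ⥤ W) (P : Split V) (Q : Split W) where
  app {A B C : V} : P.el A B C → Q.el (F.obj A) (F.obj B) (F.obj C)
  naturality {A A' B B' C C' : V} (f : A' ⟶ A) (g : B ⟶ B') (h : C ⟶ C') (p : P.el A B C) :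
    app (P.act f g h p) = Q.act (F.map f) (F.map g) (F.map h) (app p)

namespace SplitMap

variable {F : V ⥤ W} {P : Split V} {Q : Split W} (m : SplitMap F P Q)

/-- `𝕍(•; B ◁ C) ⟶ 𝕎(F •; F B ◁ F C)`. -/
def psh (B C : V) : P.psh B C ⟶ F.op ⋙ Q.psh (F.obj B) (F.obj C) where
  app A := ↾fun p => m.app p
  naturality A A' f := by
    ext p
    refine (m.naturality f.unop (𝟙 B) (𝟙 C) p).trans ?_
    rw [F.map_id, F.map_id]
    rfl

/-- The map induced on expressions, `𝕍(•; G ◁ H) ⟶ 𝕎(F •; G' ◁ H')`. -/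
def conv {G H : Psh V} {G' H' : Psh W} (s : G ⟶ F.op ⋙ G') (t : H ⟶ F.op ⋙ H') :
    conv P G H ⟶ F.op ⋙ conv Q G' H' :=
  conv.desc (H := F.op ⋙ Produo.conv Q G' H')
    (fun {A X Y} p x y =>
      (conv.mk (m.app p) (s.app (op X) x) (t.app (op Y) y) :
        (Produo.conv Q G' H').obj (op (F.obj A))))
    (fun a b p x y => by
      rw [m.naturality, F.map_id, conv.dinat, NatTrans.naturality_apply,
        NatTrans.naturality_apply]
      rfl)
    (fun f p x y => by
      rw [m.naturality, F.map_id, F.map_id]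
      rfl)

/-- Composition over a composite functor. -/
def comp {X : Type u} [SmallCategory X] {G : W ⥤ X} {R : Split X} (n : SplitMap G Q R) :
    SplitMap (F ⋙ G) P R where
  app p := n.app (m.app p)
  naturality f g h p := by
    rw [m.naturality, n.naturality]
    rfl

end SplitMap

/-- The data of a functor between symmetric produoidal categories: a functor with maps
`𝕍(A; B ⊗ C) → 𝕎(F A; F B ⊗ F C)`, `𝕍(A; B ◁ C) → 𝕎(F A; F B ◁ F C)`, `𝕍(A; I) → 𝕎(F A; I)` and
`𝕍(A; N) → 𝕎(F A; N)`, natural in all arguments.  Its laws are `IsSymProduoidal`. -/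
structure ProFunctor (𝕍 : SymProduoidalData V) (𝕎 : SymProduoidalData W) where
  functor : V ⥤ W
  mapPar : SplitMap functor 𝕍.par.split 𝕎.par.split
  mapSeq : SplitMap functor 𝕍.seq.split 𝕎.seq.split
  mapI : 𝕍.par.unit ⟶ functor.op ⋙ 𝕎.par.unit
  mapN : 𝕍.seq.unit ⟶ functor.op ⋙ 𝕎.seq.unit

/-- A functor with compatible maps of splits and units preserves the promonoidal coherence. -/
structure PreservesPromonoidal (F : V ⥤ W) (P : PromonoidalData V) (Q : PromonoidalData W)
    (m : SplitMap F P.split Q.split) (e : P.unit ⟶ F.op ⋙ Q.unit) : Prop where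
  assoc (B C D : V) :
    P.assoc B C D ≫ m.conv (yonedaMap F B) (m.psh C D) =
      m.conv (m.psh B C) (yonedaMap F D) ≫
        Functor.whiskerLeft F.op (Q.assoc (F.obj B) (F.obj C) (F.obj D))
  leftUnitor (B : V) :
    P.leftUnitor B ≫ yonedaMap F B =
      m.conv e (yonedaMap F B) ≫ Functor.whiskerLeft F.op (Q.leftUnitor (F.obj B))
  rightUnitor (B : V) :
    P.rightUnitor B ≫ yonedaMap F B =
      m.conv (yonedaMap F B) e ≫ Functor.whiskerLeft F.op (Q.rightUnitor (F.obj B))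

namespace ProFunctor

variable {𝕍 : SymProduoidalData V} {𝕎 : SymProduoidalData W}

/-- The laws of a symmetric produoidal functor. -/
structure IsSymProduoidal (F : ProFunctor 𝕍 𝕎) : Prop where
  par : PreservesPromonoidal F.functor 𝕍.par 𝕎.par F.mapPar F.mapI
  seq : PreservesPromonoidal F.functor 𝕍.seq 𝕎.seq F.mapSeq F.mapN
  ψ₂ (X Y Z T : V) :
    𝕍.ψ₂ X Y Z T ≫ F.mapSeq.conv (F.mapPar.psh X Z) (F.mapPar.psh Y T) =
      F.mapPar.conv (F.mapSeq.psh X Y) (F.mapSeq.psh Z T) ≫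
        Functor.whiskerLeft F.functor.op (𝕎.ψ₂ _ _ _ _)
  ψ₀ : 𝕍.ψ₀ ≫ F.mapSeq.conv F.mapI F.mapI = F.mapI ≫ Functor.whiskerLeft F.functor.op 𝕎.ψ₀
  φ₂ : 𝕍.φ₂ ≫ F.mapN = F.mapPar.conv F.mapN F.mapN ≫ Functor.whiskerLeft F.functor.op 𝕎.φ₂
  φ₀ : 𝕍.φ₀ ≫ F.mapN = F.mapI ≫ Functor.whiskerLeft F.functor.op 𝕎.φ₀
  σ (B C : V) :
    𝕍.σ B C ≫ F.mapPar.psh C B = F.mapPar.psh B C ≫ Functor.whiskerLeft F.functor.op (𝕎.σ _ _)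

/-- Composition of functors of symmetric produoidal categories. -/
def comp {X : Type u} [SmallCategory X] {𝕏 : SymProduoidalData X} (F : ProFunctor 𝕍 𝕎)
    (G : ProFunctor 𝕎 𝕏) : ProFunctor 𝕍 𝕏 where
  functor := F.functor ⋙ G.functor
  mapPar := F.mapPar.comp G.mapPar
  mapSeq := F.mapSeq.comp G.mapSeq
  mapI := F.mapI ≫ Functor.whiskerLeft F.functor.op G.mapI
  mapN := F.mapN ≫ Functor.whiskerLeft F.functor.op G.mapN

end ProFunctor

end Functors


theorem conv.congr {V : Type u} [SmallCategory V] {P : Split V} {F G : Psh V} {A X Y : V}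
    {p p' : P.el A X Y} {x x' : F.obj (op X)} {y y' : G.obj (op Y)}
    (hp : p = p') (hx : x = x') (hy : y = y') :
    (conv.mk p x y : (conv P F G).obj (op A)) = conv.mk p' x' y' := by
  rw [hp, hx, hy]

section Representable

open scoped MonoidalCategory

variable (V : Type u) [SmallCategory V] [MonoidalCategory V]

/-- The profunctor `V(A, B ⊗ C)`. -/
abbrev tensSplit : Split V :=
  Split.ofAct (fun A B C => A ⟶ B ⊗ C) (fun f g h p => f ≫ p ≫ (g ⊗ₘ h))
    (fun p => by simp)
    (fun f g h f' g' h' p => by simp [MonoidalCategory.tensorHom_comp_tensorHom])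

theorem tensSplit_act {A A' B B' C C' : V} (f : A' ⟶ A) (g : B ⟶ B') (h : C ⟶ C')
    (p : A ⟶ B ⊗ C) : (tensSplit V).act f g h p = f ≫ p ≫ (g ⊗ₘ h) :=
  rfl

/-- A monoidal category as a promonoidal category, `𝕍(A; B ⊗ C) = V(A, B ⊗ C)`. -/
abbrev parOfMonoidal : PromonoidalData V where
  split := tensSplit V
  unit := yoneda.obj (𝟙_ V)
  assoc B C D := conv.desc
    (fun {A X Y} (p : A ⟶ X ⊗ Y) (q : X ⟶ B ⊗ C) (z : Y ⟶ D) =>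
      conv.mk (X := B) (Y := C ⊗ D) (p ≫ (q ⊗ₘ z) ≫ (α_ B C D).hom) (𝟙 B) (𝟙 (C ⊗ D)))
    (fun {A X X' Y Y'} (a : X ⟶ X') (b : Y ⟶ Y') (p : A ⟶ X ⊗ Y) (q : X' ⟶ B ⊗ C) (z : Y' ⟶ D) =>
      conv.congr
        (show (𝟙 A ≫ p ≫ (a ⊗ₘ b)) ≫ (q ⊗ₘ z) ≫ (α_ B C D).hom =
          p ≫ ((a ≫ q ≫ (𝟙 B ⊗ₘ 𝟙 C)) ⊗ₘ (b ≫ z)) ≫ (α_ B C D).hom by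
          simp)
        rfl rfl)
    (fun {A A' X Y} f (p : A ⟶ X ⊗ Y) (q : X ⟶ B ⊗ C) (z : Y ⟶ D) =>
      conv.congr
        (show (f ≫ p ≫ (𝟙 X ⊗ₘ 𝟙 Y)) ≫ (q ⊗ₘ z) ≫ (α_ B C D).hom =
          f ≫ (p ≫ (q ⊗ₘ z) ≫ (α_ B C D).hom) ≫ (𝟙 B ⊗ₘ 𝟙 (C ⊗ D)) by
          simp)
        rfl rfl)
  assoc_naturality {B B' C C' D D'} f g h := by
    have h₁ : ∀ {A X Y : V} (p : A ⟶ X ⊗ Y) (q : X ⟶ B ⊗ C) (z : Y ⟶ D),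
        p ≫ ((𝟙 X ≫ q ≫ (f ⊗ₘ g)) ⊗ₘ (z ≫ h)) ≫ (α_ B' C' D').hom =
          𝟙 A ≫ (p ≫ (q ⊗ₘ z) ≫ (α_ B C D).hom) ≫ (f ⊗ₘ g ⊗ₘ h) := by
      intro A X Y p q z
      simp only [Category.id_comp, Category.assoc, ← MonoidalCategory.associator_naturality,
        MonoidalCategory.tensorHom_comp_tensorHom_assoc]
    ext ⟨A⟩ r
    induction r using conv.ind with
    | @h X Y p q z =>
      refine Eq.trans (conv.congr (h₁ p q z) rfl rfl)
        ((conv.dinat (P := tensSplit V) (F := yoneda.obj B')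
          (G := (tensSplit V).psh C' D') f (g ⊗ₘ h)
          (show A ⟶ B ⊗ C ⊗ D from p ≫ (q ⊗ₘ z) ≫ (α_ B C D).hom) (𝟙 B') (𝟙 (C' ⊗ D'))).trans
          (conv.congr rfl
            (show f ≫ 𝟙 B' = 𝟙 B ≫ f by simp)
            (show (g ⊗ₘ h) ≫ 𝟙 (C' ⊗ D') ≫ (𝟙 C' ⊗ₘ 𝟙 D') =
              𝟙 (C ⊗ D) ≫ 𝟙 (C ⊗ D) ≫ (g ⊗ₘ h) by simp)))
  leftUnitor B := conv.desc
    (fun {A X Y} (p : A ⟶ X ⊗ Y) (j : X ⟶ 𝟙_ V) (x : Y ⟶ B) => p ≫ (j ⊗ₘ x) ≫ (λ_ B).hom)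
    (fun {A X X' Y Y'} (a : X ⟶ X') (b : Y ⟶ Y') (p : A ⟶ X ⊗ Y) (j : X' ⟶ 𝟙_ V) (x : Y' ⟶ B) =>
      show (𝟙 A ≫ p ≫ (a ⊗ₘ b)) ≫ (j ⊗ₘ x) ≫ (λ_ B).hom =
        p ≫ ((a ≫ j) ⊗ₘ (b ≫ x)) ≫ (λ_ B).hom by simp)
    (fun {A A' X Y} f (p : A ⟶ X ⊗ Y) (j : X ⟶ 𝟙_ V) (x : Y ⟶ B) =>
      show (f ≫ p ≫ (𝟙 X ⊗ₘ 𝟙 Y)) ≫ (j ⊗ₘ x) ≫ (λ_ B).hom =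
        f ≫ p ≫ (j ⊗ₘ x) ≫ (λ_ B).hom by simp)
  leftUnitor_naturality {B B'} f := by
    have h₁ : ∀ {A X Y : V} (p : A ⟶ X ⊗ Y) (j : X ⟶ 𝟙_ V) (x : Y ⟶ B),
        p ≫ (j ⊗ₘ (x ≫ f)) ≫ (λ_ B').hom = (p ≫ (j ⊗ₘ x) ≫ (λ_ B).hom) ≫ f := by
      intro A X Y p j x
      simp [MonoidalCategory.tensorHom_def]
    ext ⟨A⟩ r
    induction r using conv.ind with
    | @h X Y p j x => exact h₁ p j x
  rightUnitor B := conv.desc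
    (fun {A X Y} (p : A ⟶ X ⊗ Y) (x : X ⟶ B) (j : Y ⟶ 𝟙_ V) => p ≫ (x ⊗ₘ j) ≫ (ρ_ B).hom)
    (fun {A X X' Y Y'} (a : X ⟶ X') (b : Y ⟶ Y') (p : A ⟶ X ⊗ Y) (x : X' ⟶ B) (j : Y' ⟶ 𝟙_ V) =>
      show (𝟙 A ≫ p ≫ (a ⊗ₘ b)) ≫ (x ⊗ₘ j) ≫ (ρ_ B).hom =
        p ≫ ((a ≫ x) ⊗ₘ (b ≫ j)) ≫ (ρ_ B).hom by simp)
    (fun {A A' X Y} f (p : A ⟶ X ⊗ Y) (x : X ⟶ B) (j : Y ⟶ 𝟙_ V) =>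
      show (f ≫ p ≫ (𝟙 X ⊗ₘ 𝟙 Y)) ≫ (x ⊗ₘ j) ≫ (ρ_ B).hom =
        f ≫ p ≫ (x ⊗ₘ j) ≫ (ρ_ B).hom by simp)
  rightUnitor_naturality {B B'} f := by
    have h₁ : ∀ {A X Y : V} (p : A ⟶ X ⊗ Y) (x : X ⟶ B) (j : Y ⟶ 𝟙_ V),
        p ≫ ((x ≫ f) ⊗ₘ j) ≫ (ρ_ B').hom = (p ≫ (x ⊗ₘ j) ≫ (ρ_ B).hom) ≫ f := by
      intro A X Y p x j
      simp [MonoidalCategory.tensorHom_def']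
    ext ⟨A⟩ r
    induction r using conv.ind with
    | @h X Y p x j => exact h₁ p x j

/-- A sequential structure over a monoidal category `V` that is compatible with its tensor: a
promonoidal structure `(◁, N)` with natural maps `V(U; X ◁ Y) × V(W; Z ◁ T) →
V(U ⊗ W; (X ⊗ Z) ◁ (Y ⊗ T))` and `V(A; N) × V(B; N) → V(A ⊗ B; N)`, and elements of
`V(I; I ◁ I)` and `V(I; N)`. -/
structure SeqOver where
  seq : PromonoidalData V
  tens {U X Y W Z T : V} : seq.split.el U X Y → seq.split.el W Z T →
    seq.split.el (U ⊗ W) (X ⊗ Z) (Y ⊗ T)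
  tens_naturality {U U' X X' Y Y' W W' Z Z' T T' : V} (f : U' ⟶ U) (g : X ⟶ X') (h : Y ⟶ Y')
    (f' : W' ⟶ W) (g' : Z ⟶ Z') (h' : T ⟶ T') (p : seq.split.el U X Y)
    (q : seq.split.el W Z T) :
    tens (seq.split.act f g h p) (seq.split.act f' g' h' q) =
      seq.split.act (f ⊗ₘ f') (g ⊗ₘ g') (h ⊗ₘ h') (tens p q)
  tensI : seq.split.el (𝟙_ V) (𝟙_ V) (𝟙_ V)
  unitTens {A B : V} : seq.unit.obj (op A) → seq.unit.obj (op B) → seq.unit.obj (op (A ⊗ B))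
  unitTens_naturality {A A' B B' : V} (f : A' ⟶ A) (g : B' ⟶ B) (m : seq.unit.obj (op A))
    (n : seq.unit.obj (op B)) :
    unitTens (seq.unit.map f.op m) (seq.unit.map g.op n) =
      seq.unit.map (f ⊗ₘ g).op (unitTens m n)
  unitI : seq.unit.obj (op (𝟙_ V))

variable {V} [SymmetricCategory V]

/-- The symmetric produoidal data induced by a sequential structure over a symmetric monoidal
category. -/
def SeqOver.toSymProduoidal (D : SeqOver V) : SymProduoidalData V where
  par := parOfMonoidal V
  seq := D.seq
  ψ₂ X Y Z W := conv.desc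
    (fun {A U T} (p : A ⟶ U ⊗ T) (q : D.seq.split.el U X Y) (r : D.seq.split.el T Z W) =>
      conv.mk (X := X ⊗ Z) (Y := Y ⊗ W)
        (D.seq.split.act p (𝟙 (X ⊗ Z)) (𝟙 (Y ⊗ W)) (D.tens q r))
        (𝟙 (X ⊗ Z)) (𝟙 (Y ⊗ W)))
    (fun {A U U' T T'} (a : U ⟶ U') (b : T ⟶ T') (p : A ⟶ U ⊗ T) (q : D.seq.split.el U' X Y)
        (r : D.seq.split.el T' Z W) =>
      conv.congr
        (show D.seq.split.act (𝟙 A ≫ p ≫ (a ⊗ₘ b)) (𝟙 (X ⊗ Z)) (𝟙 (Y ⊗ W)) (D.tens q r) =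
          D.seq.split.act p (𝟙 (X ⊗ Z)) (𝟙 (Y ⊗ W))
            (D.tens (D.seq.split.act a (𝟙 X) (𝟙 Y) q) (D.seq.split.act b (𝟙 Z) (𝟙 W) r)) by
          rw [D.tens_naturality, D.seq.split.act_act]
          simp)
        rfl rfl)
    (fun {A A' U T} f (p : A ⟶ U ⊗ T) (q : D.seq.split.el U X Y) (r : D.seq.split.el T Z W) =>
      conv.congr
        (show D.seq.split.act (f ≫ p ≫ (𝟙 U ⊗ₘ 𝟙 T)) (𝟙 (X ⊗ Z)) (𝟙 (Y ⊗ W)) (D.tens q r) =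
          D.seq.split.act f (𝟙 (X ⊗ Z)) (𝟙 (Y ⊗ W))
            (D.seq.split.act p (𝟙 (X ⊗ Z)) (𝟙 (Y ⊗ W)) (D.tens q r)) by
          rw [D.seq.split.act_act]
          simp)
        rfl rfl)
  ψ₂_naturality {X X' Y Y' Z Z' W W'} a b c d := by
    have h₁ : ∀ {A U T : V} (p : A ⟶ U ⊗ T) (q : D.seq.split.el U X Y) (r : D.seq.split.el T Z W),
        D.seq.split.act p (𝟙 (X' ⊗ Z')) (𝟙 (Y' ⊗ W'))
            (D.tens (D.seq.split.act (𝟙 U) a b q) (D.seq.split.act (𝟙 T) c d r)) =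
          D.seq.split.act (𝟙 A) (a ⊗ₘ c) (b ⊗ₘ d)
            (D.seq.split.act p (𝟙 (X ⊗ Z)) (𝟙 (Y ⊗ W)) (D.tens q r)) := by
      intro A U T p q r
      rw [D.tens_naturality, D.seq.split.act_act, D.seq.split.act_act]
      simp
    ext ⟨A⟩ r
    induction r using conv.ind with
    | @h U T p q r =>
      refine Eq.trans (conv.congr (h₁ p q r) rfl rfl)
        ((conv.dinat (P := D.seq.split) (F := (tensSplit V).psh X' Z')
          (G := (tensSplit V).psh Y' W') (a ⊗ₘ c) (b ⊗ₘ d)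
          (D.seq.split.act (show A ⟶ U ⊗ T from p) (𝟙 (X ⊗ Z)) (𝟙 (Y ⊗ W)) (D.tens q r))
          (𝟙 (X' ⊗ Z')) (𝟙 (Y' ⊗ W'))).trans
          (conv.congr rfl
            (show (a ⊗ₘ c) ≫ 𝟙 (X' ⊗ Z') ≫ (𝟙 X' ⊗ₘ 𝟙 Z') =
              𝟙 (X ⊗ Z) ≫ 𝟙 (X ⊗ Z) ≫ (a ⊗ₘ c) by simp)
            (show (b ⊗ₘ d) ≫ 𝟙 (Y' ⊗ W') ≫ (𝟙 Y' ⊗ₘ 𝟙 W') =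
              𝟙 (Y ⊗ W) ≫ 𝟙 (Y ⊗ W) ≫ (b ⊗ₘ d) by simp)))
  ψ₀ :=
    { app := fun A => ↾fun (j : A.unop ⟶ 𝟙_ V) =>
        conv.mk (X := 𝟙_ V) (Y := 𝟙_ V)
          (D.seq.split.act j (𝟙 (𝟙_ V)) (𝟙 (𝟙_ V)) D.tensI) (𝟙 (𝟙_ V)) (𝟙 (𝟙_ V))
      naturality := fun A A' f => by
        ext j
        exact conv.congr
          (show D.seq.split.act (f.unop ≫ j) (𝟙 (𝟙_ V)) (𝟙 (𝟙_ V)) D.tensI =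
            D.seq.split.act f.unop (𝟙 (𝟙_ V)) (𝟙 (𝟙_ V))
              (D.seq.split.act j (𝟙 (𝟙_ V)) (𝟙 (𝟙_ V)) D.tensI) by
            rw [D.seq.split.act_act]
            simp)
          rfl rfl }
  φ₂ := conv.desc
    (fun {A U T} (p : A ⟶ U ⊗ T) m n => D.seq.unit.map p.op (D.unitTens m n))
    (fun {A U U' T T'} (a : U ⟶ U') (b : T ⟶ T') (p : A ⟶ U ⊗ T) m n =>
      show D.seq.unit.map (𝟙 A ≫ p ≫ (a ⊗ₘ b)).op (D.unitTens m n) =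
        D.seq.unit.map p.op (D.unitTens (D.seq.unit.map a.op m) (D.seq.unit.map b.op n)) by
        rw [D.unitTens_naturality, ← D.seq.unit.map_comp_apply, ← op_comp]
        simp)
    (fun {A A' U T} f (p : A ⟶ U ⊗ T) m n =>
      show D.seq.unit.map (f ≫ p ≫ (𝟙 U ⊗ₘ 𝟙 T)).op (D.unitTens m n) =
        D.seq.unit.map f.op (D.seq.unit.map p.op (D.unitTens m n)) by
        rw [← D.seq.unit.map_comp_apply, ← op_comp]
        simp)
  φ₀ := pt D.unitI
  σ B C :=
    { app := fun A => ↾fun (p : A.unop ⟶ B ⊗ C) => p ≫ (β_ B C).hom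
      naturality := fun A A' f => by
        ext p
        have h₁ : ∀ p : A.unop ⟶ B ⊗ C, (f.unop ≫ p ≫ (𝟙 B ⊗ₘ 𝟙 C)) ≫ (β_ B C).hom =
          f.unop ≫ (p ≫ (β_ B C).hom) ≫ (𝟙 C ⊗ₘ 𝟙 B) := by simp
        exact h₁ p }
  σ_naturality {B B' C C'} f g := by
    ext A p
    have h₁ : ∀ p : A.unop ⟶ B ⊗ C, (𝟙 A.unop ≫ p ≫ (f ⊗ₘ g)) ≫ (β_ B' C').hom =
      𝟙 A.unop ≫ (p ≫ (β_ B C).hom) ≫ (g ⊗ₘ f) := by simp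
    exact h₁ p

end Representable


section SplicedArrows

/-- The objects `(A, B)` of the category of spliced monoidal arrows. -/
@[ext]
structure Splice (C : Type u) where
  dom : C
  cod : C

namespace Splice

variable (C : Type u) [SmallCategory C]

/-- A morphism `(A, B) ⟶ (X, Y)` is a pair of arrows `A ⟶ X` and `Y ⟶ B`. -/
@[ext]
structure Hom' (A X : Splice C) : Type u where
  fst : A.dom ⟶ X.dom
  snd : X.cod ⟶ A.cod

instance : Category.{u} (Splice C) where
  Hom A X := Hom' C A X
  id A := ⟨𝟙 A.dom, 𝟙 A.cod⟩
  comp f g := ⟨f.fst ≫ g.fst, g.snd ≫ f.snd⟩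
  id_comp _ := Hom'.ext (Category.id_comp _) (Category.comp_id _)
  comp_id _ := Hom'.ext (Category.comp_id _) (Category.id_comp _)
  assoc _ _ _ := Hom'.ext (Category.assoc _ _ _) (Category.assoc _ _ _).symm

variable {C}

@[ext]
theorem hom_ext {A X : Splice C} {f g : A ⟶ X} (h₁ : f.fst = g.fst) (h₂ : f.snd = g.snd) :
    f = g :=
  Hom'.ext h₁ h₂

@[simp] theorem id_fst (A : Splice C) : (𝟙 A : A ⟶ A).fst = 𝟙 A.dom := rfl
@[simp] theorem id_snd (A : Splice C) : (𝟙 A : A ⟶ A).snd = 𝟙 A.cod := rfl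
@[simp] theorem comp_fst {A B D : Splice C} (f : A ⟶ B) (g : B ⟶ D) :
    (f ≫ g).fst = f.fst ≫ g.fst := rfl
@[simp] theorem comp_snd {A B D : Splice C} (f : A ⟶ B) (g : B ⟶ D) :
    (f ≫ g).snd = g.snd ≫ f.snd := rfl

/-- A pair of arrows as a morphism. -/
abbrev homMk {A X : Splice C} (f : A.dom ⟶ X.dom) (g : X.cod ⟶ A.cod) : A ⟶ X :=
  ⟨f, g⟩

/-- A pair of isomorphisms as an isomorphism. -/
@[simps]
def isoMk {A X : Splice C} (f : A.dom ≅ X.dom) (g : A.cod ≅ X.cod) : A ≅ X where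
  hom := homMk f.hom g.inv
  inv := homMk f.inv g.hom

/-- `𝓢ℂ(A; X ◁ Y) = ℂ(A; X) × ℂ(X'; Y) × ℂ(Y'; A')`. -/
@[ext]
structure Seq (A X Y : Splice C) : Type u where
  fst : A.dom ⟶ X.dom
  mid : X.cod ⟶ Y.dom
  snd : Y.cod ⟶ A.cod

variable (C)

/-- The sequential splits of spliced monoidal arrows. -/
abbrev seqSplit : Split (Splice C) :=
  Split.ofAct (V := Splice C) (fun A X Y => Seq A X Y)
    (fun f g h p =>
      ⟨f.fst ≫ p.fst ≫ g.fst, g.snd ≫ p.mid ≫ h.fst, h.snd ≫ p.snd ≫ f.snd⟩)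
    (fun _ => by ext <;> simp)
    (fun _ _ _ _ _ _ _ => by ext <;> simp)

section

variable {C}

theorem act_fst {A A' X X' Y Y' : Splice C} (f : A' ⟶ A) (g : X ⟶ X') (h : Y ⟶ Y')
    (p : Seq A X Y) : Seq.fst ((seqSplit C).act f g h p) = f.fst ≫ p.fst ≫ g.fst := rfl

theorem act_mid {A A' X X' Y Y' : Splice C} (f : A' ⟶ A) (g : X ⟶ X') (h : Y ⟶ Y')
    (p : Seq A X Y) : Seq.mid ((seqSplit C).act f g h p) = g.snd ≫ p.mid ≫ h.fst := rfl

theorem act_snd {A A' X X' Y Y' : Splice C} (f : A' ⟶ A) (g : X ⟶ X') (h : Y ⟶ Y')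
    (p : Seq A X Y) : Seq.snd ((seqSplit C).act f g h p) = h.snd ≫ p.snd ≫ f.snd := rfl

end

/-- `𝓢ℂ(A; N) = ℂ(A; A')`. -/
abbrev unitN : Psh (Splice C) where
  obj A := A.unop.dom ⟶ A.unop.cod
  map f := ↾fun n => f.unop.fst ≫ n ≫ f.unop.snd
  map_id A := by ext n; simp
  map_comp _ _ := by ext n; simp

/-- The sequential promonoidal structure of spliced monoidal arrows, by filling holes. -/
abbrev seqData : PromonoidalData (Splice C) where
  split := seqSplit C
  unit := unitN C
  assoc B D E := conv.desc
    (fun {A U Z} (p : Seq A U Z) (q : Seq U B D) (z : Z ⟶ E) =>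
      conv.mk (X := B) (Y := ⟨D.dom, E.cod⟩)
        (⟨p.fst ≫ q.fst, q.mid, z.snd ≫ p.snd⟩ : Seq A B ⟨D.dom, E.cod⟩)
        (𝟙 B) (⟨𝟙 D.dom, q.snd ≫ p.mid ≫ z.fst, 𝟙 E.cod⟩ : Seq ⟨D.dom, E.cod⟩ D E))
    (fun {A U U' Z Z'} (a : U ⟶ U') (b : Z ⟶ Z') (p : Seq A U Z) (q : Seq U' B D) (z : Z' ⟶ E) =>
      conv.congr
        (Seq.ext (by simp [act_fst]) (by simp [act_mid]) (by simp [act_snd])) rfl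
        (Seq.ext (by simp) (by simp [act_mid, act_snd]) (by simp)))
    (fun {A A' U Z} (f : A' ⟶ A) (p : Seq A U Z) (q : Seq U B D) (z : Z ⟶ E) =>
      conv.congr
        (Seq.ext (by simp [act_fst]) (by simp [act_mid]) (by simp [act_snd])) rfl
        (Seq.ext (by simp) (by simp [act_mid]) (by simp)))
  assoc_naturality {B B' D D' E E'} f g h := by
    have key : ∀ {A U Z : Splice C} (p : Seq A U Z) (q : Seq U B D) (z : Z ⟶ E),
        (conv.mk (P := seqSplit C) (F := yoneda.obj B') (G := (seqSplit C).psh D' E')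
          (X := B') (Y := ⟨D'.dom, E'.cod⟩)
          (⟨p.fst ≫ 𝟙 _ ≫ q.fst ≫ f.fst, f.snd ≫ q.mid ≫ g.fst, (h.snd ≫ z.snd) ≫ p.snd⟩ :
            Seq A B' ⟨D'.dom, E'.cod⟩)
          (𝟙 B') (⟨𝟙 D'.dom, (g.snd ≫ q.snd ≫ 𝟙 _) ≫ p.mid ≫ z.fst ≫ h.fst, 𝟙 E'.cod⟩ :
            Seq ⟨D'.dom, E'.cod⟩ D' E') : (conv _ _ _).obj (op A)) =
        conv.mk (X := B) (Y := ⟨D.dom, E.cod⟩)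
          (⟨p.fst ≫ q.fst, q.mid, z.snd ≫ p.snd⟩ : Seq A B ⟨D.dom, E.cod⟩)
          (𝟙 B ≫ f) ((seqSplit C).act (𝟙 _) g h
            (⟨𝟙 D.dom, q.snd ≫ p.mid ≫ z.fst, 𝟙 E.cod⟩ : Seq ⟨D.dom, E.cod⟩ D E)) := by
      intro A U Z p q z
      refine (conv.congr (Seq.ext ?_ ?_ ?_) rfl rfl).trans
        ((conv.dinat (P := seqSplit C) (F := yoneda.obj B') (G := (seqSplit C).psh D' E')
          (A := A) (X := B) (X' := B') (Y := ⟨D.dom, E.cod⟩) (Y' := ⟨D'.dom, E'.cod⟩)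
          f (homMk g.fst h.snd) ⟨p.fst ≫ q.fst, q.mid, z.snd ≫ p.snd⟩ (𝟙 B')
          ⟨𝟙 D'.dom, (g.snd ≫ q.snd ≫ 𝟙 _) ≫ p.mid ≫ z.fst ≫ h.fst, 𝟙 E'.cod⟩).trans
          (conv.congr rfl ?_ (Seq.ext ?_ ?_ ?_)))
      · simp [act_fst]
      · simp [act_mid]
      · simp [act_snd]
      · exact (Category.comp_id f).trans (Category.id_comp f).symm
      · simp [act_fst]
      · simp [act_mid]
      · simp [act_snd]
    ext ⟨A⟩ r
    induction r using conv.ind with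
    | @h U Z p q z =>
      exact key p q z
  leftUnitor B := conv.desc
    (fun {A X Y} (p : Seq A X Y) (n : X.dom ⟶ X.cod) (y : Y ⟶ B) =>
      homMk (p.fst ≫ n ≫ p.mid ≫ y.fst) (y.snd ≫ p.snd))
    (fun {A X X' Y Y'} (a : X ⟶ X') (b : Y ⟶ Y') (p : Seq A X Y) (n : X'.dom ⟶ X'.cod)
        (y : Y' ⟶ B) => by
      exact hom_ext (by simp [act_fst, act_mid]) (by simp [act_mid, act_snd]))
    (fun {A A' X Y} (f : A' ⟶ A) (p : Seq A X Y) (n : X.dom ⟶ X.cod) (y : Y ⟶ B) => by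
      exact hom_ext (by simp [act_fst, act_mid]) (by simp [act_mid, act_snd]))
  leftUnitor_naturality {B B'} f := by
    have h₁ : ∀ {A X Y : Splice C} (p : Seq A X Y) (n : X.dom ⟶ X.cod) (y : Y ⟶ B),
        (homMk (p.fst ≫ n ≫ p.mid ≫ (y ≫ f).fst) ((y ≫ f).snd ≫ p.snd) : A ⟶ B') =
          homMk (p.fst ≫ n ≫ p.mid ≫ y.fst) (y.snd ≫ p.snd) ≫ f := by
      intro A X Y p n y
      ext <;> simp
    ext ⟨A⟩ r
    induction r using conv.ind with
    | @h X Y p n y => exact h₁ p n y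
  rightUnitor B := conv.desc
    (fun {A X Y} (p : Seq A X Y) (x : X ⟶ B) (n : Y.dom ⟶ Y.cod) =>
      homMk (p.fst ≫ x.fst) (x.snd ≫ p.mid ≫ n ≫ p.snd))
    (fun {A X X' Y Y'} (a : X ⟶ X') (b : Y ⟶ Y') (p : Seq A X Y) (x : X' ⟶ B)
        (n : Y'.dom ⟶ Y'.cod) => by
      exact hom_ext (by simp [act_fst, act_mid]) (by simp [act_mid, act_snd]))
    (fun {A A' X Y} (f : A' ⟶ A) (p : Seq A X Y) (x : X ⟶ B) (n : Y.dom ⟶ Y.cod) => by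
      exact hom_ext (by simp [act_fst, act_mid]) (by simp [act_mid, act_snd]))
  rightUnitor_naturality {B B'} f := by
    have h₁ : ∀ {A X Y : Splice C} (p : Seq A X Y) (x : X ⟶ B) (n : Y.dom ⟶ Y.cod),
        (homMk (p.fst ≫ (x ≫ f).fst) ((x ≫ f).snd ≫ p.mid ≫ n ≫ p.snd) : A ⟶ B') =
          homMk (p.fst ≫ x.fst) (x.snd ≫ p.mid ≫ n ≫ p.snd) ≫ f := by
      intro A X Y p x n
      ext <;> simp
    ext ⟨A⟩ r
    induction r using conv.ind with
    | @h X Y p x n => exact h₁ p x n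

variable [MonoidalCategory C]

instance : MonoidalCategoryStruct (Splice C) where
  tensorObj A B := ⟨A.dom ⊗ B.dom, A.cod ⊗ B.cod⟩
  tensorUnit := ⟨𝟙_ C, 𝟙_ C⟩
  tensorHom f g := homMk (f.fst ⊗ₘ g.fst) (f.snd ⊗ₘ g.snd)
  whiskerLeft A _ _ f := homMk (A.dom ◁ f.fst) (A.cod ◁ f.snd)
  whiskerRight f A := homMk (f.fst ▷ A.dom) (f.snd ▷ A.cod)
  associator A B D := isoMk (α_ A.dom B.dom D.dom) (α_ A.cod B.cod D.cod)
  leftUnitor A := isoMk (λ_ A.dom) (λ_ A.cod)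
  rightUnitor A := isoMk (ρ_ A.dom) (ρ_ A.cod)

section

variable {C}

@[simp] theorem tensorObj_dom (A B : Splice C) : (A ⊗ B).dom = A.dom ⊗ B.dom := rfl
@[simp] theorem tensorObj_cod (A B : Splice C) : (A ⊗ B).cod = A.cod ⊗ B.cod := rfl
@[simp] theorem tensorHom_fst {A A' B B' : Splice C} (f : A ⟶ B) (g : A' ⟶ B') :
    (f ⊗ₘ g).fst = f.fst ⊗ₘ g.fst := rfl
@[simp] theorem tensorHom_snd {A A' B B' : Splice C} (f : A ⟶ B) (g : A' ⟶ B') :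
    (f ⊗ₘ g).snd = f.snd ⊗ₘ g.snd := rfl
@[simp] theorem whiskerLeft_fst (A : Splice C) {B D : Splice C} (f : B ⟶ D) :
    (A ◁ f).fst = A.dom ◁ f.fst := rfl
@[simp] theorem whiskerLeft_snd (A : Splice C) {B D : Splice C} (f : B ⟶ D) :
    (A ◁ f).snd = A.cod ◁ f.snd := rfl
@[simp] theorem whiskerRight_fst {B D : Splice C} (f : B ⟶ D) (A : Splice C) :
    (f ▷ A).fst = f.fst ▷ A.dom := rfl
@[simp] theorem whiskerRight_snd {B D : Splice C} (f : B ⟶ D) (A : Splice C) :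
    (f ▷ A).snd = f.snd ▷ A.cod := rfl
@[simp] theorem tensorUnit_dom : (𝟙_ (Splice C)).dom = 𝟙_ C := rfl
@[simp] theorem tensorUnit_cod : (𝟙_ (Splice C)).cod = 𝟙_ C := rfl
@[simp] theorem associator_eq (A B D : Splice C) :
    α_ A B D = isoMk (α_ A.dom B.dom D.dom) (α_ A.cod B.cod D.cod) := rfl
@[simp] theorem leftUnitor_eq (A : Splice C) : λ_ A = isoMk (λ_ A.dom) (λ_ A.cod) := rfl
@[simp] theorem rightUnitor_eq (A : Splice C) : ρ_ A = isoMk (ρ_ A.dom) (ρ_ A.cod) := rfl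

end

instance : MonoidalCategory (Splice C) where
  tensorHom_def f g := by
    ext <;> simp [MonoidalCategory.tensorHom_def, MonoidalCategory.whisker_exchange]
  id_tensorHom_id _ _ := by ext <;> simp
  tensorHom_comp_tensorHom _ _ _ _ := by ext <;> simp
  whiskerLeft_id _ _ := by ext <;> simp
  id_whiskerRight _ _ := by ext <;> simp
  associator_naturality _ _ _ := by ext <;> simp
  leftUnitor_naturality _ := by ext <;> simp
  rightUnitor_naturality _ := by ext <;> simp
  pentagon _ _ _ _ := by ext <;> simp
  triangle _ _ := by ext <;> simp

variable [SymmetricCategory C]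

instance : SymmetricCategory (Splice C) where
  braiding A B := isoMk (β_ A.dom B.dom) (β_ A.cod B.cod)
  braiding_naturality_left _ _ := by ext <;> simp
  braiding_naturality_right _ _ _ _ := by ext <;> simp
  hexagon_forward _ _ _ := by ext <;> simp
  hexagon_reverse _ _ _ := by ext <;> simp
  symmetry A B := by
    ext
    · simp
    · exact (congrArg (· ≫ (β_ A.cod B.cod).inv)
        (SymmetricCategory.braiding_swap_eq_inv_braiding _ _).symm).trans (by simp)

/-- The sequential structure of spliced monoidal arrows, with its tensor. -/
abbrev seqOver : SeqOver (Splice C) where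
  seq := seqData C
  tens {U X Y W Z T} (p : Seq U X Y) (q : Seq W Z T) :=
    (⟨p.fst ⊗ₘ q.fst, p.mid ⊗ₘ q.mid, p.snd ⊗ₘ q.snd⟩ : Seq (U ⊗ W) (X ⊗ Z) (Y ⊗ T))
  tens_naturality f g h f' g' h' p q :=
    Seq.ext
      (show (f.fst ≫ p.fst ≫ g.fst) ⊗ₘ (f'.fst ≫ q.fst ≫ g'.fst) =
        (f.fst ⊗ₘ f'.fst) ≫ (p.fst ⊗ₘ q.fst) ≫ (g.fst ⊗ₘ g'.fst) by simp)
      (show (g.snd ≫ p.mid ≫ h.fst) ⊗ₘ (g'.snd ≫ q.mid ≫ h'.fst) =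
        (g.snd ⊗ₘ g'.snd) ≫ (p.mid ⊗ₘ q.mid) ≫ (h.fst ⊗ₘ h'.fst) by simp)
      (show (h.snd ≫ p.snd ≫ f.snd) ⊗ₘ (h'.snd ≫ q.snd ≫ f'.snd) =
        (h.snd ⊗ₘ h'.snd) ≫ (p.snd ⊗ₘ q.snd) ≫ (f.snd ⊗ₘ f'.snd) by simp)
  tensI := (⟨𝟙 (𝟙_ C), 𝟙 (𝟙_ C), 𝟙 (𝟙_ C)⟩ : Seq (𝟙_ (Splice C)) (𝟙_ (Splice C)) (𝟙_ (Splice C)))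
  unitTens {A B} (m : A.dom ⟶ A.cod) (n : B.dom ⟶ B.cod) := (m ⊗ₘ n :)
  unitTens_naturality f g m n :=
    show (f.fst ≫ m ≫ f.snd) ⊗ₘ (g.fst ≫ n ≫ g.snd) =
      (f.fst ⊗ₘ g.fst) ≫ (m ⊗ₘ n) ≫ (f.snd ⊗ₘ g.snd) by simp
  unitI := 𝟙 (𝟙_ C)

end Splice

/-- The symmetric produoidal category of spliced monoidal arrows of a symmetric monoidal
category. -/
abbrev spliced (C : Type u) [SmallCategory C] [MonoidalCategory C] [SymmetricCategory C] :
    SymProduoidalData (Splice C) :=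
  (Splice.seqOver C).toSymProduoidal

end SplicedArrows


section SplicedMap

open Functor.LaxMonoidal Functor.OplaxMonoidal

variable {C D : Type u} [SmallCategory C] [MonoidalCategory C] [SymmetricCategory C]
  [SmallCategory D] [MonoidalCategory D] [SymmetricCategory D]

/-- Spliced arrows are functorial in the monoidal category. -/
def spliceMap (K : C ⥤ D) [K.Monoidal] : ProFunctor (spliced C) (spliced D) where
  functor :=
    { obj := fun A => ⟨K.obj A.dom, K.obj A.cod⟩
      map := fun f => Splice.homMk (K.map f.fst) (K.map f.snd) }
  mapPar :=
    { app := fun {A X Y} (p : A ⟶ X ⊗ Y) =>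
        (Splice.homMk (K.map p.fst ≫ δ K X.dom Y.dom) (μ K X.cod Y.cod ≫ K.map p.snd) :
          (⟨K.obj A.dom, K.obj A.cod⟩ : Splice D) ⟶
            ⟨K.obj X.dom, K.obj X.cod⟩ ⊗ ⟨K.obj Y.dom, K.obj Y.cod⟩)
      naturality := fun f g h p => Splice.hom_ext
        (show K.map (f.fst ≫ p.fst ≫ (g.fst ⊗ₘ h.fst)) ≫ δ K _ _ =
          K.map f.fst ≫ (K.map p.fst ≫ δ K _ _) ≫ (K.map g.fst ⊗ₘ K.map h.fst) by simp)
        (show μ K _ _ ≫ K.map (((g.snd ⊗ₘ h.snd) ≫ p.snd) ≫ f.snd) =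
          ((K.map g.snd ⊗ₘ K.map h.snd) ≫ μ K _ _ ≫ K.map p.snd) ≫ K.map f.snd by simp) }
  mapSeq :=
    { app := fun {A X Y} (p : Splice.Seq A X Y) =>
        (⟨K.map p.fst, K.map p.mid, K.map p.snd⟩ :
          Splice.Seq ⟨K.obj A.dom, K.obj A.cod⟩ ⟨K.obj X.dom, K.obj X.cod⟩
            ⟨K.obj Y.dom, K.obj Y.cod⟩)
      naturality := fun f g h p => Splice.Seq.ext
        (show K.map (f.fst ≫ p.fst ≫ g.fst) = K.map f.fst ≫ K.map p.fst ≫ K.map g.fst by simp)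
        (show K.map (g.snd ≫ p.mid ≫ h.fst) = K.map g.snd ≫ K.map p.mid ≫ K.map h.fst by simp)
        (show K.map (h.snd ≫ p.snd ≫ f.snd) = K.map h.snd ≫ K.map p.snd ≫ K.map f.snd by simp) }
  mapI :=
    { app := fun A => ↾fun (j : A.unop ⟶ 𝟙_ (Splice C)) =>
        (Splice.homMk (K.map j.fst ≫ η K) (ε K ≫ K.map j.snd) :
          (⟨K.obj A.unop.dom, K.obj A.unop.cod⟩ : Splice D) ⟶ 𝟙_ (Splice D))
      naturality := fun A A' f => by
        ext j
        exact Splice.hom_ext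
          (show K.map (f.unop.fst ≫ j.fst) ≫ η K = K.map f.unop.fst ≫ K.map j.fst ≫ η K by simp)
          (show ε K ≫ K.map (j.snd ≫ f.unop.snd) = (ε K ≫ K.map j.snd) ≫ K.map f.unop.snd by
            simp) }
  mapN :=
    { app := fun A => ↾fun (n : A.unop.dom ⟶ A.unop.cod) => (K.map n :)
      naturality := fun A A' f => by
        ext n
        have h : ∀ n : A.unop.dom ⟶ A.unop.cod, K.map (f.unop.fst ≫ n ≫ f.unop.snd) =
          K.map f.unop.fst ≫ K.map n ≫ K.map f.unop.snd := by simp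
        exact h n }

/-- A monoidal functor is strict when its structure maps are identities. -/
structure IsStrict (K : C ⥤ D) [K.Monoidal] : Prop where
  obj_tensor (X Y : C) : K.obj X ⊗ K.obj Y = K.obj (X ⊗ Y)
  obj_unit : 𝟙_ D = K.obj (𝟙_ C)
  μ_eq (X Y : C) : μ K X Y = eqToHom (obj_tensor X Y)
  ε_eq : ε K = eqToHom obj_unit

end SplicedMap

section Tensorator

variable {C : Type u} [SmallCategory C] [MonoidalCategory C] [SymmetricCategory C]

theorem tensorμ_tensorμ (X Y Z W : C) :
    tensorμ X Y Z W ≫ tensorμ X Z Y W = 𝟙 _ := by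
  have h : tensorμ X Z Y W = tensorδ X Y Z W := by
    simp [tensorμ, tensorδ, SymmetricCategory.braiding_swap_eq_inv_braiding]
  rw [h, tensorμ_tensorδ]

theorem tensorμ_braiding (X Y Z W : C) :
    tensorμ X Y Z W ≫ ((β_ X Z).hom ⊗ₘ (β_ Y W).hom) =
      (β_ (X ⊗ Y) (Z ⊗ W)).hom ≫ tensorμ Z W X Y := by
  have h : (β_ Y Z).hom ≫ (β_ Z Y).hom = 𝟙 _ := SymmetricCategory.symmetry Y Z
  calc
    _ = 𝟙 _ ⊗≫ X ◁ (β_ Y Z).hom ▷ W ⊗≫ ((β_ X Z).hom ▷ (Y ⊗ W)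
          ≫ (Z ⊗ X) ◁ (β_ Y W).hom) ⊗≫ 𝟙 _ := by
      simp only [tensorμ, MonoidalCategory.tensorHom_def]
      monoidal
    _ = 𝟙 _ ⊗≫ X ◁ (β_ Y Z).hom ▷ W ⊗≫ (β_ X Z).hom ▷ Y ▷ W ⊗≫ Z ◁ X ◁ (β_ Y W).hom ⊗≫
          Z ◁ ((β_ X W).hom ≫ (β_ W X).hom) ▷ Y ⊗≫ 𝟙 _ := by
      rw [SymmetricCategory.symmetry]
      monoidal
    _ = _ := by
      simp only [tensorμ, BraidedCategory.braiding_tensor_left_hom,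
        BraidedCategory.braiding_tensor_right_hom]
      monoidal

theorem tensorμ_braiding' (X Y Z W : C) :
    ((β_ X Y).hom ⊗ₘ (β_ Z W).hom) ≫ tensorμ Y X W Z =
      tensorμ X Y Z W ≫ (β_ (X ⊗ Z) (Y ⊗ W)).hom := by
  have h := tensorμ_braiding X Z Y W
  calc
    _ = (tensorμ X Y Z W ≫ tensorμ X Z Y W) ≫
        ((β_ X Y).hom ⊗ₘ (β_ Z W).hom) ≫ tensorμ Y X W Z := by
      rw [tensorμ_tensorμ, Category.id_comp]
    _ = _ := by
      rw [Category.assoc, reassoc_of% h, tensorμ_tensorμ, Category.comp_id]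

theorem tensorμ_slide_dom {A A' M M' N N' X X' : C} (f : A ⟶ M ⊗ X) (f' : A' ⟶ N ⊗ X')
    (a : M ⟶ M') (b : N ⟶ N') :
    ((f ⊗ₘ f') ≫ tensorμ M X N X') ≫ (a ⊗ₘ b) ▷ (X ⊗ X') =
      ((f ≫ a ▷ X) ⊗ₘ (f' ≫ b ▷ X')) ≫ tensorμ M' X N' X' := by
  have h := tensorμ_natural a (𝟙 X) b (𝟙 X')
  rw [MonoidalCategory.id_tensorHom_id, MonoidalCategory.tensorHom_id,
    MonoidalCategory.tensorHom_id, MonoidalCategory.tensorHom_id] at h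
  rw [Category.assoc, ← h, MonoidalCategory.tensorHom_comp_tensorHom_assoc]

theorem tensorμ_slide_cod {B B' M M' N N' Y Y' : C} (g : M' ⊗ Y ⟶ B) (g' : N' ⊗ Y' ⟶ B')
    (a : M ⟶ M') (b : N ⟶ N') :
    (a ⊗ₘ b) ▷ (Y ⊗ Y') ≫ tensorμ M' N' Y Y' ≫ (g ⊗ₘ g') =
      tensorμ M N Y Y' ≫ ((a ▷ Y ≫ g) ⊗ₘ (b ▷ Y' ≫ g')) := by
  have h := tensorμ_natural a b (𝟙 Y) (𝟙 Y')
  rw [MonoidalCategory.id_tensorHom_id, MonoidalCategory.tensorHom_id,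
    MonoidalCategory.tensorHom_id, MonoidalCategory.tensorHom_id] at h
  rw [reassoc_of% h, MonoidalCategory.tensorHom_comp_tensorHom]

theorem tensorμ_comp_dom {A A' M N X X' P Q Z Z' : C} (f : A ⟶ M ⊗ X) (f' : A' ⟶ N ⊗ X')
    (h : X ⟶ P ⊗ Z) (h' : X' ⟶ Q ⊗ Z') :
    ((f ⊗ₘ f') ≫ tensorμ M X N X') ≫ (M ⊗ N) ◁ ((h ⊗ₘ h') ≫ tensorμ P Z Q Z') ≫
        (α_ (M ⊗ N) (P ⊗ Q) (Z ⊗ Z')).inv =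
      (((f ≫ M ◁ h ≫ (α_ M P Z).inv) ⊗ₘ (f' ≫ N ◁ h' ≫ (α_ N Q Z').inv)) ≫
        tensorμ (M ⊗ P) Z (N ⊗ Q) Z') ≫ tensorμ M P N Q ▷ (Z ⊗ Z') := by
  have h₁ := tensorμ_natural (𝟙 M) h (𝟙 N) h'
  rw [MonoidalCategory.id_tensorHom_id, MonoidalCategory.id_tensorHom,
    MonoidalCategory.id_tensorHom, MonoidalCategory.id_tensorHom] at h₁
  have h₂ : ((α_ M P Z).inv ⊗ₘ (α_ N Q Z').inv) ≫ ((α_ M P Z).hom ⊗ₘ (α_ N Q Z').hom) = 𝟙 _ := by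
    rw [MonoidalCategory.tensorHom_comp_tensorHom, Iso.inv_hom_id, Iso.inv_hom_id,
      MonoidalCategory.id_tensorHom_id]
  rw [← cancel_mono (α_ (M ⊗ N) (P ⊗ Q) (Z ⊗ Z')).hom, ← MonoidalCategory.tensorHom_comp_tensorHom,
    ← MonoidalCategory.tensorHom_comp_tensorHom]
  simp only [Category.assoc, associator_monoidal, Iso.inv_hom_id, Category.comp_id,
    reassoc_of% h₂, MonoidalCategory.whiskerLeft_comp]
  rw [reassoc_of% h₁]

theorem tensorμ_comp_cod {B B' M N Y Y' P Q W W' : C} (g : M ⊗ Y ⟶ B) (g' : N ⊗ Y' ⟶ B')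
    (k : P ⊗ W ⟶ Y) (k' : Q ⊗ W' ⟶ Y') :
    tensorμ M N P Q ▷ (W ⊗ W') ≫ tensorμ (M ⊗ P) (N ⊗ Q) W W' ≫
        (((α_ M P W).hom ≫ M ◁ k ≫ g) ⊗ₘ ((α_ N Q W').hom ≫ N ◁ k' ≫ g')) =
      (α_ (M ⊗ N) (P ⊗ Q) (W ⊗ W')).hom ≫ (M ⊗ N) ◁ (tensorμ P Q W W' ≫ (k ⊗ₘ k')) ≫
        tensorμ M N Y Y' ≫ (g ⊗ₘ g') := by
  rw [← MonoidalCategory.tensorHom_comp_tensorHom, ← MonoidalCategory.tensorHom_comp_tensorHom,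
    tensor_associativity_assoc, MonoidalCategory.whiskerLeft_comp, Category.assoc,
    tensorμ_natural_right_assoc]

theorem tensorμ_unit_dom {A A' X X' : C} (f : A ⟶ X) (f' : A' ⟶ X') :
    (((f ≫ (λ_ X).inv) ⊗ₘ (f' ≫ (λ_ X').inv)) ≫ tensorμ (𝟙_ C) X (𝟙_ C) X') ≫
        (λ_ (𝟙_ C)).hom ▷ (X ⊗ X') =
      (f ⊗ₘ f') ≫ (λ_ (X ⊗ X')).inv := by
  have h : ((λ_ X).inv ⊗ₘ (λ_ X').inv) ≫ ((λ_ X).hom ⊗ₘ (λ_ X').hom) = 𝟙 _ := by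
    rw [MonoidalCategory.tensorHom_comp_tensorHom, Iso.inv_hom_id, Iso.inv_hom_id,
      MonoidalCategory.id_tensorHom_id]
  rw [← cancel_mono (λ_ (X ⊗ X')).hom, ← MonoidalCategory.tensorHom_comp_tensorHom]
  simp only [Category.assoc, ← leftUnitor_monoidal, h, Iso.inv_hom_id, Category.comp_id]

theorem tensorμ_unit_cod {B B' Y Y' : C} (g : Y ⟶ B) (g' : Y' ⟶ B') :
    (λ_ (𝟙_ C)).hom ▷ (Y ⊗ Y') ≫ (λ_ (Y ⊗ Y')).hom ≫ (g ⊗ₘ g') =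
      tensorμ (𝟙_ C) (𝟙_ C) Y Y' ≫ (((λ_ Y).hom ≫ g) ⊗ₘ ((λ_ Y').hom ≫ g')) := by
  rw [← MonoidalCategory.tensorHom_comp_tensorHom, tensor_left_unitality]
  simp

theorem tensorμ_assoc_dom {A A' A'' M N P X X' X'' : C} (f : A ⟶ M ⊗ X) (f' : A' ⟶ N ⊗ X')
    (f'' : A'' ⟶ P ⊗ X'') :
    (((((f ⊗ₘ f') ≫ tensorμ M X N X') ⊗ₘ f'') ≫ tensorμ (M ⊗ N) (X ⊗ X') P X'') ≫
        ((M ⊗ N) ⊗ P) ◁ (α_ X X' X'').hom) ≫ (α_ M N P).hom ▷ (X ⊗ X' ⊗ X'') =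
      (α_ A A' A'').hom ≫ (f ⊗ₘ ((f' ⊗ₘ f'') ≫ tensorμ N X' P X'')) ≫
        tensorμ M X (N ⊗ P) (X' ⊗ X'') := by
  have h₁ : (((f ⊗ₘ f') ≫ tensorμ M X N X') ⊗ₘ f'') =
      ((f ⊗ₘ f') ⊗ₘ f'') ≫ tensorμ M X N X' ▷ (P ⊗ X'') := by
    rw [← MonoidalCategory.tensorHom_id, MonoidalCategory.tensorHom_comp_tensorHom,
      Category.comp_id]
  have h₂ : (f ⊗ₘ ((f' ⊗ₘ f'') ≫ tensorμ N X' P X'')) =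
      (f ⊗ₘ (f' ⊗ₘ f'')) ≫ (M ⊗ X) ◁ tensorμ N X' P X'' := by
    rw [← MonoidalCategory.id_tensorHom, MonoidalCategory.tensorHom_comp_tensorHom,
      Category.comp_id]
  rw [h₁, h₂, Category.assoc, Category.assoc, Category.assoc, ← MonoidalCategory.tensorHom_def',
    tensor_associativity, MonoidalCategory.associator_naturality_assoc, Category.assoc]

theorem tensorμ_assoc_cod {B B' B'' M N P Y Y' Y'' : C} (g : M ⊗ Y ⟶ B) (g' : N ⊗ Y' ⟶ B')
    (g'' : P ⊗ Y'' ⟶ B'') :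
    (α_ M N P).hom ▷ (Y ⊗ Y' ⊗ Y'') ≫ (tensorμ M (N ⊗ P) Y (Y' ⊗ Y'') ≫
        (g ⊗ₘ (tensorμ N P Y' Y'' ≫ (g' ⊗ₘ g'')))) ≫ (α_ B B' B'').inv =
      ((M ⊗ N) ⊗ P) ◁ (α_ Y Y' Y'').inv ≫ tensorμ (M ⊗ N) P (Y ⊗ Y') Y'' ≫
        ((tensorμ M N Y Y' ≫ (g ⊗ₘ g')) ⊗ₘ g'') := by
  have h₁ : ((tensorμ M N Y Y' ≫ (g ⊗ₘ g')) ⊗ₘ g'') =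
      tensorμ M N Y Y' ▷ (P ⊗ Y'') ≫ ((g ⊗ₘ g') ⊗ₘ g'') := by
    rw [← MonoidalCategory.tensorHom_id, MonoidalCategory.tensorHom_comp_tensorHom,
      Category.id_comp]
  have h₂ : (g ⊗ₘ (tensorμ N P Y' Y'' ≫ (g' ⊗ₘ g''))) =
      (M ⊗ Y) ◁ tensorμ N P Y' Y'' ≫ (g ⊗ₘ (g' ⊗ₘ g'')) := by
    rw [← MonoidalCategory.id_tensorHom, MonoidalCategory.tensorHom_comp_tensorHom,
      Category.id_comp]
  rw [h₁, h₂, ← cancel_mono (α_ B B' B'').hom, ← cancel_epi (((M ⊗ N) ⊗ P) ◁ (α_ Y Y' Y'').hom)]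
  simp only [Category.assoc, Iso.inv_hom_id, Category.comp_id,
    MonoidalCategory.associator_naturality, MonoidalCategory.whiskerLeft_hom_inv_assoc]
  rw [reassoc_of% (associator_monoidal M N P Y Y' Y''), ← MonoidalCategory.tensorHom_def'_assoc]

theorem tensorμ_left_dom {A M X : C} (f : A ⟶ M ⊗ X) :
    ((((λ_ (𝟙_ C)).inv ⊗ₘ f) ≫ tensorμ (𝟙_ C) (𝟙_ C) M X) ≫ (𝟙_ C ⊗ M) ◁ (λ_ X).hom) ≫
        (λ_ M).hom ▷ X = (λ_ A).hom ≫ f := by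
  rw [Category.assoc, Category.assoc, ← MonoidalCategory.tensorHom_def',
    MonoidalCategory.tensorHom_def', Category.assoc, ← tensor_left_unitality,
    MonoidalCategory.leftUnitor_naturality]

theorem tensorμ_left_cod {B M Y : C} (g : M ⊗ Y ⟶ B) :
    (λ_ M).hom ▷ Y ≫ g ≫ (λ_ B).inv =
      (𝟙_ C ⊗ M) ◁ (λ_ Y).inv ≫ tensorμ (𝟙_ C) M (𝟙_ C) Y ≫ ((λ_ (𝟙_ C)).hom ⊗ₘ g) := by
  have h := leftUnitor_monoidal M Y
  rw [← cancel_epi ((𝟙_ C ⊗ M) ◁ (λ_ Y).hom), ← cancel_mono (λ_ B).hom]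
  simp only [Category.assoc, Iso.inv_hom_id, Category.comp_id,
    MonoidalCategory.whiskerLeft_hom_inv_assoc]
  rw [← MonoidalCategory.tensorHom_def'_assoc, h, MonoidalCategory.tensorHom_def]
  simp only [Category.assoc, MonoidalCategory.leftUnitor_naturality]

theorem tensorμ_right_dom {A M X : C} (f : A ⟶ M ⊗ X) :
    (((f ⊗ₘ (λ_ (𝟙_ C)).inv) ≫ tensorμ M X (𝟙_ C) (𝟙_ C)) ≫ (M ⊗ 𝟙_ C) ◁ (ρ_ X).hom) ≫
        (ρ_ M).hom ▷ X = (ρ_ A).hom ≫ f := by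
  rw [Category.assoc, Category.assoc, ← MonoidalCategory.tensorHom_def',
    MonoidalCategory.tensorHom_def, Category.assoc, ← tensor_right_unitality,
    MonoidalCategory.rightUnitor_naturality]

theorem tensorμ_right_cod {B M Y : C} (g : M ⊗ Y ⟶ B) :
    (ρ_ M).hom ▷ Y ≫ g ≫ (ρ_ B).inv =
      (M ⊗ 𝟙_ C) ◁ (ρ_ Y).inv ≫ tensorμ M (𝟙_ C) Y (𝟙_ C) ≫ (g ⊗ₘ (λ_ (𝟙_ C)).hom) := by
  have h := rightUnitor_monoidal M Y
  rw [← cancel_epi ((M ⊗ 𝟙_ C) ◁ (ρ_ Y).hom), ← cancel_mono (ρ_ B).hom]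
  simp only [Category.assoc, Iso.inv_hom_id, Category.comp_id,
    MonoidalCategory.whiskerLeft_hom_inv_assoc]
  rw [← MonoidalCategory.tensorHom_def'_assoc, h, MonoidalCategory.tensorHom_def']
  simp only [Category.assoc, MonoidalCategory.rightUnitor_naturality]

theorem tensorμ_braiding_dom {A A' M N X X' : C} (f : A ⟶ M ⊗ X) (f' : A' ⟶ N ⊗ X') :
    (((f ⊗ₘ f') ≫ tensorμ M X N X') ≫ (M ⊗ N) ◁ (β_ X X').hom) ≫ (β_ M N).hom ▷ (X' ⊗ X) =
      (β_ A A').hom ≫ (f' ⊗ₘ f) ≫ tensorμ N X' M X := by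
  rw [Category.assoc, Category.assoc, ← MonoidalCategory.tensorHom_def', tensorμ_braiding,
    BraidedCategory.braiding_naturality_assoc]

theorem tensorμ_braiding_cod {B B' M N Y Y' : C} (g : M ⊗ Y ⟶ B) (g' : N ⊗ Y' ⟶ B') :
    (β_ M N).hom ▷ (Y' ⊗ Y) ≫ (tensorμ N M Y' Y ≫ (g' ⊗ₘ g)) ≫ (β_ B B').inv =
      (M ⊗ N) ◁ (β_ Y Y').inv ≫ tensorμ M N Y Y' ≫ (g ⊗ₘ g') := by
  rw [← cancel_epi ((M ⊗ N) ◁ (β_ Y Y').hom), ← cancel_mono (β_ B B').hom]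
  simp only [Category.assoc, Iso.inv_hom_id, Category.comp_id,
    MonoidalCategory.whiskerLeft_hom_inv_assoc]
  rw [← MonoidalCategory.tensorHom_def'_assoc, reassoc_of% (tensorμ_braiding' M N Y Y'),
    BraidedCategory.braiding_naturality]

theorem tensorμ_slide_mid {M₁ M₂ M₁' M₂' N₁ N₂ N₁' N₂' X X' Y Y' : C} {a : M₁ ⟶ M₂}
    {a' : M₁' ⟶ M₂'} {b : N₁ ⟶ N₂} {b' : N₁' ⟶ N₂'} {m₁ : M₁ ⊗ X ⟶ N₁ ⊗ Y}
    {m₂ : M₂ ⊗ X ⟶ N₂ ⊗ Y} {m₁' : M₁' ⊗ X' ⟶ N₁' ⊗ Y'} {m₂' : M₂' ⊗ X' ⟶ N₂' ⊗ Y'}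
    (h : m₁ ≫ b ▷ Y = a ▷ X ≫ m₂) (h' : m₁' ≫ b' ▷ Y' = a' ▷ X' ≫ m₂') :
    (tensorμ M₁ M₁' X X' ≫ (m₁ ⊗ₘ m₁') ≫ tensorμ N₁ Y N₁' Y') ≫ (b ⊗ₘ b') ▷ (Y ⊗ Y') =
      (a ⊗ₘ a') ▷ (X ⊗ X') ≫ tensorμ M₂ M₂' X X' ≫ (m₂ ⊗ₘ m₂') ≫ tensorμ N₂ Y N₂' Y' := by
  rw [Category.assoc, tensorμ_slide_dom, h, h',
    ← Category.assoc (tensorμ M₂ M₂' X X'), ← Category.assoc ((a ⊗ₘ a') ▷ (X ⊗ X')),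
    tensorμ_slide_cod, Category.assoc]

theorem tensorμ_comp_dom' {A A' M N X X' P Q Z Z' : C} (f : A ⟶ M ⊗ X) (f' : A' ⟶ N ⊗ X')
    (h : X ⟶ P ⊗ Z) (h' : X' ⟶ Q ⊗ Z') :
    (((f ⊗ₘ f') ≫ tensorμ M X N X') ≫ (M ⊗ N) ◁ ((h ⊗ₘ h') ≫ tensorμ P Z Q Z') ≫
        (α_ (M ⊗ N) (P ⊗ Q) (Z ⊗ Z')).inv) ≫ tensorμ M N P Q ▷ (Z ⊗ Z') =
      ((f ≫ M ◁ h ≫ (α_ M P Z).inv) ⊗ₘ (f' ≫ N ◁ h' ≫ (α_ N Q Z').inv)) ≫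
        tensorμ (M ⊗ P) Z (N ⊗ Q) Z' := by
  rw [tensorμ_comp_dom, Category.assoc, ← MonoidalCategory.comp_whiskerRight, tensorμ_tensorμ,
    MonoidalCategory.id_whiskerRight, Category.comp_id]

theorem tensorμ_comp_mid {L L' M M' N N' X X' Y Y' : C} (m : M ⊗ X ⟶ N ⊗ Y)
    (m' : M' ⊗ X' ⟶ N' ⊗ Y') :
    ((α_ (L ⊗ L') (M ⊗ M') (X ⊗ X')).hom ≫
        (L ⊗ L') ◁ (tensorμ M M' X X' ≫ (m ⊗ₘ m') ≫ tensorμ N Y N' Y') ≫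
        (α_ (L ⊗ L') (N ⊗ N') (Y ⊗ Y')).inv) ≫ tensorμ L L' N N' ▷ (Y ⊗ Y') =
      tensorμ L L' M M' ▷ (X ⊗ X') ≫ tensorμ (L ⊗ M) (L' ⊗ M') X X' ≫
        (((α_ L M X).hom ≫ L ◁ m ≫ (α_ L N Y).inv) ⊗ₘ
          ((α_ L' M' X').hom ≫ L' ◁ m' ≫ (α_ L' N' Y').inv)) ≫
        tensorμ (L ⊗ N) Y (L' ⊗ N') Y' := by
  have h₁ := tensorμ_comp_dom' (𝟙 (L ⊗ (N ⊗ Y))) (𝟙 (L' ⊗ (N' ⊗ Y'))) (𝟙 (N ⊗ Y)) (𝟙 (N' ⊗ Y'))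
  have h₂ := tensorμ_comp_cod (𝟙 (L ⊗ (N ⊗ Y))) (𝟙 (L' ⊗ (N' ⊗ Y'))) m m'
  simp only [MonoidalCategory.id_tensorHom_id, Category.id_comp, Category.comp_id,
    MonoidalCategory.whiskerLeft_id] at h₁ h₂
  rw [Category.assoc] at h₁
  have h₃ : (((α_ L M X).hom ≫ L ◁ m ≫ (α_ L N Y).inv) ⊗ₘ
      ((α_ L' M' X').hom ≫ L' ◁ m' ≫ (α_ L' N' Y').inv)) =
      (((α_ L M X).hom ≫ L ◁ m) ⊗ₘ ((α_ L' M' X').hom ≫ L' ◁ m')) ≫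
        ((α_ L N Y).inv ⊗ₘ (α_ L' N' Y').inv) := by
    rw [MonoidalCategory.tensorHom_comp_tensorHom, Category.assoc, Category.assoc]
  simp only [Category.assoc] at h₁ h₂
  have h₄ := congrArg (· ≫ ((α_ L N Y).inv ⊗ₘ (α_ L' N' Y').inv) ≫
    tensorμ (L ⊗ N) Y (L' ⊗ N') Y') h₂
  simp only [Category.assoc] at h₄
  rw [h₃]
  simp only [Category.assoc]
  rw [h₄, ← h₁, reassoc_of% (tensorμ_tensorμ L L' (N ⊗ Y) (N' ⊗ Y'))]
  simp only [MonoidalCategory.whiskerLeft_comp, Category.assoc]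

theorem tensorμ_unitTens {A A' B B' P Q Y Y' Z Z' : C} (f : A ⟶ P ⊗ Y) (n : Y ⟶ Z) (g : P ⊗ Z ⟶ B)
    (f' : A' ⟶ Q ⊗ Y') (n' : Y' ⟶ Z') (g' : Q ⊗ Z' ⟶ B') :
    (f ≫ P ◁ n ≫ g) ⊗ₘ (f' ≫ Q ◁ n' ≫ g') =
      ((f ⊗ₘ f') ≫ tensorμ P Y Q Y') ≫ (P ⊗ Q) ◁ (n ⊗ₘ n') ≫ tensorμ P Q Z Z' ≫ (g ⊗ₘ g') := by
  rw [tensorμ_natural_right_assoc, Category.assoc, reassoc_of% (tensorμ_tensorμ P Y Q Y'),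
    MonoidalCategory.tensorHom_comp_tensorHom, MonoidalCategory.tensorHom_comp_tensorHom]

theorem tensorμ_id_mid {M M' N N' P P' W W' Y Y' X X' : C} (m : M ⊗ X ⟶ N ⊗ Y)
    (m' : M' ⊗ X' ⟶ N' ⊗ Y') (k : P ⊗ W ⟶ X) (k' : P' ⊗ W' ⟶ X') :
    ((α_ (M ⊗ M') (P ⊗ P') (W ⊗ W')).hom ≫ (M ⊗ M') ◁ (tensorμ P P' W W' ≫ (k ⊗ₘ k')) ≫
        tensorμ M M' X X' ≫ (m ⊗ₘ m') ≫ tensorμ N Y N' Y') ≫ 𝟙 (N ⊗ N') ▷ (Y ⊗ Y') =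
      tensorμ M M' P P' ▷ (W ⊗ W') ≫ tensorμ (M ⊗ P) (M' ⊗ P') W W' ≫
        (((α_ M P W).hom ≫ M ◁ k ≫ m) ⊗ₘ ((α_ M' P' W').hom ≫ M' ◁ k' ≫ m')) ≫
          tensorμ N Y N' Y' := by
  have h₁ := congrArg (· ≫ tensorμ N Y N' Y') (tensorμ_comp_cod m m' k k')
  simp only [Category.assoc] at h₁
  rw [h₁, MonoidalCategory.id_whiskerRight, Category.comp_id]

theorem tensorμ_mid_id {M M' N N' P P' Z Z' Y Y' X X' : C} (m : M ⊗ X ⟶ N ⊗ Y)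
    (m' : M' ⊗ X' ⟶ N' ⊗ Y') (h : Y ⟶ P ⊗ Z) (h' : Y' ⟶ P' ⊗ Z') :
    ((tensorμ M M' X X' ≫ (m ⊗ₘ m') ≫ tensorμ N Y N' Y') ≫
        (N ⊗ N') ◁ ((h ⊗ₘ h') ≫ tensorμ P Z P' Z') ≫
        (α_ (N ⊗ N') (P ⊗ P') (Z ⊗ Z')).inv) ≫ tensorμ N N' P P' ▷ (Z ⊗ Z') =
      𝟙 (M ⊗ M') ▷ (X ⊗ X') ≫ tensorμ M M' X X' ≫
        ((m ≫ N ◁ h ≫ (α_ N P Z).inv) ⊗ₘ (m' ≫ N' ◁ h' ≫ (α_ N' P' Z').inv)) ≫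
          tensorμ (N ⊗ P) Z (N' ⊗ P') Z' := by
  have h₁ := congrArg (tensorμ M M' X X' ≫ ·) (tensorμ_comp_dom' m m' h h')
  simp only [Category.assoc] at h₁ ⊢
  rw [h₁, MonoidalCategory.id_whiskerRight, Category.id_comp]

end Tensorator

section MonoidalLenses

/-- The objects `(A, B)` of the category of monoidal lenses. -/
@[ext]
structure Lens (C : Type u) where
  dom : C
  cod : C

namespace Lens

variable {C : Type u} [SmallCategory C] [MonoidalCategory C]

/-- Representatives `(f ∣ g)` of lenses, `f : A ⟶ M ⊗ X` and `g : M ⊗ Y ⟶ B`. -/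
structure Rep (A X : Lens C) : Type u where
  {M : C}
  fst : A.dom ⟶ M ⊗ X.dom
  snd : M ⊗ X.cod ⟶ A.cod

/-- The dinaturality relation generating the coend over the residual `M`. -/
inductive Rel (A X : Lens C) : Rep A X → Rep A X → Prop
  | slide {M M' : C} (a : M ⟶ M') (f : A.dom ⟶ M ⊗ X.dom) (g : M' ⊗ X.cod ⟶ A.cod) :
      Rel A X ⟨f ≫ a ▷ X.dom, g⟩ ⟨f, a ▷ X.cod ≫ g⟩

/-- Monoidal lenses `(A, B) → (X, Y)`, `∫^M ℂ(A; M ⊗ X) × ℂ(M ⊗ Y; B)`. -/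
def Hom' (A X : Lens C) : Type u :=
  Quot (Rel A X)

/-- The class of `(f ∣ g)`. -/
def mk' {A X : Lens C} {M : C} (f : A.dom ⟶ M ⊗ X.dom) (g : M ⊗ X.cod ⟶ A.cod) : Hom' A X :=
  Quot.mk _ ⟨f, g⟩

theorem slide {A X : Lens C} {M M' : C} (a : M ⟶ M') {f : A.dom ⟶ M ⊗ X.dom}
    {f' : A.dom ⟶ M' ⊗ X.dom} {g : M ⊗ X.cod ⟶ A.cod} {g' : M' ⊗ X.cod ⟶ A.cod}
    (hf : f ≫ a ▷ X.dom = f') (hg : a ▷ X.cod ≫ g' = g) : mk' f g = mk' f' g' := by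
  subst hf hg
  exact (Quot.sound (Rel.slide a f g')).symm

theorem ind {A X : Lens C} {motive : Hom' A X → Prop}
    (h : ∀ {M : C} (f : A.dom ⟶ M ⊗ X.dom) (g : M ⊗ X.cod ⟶ A.cod), motive (mk' f g))
    (l : Hom' A X) : motive l :=
  Quot.ind (fun r => h r.fst r.snd) l

/-- Composition of lenses. -/
def comp {A X Z : Lens C} (l : Hom' A X) (m : Hom' X Z) : Hom' A Z :=
  Quot.lift₂
    (fun (r : Rep A X) (s : Rep X Z) =>
      (mk' (r.fst ≫ r.M ◁ s.fst ≫ (α_ r.M s.M Z.dom).inv)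
        ((α_ r.M s.M Z.cod).hom ≫ r.M ◁ s.snd ≫ r.snd) : Hom' A Z))
    (by
      rintro r _ _ ⟨a, f, g⟩
      exact (slide (r.M ◁ a) (by simp) (by simp)).symm)
    (by
      rintro _ _ s ⟨a, f, g⟩
      refine (slide (a ▷ s.M) ?_ ?_).symm
      · simp [← MonoidalCategory.whisker_exchange_assoc]
      · simp [MonoidalCategory.whisker_exchange_assoc]) l m

instance : Category.{u} (Lens C) where
  Hom A X := Hom' A X
  id A := mk' (λ_ A.dom).inv (λ_ A.cod).hom
  comp l m := comp l m
  id_comp l := by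
    induction l using ind with
    | h f g => exact slide (λ_ _).hom (by simp) (by simp)
  comp_id l := by
    induction l using ind with
    | h f g => exact slide (ρ_ _).hom (by simp) (by simp)
  assoc l m n := by
    induction l using ind with
    | h f g =>
      induction m using ind with
      | h f' g' =>
        induction n using ind with
        | h f'' g'' => exact slide (α_ _ _ _).hom (by simp) (by simp)

/-- The class of `(f ∣ g)`, as a morphism. -/
def lens {A X : Lens C} {M : C} (f : A.dom ⟶ M ⊗ X.dom) (g : M ⊗ X.cod ⟶ A.cod) : A ⟶ X :=
  mk' f g

theorem lens_ind {A X : Lens C} {motive : (A ⟶ X) → Prop}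
    (h : ∀ {M : C} (f : A.dom ⟶ M ⊗ X.dom) (g : M ⊗ X.cod ⟶ A.cod), motive (lens f g))
    (l : A ⟶ X) : motive l :=
  ind h l

theorem lens_eq {A X : Lens C} {M M' : C} (a : M ⟶ M') {f : A.dom ⟶ M ⊗ X.dom}
    {f' : A.dom ⟶ M' ⊗ X.dom} {g : M ⊗ X.cod ⟶ A.cod} {g' : M' ⊗ X.cod ⟶ A.cod}
    (hf : f ≫ a ▷ X.dom = f') (hg : a ▷ X.cod ≫ g' = g) : lens f g = lens f' g' :=
  slide a hf hg

theorem id_eq (A : Lens C) : 𝟙 A = lens (λ_ A.dom).inv (λ_ A.cod).hom :=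
  rfl

theorem lens_comp_lens {A X Z : Lens C} {M N : C} (f : A.dom ⟶ M ⊗ X.dom) (g : M ⊗ X.cod ⟶ A.cod)
    (f' : X.dom ⟶ N ⊗ Z.dom) (g' : N ⊗ Z.cod ⟶ X.cod) :
    lens f g ≫ lens f' g' =
      lens (f ≫ M ◁ f' ≫ (α_ M N Z.dom).inv) ((α_ M N Z.cod).hom ≫ M ◁ g' ≫ g) :=
  rfl

/-- The lens `(f ∣ g)` with trivial residual given by a pair of arrows. -/
def pair {A X : Lens C} (f : A.dom ⟶ X.dom) (g : X.cod ⟶ A.cod) : A ⟶ X :=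
  lens (f ≫ (λ_ X.dom).inv) ((λ_ X.cod).hom ≫ g)

theorem pair_comp_lens {A X Z : Lens C} {N : C} (f : A.dom ⟶ X.dom) (g : X.cod ⟶ A.cod)
    (f' : X.dom ⟶ N ⊗ Z.dom) (g' : N ⊗ Z.cod ⟶ X.cod) :
    pair f g ≫ lens f' g' = lens (f ≫ f') (g' ≫ g) :=
  lens_eq (λ_ N).hom (by simp) (by simp)

theorem lens_comp_pair {A X Z : Lens C} {M : C} (f : A.dom ⟶ M ⊗ X.dom) (g : M ⊗ X.cod ⟶ A.cod)
    (f' : X.dom ⟶ Z.dom) (g' : Z.cod ⟶ X.cod) :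
    lens f g ≫ pair f' g' = lens (f ≫ M ◁ f') (M ◁ g' ≫ g) :=
  lens_eq (ρ_ M).hom (by simp) (by simp)

theorem pair_id (A : Lens C) : (pair (𝟙 A.dom) (𝟙 A.cod) : A ⟶ A) = 𝟙 A := by
  rw [id_eq, pair, Category.id_comp, Category.comp_id]

theorem pair_comp_pair {A X Z : Lens C} (f : A.dom ⟶ X.dom) (g : X.cod ⟶ A.cod)
    (f' : X.dom ⟶ Z.dom) (g' : Z.cod ⟶ X.cod) :
    pair f g ≫ pair f' g' = pair (f ≫ f') (g' ≫ g) := by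
  rw [pair, lens_comp_pair, pair]
  exact congrArg₂ lens (by simp) (by simp)

/-- A pair of isomorphisms as an isomorphism of lenses. -/
@[simps]
def isoMk {A X : Lens C} (f : A.dom ≅ X.dom) (g : A.cod ≅ X.cod) : A ≅ X where
  hom := pair f.hom g.inv
  inv := pair f.inv g.hom
  hom_inv_id := by
    rw [pair_comp_pair, f.hom_inv_id, g.hom_inv_id, pair_id]
  inv_hom_id := by
    rw [pair_comp_pair, f.inv_hom_id, g.inv_hom_id, pair_id]

theorem pair_congr {X Y : Lens C} {f f' : X.dom ⟶ Y.dom} {g g' : Y.cod ⟶ X.cod} (hf : f = f')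
    (hg : g = g') : pair f g = pair f' g' := by
  rw [hf, hg]

theorem pair_comp₂ {X Y Z : Lens C} {l : X ⟶ Y} {m : Y ⟶ Z} {f : X.dom ⟶ Y.dom}
    {g : Y.cod ⟶ X.cod} {f' : Y.dom ⟶ Z.dom} {g' : Z.cod ⟶ Y.cod}
    (hl : l = pair f g) (hm : m = pair f' g') : l ≫ m = pair (f ≫ f') (g' ≫ g) := by
  rw [hl, hm, pair_comp_pair]

theorem pair_comp₃ {X Y Z W : Lens C} {l : X ⟶ Y} {m : Y ⟶ Z} {n : Z ⟶ W} {f : X.dom ⟶ Y.dom}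
    {g : Y.cod ⟶ X.cod} {f' : Y.dom ⟶ Z.dom} {g' : Z.cod ⟶ Y.cod} {f'' : Z.dom ⟶ W.dom}
    {g'' : W.cod ⟶ Z.cod} (hl : l = pair f g) (hm : m = pair f' g') (hn : n = pair f'' g'') :
    l ≫ m ≫ n = pair (f ≫ f' ≫ f'') ((g'' ≫ g') ≫ g) := by
  rw [hl, hm, hn, pair_comp_pair, pair_comp_pair]

section Symmetric

variable [SymmetricCategory C]

/-- The tensor of lenses. -/
def tensor {A X A' X' : Lens C} (l : A ⟶ X) (m : A' ⟶ X') :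
    (⟨A.dom ⊗ A'.dom, A.cod ⊗ A'.cod⟩ : Lens C) ⟶ ⟨X.dom ⊗ X'.dom, X.cod ⊗ X'.cod⟩ :=
  Quot.lift₂
    (fun (r : Rep A X) (s : Rep A' X') =>
      (lens ((r.fst ⊗ₘ s.fst) ≫ tensorμ r.M X.dom s.M X'.dom)
        (tensorμ r.M s.M X.cod X'.cod ≫ (r.snd ⊗ₘ s.snd)) :
          (⟨A.dom ⊗ A'.dom, A.cod ⊗ A'.cod⟩ : Lens C) ⟶ ⟨X.dom ⊗ X'.dom, X.cod ⊗ X'.cod⟩))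
    (by
      rintro r _ _ ⟨a, f, g⟩
      refine (lens_eq (𝟙 r.M ⊗ₘ a) ?_ ?_).symm
      · exact (tensorμ_slide_dom r.fst f (𝟙 r.M) a).trans (by simp)
      · exact (tensorμ_slide_cod r.snd g (𝟙 r.M) a).trans (by simp))
    (by
      rintro _ _ s ⟨a, f, g⟩
      refine (lens_eq (a ⊗ₘ 𝟙 s.M) ?_ ?_).symm
      · exact (tensorμ_slide_dom f s.fst a (𝟙 s.M)).trans (by simp)
      · exact (tensorμ_slide_cod g s.snd a (𝟙 s.M)).trans (by simp)) l m

theorem tensor_lens {A X A' X' : Lens C} {M N : C} (f : A.dom ⟶ M ⊗ X.dom)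
    (g : M ⊗ X.cod ⟶ A.cod) (f' : A'.dom ⟶ N ⊗ X'.dom) (g' : N ⊗ X'.cod ⟶ A'.cod) :
    tensor (lens f g) (lens f' g') =
      lens ((f ⊗ₘ f') ≫ tensorμ M X.dom N X'.dom) (tensorμ M N X.cod X'.cod ≫ (g ⊗ₘ g')) :=
  rfl

instance : MonoidalCategoryStruct (Lens C) where
  tensorObj A B := ⟨A.dom ⊗ B.dom, A.cod ⊗ B.cod⟩
  tensorUnit := ⟨𝟙_ C, 𝟙_ C⟩
  tensorHom l m := tensor l m
  whiskerLeft A _ _ l := tensor (𝟙 A) l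
  whiskerRight l A := tensor l (𝟙 A)
  associator A B D := isoMk (α_ A.dom B.dom D.dom) (α_ A.cod B.cod D.cod)
  leftUnitor A := isoMk (λ_ A.dom) (λ_ A.cod)
  rightUnitor A := isoMk (ρ_ A.dom) (ρ_ A.cod)

theorem lens_tensorHom_lens {A X A' X' : Lens C} {M N : C} (f : A.dom ⟶ M ⊗ X.dom)
    (g : M ⊗ X.cod ⟶ A.cod) (f' : A'.dom ⟶ N ⊗ X'.dom) (g' : N ⊗ X'.cod ⟶ A'.cod) :
    (lens f g ⊗ₘ lens f' g' : A ⊗ A' ⟶ X ⊗ X') =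
      lens (A := A ⊗ A') (X := X ⊗ X') ((f ⊗ₘ f') ≫ tensorμ M X.dom N X'.dom)
        (tensorμ M N X.cod X'.cod ≫ (g ⊗ₘ g')) :=
  rfl

theorem pair_tensorHom_pair {A X A' X' : Lens C} (f : A.dom ⟶ X.dom) (g : X.cod ⟶ A.cod)
    (f' : A'.dom ⟶ X'.dom) (g' : X'.cod ⟶ A'.cod) :
    (pair f g ⊗ₘ pair f' g' : A ⊗ A' ⟶ X ⊗ X') =
      pair (A := A ⊗ A') (X := X ⊗ X') (f ⊗ₘ f') (g ⊗ₘ g') := by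
  exact lens_eq (A := A ⊗ A') (X := X ⊗ X') (λ_ (𝟙_ C)).hom (tensorμ_unit_dom f f')
    (tensorμ_unit_cod g g')

theorem tensorHom_comp {A X A' X' Z Z' : Lens C} (l : A ⟶ X) (l' : A' ⟶ X') (m : X ⟶ Z)
    (m' : X' ⟶ Z') : (l ⊗ₘ l') ≫ (m ⊗ₘ m') = (l ≫ m) ⊗ₘ (l' ≫ m') := by
  induction l using lens_ind with
  | @h M f g =>
  induction l' using lens_ind with
  | @h M' f' g' =>
  induction m using lens_ind with
  | @h N h k =>
  induction m' using lens_ind with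
  | @h N' h' k' =>
  refine (lens_eq (A := A ⊗ A') (X := Z ⊗ Z') (tensorμ M N M' N') ?_ ?_).symm
  · exact (tensorμ_comp_dom f f' h h').symm
  · refine (congrArg (tensorμ M N M' N' ▷ (Z.cod ⊗ Z'.cod) ≫ ·)
      (tensorμ_comp_cod g g' k k').symm).trans ?_
    rw [← MonoidalCategory.comp_whiskerRight_assoc, tensorμ_tensorμ]
    simp

theorem associator_nat {A A' B B' D D' : Lens C} (l : A ⟶ A') (m : B ⟶ B') (n : D ⟶ D') :
    ((l ⊗ₘ m) ⊗ₘ n) ≫ (α_ A' B' D').hom = (α_ A B D).hom ≫ (l ⊗ₘ (m ⊗ₘ n)) := by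
  induction l using lens_ind with
  | @h M f g =>
  induction m using lens_ind with
  | @h N f' g' =>
  induction n using lens_ind with
  | @h P f'' g'' =>
  refine (lens_comp_pair _ _ _ _).trans (Eq.trans ?_ (pair_comp_lens _ _ _ _).symm)
  refine lens_eq (α_ M N P).hom ?_ ?_
  · exact tensorμ_assoc_dom f f' f''
  · exact tensorμ_assoc_cod g g' g''

theorem leftUnitor_nat {A B : Lens C} (l : A ⟶ B) :
    (𝟙 (𝟙_ (Lens C)) ⊗ₘ l) ≫ (λ_ B).hom = (λ_ A).hom ≫ l := by
  induction l using lens_ind with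
  | @h M f g =>
  refine (lens_comp_pair _ _ _ _).trans (Eq.trans ?_ (pair_comp_lens _ _ _ _).symm)
  refine lens_eq (λ_ M).hom ?_ ?_
  · exact tensorμ_left_dom f
  · exact tensorμ_left_cod g

theorem rightUnitor_nat {A B : Lens C} (l : A ⟶ B) :
    (l ⊗ₘ 𝟙 (𝟙_ (Lens C))) ≫ (ρ_ B).hom = (ρ_ A).hom ≫ l := by
  induction l using lens_ind with
  | @h M f g =>
  refine (lens_comp_pair _ _ _ _).trans (Eq.trans ?_ (pair_comp_lens _ _ _ _).symm)
  refine lens_eq (ρ_ M).hom ?_ ?_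
  · exact tensorμ_right_dom f
  · exact tensorμ_right_cod g

theorem id_tensor_pair (A : Lens C) {X Y : Lens C} (f : X.dom ⟶ Y.dom) (g : Y.cod ⟶ X.cod) :
    (𝟙 A ⊗ₘ pair f g : A ⊗ X ⟶ A ⊗ Y) =
      pair (X := A ⊗ Y) (A := A ⊗ X) (A.dom ◁ f) (A.cod ◁ g) := by
  rw [← pair_id, pair_tensorHom_pair, MonoidalCategory.id_tensorHom,
    MonoidalCategory.id_tensorHom]

theorem pair_tensor_id (A : Lens C) {X Y : Lens C} (f : X.dom ⟶ Y.dom) (g : Y.cod ⟶ X.cod) :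
    (pair f g ⊗ₘ 𝟙 A : X ⊗ A ⟶ Y ⊗ A) =
      pair (X := Y ⊗ A) (A := X ⊗ A) (f ▷ A.dom) (g ▷ A.cod) := by
  rw [← pair_id, pair_tensorHom_pair, MonoidalCategory.tensorHom_id,
    MonoidalCategory.tensorHom_id]

instance : MonoidalCategory (Lens C) :=
  MonoidalCategory.ofTensorHom
    (id_tensorHom_id := fun A B => by
      rw [← pair_id, ← pair_id, pair_tensorHom_pair, ← pair_id]
      exact congrArg₂ (pair (A := A ⊗ B) (X := A ⊗ B)) (by simp; rfl) (by simp; rfl))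
    (id_tensorHom := fun _ _ _ _ => rfl)
    (tensorHom_id := fun _ _ => rfl)
    (tensorHom_comp_tensorHom := tensorHom_comp)
    (associator_naturality := associator_nat)
    (leftUnitor_naturality := leftUnitor_nat)
    (rightUnitor_naturality := rightUnitor_nat)
    (pentagon := fun A B D E => by
      refine (pair_comp₃ (X := ((A ⊗ B) ⊗ D) ⊗ E) (Y := (A ⊗ (B ⊗ D)) ⊗ E)
        (Z := A ⊗ ((B ⊗ D) ⊗ E)) (W := A ⊗ (B ⊗ (D ⊗ E)))
        (pair_tensor_id _ _ _) rfl (id_tensor_pair _ _ _)).trans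
        (Eq.trans ?_ (pair_comp₂ (X := ((A ⊗ B) ⊗ D) ⊗ E) (Y := (A ⊗ B) ⊗ (D ⊗ E))
          (Z := A ⊗ (B ⊗ (D ⊗ E))) rfl rfl).symm)
      exact pair_congr (MonoidalCategory.pentagon _ _ _ _)
        ((Category.assoc _ _ _).trans MonoidalCategory.pentagon_inv))
    (triangle := fun A B => by
      refine (pair_comp₂ (X := (A ⊗ 𝟙_ (Lens C)) ⊗ B) (Y := A ⊗ (𝟙_ (Lens C) ⊗ B))
        (Z := A ⊗ B) rfl (id_tensor_pair _ _ _)).trans (Eq.trans ?_ (pair_tensor_id _ _ _).symm)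
      exact pair_congr (MonoidalCategory.triangle _ _) (MonoidalCategory.triangle_assoc_comp_left_inv _ _))

theorem braiding_nat {A A' B B' : Lens C} (l : A ⟶ A') (m : B ⟶ B') :
    (l ⊗ₘ m) ≫ (isoMk (A := A' ⊗ B') (X := B' ⊗ A') (β_ A'.dom B'.dom) (β_ A'.cod B'.cod)).hom =
      (isoMk (A := A ⊗ B) (X := B ⊗ A) (β_ A.dom B.dom) (β_ A.cod B.cod)).hom ≫ (m ⊗ₘ l) := by
  induction l using lens_ind with
  | @h M f g =>
  induction m using lens_ind with
  | @h N f' g' =>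
  refine (lens_comp_pair _ _ _ _).trans (Eq.trans ?_ (pair_comp_lens _ _ _ _).symm)
  refine lens_eq (β_ M N).hom ?_ ?_
  · exact tensorμ_braiding_dom f f'
  · exact tensorμ_braiding_cod g g'

instance : SymmetricCategory (Lens C) where
  braiding A B := isoMk (A := A ⊗ B) (X := B ⊗ A) (β_ A.dom B.dom) (β_ A.cod B.cod)
  braiding_naturality_left f D := by
    rw [← MonoidalCategory.tensorHom_id, ← MonoidalCategory.id_tensorHom, braiding_nat]
  braiding_naturality_right D _ _ f := by
    rw [← MonoidalCategory.tensorHom_id, ← MonoidalCategory.id_tensorHom, braiding_nat]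
  hexagon_forward A B D := by
    refine (pair_comp₃ (X := (A ⊗ B) ⊗ D) (Y := A ⊗ (B ⊗ D)) (Z := (B ⊗ D) ⊗ A)
      (W := B ⊗ (D ⊗ A)) rfl rfl rfl).trans (Eq.trans ?_ (pair_comp₃ (X := (A ⊗ B) ⊗ D)
        (Y := (B ⊗ A) ⊗ D) (Z := B ⊗ (A ⊗ D)) (W := B ⊗ (D ⊗ A)) (pair_tensor_id _ _ _) rfl
        (id_tensor_pair _ _ _)).symm)
    exact pair_congr (BraidedCategory.hexagon_forward _ _ _)
      ((Category.assoc _ _ _).trans ((BraidedCategory.hexagon_forward_inv A.cod B.cod D.cod).trans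
        (Category.assoc _ _ _).symm))
  hexagon_reverse A B D := by
    refine (pair_comp₃ (X := A ⊗ (B ⊗ D)) (Y := (A ⊗ B) ⊗ D) (Z := D ⊗ (A ⊗ B))
      (W := (D ⊗ A) ⊗ B) rfl rfl rfl).trans (Eq.trans ?_ (pair_comp₃ (X := A ⊗ (B ⊗ D))
        (Y := A ⊗ (D ⊗ B)) (Z := (A ⊗ D) ⊗ B) (W := (D ⊗ A) ⊗ B) (id_tensor_pair _ _ _) rfl
        (pair_tensor_id _ _ _)).symm)
    exact pair_congr (BraidedCategory.hexagon_reverse _ _ _)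
      ((Category.assoc _ _ _).trans ((BraidedCategory.hexagon_reverse_inv A.cod B.cod D.cod).trans
        (Category.assoc _ _ _).symm))
  symmetry A B := by
    refine (pair_comp₂ (X := A ⊗ B) (Y := B ⊗ A) (Z := A ⊗ B) rfl rfl).trans
      (Eq.trans ?_ (pair_id (A ⊗ B)))
    refine pair_congr (SymmetricCategory.symmetry _ _) ?_
    exact (congrArg (· ≫ (β_ A.cod B.cod).inv)
      (SymmetricCategory.braiding_swap_eq_inv_braiding _ _).symm).trans (Iso.hom_inv_id _)

end Symmetric

section Sequential

/-- Representatives `(f ∣ m ∣ s)` of sequential splits of lenses, `f : A ⟶ M ⊗ X`,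
`m : M ⊗ X' ⟶ N ⊗ Y` and `s : N ⊗ Y' ⟶ A'`. -/
structure SeqRep (A X Y : Lens C) : Type u where
  {M N : C}
  fst : A.dom ⟶ M ⊗ X.dom
  mid : M ⊗ X.cod ⟶ N ⊗ Y.dom
  snd : N ⊗ Y.cod ⟶ A.cod

/-- The dinaturality relation generating the coend over the residuals `M` and `N`. -/
inductive SeqRel (A X Y : Lens C) : SeqRep A X Y → SeqRep A X Y → Prop
  | slide {M M' N N' : C} (a : M ⟶ M') (b : N ⟶ N') (f : A.dom ⟶ M ⊗ X.dom)
      (m : M' ⊗ X.cod ⟶ N ⊗ Y.dom) (s : N' ⊗ Y.cod ⟶ A.cod) :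
      SeqRel A X Y ⟨f ≫ a ▷ X.dom, m ≫ b ▷ Y.dom, s⟩ ⟨f, a ▷ X.cod ≫ m, b ▷ Y.cod ≫ s⟩

/-- Sequential splits of lenses,
`∫^{M, N} ℂ(A; M ⊗ X) × ℂ(M ⊗ X'; N ⊗ Y) × ℂ(N ⊗ Y'; A')`. -/
def Seq (A X Y : Lens C) : Type u :=
  Quot (SeqRel A X Y)

/-- The class of `(f ∣ m ∣ s)`. -/
def seq {A X Y : Lens C} {M N : C} (f : A.dom ⟶ M ⊗ X.dom) (m : M ⊗ X.cod ⟶ N ⊗ Y.dom)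
    (s : N ⊗ Y.cod ⟶ A.cod) : Seq A X Y :=
  Quot.mk _ ⟨f, m, s⟩

theorem seq_ind {A X Y : Lens C} {motive : Seq A X Y → Prop}
    (h : ∀ {M N : C} (f : A.dom ⟶ M ⊗ X.dom) (m : M ⊗ X.cod ⟶ N ⊗ Y.dom)
      (s : N ⊗ Y.cod ⟶ A.cod), motive (seq f m s)) (p : Seq A X Y) : motive p :=
  Quot.ind (fun r => h r.fst r.mid r.snd) p

theorem seq_eq {A X Y : Lens C} {M M' N N' : C} (a : M ⟶ M') (b : N ⟶ N')
    {f : A.dom ⟶ M ⊗ X.dom} {f' : A.dom ⟶ M' ⊗ X.dom} {m : M ⊗ X.cod ⟶ N ⊗ Y.dom}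
    {m' : M' ⊗ X.cod ⟶ N' ⊗ Y.dom} {s : N ⊗ Y.cod ⟶ A.cod} {s' : N' ⊗ Y.cod ⟶ A.cod}
    (hf : f ≫ a ▷ X.dom = f') (hm : m ≫ b ▷ Y.dom = a ▷ X.cod ≫ m')
    (hs : b ▷ Y.cod ≫ s' = s) : seq f m s = seq f' m' s' := by
  subst hf hs
  have h₁ := Quot.sound (SeqRel.slide (𝟙 M) b f m s')
  have h₂ := Quot.sound (SeqRel.slide a (𝟙 N') f m' s')
  simp only [MonoidalCategory.id_whiskerRight, Category.comp_id, Category.id_comp] at h₁ h₂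
  rw [hm] at h₁
  exact h₁.symm.trans h₂.symm

/-- The action of lenses on the input of a sequential split. -/
def actA {A A' X Y : Lens C} (l : A' ⟶ A) (p : Seq A X Y) : Seq A' X Y :=
  Quot.lift₂
    (fun (r : Rep A' A) (t : SeqRep A X Y) =>
      (seq (r.fst ≫ r.M ◁ t.fst ≫ (α_ r.M t.M X.dom).inv)
        ((α_ r.M t.M X.cod).hom ≫ r.M ◁ t.mid ≫ (α_ r.M t.N Y.dom).inv)
        ((α_ r.M t.N Y.cod).hom ≫ r.M ◁ t.snd ≫ r.snd) : Seq A' X Y))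
    (by
      rintro r _ _ ⟨a, b, f, m, s⟩
      exact (seq_eq (r.M ◁ a) (r.M ◁ b) (by simp) (by simp) (by simp)).symm)
    (by
      rintro _ _ t ⟨a, f, g⟩
      refine (seq_eq (a ▷ t.M) (a ▷ t.N) ?_ ?_ ?_).symm
      · simp [← MonoidalCategory.whisker_exchange_assoc]
      · simp only [Category.assoc, ← MonoidalCategory.associator_inv_naturality_left,
          MonoidalCategory.associator_naturality_left_assoc,
          MonoidalCategory.whisker_exchange_assoc]
      · simp [MonoidalCategory.whisker_exchange_assoc]) l p

/-- The action of lenses on the first output of a sequential split. -/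
def actX {A X X' Y : Lens C} (l : X ⟶ X') (p : Seq A X Y) : Seq A X' Y :=
  Quot.lift₂
    (fun (r : Rep X X') (t : SeqRep A X Y) =>
      (seq (t.fst ≫ t.M ◁ r.fst ≫ (α_ t.M r.M X'.dom).inv)
        ((α_ t.M r.M X'.cod).hom ≫ t.M ◁ r.snd ≫ t.mid) t.snd : Seq A X' Y))
    (by
      rintro r _ _ ⟨a, b, f, m, s⟩
      refine (seq_eq (a ▷ r.M) b ?_ ?_ ?_).symm
      · simp [← MonoidalCategory.whisker_exchange_assoc]
      · simp [MonoidalCategory.whisker_exchange_assoc]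
      · simp)
    (by
      rintro _ _ t ⟨a, f, g⟩
      exact (seq_eq (t.M ◁ a) (𝟙 t.N) (by simp) (by simp) (by simp)).symm) l p

/-- The action of lenses on the second output of a sequential split. -/
def actY {A X Y Y' : Lens C} (l : Y ⟶ Y') (p : Seq A X Y) : Seq A X Y' :=
  Quot.lift₂
    (fun (r : Rep Y Y') (t : SeqRep A X Y) =>
      (seq t.fst (t.mid ≫ t.N ◁ r.fst ≫ (α_ t.N r.M Y'.dom).inv)
        ((α_ t.N r.M Y'.cod).hom ≫ t.N ◁ r.snd ≫ t.snd) : Seq A X Y'))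
    (by
      rintro r _ _ ⟨a, b, f, m, s⟩
      refine (seq_eq a (b ▷ r.M) ?_ ?_ ?_).symm
      · simp
      · simp [← MonoidalCategory.whisker_exchange_assoc]
      · simp [MonoidalCategory.whisker_exchange_assoc])
    (by
      rintro _ _ t ⟨a, f, g⟩
      exact (seq_eq (𝟙 t.M) (t.N ◁ a) (by simp) (by simp) (by simp)).symm) l p

theorem actA_id {A X Y : Lens C} (p : Seq A X Y) : actA (𝟙 A) p = p := by
  induction p using seq_ind with
  | @h M N f m s => exact seq_eq (λ_ M).hom (λ_ N).hom (by simp) (by simp) (by simp)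

theorem actX_id {A X Y : Lens C} (p : Seq A X Y) : actX (𝟙 X) p = p := by
  induction p using seq_ind with
  | @h M N f m s => exact seq_eq (ρ_ M).hom (𝟙 N) (by simp) (by simp) (by simp)

theorem actY_id {A X Y : Lens C} (p : Seq A X Y) : actY (𝟙 Y) p = p := by
  induction p using seq_ind with
  | @h M N f m s => exact seq_eq (𝟙 M) (ρ_ N).hom (by simp) (by simp) (by simp)

theorem actA_comp {A A' A'' X Y : Lens C} (l' : A'' ⟶ A') (l : A' ⟶ A) (p : Seq A X Y) :
    actA (l' ≫ l) p = actA l' (actA l p) := by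
  induction p using seq_ind with
  | @h M N f m s =>
  induction l using lens_ind with
  | @h P g h =>
  induction l' using lens_ind with
  | @h P' g' h' => exact seq_eq (α_ P' P M).hom (α_ P' P N).hom (by simp) (by simp) (by simp)

theorem actX_comp {A X X' X'' Y : Lens C} (l : X ⟶ X') (l' : X' ⟶ X'') (p : Seq A X Y) :
    actX (l ≫ l') p = actX l' (actX l p) := by
  induction p using seq_ind with
  | @h M N f m s =>
  induction l using lens_ind with
  | @h P g h =>
  induction l' using lens_ind with
  | @h P' g' h' => exact seq_eq (α_ M P P').inv (𝟙 N) (by simp) (by simp) (by simp)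

theorem actY_comp {A X Y Y' Y'' : Lens C} (l : Y ⟶ Y') (l' : Y' ⟶ Y'') (p : Seq A X Y) :
    actY (l ≫ l') p = actY l' (actY l p) := by
  induction p using seq_ind with
  | @h M N f m s =>
  induction l using lens_ind with
  | @h P g h =>
  induction l' using lens_ind with
  | @h P' g' h' => exact seq_eq (𝟙 M) (α_ N P P').inv (by simp) (by simp) (by simp)

theorem actX_actA {A A' X X' Y : Lens C} (l : A' ⟶ A) (x : X ⟶ X') (p : Seq A X Y) :
    actX x (actA l p) = actA l (actX x p) := by
  induction p using seq_ind with
  | @h M N f m s =>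
  induction l using lens_ind with
  | @h P g h =>
  induction x using lens_ind with
  | @h P' g' h' => exact seq_eq (α_ P M P').hom (𝟙 _) (by simp) (by simp) (by simp)

theorem actY_actA {A A' X Y Y' : Lens C} (l : A' ⟶ A) (y : Y ⟶ Y') (p : Seq A X Y) :
    actY y (actA l p) = actA l (actY y p) := by
  induction p using seq_ind with
  | @h M N f m s =>
  induction l using lens_ind with
  | @h P g h =>
  induction y using lens_ind with
  | @h P' g' h' => exact seq_eq (𝟙 _) (α_ P N P').hom (by simp) (by simp) (by simp)

theorem actY_actX {A X X' Y Y' : Lens C} (x : X ⟶ X') (y : Y ⟶ Y') (p : Seq A X Y) :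
    actY y (actX x p) = actX x (actY y p) := by
  induction p using seq_ind with
  | @h M N f m s =>
  induction x using lens_ind with
  | @h P g h =>
  induction y using lens_ind with
  | @h P' g' h' => exact seq_eq (𝟙 _) (𝟙 _) (by simp) (by simp) (by simp)

theorem seq_actA_pair {A A' X Y : Lens C} {M N : C} (g : A'.dom ⟶ A.dom) (h : A.cod ⟶ A'.cod)
    (f : A.dom ⟶ M ⊗ X.dom) (m : M ⊗ X.cod ⟶ N ⊗ Y.dom) (s : N ⊗ Y.cod ⟶ A.cod) :
    actA (pair g h) (seq f m s) = seq (g ≫ f) m (s ≫ h) :=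
  seq_eq (λ_ M).hom (λ_ N).hom (by simp) (by simp) (by simp)

theorem seq_actX_pair {A X X' Y : Lens C} {M N : C} (g : X.dom ⟶ X'.dom) (h : X'.cod ⟶ X.cod)
    (f : A.dom ⟶ M ⊗ X.dom) (m : M ⊗ X.cod ⟶ N ⊗ Y.dom) (s : N ⊗ Y.cod ⟶ A.cod) :
    actX (pair g h) (seq f m s) = seq (f ≫ M ◁ g) (M ◁ h ≫ m) s :=
  seq_eq (ρ_ M).hom (𝟙 N) (by simp) (by simp) (by simp)

theorem seq_actY_pair {A X Y Y' : Lens C} {M N : C} (g : Y.dom ⟶ Y'.dom) (h : Y'.cod ⟶ Y.cod)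
    (f : A.dom ⟶ M ⊗ X.dom) (m : M ⊗ X.cod ⟶ N ⊗ Y.dom) (s : N ⊗ Y.cod ⟶ A.cod) :
    actY (pair g h) (seq f m s) = seq f (m ≫ N ◁ g) (N ◁ h ≫ s) :=
  seq_eq (𝟙 M) (ρ_ N).hom (by simp) (by simp) (by simp)

variable (C)

/-- The sequential splits of monoidal lenses. -/
abbrev seqSplit : Split (Lens C) :=
  Split.ofAct (V := Lens C) (fun A X Y => Seq A X Y)
    (fun f g h p => actA f (actX g (actY h p)))
    (fun p => by rw [actY_id, actX_id, actA_id])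
    (fun f g h f' g' h' p => by
      rw [actY_actA, actX_actA, ← actA_comp, actY_actX, ← actX_comp, ← actY_comp])

/-- The action of lenses on `𝓛ℂ(A; N) = ℂ(A; A')`. -/
def actN {A A' : Lens C} (l : A' ⟶ A) (n : A.dom ⟶ A.cod) : A'.dom ⟶ A'.cod :=
  Quot.lift (fun r : Rep A' A => r.fst ≫ r.M ◁ n ≫ r.snd)
    (by
      rintro _ _ ⟨a, f, g⟩
      simp [MonoidalCategory.whisker_exchange_assoc]) l

/-- `𝓛ℂ(A; N) = ℂ(A; A')`. -/
abbrev unitN : Psh (Lens C) where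
  obj A := A.unop.dom ⟶ A.unop.cod
  map l := ↾fun n => actN C l.unop n
  map_id A := by
    ext n
    exact (show (λ_ A.unop.dom).inv ≫ 𝟙_ C ◁ n ≫ (λ_ A.unop.cod).hom = n by simp)
  map_comp {A A' A''} l m := by
    ext n
    have h : ∀ (l : A'.unop ⟶ A.unop) (m : A''.unop ⟶ A'.unop) (n : A.unop.dom ⟶ A.unop.cod),
        actN C (m ≫ l) n = actN C m (actN C l n) := by
      intro l m n
      induction l using lens_ind with
      | @h P f g =>
      induction m using lens_ind with
      | @h Q f' g' =>
      exact (show (f' ≫ Q ◁ f ≫ (α_ _ _ _).inv) ≫ (Q ⊗ P) ◁ n ≫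
        (α_ _ _ _).hom ≫ Q ◁ g ≫ g' = f' ≫ Q ◁ (f ≫ P ◁ n ≫ g) ≫ g' by simp)
    exact h l.unop m.unop n

end Sequential

section SequentialData

/-- Filling the first hole of a sequential split by a unit element. -/
def fillX {A X Y : Lens C} (p : Seq A X Y) (n : X.dom ⟶ X.cod) : A ⟶ Y :=
  Quot.lift
    (fun t : SeqRep A X Y => (lens (t.fst ≫ t.M ◁ n ≫ t.mid) t.snd : A ⟶ Y))
    (by
      rintro _ _ ⟨a, b, f, m, s⟩
      refine (lens_eq b ?_ ?_).symm
      · simp [MonoidalCategory.whisker_exchange_assoc]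
      · simp) p

/-- Filling the second hole of a sequential split by a unit element. -/
def fillY {A X Y : Lens C} (p : Seq A X Y) (n : Y.dom ⟶ Y.cod) : A ⟶ X :=
  Quot.lift
    (fun t : SeqRep A X Y => (lens t.fst (t.mid ≫ t.N ◁ n ≫ t.snd) : A ⟶ X))
    (by
      rintro _ _ ⟨a, b, f, m, s⟩
      refine (lens_eq a ?_ ?_).symm
      · simp
      · simp [MonoidalCategory.whisker_exchange_assoc]) p

theorem fillX_actA {A A' X Y : Lens C} (l : A' ⟶ A) (p : Seq A X Y) (n : X.dom ⟶ X.cod) :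
    fillX (actA l p) n = l ≫ fillX p n := by
  induction p using seq_ind with
  | @h M N f m s =>
  induction l using lens_ind with
  | @h P g h => exact lens_eq (𝟙 _) (by simp) (by simp)

theorem fillX_actX {A X X' Y : Lens C} (l : X ⟶ X') (p : Seq A X Y) (n : X'.dom ⟶ X'.cod) :
    fillX (actX l p) n = fillX p (actN C l n) := by
  induction p using seq_ind with
  | @h M N f m s =>
  induction l using lens_ind with
  | @h P g h => exact lens_eq (𝟙 _) (by simp [actN, lens, mk']) (by simp)

theorem fillX_actY {A X Y Y' : Lens C} (l : Y ⟶ Y') (p : Seq A X Y) (n : X.dom ⟶ X.cod) :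
    fillX (actY l p) n = fillX p n ≫ l := by
  induction p using seq_ind with
  | @h M N f m s =>
  induction l using lens_ind with
  | @h P g h => exact lens_eq (𝟙 _) (by simp) (by simp)

theorem fillY_actA {A A' X Y : Lens C} (l : A' ⟶ A) (p : Seq A X Y) (n : Y.dom ⟶ Y.cod) :
    fillY (actA l p) n = l ≫ fillY p n := by
  induction p using seq_ind with
  | @h M N f m s =>
  induction l using lens_ind with
  | @h P g h => exact lens_eq (𝟙 _) (by simp) (by simp)

theorem fillY_actY {A X Y Y' : Lens C} (l : Y ⟶ Y') (p : Seq A X Y) (n : Y'.dom ⟶ Y'.cod) :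
    fillY (actY l p) n = fillY p (actN C l n) := by
  induction p using seq_ind with
  | @h M N f m s =>
  induction l using lens_ind with
  | @h P g h => exact lens_eq (𝟙 _) (by simp) (by simp [actN, lens, mk'])

theorem fillY_actX {A X X' Y : Lens C} (l : X ⟶ X') (p : Seq A X Y) (n : Y.dom ⟶ Y.cod) :
    fillY (actX l p) n = fillY p n ≫ l := by
  induction p using seq_ind with
  | @h M N f m s =>
  induction l using lens_ind with
  | @h P g h => exact lens_eq (𝟙 _) (by simp) (by simp)

/-- The associator of sequential splits on a pair `p ∈ 𝓛ℂ(A; U ◁ D)`, `q ∈ 𝓛ℂ(U; B ◁ E)` of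
representatives. -/
def assocRep {A U B E D : Lens C} (p : SeqRep A U D) (q : SeqRep U B E) :
    (conv (seqSplit C) (yoneda.obj B) ((seqSplit C).psh E D)).obj (op A) :=
  conv.mk (X := B) (Y := ⟨(p.M ⊗ q.M) ⊗ B.cod, A.cod⟩)
    (seq (p.fst ≫ p.M ◁ q.fst ≫ (α_ p.M q.M B.dom).inv)
      (λ_ ((p.M ⊗ q.M) ⊗ B.cod)).inv (λ_ A.cod).hom)
    (𝟙 B)
    (seq (A := ⟨(p.M ⊗ q.M) ⊗ B.cod, A.cod⟩)
      ((α_ p.M q.M B.cod).hom ≫ p.M ◁ q.mid ≫ (α_ p.M q.N E.dom).inv)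
      ((α_ p.M q.N E.cod).hom ≫ p.M ◁ q.snd ≫ p.mid) p.snd)

theorem act_left {A A' X Y : Lens C} (l : A' ⟶ A) (p : Seq A X Y) :
    (seqSplit C).act l (𝟙 X) (𝟙 Y) p = actA l p :=
  show actA l (actX (𝟙 X) (actY (𝟙 Y) p)) = actA l p by rw [actY_id, actX_id]

theorem act_mid {A X X' Y : Lens C} (l : X ⟶ X') (p : Seq A X Y) :
    (seqSplit C).act (𝟙 A) l (𝟙 Y) p = actX l p :=
  show actA (𝟙 A) (actX l (actY (𝟙 Y) p)) = actX l p by rw [actY_id, actA_id]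

theorem act_right {A X Y Y' : Lens C} (l : Y ⟶ Y') (p : Seq A X Y) :
    (seqSplit C).act (𝟙 A) (𝟙 X) l p = actY l p :=
  show actA (𝟙 A) (actX (𝟙 X) (actY l p)) = actY l p by rw [actX_id, actA_id]

theorem assoc_eq {A B W W' E D : Lens C} (t : W ⟶ W') {p : Seq A B W} {p' : Seq A B W'}
    {q : Seq W E D} {q' : Seq W' E D} {F : Psh (Lens C)} (x : F.obj (op B))
    (hp : actY t p = p') (hq : actA t q' = q) :
    (conv.mk (P := seqSplit C) (F := F) (G := (seqSplit C).psh E D) p x q :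
      (conv _ _ _).obj (op A)) = conv.mk p' x q' := by
  subst hp hq
  have h := conv.dinat (P := seqSplit C) (F := F) (G := (seqSplit C).psh E D) (𝟙 B) t p x q'
  rw [op_id, F.map_id_apply] at h
  refine Eq.trans (conv.congr rfl rfl ?_) (h.symm.trans (conv.congr ?_ rfl rfl))
  · exact (act_left t q').symm
  · exact act_right t p

/-- The associator of sequential splits. -/
def assocSeq {A U B E D : Lens C} (p : Seq A U D) (q : Seq U B E) :
    (conv (seqSplit C) (yoneda.obj B) ((seqSplit C).psh E D)).obj (op A) :=
  Quot.lift₂ assocRep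
    (by
      rintro r _ _ ⟨a, b, g, m, s⟩
      refine (assoc_eq (F := yoneda.obj B) (pair (A := ⟨(r.M ⊗ _) ⊗ B.cod, A.cod⟩)
        (X := ⟨(r.M ⊗ _) ⊗ B.cod, A.cod⟩) ((r.M ◁ a) ▷ B.cod) (𝟙 A.cod)) (𝟙 B) ?_ ?_).symm
      · rw [seq_actY_pair]
        exact seq_eq (r.M ◁ a) (𝟙 _) (by simp) (by simp) (by simp)
      · rw [seq_actA_pair]
        exact (seq_eq (r.M ◁ b) (𝟙 _) (by simp) (by simp) (by simp)).symm)
    (by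
      rintro _ _ t ⟨a, b, f, m, s⟩
      refine (assoc_eq (F := yoneda.obj B) (pair (A := ⟨(_ ⊗ t.M) ⊗ B.cod, A.cod⟩)
        (X := ⟨(_ ⊗ t.M) ⊗ B.cod, A.cod⟩) ((a ▷ t.M) ▷ B.cod) (𝟙 A.cod)) (𝟙 B) ?_ ?_).symm
      · rw [seq_actY_pair]
        refine seq_eq (a ▷ t.M) (𝟙 _) ?_ ?_ ?_
        · simp [← MonoidalCategory.whisker_exchange_assoc]
        · simp
        · simp
      · rw [seq_actA_pair]
        refine (seq_eq (a ▷ t.N) b ?_ ?_ ?_).symm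
        · simp only [Category.assoc, ← MonoidalCategory.associator_inv_naturality_left,
            MonoidalCategory.associator_naturality_left_assoc,
            MonoidalCategory.whisker_exchange_assoc]
        · simp [MonoidalCategory.whisker_exchange_assoc]
        · simp) p q

theorem assocSeq_actX_left {A U U' B E D : Lens C} (l : U ⟶ U') (p : Seq A U D) (q : Seq U' B E) :
    assocSeq (actX l p) q = assocSeq p (actA l q) := by
  induction p using seq_ind with
  | @h M N f m s =>
  induction q using seq_ind with
  | @h P Q g k r =>
  induction l using lens_ind with
  | @h K h h' =>
  refine assoc_eq (F := yoneda.obj B) (pair (A := ⟨((M ⊗ K) ⊗ P) ⊗ B.cod, A.cod⟩)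
        (X := ⟨(M ⊗ (K ⊗ P)) ⊗ B.cod, A.cod⟩) ((α_ M K P).hom ▷ B.cod) (𝟙 A.cod)) (𝟙 B) ?_ ?_
  · refine (seq_actY_pair _ _ _ _ _).trans ?_
    exact seq_eq (α_ M K P).hom (𝟙 _) (by simp) (by simp) (by simp)
  · refine (seq_actA_pair _ _ _ _ _).trans ?_
    exact (seq_eq (α_ M K Q).hom (𝟙 _) (by simp) (by simp) (by simp)).symm

theorem assocSeq_actA {A A' U B E D : Lens C} (l : A' ⟶ A) (p : Seq A U D) (q : Seq U B E) :
    assocSeq (actA l p) q =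
      (conv (seqSplit C) (yoneda.obj B) ((seqSplit C).psh E D)).map l.op (assocSeq p q) := by
  induction p using seq_ind with
  | @h M N f m s =>
  induction q using seq_ind with
  | @h P Q g k r =>
  induction l using lens_ind with
  | @h L h h' =>
  refine (assoc_eq (F := yoneda.obj B) (lens (A := ⟨((L ⊗ M) ⊗ P) ⊗ B.cod, A'.cod⟩)
        (X := ⟨(M ⊗ P) ⊗ B.cod, A.cod⟩) (M := L)
        ((α_ L M P).hom ▷ B.cod ≫ (α_ L (M ⊗ P) B.cod).hom) h') (𝟙 B) ?_ ?_).trans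
    (conv.congr (p := actA (lens h h') (seq (Y := ⟨(M ⊗ P) ⊗ B.cod, A.cod⟩) (f ≫ M ◁ g ≫ (α_ M P B.dom).inv)
      (λ_ ((M ⊗ P) ⊗ B.cod)).inv (λ_ A.cod).hom)) ?_ rfl rfl)
  · exact seq_eq (α_ L M P).hom ((λ_ _).hom ≫ (ρ_ _).inv) (by simp) (by simp) (by simp)
  · exact (seq_eq (α_ L M Q).hom (𝟙 _) (by simp) (by simp) (by simp)).symm
  · exact (act_left _ _).symm

theorem assocSeq_actX {A U B B' E D : Lens C} (l : B ⟶ B') (p : Seq A U D) (q : Seq U B E) :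
    assocSeq p (actX l q) =
      (conv.map (yoneda.map l) (𝟙 ((seqSplit C).psh E D))).app (op A) (assocSeq p q) := by
  induction p using seq_ind with
  | @h M N f m s =>
  induction q using seq_ind with
  | @h P Q g k r =>
  induction l using lens_ind with
  | @h K h h' =>
  have key : conv.mk (P := seqSplit C) (F := yoneda.obj B') (G := (seqSplit C).psh E D)
      (Y := ⟨(M ⊗ P) ⊗ B.cod, A.cod⟩)
      (seq (f ≫ M ◁ g ≫ (α_ M P B.dom).inv) (λ_ ((M ⊗ P) ⊗ B.cod)).inv (λ_ A.cod).hom :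
        Seq A B ⟨(M ⊗ P) ⊗ B.cod, A.cod⟩) (𝟙 B ≫ lens h h')
      (seq (A := ⟨(M ⊗ P) ⊗ B.cod, A.cod⟩)
        ((α_ M P B.cod).hom ≫ M ◁ k ≫ (α_ M Q E.dom).inv)
        ((α_ M Q E.cod).hom ≫ M ◁ r ≫ m) s) =
      conv.mk (P := seqSplit C) (F := yoneda.obj B') (G := (seqSplit C).psh E D)
      (Y := ⟨(M ⊗ P) ⊗ B.cod, A.cod⟩)
      (actX (lens h h') (seq (f ≫ M ◁ g ≫ (α_ M P B.dom).inv) (λ_ ((M ⊗ P) ⊗ B.cod)).inv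
        (λ_ A.cod).hom : Seq A B ⟨(M ⊗ P) ⊗ B.cod, A.cod⟩)) (𝟙 B')
      (seq (A := ⟨(M ⊗ P) ⊗ B.cod, A.cod⟩)
        ((α_ M P B.cod).hom ≫ M ◁ k ≫ (α_ M Q E.dom).inv)
        ((α_ M Q E.cod).hom ≫ M ◁ r ≫ m) s) := by
    have h₁ := conv.dinat (P := seqSplit C) (F := yoneda.obj B') (G := (seqSplit C).psh E D)
      (lens h h' : B ⟶ B') (𝟙 (⟨(M ⊗ P) ⊗ B.cod, A.cod⟩ : Lens C))
      (seq (f ≫ M ◁ g ≫ (α_ M P B.dom).inv) (λ_ ((M ⊗ P) ⊗ B.cod)).inv (λ_ A.cod).hom :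
        Seq A B ⟨(M ⊗ P) ⊗ B.cod, A.cod⟩) (𝟙 B')
      (seq (A := ⟨(M ⊗ P) ⊗ B.cod, A.cod⟩)
        ((α_ M P B.cod).hom ≫ M ◁ k ≫ (α_ M Q E.dom).inv)
        ((α_ M Q E.cod).hom ≫ M ◁ r ≫ m) s : Seq ⟨(M ⊗ P) ⊗ B.cod, A.cod⟩ E D)
    refine Eq.trans (conv.congr rfl ?_ ?_) (h₁.symm.trans (conv.congr (act_mid _ _) rfl rfl))
    · exact (Category.id_comp _).trans (Category.comp_id _).symm
    · exact (((seqSplit C).psh E D).map_id_apply _ _).symm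
  refine Eq.trans ?_ key.symm
  refine assoc_eq (F := yoneda.obj B') (pair (A := ⟨(M ⊗ (P ⊗ K)) ⊗ B'.cod, A.cod⟩)
        (X := ⟨(M ⊗ P) ⊗ B.cod, A.cod⟩)
        ((α_ M P K).inv ▷ B'.cod ≫ (α_ (M ⊗ P) K B'.cod).hom ≫ (M ⊗ P) ◁ h') (𝟙 A.cod)) (𝟙 B') ?_ ?_
  · refine (seq_actY_pair _ _ _ _ _).trans ?_
    exact seq_eq (α_ M P K).inv (𝟙 _) (by simp) (by simp) (by simp)
  · refine (seq_actA_pair _ _ _ _ _).trans ?_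
    exact seq_eq (𝟙 _) (𝟙 _) (by simp) (by simp) (by simp)

theorem assocSeq_actY {A U B E E' D : Lens C} (l : E ⟶ E') (p : Seq A U D) (q : Seq U B E) :
    assocSeq p (actY l q) =
      (conv.map (𝟙 (yoneda.obj B)) ((seqSplit C).atMap l (𝟙 D))).app (op A) (assocSeq p q) := by
  induction p using seq_ind with
  | @h M N f m s =>
  induction q using seq_ind with
  | @h P Q g k r =>
  induction l using lens_ind with
  | @h K h h' =>
  refine conv.congr rfl rfl (Eq.trans ?_ (act_mid _ _).symm)
  exact seq_eq (α_ M Q K).inv (𝟙 _) (by simp) (by simp) (by simp)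

theorem assocSeq_actY_left {A U B E D D' : Lens C} (l : D ⟶ D') (p : Seq A U D) (q : Seq U B E) :
    assocSeq (actY l p) q =
      (conv.map (𝟙 (yoneda.obj B)) ((seqSplit C).atMap (𝟙 E) l)).app (op A) (assocSeq p q) := by
  induction p using seq_ind with
  | @h M N f m s =>
  induction q using seq_ind with
  | @h P Q g k r =>
  induction l using lens_ind with
  | @h K h h' =>
  refine conv.congr rfl rfl (Eq.trans ?_ (act_right _ _).symm)
  exact seq_eq (𝟙 _) (𝟙 _) (by simp) (by simp) (by simp)

end SequentialData

section Structure

variable (C)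

/-- The sequential promonoidal structure of monoidal lenses. -/
abbrev seqData : PromonoidalData (Lens C) where
  split := seqSplit C
  unit := unitN C
  assoc B E D := conv.desc
    (fun {A U Z} (p : Seq A U Z) (q : Seq U B E) (z : Z ⟶ D) => assocSeq (actY z p) q)
    (fun {A U U' Z Z'} (a : U ⟶ U') (b : Z ⟶ Z') (p : Seq A U Z) (q : Seq U' B E)
        (z : Z' ⟶ D) =>
      show assocSeq (actY z (actA (𝟙 A) (actX a (actY b p)))) q =
        assocSeq (actY (b ≫ z) p) (actA a (actX (𝟙 B) (actY (𝟙 E) q))) by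
        rw [actA_id, actY_actX, ← actY_comp, assocSeq_actX_left, actY_id, actX_id])
    (fun {A A' U Z} (f : A' ⟶ A) (p : Seq A U Z) (q : Seq U B E) (z : Z ⟶ D) => by
      rw [← assocSeq_actA, ← actY_actA]
      exact congrArg (fun t => assocSeq (actY z t) q) (act_left f p))
  assoc_naturality {B B' E E' D D'} f g h := by
    have key : ∀ {A U Z : Lens C} (p : Seq A U Z) (q : Seq U B E) (z : Z ⟶ D),
        assocSeq (actY (z ≫ h) p) (actA (𝟙 U) (actX f (actY g q))) =
          (conv.map (yoneda.map f) ((seqSplit C).atMap g h)).app (op A)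
            (assocSeq (actY z p) q) := by
      intro A U Z p q z
      have h₁ : (yoneda.map f : yoneda.obj B ⟶ yoneda.obj B') =
          (𝟙 _ ≫ 𝟙 _) ≫ yoneda.map f := by simp
      have h₂ : (seqSplit C).atMap g h =
          ((seqSplit C).atMap (𝟙 E) h ≫ (seqSplit C).atMap g (𝟙 D')) ≫ 𝟙 _ := by
        ext A p
        have h₃ : ∀ {A : Lens C} (p : (seqSplit C).el A E D),
            (seqSplit C).act (𝟙 A) g h p =
              (seqSplit C).act (𝟙 A) g (𝟙 D') ((seqSplit C).act (𝟙 A) (𝟙 E) h p) := by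
          intro A p
          rw [Split.act_act]
          simp
        exact h₃ p
      rw [actA_id, actY_comp, assocSeq_actX, assocSeq_actY, assocSeq_actY_left, h₁, h₂,
        conv.map_comp, conv.map_comp]
      rfl
    ext ⟨A⟩ r
    induction r using conv.ind with
    | @h U Z p q z => exact key p q z
  leftUnitor B := conv.desc
    (fun {A X Y} (p : Seq A X Y) (n : X.dom ⟶ X.cod) (y : Y ⟶ B) => fillX p n ≫ y)
    (fun {A X X' Y Y'} (a : X ⟶ X') (b : Y ⟶ Y') (p : Seq A X Y) (n : X'.dom ⟶ X'.cod)
        (y : Y' ⟶ B) =>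
      show fillX (actA (𝟙 A) (actX a (actY b p))) n ≫ y = fillX p (actN C a n) ≫ b ≫ y by
        rw [actA_id, fillX_actX, fillX_actY, Category.assoc])
    (fun {A A' X Y} (f : A' ⟶ A) (p : Seq A X Y) (n : X.dom ⟶ X.cod) (y : Y ⟶ B) =>
      show fillX (actA f (actX (𝟙 X) (actY (𝟙 Y) p))) n ≫ y = f ≫ fillX p n ≫ y by
        rw [actY_id, actX_id, fillX_actA, Category.assoc])
  leftUnitor_naturality {B B'} f := by
    ext ⟨A⟩ r
    induction r using conv.ind with
    | @h X Y p n y => exact (Category.assoc (fillX p n) y f).symm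
  rightUnitor B := conv.desc
    (fun {A X Y} (p : Seq A X Y) (x : X ⟶ B) (n : Y.dom ⟶ Y.cod) => fillY p n ≫ x)
    (fun {A X X' Y Y'} (a : X ⟶ X') (b : Y ⟶ Y') (p : Seq A X Y) (x : X' ⟶ B)
        (n : Y'.dom ⟶ Y'.cod) =>
      show fillY (actA (𝟙 A) (actX a (actY b p))) n ≫ x = fillY p (actN C b n) ≫ a ≫ x by
        rw [actA_id, fillY_actX, fillY_actY, Category.assoc])
    (fun {A A' X Y} (f : A' ⟶ A) (p : Seq A X Y) (x : X ⟶ B) (n : Y.dom ⟶ Y.cod) =>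
      show fillY (actA f (actX (𝟙 X) (actY (𝟙 Y) p))) n ≫ x = f ≫ fillY p n ≫ x by
        rw [actY_id, actX_id, fillY_actA, Category.assoc])
  rightUnitor_naturality {B B'} f := by
    ext ⟨A⟩ r
    induction r using conv.ind with
    | @h X Y p x n => exact (Category.assoc (fillY p n) x f).symm

variable [SymmetricCategory C]

variable {C}

/-- The tensor of sequential splits of lenses. -/
def tensSeq {U X Y W Z T : Lens C} (p : Seq U X Y) (q : Seq W Z T) :
    Seq (U ⊗ W) (X ⊗ Z) (Y ⊗ T) :=
  Quot.lift₂
    (fun (r : SeqRep U X Y) (t : SeqRep W Z T) =>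
      (seq (A := U ⊗ W) (X := X ⊗ Z) (Y := Y ⊗ T)
        ((r.fst ⊗ₘ t.fst) ≫ tensorμ r.M X.dom t.M Z.dom)
        (tensorμ r.M t.M X.cod Z.cod ≫ (r.mid ⊗ₘ t.mid) ≫ tensorμ r.N Y.dom t.N T.dom)
        (tensorμ r.N t.N Y.cod T.cod ≫ (r.snd ⊗ₘ t.snd)) : Seq (U ⊗ W) (X ⊗ Z) (Y ⊗ T)))
    (by
      rintro r _ _ ⟨a, b, f, m, s⟩
      refine (seq_eq (A := U ⊗ W) (X := X ⊗ Z) (Y := Y ⊗ T) (𝟙 r.M ⊗ₘ a) (𝟙 r.N ⊗ₘ b)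
        ?_ ?_ ?_).symm
      · exact (tensorμ_slide_dom r.fst f (𝟙 r.M) a).trans (by simp)
      · exact tensorμ_slide_mid (by simp) (by simp)
      · exact (tensorμ_slide_cod r.snd s (𝟙 r.N) b).trans (by simp))
    (by
      rintro _ _ t ⟨a, b, f, m, s⟩
      refine (seq_eq (A := U ⊗ W) (X := X ⊗ Z) (Y := Y ⊗ T) (a ⊗ₘ 𝟙 t.M) (b ⊗ₘ 𝟙 t.N)
        ?_ ?_ ?_).symm
      · exact (tensorμ_slide_dom f t.fst a (𝟙 t.M)).trans (by simp)
      · exact tensorμ_slide_mid (by simp) (by simp)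
      · exact (tensorμ_slide_cod s t.snd b (𝟙 t.N)).trans (by simp)) p q

theorem tensSeq_actA {U U' X Y W W' Z T : Lens C} (l : U' ⟶ U) (l' : W' ⟶ W) (p : Seq U X Y)
    (q : Seq W Z T) : tensSeq (actA l p) (actA l' q) = actA (l ⊗ₘ l') (tensSeq p q) := by
  induction p using seq_ind with
  | @h M N f m s =>
  induction q using seq_ind with
  | @h M' N' f' m' s' =>
  induction l using lens_ind with
  | @h K h k =>
  induction l' using lens_ind with
  | @h K' h' k' =>
  exact (seq_eq (A := U' ⊗ W') (X := X ⊗ Z) (Y := Y ⊗ T) (tensorμ K K' M M') (tensorμ K K' N N')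
    (tensorμ_comp_dom' h h' f f') (tensorμ_comp_mid m m') (tensorμ_comp_cod k k' s s')).symm

theorem tensSeq_actX {U X X' Y W Z Z' T : Lens C} (l : X ⟶ X') (l' : Z ⟶ Z') (p : Seq U X Y)
    (q : Seq W Z T) : tensSeq (actX l p) (actX l' q) = actX (l ⊗ₘ l') (tensSeq p q) := by
  induction p using seq_ind with
  | @h M N f m s =>
  induction q using seq_ind with
  | @h M' N' f' m' s' =>
  induction l using lens_ind with
  | @h K h k =>
  induction l' using lens_ind with
  | @h K' h' k' =>
  exact (seq_eq (A := U ⊗ W) (X := X' ⊗ Z') (Y := Y ⊗ T) (tensorμ M M' K K') (𝟙 _)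
    (tensorμ_comp_dom' f f' h h') (tensorμ_id_mid m m' k k') (by simp)).symm

theorem tensSeq_actY {U X Y Y' W Z T T' : Lens C} (l : Y ⟶ Y') (l' : T ⟶ T') (p : Seq U X Y)
    (q : Seq W Z T) : tensSeq (actY l p) (actY l' q) = actY (l ⊗ₘ l') (tensSeq p q) := by
  induction p using seq_ind with
  | @h M N f m s =>
  induction q using seq_ind with
  | @h M' N' f' m' s' =>
  induction l using lens_ind with
  | @h K h k =>
  induction l' using lens_ind with
  | @h K' h' k' =>
  exact (seq_eq (A := U ⊗ W) (X := X ⊗ Z) (Y := Y' ⊗ T') (𝟙 _) (tensorμ N N' K K')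
    (by simp) (tensorμ_mid_id m m' h h') (tensorμ_comp_cod s s' k k')).symm

variable (C)

/-- The sequential structure of monoidal lenses, with its tensor. -/
abbrev seqOver : SeqOver (Lens C) where
  seq := seqData C
  tens p q := tensSeq p q
  tens_naturality {U U' X X' Y Y' W W' Z Z' T T'} f g h f' g' h' p q := by
    have key : ∀ (p : Seq U X Y) (q : Seq W Z T),
        tensSeq (actA f (actX g (actY h p))) (actA f' (actX g' (actY h' q))) =
          actA (f ⊗ₘ f') (actX (g ⊗ₘ g') (actY (h ⊗ₘ h') (tensSeq p q))) := by
      intro p q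
      rw [tensSeq_actA, tensSeq_actX, tensSeq_actY]
    exact key p q
  tensI := (seq (λ_ (𝟙_ C)).inv ((λ_ (𝟙_ C)).hom ≫ (λ_ (𝟙_ C)).inv) (λ_ (𝟙_ C)).hom :
    Seq (𝟙_ (Lens C)) (𝟙_ (Lens C)) (𝟙_ (Lens C)))
  unitTens {A B} (m : A.dom ⟶ A.cod) (n : B.dom ⟶ B.cod) := (m ⊗ₘ n :)
  unitTens_naturality {A A' B B'} f g m n := by
    have h : ∀ (f : A' ⟶ A) (g : B' ⟶ B) (m : A.dom ⟶ A.cod) (n : B.dom ⟶ B.cod),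
        (actN C f m) ⊗ₘ (actN C g n) = actN C (A := A ⊗ B) (A' := A' ⊗ B') (f ⊗ₘ g) (m ⊗ₘ n) := by
      intro f g m n
      induction f using lens_ind with
      | @h P f f' =>
      induction g using lens_ind with
      | @h Q g g' => exact tensorμ_unitTens f m f' g n g'
    exact h f g m n
  unitI := 𝟙 (𝟙_ C)

end Structure

end Lens

/-- The symmetric produoidal category of monoidal lenses. -/
abbrev lenses (C : Type u) [SmallCategory C] [MonoidalCategory C] [SymmetricCategory C] :
    SymProduoidalData (Lens C) :=
  (Lens.seqOver C).toSymProduoidal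

section Inclusion

variable (C : Type u) [SmallCategory C] [MonoidalCategory C] [SymmetricCategory C]

/-- Pairs of arrows as lenses with trivial residual, as a functor. -/
abbrev inclusionFunctor : Splice C ⥤ Lens C where
  obj A := ⟨A.dom, A.cod⟩
  map {A X} f := (Lens.pair f.fst f.snd : (⟨A.dom, A.cod⟩ : Lens C) ⟶ ⟨X.dom, X.cod⟩)
  map_id A := Lens.pair_id (⟨A.dom, A.cod⟩ : Lens C)
  map_comp {A X Z} f g := (Lens.pair_comp_pair (A := ⟨A.dom, A.cod⟩) (X := ⟨X.dom, X.cod⟩)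
    (Z := ⟨Z.dom, Z.cod⟩) f.fst f.snd g.fst g.snd).symm

variable {C}

/-- Pairs of arrows as parallel splits of lenses. -/
abbrev inclusionPar {A X Y : Splice C} (p : A ⟶ X ⊗ Y) :
    (inclusionFunctor C).obj A ⟶ (inclusionFunctor C).obj X ⊗ (inclusionFunctor C).obj Y :=
  Lens.pair p.fst p.snd

/-- Sequential splits of arrows as sequential splits of lenses with trivial residuals. -/
abbrev inclusionSeq {A X Y : Splice C} (p : Splice.Seq A X Y) :
    Lens.Seq ((inclusionFunctor C).obj A) ((inclusionFunctor C).obj X)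
      ((inclusionFunctor C).obj Y) :=
  Lens.seq (p.fst ≫ (λ_ X.dom).inv) ((λ_ X.cod).hom ≫ p.mid ≫ (λ_ Y.dom).inv)
    ((λ_ Y.cod).hom ≫ p.snd)

theorem inclusionPar_act {A A' X X' Y Y' : Splice C} (f : A' ⟶ A) (g : X ⟶ X') (h : Y ⟶ Y')
    (p : A ⟶ X ⊗ Y) :
    inclusionPar (f ≫ p ≫ (g ⊗ₘ h)) =
      (inclusionFunctor C).map f ≫ inclusionPar p ≫
        ((inclusionFunctor C).map g ⊗ₘ (inclusionFunctor C).map h) :=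
  (Lens.pair_comp₃ (X := ⟨A'.dom, A'.cod⟩) (Y := ⟨A.dom, A.cod⟩)
    (Z := ⟨X.dom ⊗ Y.dom, X.cod ⊗ Y.cod⟩) (W := ⟨X'.dom ⊗ Y'.dom, X'.cod ⊗ Y'.cod⟩) rfl rfl
    (Lens.pair_tensorHom_pair (A := ⟨X.dom, X.cod⟩) (A' := ⟨Y.dom, Y.cod⟩)
      (X := ⟨X'.dom, X'.cod⟩) (X' := ⟨Y'.dom, Y'.cod⟩) g.fst g.snd h.fst h.snd)).symm

theorem inclusionSeq_act {A A' X X' Y Y' : Splice C} (f : A' ⟶ A) (g : X ⟶ X') (h : Y ⟶ Y')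
    (p : Splice.Seq A X Y) :
    inclusionSeq ⟨f.fst ≫ p.fst ≫ g.fst, g.snd ≫ p.mid ≫ h.fst, h.snd ≫ p.snd ≫ f.snd⟩ =
      Lens.actA ((inclusionFunctor C).map f) (Lens.actX ((inclusionFunctor C).map g)
        (Lens.actY ((inclusionFunctor C).map h) (inclusionSeq p))) := by
  refine Eq.symm ?_
  refine (congrArg (fun t => Lens.actA _ (Lens.actX _ t)) (Lens.seq_actY_pair _ _ _ _ _)).trans ?_
  refine (congrArg (Lens.actA _) (Lens.seq_actX_pair _ _ _ _ _)).trans ?_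
  refine (Lens.seq_actA_pair _ _ _ _ _).trans ?_
  exact Lens.seq_eq (𝟙 _) (𝟙 _) (by simp) (by simp) (by simp)

theorem inclusionN_act {A A' : Splice C} (f : A' ⟶ A) (n : A.dom ⟶ A.cod) :
    f.fst ≫ n ≫ f.snd = Lens.actN C ((inclusionFunctor C).map f) n := by
  refine Eq.symm ((show (f.fst ≫ (λ_ A.dom).inv) ≫ 𝟙_ C ◁ n ≫ (λ_ A.cod).hom ≫ f.snd =
    f.fst ≫ n ≫ f.snd by simp))

variable (C)

/-- The inclusion of spliced monoidal arrows into monoidal lenses, with trivial residuals. -/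
def inclusion : ProFunctor (spliced C) (lenses C) where
  functor := inclusionFunctor C
  mapPar :=
    { app := fun {A X Y} (p : A ⟶ X ⊗ Y) => inclusionPar p
      naturality := fun f g h p => inclusionPar_act f g h p }
  mapSeq :=
    { app := fun {A X Y} (p : Splice.Seq A X Y) => inclusionSeq p
      naturality := fun f g h p => inclusionSeq_act f g h p }
  mapI :=
    { app := fun A => ↾fun (j : A.unop ⟶ 𝟙_ (Splice C)) =>
        (Lens.pair j.fst j.snd : (inclusionFunctor C).obj A.unop ⟶ 𝟙_ (Lens C))
      naturality := fun A A' f => by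
        ext j
        exact (Lens.pair_comp_pair (A := ⟨A'.unop.dom, A'.unop.cod⟩)
          (X := ⟨A.unop.dom, A.unop.cod⟩) (Z := 𝟙_ (Lens C))
          f.unop.fst f.unop.snd j.fst j.snd).symm }
  mapN :=
    { app := fun A => ↾fun (n : A.unop.dom ⟶ A.unop.cod) => n
      naturality := fun A A' f => by
        ext n
        exact inclusionN_act f.unop n }

end Inclusion

end MonoidalLenses

section Normalization

/-- The co-Yoneda map `𝕍(•; B ◁ C) ⟶ 𝕍(•; B ◁ C)` from the coend over representable
presheaves. -/
def conv.collapse {V : Type u} [SmallCategory V] (P : Split V) (B C : V) :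
    conv P (yoneda.obj B) (yoneda.obj C) ⟶ P.psh B C :=
  conv.desc (H := P.psh B C) (fun {A X Y} p (x : X ⟶ B) (y : Y ⟶ C) => P.act (𝟙 A) x y p)
    (fun {A X X' Y Y'} a b p (x : X' ⟶ B) (y : Y' ⟶ C) =>
      show P.act (𝟙 A) x y (P.act (𝟙 A) a b p) = P.act (𝟙 A) (a ≫ x) (b ≫ y) p by
        rw [P.act_act, Category.comp_id])
    (fun {A A' X Y} f p (x : X ⟶ B) (y : Y ⟶ C) =>
      show P.act (𝟙 A') x y (P.act f (𝟙 X) (𝟙 Y) p) =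
        P.act f (𝟙 B) (𝟙 C) (P.act (𝟙 A) x y p) by
        rw [P.act_act, P.act_act]
        simp)

variable {V W : Type u} [SmallCategory V] [SmallCategory W] {𝕍 : SymProduoidalData V}
  {𝕎 : SymProduoidalData W}

namespace ProFunctor

variable (F : ProFunctor 𝕍 𝕎) [IsIso 𝕎.φ₀]

/-- For `𝕎` normal, a map of expressions `𝕍(•; G) ⟶ 𝕎(F •; H)` extends to
`𝕍(•; N ⊗ G) ⟶ 𝕎(F •; N ⊗ H) ≅ 𝕎(F •; I ⊗ H) ≅ 𝕎(F •; H)`. -/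
noncomputable def normalize {G : Psh V} {H : Psh W} (s : G ⟶ F.functor.op ⋙ H) :
    𝕍.T 𝕍.seq.unit G ⟶ F.functor.op ⋙ H :=
  F.mapPar.conv F.mapN s ≫
    Functor.whiskerLeft F.functor.op (conv.map (inv 𝕎.φ₀) (𝟙 H) ≫ 𝕎.par.leftExt H)

/-- The canonical map `𝕍(A; N ⊗ B) → 𝕎(F A; F B)`. -/
noncomputable def normHom (B : V) :
    𝕍.T 𝕍.seq.unit (yoneda.obj B) ⟶ F.functor.op ⋙ yoneda.obj (F.functor.obj B) :=
  F.normalize (yonedaMap F.functor B)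

/-- The canonical map `𝕍(A; N ⊗ B ⊗ C) → 𝕎(F A; F B ⊗ F C)`. -/
noncomputable def normPar (B C : V) :
    𝕍.T 𝕍.seq.unit (𝕍.par.split.psh B C) ⟶
      F.functor.op ⋙ 𝕎.par.split.psh (F.functor.obj B) (F.functor.obj C) :=
  F.normalize (F.mapPar.psh B C)

/-- The canonical map `𝕍(A; (N ⊗ B) ◁ (N ⊗ C)) → 𝕎(F A; F B ◁ F C)`. -/
noncomputable def normSeq (B C : V) :
    𝕍.S (𝕍.T 𝕍.seq.unit (yoneda.obj B)) (𝕍.T 𝕍.seq.unit (yoneda.obj C)) ⟶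
      F.functor.op ⋙ 𝕎.seq.split.psh (F.functor.obj B) (F.functor.obj C) :=
  F.mapSeq.conv (F.normHom B) (F.normHom C) ≫
    Functor.whiskerLeft F.functor.op (conv.collapse 𝕎.seq.split _ _)

/-- The canonical map `𝕍(A; N) → 𝕎(F A; I)`. -/
noncomputable def normI : 𝕍.seq.unit ⟶ F.functor.op ⋙ 𝕎.par.unit :=
  F.mapN ≫ Functor.whiskerLeft F.functor.op (inv 𝕎.φ₀)

/-- The canonical maps out of the symmetric normalization of `𝕍` are isomorphisms: `F` is bijective
on objects and it identifies the morphisms, splits and units of `𝕎` with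
`𝕍(A; N ⊗ B)`, `𝕍(A; N ⊗ B ⊗ C)`, `𝕍(A; (N ⊗ B) ◁ (N ⊗ C))` and `𝕍(A; N)`. -/
structure IsKleisli : Prop where
  obj_bijective : Function.Bijective F.functor.obj
  hom (B : V) : IsIso (F.normHom B)
  par (B C : V) : IsIso (F.normPar B C)
  seq (B C : V) : IsIso (F.normSeq B C)
  unitI : IsIso F.normI
  unitN : IsIso F.mapN

end ProFunctor

/-- `F : 𝕍 ⟶ 𝕎` exhibits `𝕎` as the free normal symmetric produoidal category over `𝕍`. -/
structure IsFreeNormalization (F : ProFunctor 𝕍 𝕎) : Prop where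
  laws : 𝕎.IsSymProduoidal
  normal : 𝕎.IsNormal
  functor_laws : F.IsSymProduoidal
  universal {X : Type u} [SmallCategory X] (𝕏 : SymProduoidalData X) :
    𝕏.IsSymProduoidal → 𝕏.IsNormal → ∀ G : ProFunctor 𝕍 𝕏, G.IsSymProduoidal →
      ∃! H : ProFunctor 𝕎 𝕏, H.IsSymProduoidal ∧ F.comp H = G

/-- `η : 𝕍 ⟶ 𝓢 D` exhibits the symmetric monoidal category `D` as the monoidal contour of `𝕍`: it
is universal among the symmetric produoidal functors from `𝕍` to spliced monoidal arrows. -/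
structure IsContour (𝕍 : SymProduoidalData V) {D : Type u} [SmallCategory D] [MonoidalCategory D]
    [SymmetricCategory D] (η : ProFunctor 𝕍 (spliced D)) : Prop where
  functor_laws : η.IsSymProduoidal
  universal {C : Type u} [SmallCategory C] [MonoidalCategory C] [SymmetricCategory C]
    (F : ProFunctor 𝕍 (spliced C)) : F.IsSymProduoidal →
      ∃! K : D ⥤ C, ∃ _ : K.Braided, IsStrict K ∧ η.comp (spliceMap K) = F

end Normalization

end Produo

namespace Produo

section Squares

variable {V W : Type u} [SmallCategory V] [SmallCategory W]

/-- A commutative square over a functor `J`, relating a map of presheaves on `V` to a map of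
presheaves on `W`. -/
def Sq (J : V ⥤ W) {E E' : Psh V} {F F' : Psh W} (a : E ⟶ E') (b : F ⟶ F')
    (s : E ⟶ J.op ⋙ F) (s' : E' ⟶ J.op ⋙ F') : Prop :=
  ∀ (A : V) (x : E.obj (op A)), b.app (op (J.obj A)) (s.app (op A) x) = s'.app (op A) (a.app (op A) x)

/-- Componentwise surjectivity of a map of expressions. -/
def Onto {J : V ⥤ W} {E : Psh V} {F : Psh W} (s : E ⟶ J.op ⋙ F) : Prop :=
  ∀ A, Function.Surjective (s.app (op A))

namespace Sq

variable {J : V ⥤ W}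

theorem of_eq {E E' : Psh V} {F F' : Psh W} {a : E ⟶ E'} {b : F ⟶ F'}
    {s : E ⟶ J.op ⋙ F} {s' : E' ⟶ J.op ⋙ F'} (h : a ≫ s' = s ≫ Functor.whiskerLeft J.op b) :
    Sq J a b s s' := fun A x => (app_congr h (A := op A) x).symm

theorem eq {E E' : Psh V} {F F' : Psh W} {a : E ⟶ E'} {b : F ⟶ F'}
    {s : E ⟶ J.op ⋙ F} {s' : E' ⟶ J.op ⋙ F'} (h : Sq J a b s s') :
    a ≫ s' = s ≫ Functor.whiskerLeft J.op b := by
  ext ⟨A⟩ x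
  exact (h A x).symm

theorem id {E : Psh V} {F : Psh W} (s : E ⟶ J.op ⋙ F) : Sq J (𝟙 E) (𝟙 F) s s :=
  fun _ _ => rfl

theorem comp {E E' E'' : Psh V} {F F' F'' : Psh W} {a : E ⟶ E'} {b : F ⟶ F'}
    {a' : E' ⟶ E''} {b' : F' ⟶ F''}
    {s : E ⟶ J.op ⋙ F} {s' : E' ⟶ J.op ⋙ F'} {s'' : E'' ⟶ J.op ⋙ F''}
    (h : Sq J a b s s') (h' : Sq J a' b' s' s'') : Sq J (a ≫ a') (b ≫ b') s s'' := fun A x =>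
  (congrArg (b'.app _) (h A x)).trans (h' A _)

theorem map {P : Split V} {Q : Split W} (m : SplitMap J P Q) {E E' G G' : Psh V}
    {F F' H H' : Psh W} {a : E ⟶ E'} {b : F ⟶ F'}
    {s : E ⟶ J.op ⋙ F} {s' : E' ⟶ J.op ⋙ F'} {c : G ⟶ G'} {d : H ⟶ H'}
    {t : G ⟶ J.op ⋙ H} {t' : G' ⟶ J.op ⋙ H'} (h : Sq J a b s s') (h' : Sq J c d t t') :
    Sq J (conv.map a c : conv P _ _ ⟶ _) (conv.map b d : conv Q _ _ ⟶ _)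
      (m.conv s t) (m.conv s' t') := fun A x => by
  induction x using conv.ind with
  | @h X Y p x y => exact conv.congr rfl (h X x) (h' Y y)

/-- Two maps related to the same map through a componentwise surjective one are equal. -/
theorem cancel {E E' : Psh V} {F F' : Psh W} {a a' : E ⟶ E'} {b b' : F ⟶ F'}
    {s : E ⟶ J.op ⋙ F} {s' : E' ⟶ J.op ⋙ F'} (hJ : Function.Surjective J.obj)
    (hs : Onto s) (h : Sq J a b s s') (h' : Sq J a' b' s s')
    (e : a = a') : b = b' := by
  ext ⟨B⟩ y
  obtain ⟨A, rfl⟩ := hJ B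
  obtain ⟨x, rfl⟩ := hs A y
  exact (h A x).trans ((congrArg (fun t => s'.app _ (t.app _ x)) e).trans (h' A x).symm)

end Sq

theorem conv.mk_eq {P : Split V} {F G : Psh V} {A X X' Y Y' : V} (a : X ⟶ X') (b : Y ⟶ Y')
    {p : P.el A X Y} {p' : P.el A X' Y'} {x : F.obj (op X)} {x' : F.obj (op X')}
    {y : G.obj (op Y)} {y' : G.obj (op Y')} (hp : P.act (𝟙 A) a b p = p')
    (hx : F.map a.op x' = x) (hy : G.map b.op y' = y) :
    (conv.mk p x y : (conv P F G).obj (op A)) = conv.mk p' x' y' := by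
  subst hp hx hy
  exact (conv.dinat a b p x' y').symm

end Squares

section FunctorLaws

variable {V W : Type u} [SmallCategory V] [SmallCategory W] {J : V ⥤ W} {P : PromonoidalData V}
  {Q : PromonoidalData W} {m : SplitMap J P.split Q.split} {e : P.unit ⟶ J.op ⋙ Q.unit}

theorem sq_pt {E : Psh V} {F : Psh W} (s : E ⟶ J.op ⋙ F) {X : V} (x : E.obj (op X)) :
    Sq J (pt x) (pt (s.app (op X) x)) (yonedaMap J X) s := fun A f =>
  (NatTrans.naturality_apply s f.op x).symm

theorem sq_pt₂ (m : SplitMap J P.split Q.split) {E E' : Psh V} {F F' : Psh W} (s : E ⟶ J.op ⋙ F)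
    (s' : E' ⟶ J.op ⋙ F') {X Y : V} (x : E.obj (op X)) (y : E'.obj (op Y)) :
    Sq J (pt₂ P.split x y) (pt₂ Q.split (s.app (op X) x) (s'.app (op Y) y)) (m.psh X Y)
      (m.conv s s') := fun _ _ => rfl

namespace PreservesPromonoidal

theorem sq_assoc (h : PreservesPromonoidal J P Q m e) {F G H : Psh V} {F' G' H' : Psh W}
    (s : F ⟶ J.op ⋙ F') (t : G ⟶ J.op ⋙ G') (r : H ⟶ J.op ⋙ H') :
    Sq J (P.assocExt F G H) (Q.assocExt F' G' H') (m.conv (m.conv s t) r)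
      (m.conv s (m.conv t r)) := fun A w => by
  induction w using conv.ind with
  | @h U Z p q z =>
  induction q using conv.ind with
  | @h X Y q x y =>
  have h₁ := ((Sq.of_eq (h.assoc X Y Z)).comp ((sq_pt s x).map m (sq_pt₂ m t r y z))) A
    (conv.mk p q (𝟙 Z))
  refine Eq.trans ?_ h₁
  refine congrArg (fun c => (conv.map (pt _) (pt₂ Q.split _ _)).app _ ((Q.assoc _ _ _).app _
    (conv.mk _ _ c))) (J.map_id Z).symm

theorem sq_left (h : PreservesPromonoidal J P Q m e) {F : Psh V} {F' : Psh W}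
    (s : F ⟶ J.op ⋙ F') :
    Sq J (P.leftExt F) (Q.leftExt F') (m.conv e s) s := fun A w => by
  induction w using conv.ind with
  | @h U Z p j z =>
  have h₁ := ((Sq.of_eq (h.leftUnitor Z)).comp (sq_pt s z)) A (conv.mk p j (𝟙 Z))
  refine Eq.trans ?_ h₁
  exact congrArg (fun c => (pt (F := F') _).app (op (J.obj A)) ((Q.leftUnitor _).app _
    (conv.mk _ _ c))) (J.map_id Z).symm

theorem sq_right (h : PreservesPromonoidal J P Q m e) {F : Psh V} {F' : Psh W}
    (s : F ⟶ J.op ⋙ F') :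
    Sq J (P.rightExt F) (Q.rightExt F') (m.conv s e) s := fun A w => by
  induction w using conv.ind with
  | @h U Z p z j =>
  have h₁ := ((Sq.of_eq (h.rightUnitor U)).comp (sq_pt s z)) A (conv.mk p (𝟙 U) j)
  refine Eq.trans ?_ h₁
  exact congrArg (fun c => (pt (F := F') _).app (op (J.obj A)) ((Q.rightUnitor _).app _
    (conv.mk _ c _))) (J.map_id U).symm

end PreservesPromonoidal

end FunctorLaws

namespace ProFunctor

variable {V W : Type u} [SmallCategory V] [SmallCategory W] {𝕍 : SymProduoidalData V}
  {𝕎 : SymProduoidalData W} {J : ProFunctor 𝕍 𝕎}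

namespace IsSymProduoidal

theorem sq_ψ₂ (h : J.IsSymProduoidal) {F G H K : Psh V} {F' G' H' K' : Psh W}
    (s : F ⟶ J.functor.op ⋙ F') (t : G ⟶ J.functor.op ⋙ G') (r : H ⟶ J.functor.op ⋙ H')
    (k : K ⟶ J.functor.op ⋙ K') :
    Sq J.functor (𝕍.ψ₂Ext F G H K) (𝕎.ψ₂Ext F' G' H' K')
      (J.mapPar.conv (J.mapSeq.conv s t) (J.mapSeq.conv r k))
      (J.mapSeq.conv (J.mapPar.conv s r) (J.mapPar.conv t k)) := fun A w => by
  induction w using conv.ind with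
  | @h U Z p q q' =>
  induction q using conv.ind with
  | @h X Y q x y =>
  induction q' using conv.ind with
  | @h X' Y' q' x' y' =>
  exact ((Sq.of_eq (h.ψ₂ X Y X' Y')).comp ((sq_pt₂ J.mapPar s r x x').map J.mapSeq
    (sq_pt₂ J.mapPar t k y y'))) A (conv.mk p q q')

theorem sq_σ (h : J.IsSymProduoidal) {F G : Psh V} {F' G' : Psh W}
    (s : F ⟶ J.functor.op ⋙ F') (t : G ⟶ J.functor.op ⋙ G') :
    Sq J.functor (𝕍.σExt F G) (𝕎.σExt F' G') (J.mapPar.conv s t) (J.mapPar.conv t s) := fun A w => by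
  induction w using conv.ind with
  | @h U Z p x y =>
  exact ((Sq.of_eq (h.σ U Z)).comp (sq_pt₂ J.mapPar t s y x)) A p

theorem sq_ψ₀ (h : J.IsSymProduoidal) :
    Sq J.functor 𝕍.ψ₀ 𝕎.ψ₀ J.mapI (J.mapSeq.conv J.mapI J.mapI) := Sq.of_eq h.ψ₀

theorem sq_φ₂ (h : J.IsSymProduoidal) :
    Sq J.functor 𝕍.φ₂ 𝕎.φ₂ (J.mapPar.conv J.mapN J.mapN) J.mapN := Sq.of_eq h.φ₂

theorem sq_φ₀ (h : J.IsSymProduoidal) : Sq J.functor 𝕍.φ₀ 𝕎.φ₀ J.mapI J.mapN := Sq.of_eq h.φ₀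

end IsSymProduoidal

end ProFunctor

end Produo

namespace Produo

section Applications

variable {V : Type u} [SmallCategory V]

theorem comp_app_el {F G H : Psh V} (s : F ⟶ G) (t : G ⟶ H) {A : V} (x : F.obj (op A)) :
    (s ≫ t).app (op A) x = t.app (op A) (s.app (op A) x) := rfl

theorem id_app_el (F : Psh V) {A : V} (x : F.obj (op A)) : (𝟙 F : F ⟶ F).app (op A) x = x := rfl

theorem psh_ext {F G : Psh V} {s t : F ⟶ G}
    (h : ∀ (A : V) (x : F.obj (op A)), s.app (op A) x = t.app (op A) x) : s = t := by
  ext ⟨A⟩ x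
  exact h A x

theorem isIso_of_bijective {F G : Psh V} (s : F ⟶ G)
    (h : ∀ A : V, Function.Bijective (s.app (op A))) : IsIso s := by
  have : ∀ A, IsIso (s.app A) := fun A => (isIso_iff_bijective _).2 (h A.unop)
  exact NatIso.isIso_of_isIso_app s

theorem bijective_of_isIso {F G : Psh V} (s : F ⟶ G) [IsIso s] (A : V) :
    Function.Bijective (s.app (op A)) :=
  (isIso_iff_bijective _).1 inferInstance

end Applications

section ParallelLaws

variable {V : Type u} [SmallCategory V] [MonoidalCategory V]

/-- The class of `(p ∣ x ∣ y)` for a parallel split `p : A ⟶ X ⊗ Y`. -/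
abbrev tmk {F G : Psh V} {A X Y : V} (p : A ⟶ X ⊗ Y) (x : F.obj (op X)) (y : G.obj (op Y)) :
    (conv (tensSplit V) F G).obj (op A) :=
  conv.mk (P := tensSplit V) p x y

theorem tmk_ind {F G : Psh V} {A : V} {motive : (conv (tensSplit V) F G).obj (op A) → Prop}
    (h : ∀ {X Y : V} (p : A ⟶ X ⊗ Y) (x : F.obj (op X)) (y : G.obj (op Y)), motive (tmk p x y))
    (r : (conv (tensSplit V) F G).obj (op A)) : motive r :=
  conv.ind h r

theorem tmk_eq {F G : Psh V} {A X X' Y Y' : V} (a : X ⟶ X') (b : Y ⟶ Y')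
    {p : A ⟶ X ⊗ Y} {p' : A ⟶ X' ⊗ Y'} {x : F.obj (op X)} {x' : F.obj (op X')}
    {y : G.obj (op Y)} {y' : G.obj (op Y')} (hp : p ≫ (a ⊗ₘ b) = p')
    (hx : F.map a.op x' = x) (hy : G.map b.op y' = y) :
    tmk p x y = tmk p' x' y' :=
  conv.mk_eq a b ((Category.id_comp _).trans hp) hx hy

theorem tmk_yoneda {A B C X Y : V} (p : A ⟶ X ⊗ Y) (x : X ⟶ B) (y : Y ⟶ C) :
    tmk (F := yoneda.obj B) (G := yoneda.obj C) p x y = tmk (p ≫ (x ⊗ₘ y)) (𝟙 B) (𝟙 C) :=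
  tmk_eq (F := yoneda.obj B) (G := yoneda.obj C) x y rfl (Category.comp_id x) (Category.comp_id y)

theorem map_tmk {F G : Psh V} {A A' X Y : V} (f : A' ⟶ A) (p : A ⟶ X ⊗ Y)
    (x : F.obj (op X)) (y : G.obj (op Y)) :
    (conv (tensSplit V) F G).map f.op (tmk p x y) = tmk (f ≫ p) x y :=
  conv.congr (show f ≫ p ≫ (𝟙 X ⊗ₘ 𝟙 Y) = f ≫ p by simp) rfl rfl

theorem conv_map_tmk {F F' G G' : Psh V} (s : F ⟶ F') (t : G ⟶ G') {A X Y : V} (p : A ⟶ X ⊗ Y)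
    (x : F.obj (op X)) (y : G.obj (op Y)) :
    (conv.map s t).app (op A) (tmk p x y) = tmk p (s.app (op X) x) (t.app (op Y) y) := rfl

theorem parOfMonoidal_assocExt_mk {F G H : Psh V} {A U X Y Z : V} (p : A ⟶ U ⊗ Z) (q : U ⟶ X ⊗ Y)
    (x : F.obj (op X)) (y : G.obj (op Y)) (z : H.obj (op Z)) :
    ((parOfMonoidal V).assocExt F G H).app (op A) (tmk p (tmk q x y) z) =
      tmk (p ≫ q ▷ Z ≫ (α_ X Y Z).hom) x (tmk (𝟙 (Y ⊗ Z)) y z) :=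
  conv.congr (by rw [MonoidalCategory.tensorHom_id]) (F.map_id_apply _ x) rfl

theorem parOfMonoidal_leftExt_mk {F : Psh V} {A X Y : V} (p : A ⟶ X ⊗ Y) (j : X ⟶ 𝟙_ V)
    (x : F.obj (op Y)) :
    ((parOfMonoidal V).leftExt F).app (op A) (tmk (F := yoneda.obj (𝟙_ V)) p j x) =
      F.map (p ≫ j ▷ Y ≫ (λ_ Y).hom).op x :=
  congrArg (fun t => F.map (Quiver.Hom.op t) x)
    (show p ≫ (j ⊗ₘ 𝟙 Y) ≫ (λ_ Y).hom = _ by rw [MonoidalCategory.tensorHom_id])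

theorem parOfMonoidal_rightExt_mk {F : Psh V} {A X Y : V} (p : A ⟶ X ⊗ Y) (x : F.obj (op X))
    (j : Y ⟶ 𝟙_ V) :
    ((parOfMonoidal V).rightExt F).app (op A) (tmk (G := yoneda.obj (𝟙_ V)) p x j) =
      F.map (p ≫ X ◁ j ≫ (ρ_ X).hom).op x :=
  congrArg (fun t => F.map (Quiver.Hom.op t) x)
    (show p ≫ (𝟙 X ⊗ₘ j) ≫ (ρ_ X).hom = _ by rw [MonoidalCategory.id_tensorHom])

theorem parOfMonoidal_assoc_bijective (A B C D : V) :
    Function.Bijective (((parOfMonoidal V).assoc B C D).app (op A)) := by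
  constructor
  · intro v w hvw
    have key : ∀ v, ∃ f : A ⟶ (B ⊗ C) ⊗ D,
        v = tmk (F := (tensSplit V).psh B C) (G := yoneda.obj D) f (𝟙 (B ⊗ C)) (𝟙 D) := by
      intro v
      induction v using tmk_ind with
      | @h X Y p x y =>
      have : ∀ (x : X ⟶ B ⊗ C) (y : Y ⟶ D), tmk (F := (tensSplit V).psh B C) (G := yoneda.obj D)
          p x y = tmk (p ≫ (x ⊗ₘ y)) (𝟙 (B ⊗ C)) (𝟙 D) := fun x y =>
        tmk_eq (F := (tensSplit V).psh B C) (G := yoneda.obj D) x y rfl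
          (show x ≫ 𝟙 _ ≫ (𝟙 B ⊗ₘ 𝟙 C) = x by simp) (Category.comp_id y)
      exact ⟨_, this x y⟩
    obtain ⟨f, rfl⟩ := key v
    obtain ⟨g, rfl⟩ := key w
    have := congrArg ((conv.collapse (tensSplit V) B (C ⊗ D)).app (op A)) ((congrArg (conv.map (𝟙 _)
      (show (tensSplit V).psh C D ⟶ yoneda.obj (C ⊗ D) from
          { app := fun A => ↾fun p => p
            naturality := fun A A' f => by
              ext p
              have : ∀ p : A.unop ⟶ C ⊗ D, f.unop ≫ p ≫ (𝟙 C ⊗ₘ 𝟙 D) = f.unop ≫ p := by simp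
              exact this p }) |>.app (op A))) hvw)
    have h₁ : 𝟙 A ≫ (f ≫ (𝟙 (B ⊗ C) ⊗ₘ 𝟙 D) ≫ (α_ B C D).hom) ≫ (𝟙 B ⊗ₘ 𝟙 (C ⊗ D)) =
      𝟙 A ≫ (g ≫ (𝟙 (B ⊗ C) ⊗ₘ 𝟙 D) ≫ (α_ B C D).hom) ≫ (𝟙 B ⊗ₘ 𝟙 (C ⊗ D)) := this
    simp only [MonoidalCategory.id_tensorHom_id, Category.id_comp, Category.comp_id,
      Iso.cancel_iso_hom_right] at h₁
    rw [h₁]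
  · intro w
    induction w using tmk_ind with
    | @h X Y p x q =>
    have key : ∀ (x : X ⟶ B) (q : Y ⟶ C ⊗ D), tmk (F := yoneda.obj B) (G := (tensSplit V).psh C D)
        (((p ≫ (x ⊗ₘ q)) ≫ (α_ B C D).inv) ≫ (𝟙 (B ⊗ C) ⊗ₘ 𝟙 D) ≫ (α_ B C D).hom)
        (𝟙 B) (𝟙 (C ⊗ D)) = tmk p x q := fun x q =>
      Eq.symm (tmk_eq (F := yoneda.obj B) (G := (tensSplit V).psh C D) x q (by simp)
        (Category.comp_id x) (show q ≫ 𝟙 _ ≫ (𝟙 C ⊗ₘ 𝟙 D) = q by simp))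
    exact ⟨tmk (F := (tensSplit V).psh B C) (G := yoneda.obj D)
      ((p ≫ (MonoidalCategoryStruct.tensorHom (X₁ := X) (Y₁ := B) (X₂ := Y) (Y₂ := C ⊗ D) x q)) ≫
        (α_ B C D).inv) (𝟙 (B ⊗ C)) (𝟙 D), key x q⟩

theorem parOfMonoidal_leftUnitor_bijective (A B : V) :
    Function.Bijective (((parOfMonoidal V).leftUnitor B).app (op A)) := by
  refine Function.bijective_iff_has_inverse.2 ⟨fun t => tmk (F := yoneda.obj (𝟙_ V))
    (G := yoneda.obj B) (CategoryStruct.comp (X := A) (Y := B) t (λ_ B).inv) (𝟙 (𝟙_ V)) (𝟙 B), ?_, ?_⟩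
  · intro w
    induction w using tmk_ind with
    | @h X Y p j x =>
    have key : ∀ (j : X ⟶ 𝟙_ V) (x : Y ⟶ B), tmk (F := yoneda.obj (𝟙_ V)) (G := yoneda.obj B)
        ((p ≫ (j ⊗ₘ x) ≫ (λ_ B).hom) ≫ (λ_ B).inv) (𝟙 (𝟙_ V)) (𝟙 B) = tmk p j x := fun j x => by
      rw [tmk_yoneda p j x]
      simp
    exact key j x
  · have key : ∀ t : A ⟶ B, (t ≫ (λ_ B).inv) ≫ (𝟙 (𝟙_ V) ⊗ₘ 𝟙 B) ≫ (λ_ B).hom = t := by simp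
    exact key

theorem parOfMonoidal_rightUnitor_bijective (A B : V) :
    Function.Bijective (((parOfMonoidal V).rightUnitor B).app (op A)) := by
  refine Function.bijective_iff_has_inverse.2 ⟨fun t => tmk (F := yoneda.obj B)
    (G := yoneda.obj (𝟙_ V)) (CategoryStruct.comp (X := A) (Y := B) t (ρ_ B).inv) (𝟙 B) (𝟙 (𝟙_ V)), ?_, ?_⟩
  · intro w
    induction w using tmk_ind with
    | @h X Y p x j =>
    have key : ∀ (j : Y ⟶ 𝟙_ V) (x : X ⟶ B), tmk (F := yoneda.obj B) (G := yoneda.obj (𝟙_ V))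
        ((p ≫ (x ⊗ₘ j) ≫ (ρ_ B).hom) ≫ (ρ_ B).inv) (𝟙 B) (𝟙 (𝟙_ V)) = tmk p x j := fun j x => by
      rw [tmk_yoneda p x j]
      simp
    exact key j x
  · have key : ∀ t : A ⟶ B, (t ≫ (ρ_ B).inv) ≫ (𝟙 B ⊗ₘ 𝟙 (𝟙_ V)) ≫ (ρ_ B).hom = t := by simp
    exact key

theorem parOfMonoidal_pentagon (F G H K : Psh V) :
    conv.map ((parOfMonoidal V).assocExt F G H) (𝟙 K) ≫
        (parOfMonoidal V).assocExt F (conv (parOfMonoidal V).split G H) K ≫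
        conv.map (𝟙 F) ((parOfMonoidal V).assocExt G H K) =
      (parOfMonoidal V).assocExt (conv (parOfMonoidal V).split F G) H K ≫
        (parOfMonoidal V).assocExt F G (conv (parOfMonoidal V).split H K) := by
  refine psh_ext fun A w => ?_
  induction w using tmk_ind with
  | @h U T p w t =>
  induction w using tmk_ind with
  | @h U' Z q w z =>
  induction w using tmk_ind with
  | @h X Y r x y =>
  rw [comp_app_el, comp_app_el, comp_app_el, conv_map_tmk, parOfMonoidal_assocExt_mk,
    parOfMonoidal_assocExt_mk, parOfMonoidal_assocExt_mk, parOfMonoidal_assocExt_mk, conv_map_tmk,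
    id_app_el, id_app_el, parOfMonoidal_assocExt_mk]
  refine tmk_eq (𝟙 X) (α_ Y Z T).hom (by simp) (F.map_id_apply _ x)
    ((map_tmk _ _ _ _).trans (conv.congr (show (α_ Y Z T).hom ≫ 𝟙 _ = _ from ?_) rfl rfl))
  rw [Category.comp_id, MonoidalCategory.id_whiskerRight, Category.id_comp, Category.id_comp]

theorem parOfMonoidal_triangle (F G : Psh V) :
    (parOfMonoidal V).assocExt F (parOfMonoidal V).unit G ≫
      conv.map (𝟙 F) ((parOfMonoidal V).leftExt G) = conv.map ((parOfMonoidal V).rightExt F) (𝟙 G) := by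
  refine psh_ext fun A w => ?_
  induction w using tmk_ind with
  | @h U T p w t =>
  induction w using tmk_ind with
  | @h X Y q x j =>
  have key : ∀ j : Y ⟶ 𝟙_ V, tmk (p ≫ q ▷ T ≫ (α_ X Y T).hom) x
      (G.map (𝟙 (Y ⊗ T) ≫ j ▷ T ≫ (λ_ T).hom).op t) =
      tmk p (F.map (q ≫ X ◁ j ≫ (ρ_ X).hom).op x) t := fun j =>
    Eq.trans (tmk_eq (p' := p ≫ (q ≫ X ◁ j ≫ (ρ_ X).hom) ▷ T) (x' := x) (y' := t)
      (𝟙 X) (j ▷ T ≫ (λ_ T).hom) (by simp) (F.map_id_apply _ x) (by simp))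
      (Eq.symm (tmk_eq (q ≫ X ◁ j ≫ (ρ_ X).hom) (𝟙 T) (by simp) rfl (G.map_id_apply _ t)))
  rw [comp_app_el, parOfMonoidal_assocExt_mk, conv_map_tmk, conv_map_tmk, id_app_el, id_app_el]
  refine Eq.trans (conv.congr rfl rfl (parOfMonoidal_leftExt_mk _ j t)) ((key j).trans ?_)
  exact (conv.congr rfl (parOfMonoidal_rightExt_mk q x j) rfl).symm

theorem parOfMonoidal_isPromonoidal : (parOfMonoidal V).IsPromonoidal where
  assoc_iso B C D := isIso_of_bijective _ fun A => parOfMonoidal_assoc_bijective A B C D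
  leftUnitor_iso B := isIso_of_bijective _ fun A => parOfMonoidal_leftUnitor_bijective A B
  rightUnitor_iso B := isIso_of_bijective _ fun A => parOfMonoidal_rightUnitor_bijective A B
  pentagon := parOfMonoidal_pentagon
  triangle := parOfMonoidal_triangle

end ParallelLaws

section Symmetry

variable {V : Type u} [SmallCategory V] [MonoidalCategory V] [SymmetricCategory V]

theorem SeqOver.symmetry (D : SeqOver V) (B C : V) :
    D.toSymProduoidal.σ B C ≫ D.toSymProduoidal.σ C B = 𝟙 _ := by
  ext ⟨A⟩ p
  have h : ∀ p : A ⟶ B ⊗ C, (p ≫ (β_ B C).hom) ≫ (β_ C B).hom = p := by simp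
  exact h p

end Symmetry

end Produo

namespace Produo

namespace Splice

section SequentialLaws

variable {C : Type u} [SmallCategory C]

/-- The class of `(p ∣ x ∣ y)` for a sequential split `p`. -/
abbrev smk {F G : Psh (Splice C)} {A X Y : Splice C} (p : Seq A X Y) (x : F.obj (op X))
    (y : G.obj (op Y)) : (conv (seqSplit C) F G).obj (op A) :=
  conv.mk (P := seqSplit C) p x y

theorem smk_ind {F G : Psh (Splice C)} {A : Splice C}
    {motive : (conv (seqSplit C) F G).obj (op A) → Prop}
    (h : ∀ {X Y : Splice C} (p : Seq A X Y) (x : F.obj (op X)) (y : G.obj (op Y)),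
      motive (smk p x y)) (r : (conv (seqSplit C) F G).obj (op A)) : motive r :=
  conv.ind h r

theorem smk_eq {F G : Psh (Splice C)} {A X X' Y Y' : Splice C} (a : X ⟶ X') (b : Y ⟶ Y')
    {p : Seq A X Y} {p' : Seq A X' Y'} {x : F.obj (op X)} {x' : F.obj (op X')}
    {y : G.obj (op Y)} {y' : G.obj (op Y')} (h₁ : p.fst ≫ a.fst = p'.fst)
    (h₂ : a.snd ≫ p.mid ≫ b.fst = p'.mid) (h₃ : b.snd ≫ p.snd = p'.snd)
    (hx : F.map a.op x' = x) (hy : G.map b.op y' = y) : smk p x y = smk p' x' y' :=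
  conv.mk_eq a b (Seq.ext ((Category.id_comp _).trans h₁) h₂
    (((Category.assoc _ _ _).symm.trans (Category.comp_id _)).trans h₃)) hx hy

theorem smk_congr {F G : Psh (Splice C)} {A X Y : Splice C} {p p' : Seq A X Y} {x x' : F.obj (op X)}
    {y y' : G.obj (op Y)} (h₁ : p.fst = p'.fst)
    (h₂ : p.mid = p'.mid) (h₃ : p.snd = p'.snd)
    (hx : x = x') (hy : y = y') : smk p x y = smk p' x' y' :=
  conv.congr (Seq.ext h₁ h₂ h₃) hx hy

theorem map_smk {F G : Psh (Splice C)} {A A' X Y : Splice C} (f : A' ⟶ A) (p : Seq A X Y)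
    (x : F.obj (op X)) (y : G.obj (op Y)) :
    (conv (seqSplit C) F G).map f.op (smk p x y) =
      smk (⟨f.fst ≫ p.fst, p.mid, p.snd ≫ f.snd⟩ : Seq A' X Y) x y :=
  smk_congr (show f.fst ≫ p.fst ≫ 𝟙 _ = f.fst ≫ p.fst by simp)
    (show 𝟙 _ ≫ p.mid ≫ 𝟙 _ = p.mid by simp) (show 𝟙 _ ≫ p.snd ≫ f.snd = p.snd ≫ f.snd by simp)
    rfl rfl

theorem conv_map_smk {F F' G G' : Psh (Splice C)} (s : F ⟶ F') (t : G ⟶ G') {A X Y : Splice C}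
    (p : Seq A X Y) (x : F.obj (op X)) (y : G.obj (op Y)) :
    (conv.map s t).app (op A) (smk p x y) = smk p (s.app (op X) x) (t.app (op Y) y) := rfl

theorem seqData_assocExt_mk {F G H : Psh (Splice C)} {A U X Y Z : Splice C} (p : Seq A U Z)
    (q : Seq U X Y) (x : F.obj (op X)) (y : G.obj (op Y)) (z : H.obj (op Z)) :
    ((seqData C).assocExt F G H).app (op A) (smk p (smk q x y) z) =
      smk (Y := ⟨Y.dom, Z.cod⟩) ⟨p.fst ≫ q.fst, q.mid, p.snd⟩ x
        (smk (A := ⟨Y.dom, Z.cod⟩) ⟨𝟙 Y.dom, q.snd ≫ p.mid, 𝟙 Z.cod⟩ y z) :=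
  smk_congr rfl rfl (Category.id_comp p.snd) (F.map_id_apply _ x)
    (smk_congr rfl (show q.snd ≫ p.mid ≫ 𝟙 _ = _ by simp) rfl rfl rfl)

theorem seqData_leftExt_mk {F : Psh (Splice C)} {A X Y : Splice C} (p : Seq A X Y)
    (n : X.dom ⟶ X.cod) (x : F.obj (op Y)) :
    ((seqData C).leftExt F).app (op A) (smk (F := unitN C) p n x) =
      F.map (homMk (p.fst ≫ n ≫ p.mid) p.snd : A ⟶ Y).op x :=
  congrArg (fun t => F.map (Quiver.Hom.op t) x)
    (hom_ext (show p.fst ≫ n ≫ p.mid ≫ 𝟙 _ = _ by simp) (show 𝟙 _ ≫ p.snd = _ by simp))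

theorem seqData_rightExt_mk {F : Psh (Splice C)} {A X Y : Splice C} (p : Seq A X Y)
    (x : F.obj (op X)) (n : Y.dom ⟶ Y.cod) :
    ((seqData C).rightExt F).app (op A) (smk (G := unitN C) p x n) =
      F.map (homMk p.fst (p.mid ≫ n ≫ p.snd) : A ⟶ X).op x :=
  congrArg (fun t => F.map (Quiver.Hom.op t) x)
    (hom_ext (show p.fst ≫ 𝟙 _ = _ by simp) (show 𝟙 _ ≫ p.mid ≫ n ≫ p.snd = _ by simp))

theorem seqData_pentagon (F G H K : Psh (Splice C)) :
    conv.map ((seqData C).assocExt F G H) (𝟙 K) ≫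
        (seqData C).assocExt F (conv (seqData C).split G H) K ≫
        conv.map (𝟙 F) ((seqData C).assocExt G H K) =
      (seqData C).assocExt (conv (seqData C).split F G) H K ≫
        (seqData C).assocExt F G (conv (seqData C).split H K) := by
  refine psh_ext fun A w => ?_
  induction w using smk_ind with
  | @h U T p w t =>
  induction w using smk_ind with
  | @h U' Z q w z =>
  induction w using smk_ind with
  | @h X Y r x y =>
  rw [comp_app_el, comp_app_el, comp_app_el, conv_map_smk, seqData_assocExt_mk,
    seqData_assocExt_mk, seqData_assocExt_mk, seqData_assocExt_mk, conv_map_smk, id_app_el,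
    id_app_el, seqData_assocExt_mk]
  refine smk_congr (by simp) rfl rfl rfl (smk_congr (by simp) (by simp) rfl rfl
    (smk_congr rfl (by simp) rfl rfl rfl))

theorem seqData_triangle (F G : Psh (Splice C)) :
    (seqData C).assocExt F (seqData C).unit G ≫
      conv.map (𝟙 F) ((seqData C).leftExt G) = conv.map ((seqData C).rightExt F) (𝟙 G) := by
  refine psh_ext fun A w => ?_
  induction w using smk_ind with
  | @h U T p w t =>
  induction w using smk_ind with
  | @h X Y q x n =>
  have key : ∀ n : Y.dom ⟶ Y.cod,
      smk (A := A) (X := X) (Y := ⟨Y.dom, T.cod⟩) ⟨p.fst ≫ q.fst, q.mid, p.snd⟩ x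
        (G.map (homMk (𝟙 _ ≫ n ≫ q.snd ≫ p.mid) (𝟙 _) : (⟨Y.dom, T.cod⟩ : Splice C) ⟶ T).op t) =
      smk p (F.map (homMk q.fst (q.mid ≫ n ≫ q.snd) : U ⟶ X).op x) t := fun n =>
    Eq.trans (smk_eq (p' := ⟨p.fst ≫ q.fst, q.mid ≫ n ≫ q.snd ≫ p.mid, p.snd⟩) (x' := x)
      (𝟙 X) (homMk (𝟙 _ ≫ n ≫ q.snd ≫ p.mid) (𝟙 _) : (⟨Y.dom, T.cod⟩ : Splice C) ⟶ T)
        (by simp) (by simp) (by simp) (F.map_id_apply _ x) rfl)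
      (Eq.symm (smk_eq (homMk q.fst (q.mid ≫ n ≫ q.snd)) (𝟙 T) (by simp) (by simp) (by simp)
        rfl (G.map_id_apply _ t)))
  rw [comp_app_el, seqData_assocExt_mk, conv_map_smk, conv_map_smk, id_app_el, id_app_el]
  refine Eq.trans (smk_congr rfl rfl rfl rfl (seqData_leftExt_mk _ n t)) ((key n).trans ?_)
  exact (smk_congr rfl rfl rfl (seqData_rightExt_mk q x n) rfl).symm

theorem seqData_assoc_bijective (A B D E : Splice C) :
    Function.Bijective (((seqData C).assoc B D E).app (op A)) := by
  have val : ∀ {X Y Z : Splice C} (p : Seq A X Y) (q : Seq X B D) (z : Y ⟶ E),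
      ((seqData C).assoc B D E).app (op A) (smk (F := (seqSplit C).psh B D) (G := yoneda.obj E)
        p q z) = smk (F := yoneda.obj B) (G := (seqSplit C).psh D E) (X := B) (Y := ⟨D.dom, E.cod⟩)
        (⟨p.fst ≫ q.fst, q.mid, z.snd ≫ p.snd⟩ : Seq A B ⟨D.dom, E.cod⟩)
        (𝟙 B) (⟨𝟙 D.dom, q.snd ≫ p.mid ≫ z.fst, 𝟙 E.cod⟩ : Seq ⟨D.dom, E.cod⟩ D E) :=
    fun _ _ _ => rfl
  let inv : ∀ {X Y : Splice C}, Seq A X Y → (X ⟶ B) → Seq Y D E →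
      (conv (seqSplit C) ((seqSplit C).psh B D) (yoneda.obj E)).obj (op A) := fun p x q =>
    smk (F := (seqSplit C).psh B D) (G := yoneda.obj E) (X := ⟨B.dom, D.cod⟩) (Y := E)
      ⟨p.fst ≫ x.fst, q.mid, q.snd ≫ p.snd⟩
      (⟨𝟙 _, x.snd ≫ p.mid ≫ q.fst, 𝟙 _⟩ : Seq ⟨B.dom, D.cod⟩ B D) (𝟙 E)
  refine Function.bijective_iff_has_inverse.2 ⟨fun w => Quot.lift
    (fun r : ConvRep (seqSplit C) (yoneda.obj B) ((seqSplit C).psh D E) A =>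
      inv r.p r.x r.y) ?_ w, ?_, ?_⟩
  · rintro _ _ ⟨a, b, p, x, y⟩
    have key : ∀ {X X' Y Y' : Splice C} (a : X ⟶ X') (b : Y ⟶ Y') (p : Seq A X Y) (x : X' ⟶ B)
        (y : Seq Y' D E),
        inv ⟨𝟙 _ ≫ p.fst ≫ a.fst, a.snd ≫ p.mid ≫ b.fst, b.snd ≫ p.snd ≫ 𝟙 _⟩ x y =
          inv p (a ≫ x) ⟨b.fst ≫ y.fst ≫ 𝟙 _, 𝟙 _ ≫ y.mid ≫ 𝟙 _, 𝟙 _ ≫ y.snd ≫ b.snd⟩ :=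
      fun a b p x y =>
      smk_congr (by simp) (by simp) (by simp) (Seq.ext rfl (by simp) rfl) rfl
    exact key a b p x y
  · intro w
    induction w using smk_ind with
    | @h X Y p q z =>
    have key : ∀ (q : Seq X B D) (z : Y ⟶ E),
        smk (F := (seqSplit C).psh B D) (G := yoneda.obj E) (A := A) (X := ⟨B.dom, D.cod⟩) (Y := E)
          ⟨(p.fst ≫ q.fst) ≫ 𝟙 _, q.snd ≫ p.mid ≫ z.fst, 𝟙 _ ≫ z.snd ≫ p.snd⟩
          (⟨𝟙 _, 𝟙 _ ≫ q.mid ≫ 𝟙 _, 𝟙 _⟩ : Seq ⟨B.dom, D.cod⟩ B D) (𝟙 E) =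
        smk p q z := fun q z =>
      Eq.symm (smk_eq (F := (seqSplit C).psh B D) (G := yoneda.obj E)
          (homMk q.fst q.snd : X ⟶ ⟨B.dom, D.cod⟩) z (by simp) (by simp) (by simp)
          (Seq.ext (show q.fst ≫ 𝟙 _ ≫ 𝟙 _ = _ by simp)
            (show 𝟙 _ ≫ (𝟙 _ ≫ q.mid ≫ 𝟙 _) ≫ 𝟙 _ = _ by simp)
            (show 𝟙 _ ≫ 𝟙 _ ≫ q.snd = _ by simp)) (Category.comp_id z))
    exact key q z
  · intro w
    induction w using smk_ind with
    | @h X Y p x q =>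
    have key : ∀ (x : X ⟶ B) (q : Seq Y D E),
        smk (F := yoneda.obj B) (G := (seqSplit C).psh D E) (A := A) (X := B) (Y := ⟨D.dom, E.cod⟩)
          ⟨(p.fst ≫ x.fst) ≫ 𝟙 _, x.snd ≫ p.mid ≫ q.fst, 𝟙 _ ≫ q.snd ≫ p.snd⟩ (𝟙 B)
          (⟨𝟙 D.dom, 𝟙 _ ≫ q.mid ≫ 𝟙 _, 𝟙 E.cod⟩ : Seq ⟨D.dom, E.cod⟩ D E) = smk p x q :=
      fun x q => Eq.symm (smk_eq (F := yoneda.obj B) (G := (seqSplit C).psh D E) x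
          (homMk q.fst q.snd : Y ⟶ ⟨D.dom, E.cod⟩) (by simp) (by simp) (by simp)
          (Category.comp_id x) (Seq.ext (show q.fst ≫ 𝟙 _ ≫ 𝟙 _ = _ by simp)
            (show 𝟙 _ ≫ (𝟙 _ ≫ q.mid ≫ 𝟙 _) ≫ 𝟙 _ = _ by simp)
            (show 𝟙 _ ≫ 𝟙 _ ≫ q.snd = _ by simp)))
    exact key x q

theorem seqData_leftUnitor_bijective (A B : Splice C) :
    Function.Bijective (((seqData C).leftUnitor B).app (op A)) := by
  refine Function.bijective_iff_has_inverse.2 ⟨fun t => smk (F := unitN C) (G := yoneda.obj B)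
    (X := ⟨A.dom, A.dom⟩) (Y := B) ⟨𝟙 _, Hom'.fst t, Hom'.snd t⟩ (𝟙 A.dom) (𝟙 B), ?_, ?_⟩
  · intro w
    induction w using smk_ind with
    | @h X Y p n y =>
    have key : ∀ (n : X.dom ⟶ X.cod) (y : Y ⟶ B),
        smk (F := unitN C) (G := yoneda.obj B) (A := A) (X := ⟨A.dom, A.dom⟩) (Y := B)
          ⟨𝟙 _, p.fst ≫ n ≫ p.mid ≫ y.fst, y.snd ≫ p.snd⟩ (𝟙 A.dom) (𝟙 B) = smk p n y := fun n y =>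
      Eq.trans (Eq.symm (smk_eq (F := unitN C) (G := yoneda.obj B)
          (p := (⟨𝟙 _, p.mid ≫ y.fst, y.snd ≫ p.snd⟩ : Seq A ⟨A.dom, X.cod⟩ B)) (x := p.fst ≫ n)
          (y := 𝟙 B)
          (homMk (𝟙 _) (p.fst ≫ n) : (⟨A.dom, X.cod⟩ : Splice C) ⟶ ⟨A.dom, A.dom⟩) (𝟙 B)
          (by simp) (by simp) (by simp) (show 𝟙 _ ≫ 𝟙 _ ≫ p.fst ≫ n = _ by simp)
          (Category.comp_id (𝟙 B))))
        (Eq.trans (smk_eq (F := unitN C) (G := yoneda.obj B) (p' := ⟨p.fst, p.mid ≫ y.fst,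
          y.snd ≫ p.snd⟩)
          (homMk p.fst (𝟙 _) : (⟨A.dom, X.cod⟩ : Splice C) ⟶ X) (𝟙 B)
          (by simp) (by simp) (by simp) (show p.fst ≫ n ≫ 𝟙 _ = _ by simp) (Category.comp_id (𝟙 B)))
          (Eq.symm (smk_eq (F := unitN C) (G := yoneda.obj B) (𝟙 X) y (by simp) (by simp)
            (by simp) ((unitN C).map_id_apply _ n) (Category.comp_id y))))
    exact key n y
  · have key : ∀ t : A ⟶ B, homMk (𝟙 _ ≫ 𝟙 _ ≫ t.fst ≫ 𝟙 _) (𝟙 _ ≫ t.snd) = t := fun t => by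
      ext <;> simp
    exact key

theorem seqData_rightUnitor_bijective (A B : Splice C) :
    Function.Bijective (((seqData C).rightUnitor B).app (op A)) := by
  refine Function.bijective_iff_has_inverse.2 ⟨fun t => smk (F := yoneda.obj B) (G := unitN C)
    (X := B) (Y := ⟨A.cod, A.cod⟩) ⟨Hom'.fst t, Hom'.snd t, 𝟙 _⟩ (𝟙 B) (𝟙 A.cod), ?_, ?_⟩
  · intro w
    induction w using smk_ind with
    | @h X Y p x n =>
    have key : ∀ (x : X ⟶ B) (n : Y.dom ⟶ Y.cod),
        smk (F := yoneda.obj B) (G := unitN C) (A := A) (X := B) (Y := ⟨A.cod, A.cod⟩)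
          ⟨p.fst ≫ x.fst, x.snd ≫ p.mid ≫ n ≫ p.snd, 𝟙 _⟩ (𝟙 B) (𝟙 A.cod) = smk p x n := fun x n =>
      Eq.trans (Eq.symm (smk_eq (F := yoneda.obj B) (G := unitN C)
          (p := (⟨p.fst ≫ x.fst, x.snd ≫ p.mid, 𝟙 _⟩ : Seq A B ⟨Y.dom, A.cod⟩)) (x := 𝟙 B)
          (y := n ≫ p.snd)
          (𝟙 B) (homMk (n ≫ p.snd) (𝟙 _) : (⟨Y.dom, A.cod⟩ : Splice C) ⟶ ⟨A.cod, A.cod⟩)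
          (by simp) (by simp) (by simp)
          (Category.comp_id (𝟙 B)) (show (n ≫ p.snd) ≫ 𝟙 _ ≫ 𝟙 _ = _ by simp)))
        (Eq.trans (smk_eq (F := yoneda.obj B) (G := unitN C) (p' := ⟨p.fst ≫ x.fst,
          x.snd ≫ p.mid, p.snd⟩)
          (𝟙 B) (homMk (𝟙 _) p.snd : (⟨Y.dom, A.cod⟩ : Splice C) ⟶ Y)
          (by simp) (by simp) (by simp) (Category.comp_id (𝟙 B)) (show 𝟙 _ ≫ n ≫ p.snd = _ by simp))
          (Eq.symm (smk_eq (F := yoneda.obj B) (G := unitN C) x (𝟙 Y) (by simp) (by simp)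
            (by simp) (Category.comp_id x) ((unitN C).map_id_apply _ n))))
    exact key x n
  · have key : ∀ t : A ⟶ B, homMk (t.fst ≫ 𝟙 _) (𝟙 _ ≫ t.snd ≫ 𝟙 _ ≫ 𝟙 _) = t := fun t => by
      ext <;> simp
    exact key

theorem seqData_isPromonoidal : (seqData C).IsPromonoidal where
  assoc_iso B D E := isIso_of_bijective _ fun A => seqData_assoc_bijective A B D E
  leftUnitor_iso B := isIso_of_bijective _ fun A => seqData_leftUnitor_bijective A B
  rightUnitor_iso B := isIso_of_bijective _ fun A => seqData_rightUnitor_bijective A B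
  pentagon := seqData_pentagon
  triangle := seqData_triangle

end SequentialLaws

end Splice

end Produo

namespace Produo

namespace SeqOver

variable {V : Type u} [SmallCategory V] [MonoidalCategory V] [SymmetricCategory V] (D : SeqOver V)

/-- The class of `(p ∣ x ∣ y)` for a parallel split `p : A ⟶ X ⊗ Y`. -/
abbrev pmk {F G : Psh V} {A X Y : V} (p : A ⟶ X ⊗ Y) (x : F.obj (op X)) (y : G.obj (op Y)) :
    (D.toSymProduoidal.T F G).obj (op A) :=
  conv.mk (P := D.toSymProduoidal.par.split) p x y

/-- The class of `(p ∣ x ∣ y)` for a sequential split `p`. -/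
abbrev qmk {F G : Psh V} {A X Y : V} (p : D.seq.split.el A X Y) (x : F.obj (op X))
    (y : G.obj (op Y)) : (D.toSymProduoidal.S F G).obj (op A) :=
  conv.mk (P := D.toSymProduoidal.seq.split) p x y

variable {D}

/-- An element of the parallel unit as a morphism. -/
def unitHom {A : V} (j : D.toSymProduoidal.par.unit.obj (op A)) : A ⟶ 𝟙_ V := j

/-- A morphism to the unit object as an element of the parallel unit. -/
def ofUnitHom {A : V} (j : A ⟶ 𝟙_ V) : D.toSymProduoidal.par.unit.obj (op A) := j

@[simp] theorem unitHom_ofUnitHom {A : V} (j : A ⟶ 𝟙_ V) : unitHom (D := D) (ofUnitHom j) = j := rfl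

theorem pmk_ind {F G : Psh V} {A : V} {motive : (D.toSymProduoidal.T F G).obj (op A) → Prop}
    (h : ∀ {X Y : V} (p : A ⟶ X ⊗ Y) (x : F.obj (op X)) (y : G.obj (op Y)), motive (D.pmk p x y))
    (r : (D.toSymProduoidal.T F G).obj (op A)) : motive r :=
  conv.ind h r

theorem pmk_eq {F G : Psh V} {A X X' Y Y' : V} (a : X ⟶ X') (b : Y ⟶ Y')
    {p : A ⟶ X ⊗ Y} {p' : A ⟶ X' ⊗ Y'} {x : F.obj (op X)} {x' : F.obj (op X')}
    {y : G.obj (op Y)} {y' : G.obj (op Y')} (hp : p ≫ (a ⊗ₘ b) = p')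
    (hx : F.map a.op x' = x) (hy : G.map b.op y' = y) :
    D.pmk p x y = D.pmk p' x' y' :=
  tmk_eq a b hp hx hy

theorem pmk_congr {F G : Psh V} {A X Y : V} 
    {p p' : A ⟶ X ⊗ Y} {x x' : F.obj (op X)} {y y' : G.obj (op Y)} (hp : p = p')
    (hx : x = x') (hy : y = y') :
    D.pmk p x y = D.pmk p' x' y' := by
  rw [hp, hx, hy]

theorem map_pmk {F G : Psh V} {A A' X Y : V} (f : A' ⟶ A) (p : A ⟶ X ⊗ Y)
    (x : F.obj (op X)) (y : G.obj (op Y)) :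
    (D.toSymProduoidal.T F G).map f.op (D.pmk p x y) = D.pmk (f ≫ p) x y :=
  map_tmk f p x y

theorem conv_map_pmk {F F' G G' : Psh V} (s : F ⟶ F') (t : G ⟶ G') {A X Y : V} (p : A ⟶ X ⊗ Y)
    (x : F.obj (op X)) (y : G.obj (op Y)) :
    (conv.map (P := D.toSymProduoidal.par.split) s t).app (op A) (D.pmk p x y) =
      D.pmk p (s.app (op X) x) (t.app (op Y) y) := rfl

theorem par_assocExt_mk {F G H : Psh V} {A U X Y Z : V} (p : A ⟶ U ⊗ Z) (q : U ⟶ X ⊗ Y)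
    (x : F.obj (op X)) (y : G.obj (op Y)) (z : H.obj (op Z)) :
    (D.toSymProduoidal.par.assocExt F G H).app (op A) (D.pmk p (D.pmk q x y) z) =
      D.pmk (p ≫ q ▷ Z ≫ (α_ X Y Z).hom) x (D.pmk (𝟙 (Y ⊗ Z)) y z) :=
  parOfMonoidal_assocExt_mk p q x y z

theorem par_leftExt_mk {F : Psh V} {A X Y : V} (p : A ⟶ X ⊗ Y)
    (j : D.toSymProduoidal.par.unit.obj (op X)) (x : F.obj (op Y)) :
    (D.toSymProduoidal.par.leftExt F).app (op A) (D.pmk p j x) =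
      F.map (p ≫ unitHom j ▷ Y ≫ (λ_ Y).hom).op x :=
  parOfMonoidal_leftExt_mk p j x

theorem par_rightExt_mk {F : Psh V} {A X Y : V} (p : A ⟶ X ⊗ Y) (x : F.obj (op X))
    (j : D.toSymProduoidal.par.unit.obj (op Y)) :
    (D.toSymProduoidal.par.rightExt F).app (op A) (D.pmk p x j) =
      F.map (p ≫ X ◁ unitHom j ≫ (ρ_ X).hom).op x :=
  parOfMonoidal_rightExt_mk p x j

theorem σExt_mk {F G : Psh V} {A X Y : V} (p : A ⟶ X ⊗ Y) (x : F.obj (op X)) (y : G.obj (op Y)) :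
    (D.toSymProduoidal.σExt F G).app (op A) (D.pmk p x y) = D.pmk (p ≫ (β_ X Y).hom) y x := rfl

theorem par_isPromonoidal : D.toSymProduoidal.par.IsPromonoidal := parOfMonoidal_isPromonoidal

theorem hexagon (F G H : Psh V) :
    D.toSymProduoidal.par.assocExt F G H ≫ D.toSymProduoidal.σExt F (D.toSymProduoidal.T G H) ≫
        D.toSymProduoidal.par.assocExt G H F =
      conv.map (D.toSymProduoidal.σExt F G) (𝟙 H) ≫ D.toSymProduoidal.par.assocExt G F H ≫
        conv.map (𝟙 G) (D.toSymProduoidal.σExt F H) := by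
  refine psh_ext fun A w => ?_
  induction w using pmk_ind with
  | @h U Z p w z =>
  induction w using pmk_ind with
  | @h X Y q x y =>
  rw [comp_app_el, comp_app_el, comp_app_el, comp_app_el, conv_map_pmk, par_assocExt_mk, σExt_mk,
    par_assocExt_mk, σExt_mk, par_assocExt_mk, conv_map_pmk, σExt_mk, id_app_el, id_app_el]
  refine pmk_eq (𝟙 Y) (β_ Z X).hom (by simp [← MonoidalCategory.whiskerLeft_comp])
    (G.map_id_apply _ y) ?_
  refine (map_pmk _ _ _ _).trans (pmk_congr (by simp) rfl rfl)

end SeqOver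

namespace Splice

open SeqOver

theorem comp_tensorHom {C : Type u} [SmallCategory C] [MonoidalCategory C] {X Y Z W W' : C} (f : X ⟶ Y)
    (g : Y ⟶ Z) (h : W ⟶ W') : (f ≫ g) ⊗ₘ h = f ▷ W ≫ (g ⊗ₘ h) := by
  simp [MonoidalCategory.tensorHom_def]

theorem comp_tensorHom' {C : Type u} [SmallCategory C] [MonoidalCategory C] {X Y Z W W' : C} (f : X ⟶ Y)
    (g : Y ⟶ Z) (h : W ⟶ W') : (f ≫ g) ⊗ₘ h = (f ⊗ₘ h) ≫ g ▷ W' := by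
  simp [MonoidalCategory.tensorHom_def']

section ProduoidalLaws

variable {C : Type u} [SmallCategory C] [MonoidalCategory C] [SymmetricCategory C]

/-- The class of `(p ∣ x ∣ y)` for a parallel split `p` of spliced arrows. -/
abbrev spmk {F G : Psh (Splice C)} {A X Y : Splice C} (p : A ⟶ X ⊗ Y) (x : F.obj (op X))
    (y : G.obj (op Y)) : ((spliced C).T F G).obj (op A) :=
  (seqOver C).pmk p x y

/-- The class of `(p ∣ x ∣ y)` for a sequential split `p` of spliced arrows. -/
abbrev sqmk {F G : Psh (Splice C)} {A X Y : Splice C} (p : Seq A X Y) (x : F.obj (op X))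
    (y : G.obj (op Y)) : ((spliced C).S F G).obj (op A) :=
  (seqOver C).qmk p x y

/-- An element of the sequential unit of spliced arrows as an arrow. -/
def arrow {A : Splice C} (n : (spliced C).seq.unit.obj (op A)) : A.dom ⟶ A.cod := n

/-- An arrow as an element of the sequential unit of spliced arrows. -/
def ofArrow {A : Splice C} (n : A.dom ⟶ A.cod) : (spliced C).seq.unit.obj (op A) := n

theorem sqmk_ind {F G : Psh (Splice C)} {A : Splice C}
    {motive : ((spliced C).S F G).obj (op A) → Prop}
    (h : ∀ {X Y : Splice C} (p : Seq A X Y) (x : F.obj (op X)) (y : G.obj (op Y)),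
      motive (sqmk p x y)) (r : ((spliced C).S F G).obj (op A)) : motive r :=
  conv.ind h r

theorem sqmk_eq {F G : Psh (Splice C)} {A X X' Y Y' : Splice C} (a : X ⟶ X') (b : Y ⟶ Y')
    {p : Seq A X Y} {p' : Seq A X' Y'} {x : F.obj (op X)} {x' : F.obj (op X')}
    {y : G.obj (op Y)} {y' : G.obj (op Y')} (h₁ : p.fst ≫ a.fst = p'.fst)
    (h₂ : a.snd ≫ p.mid ≫ b.fst = p'.mid) (h₃ : b.snd ≫ p.snd = p'.snd)
    (hx : F.map a.op x' = x) (hy : G.map b.op y' = y) : sqmk p x y = sqmk p' x' y' :=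
  smk_eq a b h₁ h₂ h₃ hx hy

theorem sqmk_congr {F G : Psh (Splice C)} {A X Y : Splice C} {p p' : Seq A X Y} {x x' : F.obj (op X)}
    {y y' : G.obj (op Y)} (h₁ : p.fst = p'.fst)
    (h₂ : p.mid = p'.mid) (h₃ : p.snd = p'.snd)
    (hx : x = x') (hy : y = y') : sqmk p x y = sqmk p' x' y' :=
  smk_congr h₁ h₂ h₃ hx hy

theorem map_sqmk {F G : Psh (Splice C)} {A A' X Y : Splice C} (f : A' ⟶ A) (p : Seq A X Y)
    (x : F.obj (op X)) (y : G.obj (op Y)) :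
    ((spliced C).S F G).map f.op (sqmk p x y) =
      sqmk (⟨f.fst ≫ p.fst, p.mid, p.snd ≫ f.snd⟩ : Seq A' X Y) x y :=
  map_smk f p x y

theorem conv_map_sqmk {F F' G G' : Psh (Splice C)} (s : F ⟶ F') (t : G ⟶ G') {A X Y : Splice C}
    (p : Seq A X Y) (x : F.obj (op X)) (y : G.obj (op Y)) :
    (conv.map (P := (spliced C).seq.split) s t).app (op A) (sqmk p x y) =
      sqmk p (s.app (op X) x) (t.app (op Y) y) := rfl

theorem seq_assocExt_mk {F G H : Psh (Splice C)} {A U X Y Z : Splice C} (p : Seq A U Z)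
    (q : Seq U X Y) (x : F.obj (op X)) (y : G.obj (op Y)) (z : H.obj (op Z)) :
    ((spliced C).seq.assocExt F G H).app (op A) (sqmk p (sqmk q x y) z) =
      sqmk (Y := ⟨Y.dom, Z.cod⟩) ⟨p.fst ≫ q.fst, q.mid, p.snd⟩ x
        (sqmk (A := ⟨Y.dom, Z.cod⟩) ⟨𝟙 Y.dom, q.snd ≫ p.mid, 𝟙 Z.cod⟩ y z) :=
  seqData_assocExt_mk p q x y z

theorem seq_leftExt_mk {F : Psh (Splice C)} {A X Y : Splice C} (p : Seq A X Y)
    (n : (spliced C).seq.unit.obj (op X)) (x : F.obj (op Y)) :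
    ((spliced C).seq.leftExt F).app (op A) (sqmk p n x) =
      F.map (homMk (p.fst ≫ arrow n ≫ p.mid) p.snd : A ⟶ Y).op x :=
  seqData_leftExt_mk p n x

theorem seq_rightExt_mk {F : Psh (Splice C)} {A X Y : Splice C} (p : Seq A X Y)
    (x : F.obj (op X)) (n : (spliced C).seq.unit.obj (op Y)) :
    ((spliced C).seq.rightExt F).app (op A) (sqmk p x n) =
      F.map (homMk p.fst (p.mid ≫ arrow n ≫ p.snd) : A ⟶ X).op x :=
  seqData_rightExt_mk p x n

theorem spliced_ψ₂Ext_mk {F G H K : Psh (Splice C)} {A U W X Y Z T : Splice C} (p : A ⟶ U ⊗ W)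
    (q : Seq U X Y) (r : Seq W Z T) (x : F.obj (op X)) (y : G.obj (op Y))
    (z : H.obj (op Z)) (t : K.obj (op T)) :
    ((spliced C).ψ₂Ext F G H K).app (op A) (spmk p (sqmk q x y) (sqmk r z t)) =
      sqmk (X := X ⊗ Z) (Y := Y ⊗ T) ⟨p.fst ≫ (q.fst ⊗ₘ r.fst), q.mid ⊗ₘ r.mid,
        (q.snd ⊗ₘ r.snd) ≫ p.snd⟩ (spmk (𝟙 (X ⊗ Z)) x z) (spmk (𝟙 (Y ⊗ T)) y t) :=
  smk_congr (show p.fst ≫ (q.fst ⊗ₘ r.fst) ≫ 𝟙 _ = p.fst ≫ (q.fst ⊗ₘ r.fst) by simp)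
    (show 𝟙 _ ≫ (q.mid ⊗ₘ r.mid) ≫ 𝟙 _ = q.mid ⊗ₘ r.mid by simp)
    (show 𝟙 _ ≫ (q.snd ⊗ₘ r.snd) ≫ p.snd = (q.snd ⊗ₘ r.snd) ≫ p.snd by simp) rfl rfl

theorem spliced_ψ₀_mk {A : Splice C} (j : (spliced C).par.unit.obj (op A)) :
    (spliced C).ψ₀.app (op A) j =
      sqmk (F := (spliced C).par.unit) (G := (spliced C).par.unit)
        (X := 𝟙_ (Splice C)) (Y := 𝟙_ (Splice C)) ⟨(unitHom j).fst, 𝟙 (𝟙_ C), (unitHom j).snd⟩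
        (ofUnitHom (𝟙 (𝟙_ (Splice C)))) (ofUnitHom (𝟙 (𝟙_ (Splice C)))) :=
  smk_congr (show (unitHom j).fst ≫ 𝟙 _ ≫ 𝟙 _ = (unitHom j).fst by simp)
    (show 𝟙 _ ≫ 𝟙 _ ≫ 𝟙 _ = 𝟙 (𝟙_ C) by simp)
    (show 𝟙 _ ≫ 𝟙 _ ≫ (unitHom j).snd = (unitHom j).snd by simp) rfl rfl

theorem spliced_φ₂_mk {A U T : Splice C} (p : A ⟶ U ⊗ T) (m : (spliced C).seq.unit.obj (op U))
    (n : (spliced C).seq.unit.obj (op T)) :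
    (spliced C).φ₂.app (op A) (spmk p m n) =
      ofArrow (p.fst ≫ (arrow m ⊗ₘ arrow n) ≫ p.snd) := rfl

theorem spliced_φ₀_mk {A : Splice C} (j : (spliced C).par.unit.obj (op A)) :
    (spliced C).φ₀.app (op A) j = ofArrow ((unitHom j).fst ≫ (unitHom j).snd) :=
  show (unitHom j).fst ≫ 𝟙 _ ≫ (unitHom j).snd = (unitHom j).fst ≫ (unitHom j).snd by
    rw [Category.id_comp]

theorem spliced_ψ₂_par_assoc (F G H K L M : Psh (Splice C)) :
    conv.map ((spliced C).ψ₂Ext F G H K) (𝟙 ((spliced C).S L M)) ≫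
        (spliced C).ψ₂Ext ((spliced C).T F H) ((spliced C).T G K) L M ≫
        conv.map ((spliced C).par.assocExt F H L) ((spliced C).par.assocExt G K M) =
      (spliced C).par.assocExt ((spliced C).S F G) ((spliced C).S H K) ((spliced C).S L M) ≫
        conv.map (𝟙 ((spliced C).S F G)) ((spliced C).ψ₂Ext H K L M) ≫
        (spliced C).ψ₂Ext F G ((spliced C).T H L) ((spliced C).T K M) := by
  refine psh_ext fun A w => ?_
  induction w using pmk_ind with
  | @h U Z p w w' =>
  induction w' using sqmk_ind with
  | @h X₃ Y₃ q₃ x₃ y₃ =>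
  induction w using pmk_ind with
  | @h U' Z' p' w w' =>
  induction w using sqmk_ind with
  | @h X₁ Y₁ q₁ x₁ y₁ =>
  induction w' using sqmk_ind with
  | @h X₂ Y₂ q₂ x₂ y₂ =>
  rw [comp_app_el, comp_app_el, comp_app_el, comp_app_el, conv_map_pmk, spliced_ψ₂Ext_mk,
    id_app_el, spliced_ψ₂Ext_mk, conv_map_sqmk, par_assocExt_mk, par_assocExt_mk, par_assocExt_mk,
    conv_map_pmk, id_app_el, spliced_ψ₂Ext_mk, spliced_ψ₂Ext_mk]
  refine sqmk_eq (α_ X₁ X₂ X₃).hom (α_ Y₁ Y₂ Y₃).hom ?_ ?_ ?_ ?_ ?_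
  · simp [comp_tensorHom]
  · simp
  · simp [comp_tensorHom']
  · exact (map_pmk _ _ _ _).trans (pmk_congr (by simp) rfl rfl)
  · exact (map_pmk _ _ _ _).trans (pmk_congr (by simp) rfl rfl)

theorem spliced_ψ₂_seq_assoc (F G H K L M : Psh (Splice C)) :
    (spliced C).ψ₂Ext ((spliced C).S F G) H ((spliced C).S K L) M ≫
        conv.map ((spliced C).ψ₂Ext F G K L) (𝟙 ((spliced C).T H M)) ≫
        (spliced C).seq.assocExt ((spliced C).T F K) ((spliced C).T G L) ((spliced C).T H M) =
      conv.map ((spliced C).seq.assocExt F G H) ((spliced C).seq.assocExt K L M) ≫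
        (spliced C).ψ₂Ext F ((spliced C).S G H) K ((spliced C).S L M) ≫
        conv.map (𝟙 ((spliced C).T F K)) ((spliced C).ψ₂Ext G H L M) := by
  refine psh_ext fun A w => ?_
  induction w using pmk_ind with
  | @h U Z p w w' =>
  induction w using sqmk_ind with
  | @h X Y q w z =>
  induction w using sqmk_ind with
  | @h X' Y' q' x y =>
  induction w' using sqmk_ind with
  | @h X₁ Y₁ q₁ w z₁ =>
  induction w using sqmk_ind with
  | @h X₁' Y₁' q₁' x₁ y₁ =>
  rw [comp_app_el, comp_app_el, comp_app_el, comp_app_el, spliced_ψ₂Ext_mk, conv_map_sqmk,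
    spliced_ψ₂Ext_mk, id_app_el, seq_assocExt_mk, conv_map_pmk, seq_assocExt_mk, seq_assocExt_mk,
    spliced_ψ₂Ext_mk, conv_map_sqmk, id_app_el, spliced_ψ₂Ext_mk]
  exact sqmk_congr (by simp) rfl rfl rfl (sqmk_congr (by simp) (by simp) (by simp) rfl rfl)

theorem spliced_ψ₂_par_left (F G : Psh (Splice C)) :
    conv.map (spliced C).ψ₀ (𝟙 ((spliced C).S F G)) ≫
        (spliced C).ψ₂Ext (spliced C).par.unit (spliced C).par.unit F G ≫
        conv.map ((spliced C).par.leftExt F) ((spliced C).par.leftExt G) =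
      (spliced C).par.leftExt ((spliced C).S F G) := by
  refine psh_ext fun A w => ?_
  induction w using pmk_ind with
  | @h U Z p j w =>
  induction w using sqmk_ind with
  | @h X Y q x y =>
  rw [comp_app_el, comp_app_el, conv_map_pmk, id_app_el, spliced_ψ₀_mk,
    spliced_ψ₂Ext_mk, conv_map_sqmk, par_leftExt_mk, par_leftExt_mk, par_leftExt_mk, map_sqmk]
  exact sqmk_eq (λ_ X).hom (λ_ Y).hom (by simp [MonoidalCategory.tensorHom_def]) (by simp)
    (by simp [MonoidalCategory.tensorHom_def']) (by simp) (by simp)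

theorem spliced_ψ₂_par_right (F G : Psh (Splice C)) :
    conv.map (𝟙 ((spliced C).S F G)) (spliced C).ψ₀ ≫
        (spliced C).ψ₂Ext F G (spliced C).par.unit (spliced C).par.unit ≫
        conv.map ((spliced C).par.rightExt F) ((spliced C).par.rightExt G) =
      (spliced C).par.rightExt ((spliced C).S F G) := by
  refine psh_ext fun A w => ?_
  induction w using pmk_ind with
  | @h U Z p w j =>
  induction w using sqmk_ind with
  | @h X Y q x y =>
  rw [comp_app_el, comp_app_el, conv_map_pmk, id_app_el, spliced_ψ₀_mk,
    spliced_ψ₂Ext_mk, conv_map_sqmk, par_rightExt_mk, par_rightExt_mk, par_rightExt_mk,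
    map_sqmk]
  exact sqmk_eq (ρ_ X).hom (ρ_ Y).hom (by simp [MonoidalCategory.tensorHom_def']) (by simp)
    (by simp [MonoidalCategory.tensorHom_def]) (by simp) (by simp)

theorem spliced_ψ₂_seq_left (F G : Psh (Splice C)) :
    (spliced C).ψ₂Ext (spliced C).seq.unit F (spliced C).seq.unit G ≫
        conv.map (spliced C).φ₂ (𝟙 ((spliced C).T F G)) ≫
        (spliced C).seq.leftExt ((spliced C).T F G) =
      conv.map ((spliced C).seq.leftExt F) ((spliced C).seq.leftExt G) := by
  refine psh_ext fun A w => ?_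
  induction w using pmk_ind with
  | @h U Z p w w' =>
  induction w using sqmk_ind with
  | @h X Y q n x =>
  induction w' using sqmk_ind with
  | @h X' Y' q' n' x' =>
  rw [comp_app_el, comp_app_el, spliced_ψ₂Ext_mk, conv_map_sqmk, spliced_φ₂_mk, id_app_el,
    seq_leftExt_mk, conv_map_pmk, seq_leftExt_mk, seq_leftExt_mk, map_pmk]
  have key : ∀ (n : X.dom ⟶ X.cod) (n' : X'.dom ⟶ X'.cod),
      spmk ((homMk ((p.fst ≫ (q.fst ⊗ₘ q'.fst)) ≫ (𝟙 _ ≫ (n ⊗ₘ n') ≫ 𝟙 _) ≫ (q.mid ⊗ₘ q'.mid))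
        ((q.snd ⊗ₘ q'.snd) ≫ p.snd) : A ⟶ Y ⊗ Y') ≫ 𝟙 (Y ⊗ Y')) x x' =
      spmk p (F.map (homMk (q.fst ≫ n ≫ q.mid) q.snd : U ⟶ Y).op x)
        (G.map (homMk (q'.fst ≫ n' ≫ q'.mid) q'.snd : Z ⟶ Y').op x') := fun n n' =>
    Eq.symm (pmk_eq _ _ (by ext <;> simp) rfl rfl)
  exact key n n'

theorem spliced_ψ₂_seq_right (F G : Psh (Splice C)) :
    (spliced C).ψ₂Ext F (spliced C).seq.unit G (spliced C).seq.unit ≫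
        conv.map (𝟙 ((spliced C).T F G)) (spliced C).φ₂ ≫
        (spliced C).seq.rightExt ((spliced C).T F G) =
      conv.map ((spliced C).seq.rightExt F) ((spliced C).seq.rightExt G) := by
  refine psh_ext fun A w => ?_
  induction w using pmk_ind with
  | @h U Z p w w' =>
  induction w using sqmk_ind with
  | @h X Y q x n =>
  induction w' using sqmk_ind with
  | @h X' Y' q' x' n' =>
  rw [comp_app_el, comp_app_el, spliced_ψ₂Ext_mk, conv_map_sqmk, spliced_φ₂_mk, id_app_el,
    seq_rightExt_mk, conv_map_pmk, seq_rightExt_mk, seq_rightExt_mk, map_pmk]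
  have key : ∀ (n : Y.dom ⟶ Y.cod) (n' : Y'.dom ⟶ Y'.cod),
      spmk ((homMk (p.fst ≫ (q.fst ⊗ₘ q'.fst)) ((q.mid ⊗ₘ q'.mid) ≫ (𝟙 _ ≫ (n ⊗ₘ n') ≫ 𝟙 _) ≫
        (q.snd ⊗ₘ q'.snd) ≫ p.snd) : A ⟶ X ⊗ X') ≫ 𝟙 (X ⊗ X')) x x' =
      spmk p (F.map (homMk q.fst (q.mid ≫ n ≫ q.snd) : U ⟶ X).op x)
        (G.map (homMk q'.fst (q'.mid ≫ n' ≫ q'.snd) : Z ⟶ X').op x') := fun n n' =>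
    Eq.symm (pmk_eq _ _ (by ext <;> simp) rfl rfl)
  exact key n n'

theorem spliced_ψ₀_coassoc :
    (spliced C).ψ₀ ≫ conv.map (spliced C).ψ₀ (𝟙 (spliced C).par.unit) ≫
        (spliced C).seq.assocExt (spliced C).par.unit (spliced C).par.unit (spliced C).par.unit =
      (spliced C).ψ₀ ≫ conv.map (𝟙 (spliced C).par.unit) (spliced C).ψ₀ := by
  refine psh_ext fun A j => ?_
  rw [comp_app_el, comp_app_el, comp_app_el, spliced_ψ₀_mk, conv_map_sqmk, conv_map_sqmk,
    spliced_ψ₀_mk, seq_assocExt_mk, id_app_el]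
  exact sqmk_congr (by simp) rfl rfl rfl (sqmk_congr rfl (by simp) rfl rfl rfl)

theorem spliced_ψ₀_counit_left :
    (spliced C).ψ₀ ≫ conv.map (spliced C).φ₀ (𝟙 (spliced C).par.unit) ≫
      (spliced C).seq.leftExt (spliced C).par.unit = 𝟙 (spliced C).par.unit := by
  refine psh_ext fun A j => ?_
  rw [comp_app_el, comp_app_el, spliced_ψ₀_mk, conv_map_sqmk, spliced_φ₀_mk, id_app_el,
    seq_leftExt_mk, id_app_el]
  have key : ∀ j : A ⟶ 𝟙_ (Splice C), (homMk (j.fst ≫ (𝟙 _ ≫ 𝟙 _) ≫ 𝟙 _) j.snd :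
      A ⟶ 𝟙_ (Splice C)) ≫ 𝟙 _ = j := fun j => by ext <;> simp
  exact key j

theorem spliced_ψ₀_counit_right :
    (spliced C).ψ₀ ≫ conv.map (𝟙 (spliced C).par.unit) (spliced C).φ₀ ≫
      (spliced C).seq.rightExt (spliced C).par.unit = 𝟙 (spliced C).par.unit := by
  refine psh_ext fun A j => ?_
  rw [comp_app_el, comp_app_el, spliced_ψ₀_mk, conv_map_sqmk, spliced_φ₀_mk, id_app_el,
    seq_rightExt_mk, id_app_el]
  have key : ∀ j : A ⟶ 𝟙_ (Splice C), (homMk j.fst (𝟙 _ ≫ (𝟙 _ ≫ 𝟙 _) ≫ j.snd) :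
      A ⟶ 𝟙_ (Splice C)) ≫ 𝟙 _ = j := fun j => by ext <;> simp
  exact key j

theorem spliced_φ₂_assoc :
    conv.map (spliced C).φ₂ (𝟙 (spliced C).seq.unit) ≫ (spliced C).φ₂ =
      (spliced C).par.assocExt (spliced C).seq.unit (spliced C).seq.unit (spliced C).seq.unit ≫
        conv.map (𝟙 (spliced C).seq.unit) (spliced C).φ₂ ≫ (spliced C).φ₂ := by
  refine psh_ext fun A w => ?_
  induction w using pmk_ind with
  | @h U Z p w n₃ =>
  induction w using pmk_ind with
  | @h X Y q n₁ n₂ =>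
  rw [comp_app_el, comp_app_el, comp_app_el, conv_map_pmk, spliced_φ₂_mk, spliced_φ₂_mk,
    par_assocExt_mk, conv_map_pmk, spliced_φ₂_mk, spliced_φ₂_mk, id_app_el, id_app_el]
  have key : ∀ (n₁ : X.dom ⟶ X.cod) (n₂ : Y.dom ⟶ Y.cod) (n₃ : Z.dom ⟶ Z.cod),
      p.fst ≫ ((q.fst ≫ (n₁ ⊗ₘ n₂) ≫ q.snd) ⊗ₘ n₃) ≫ p.snd =
      (p ≫ q ▷ Z ≫ (α_ X Y Z).hom).fst ≫ (n₁ ⊗ₘ (𝟙 _ ≫ (n₂ ⊗ₘ n₃) ≫ 𝟙 _)) ≫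
        (p ≫ q ▷ Z ≫ (α_ X Y Z).hom).snd := fun n₁ n₂ n₃ => by
    rw [comp_tensorHom, comp_tensorHom']
    simp
  exact key n₁ n₂ n₃

theorem spliced_φ₂_unit_left :
    conv.map (spliced C).φ₀ (𝟙 (spliced C).seq.unit) ≫ (spliced C).φ₂ =
      (spliced C).par.leftExt (spliced C).seq.unit := by
  refine psh_ext fun A w => ?_
  induction w using pmk_ind with
  | @h U Z p j n =>
  rw [comp_app_el, conv_map_pmk, id_app_el, spliced_φ₀_mk,
    spliced_φ₂_mk, par_leftExt_mk]
  have key : ∀ (j : U ⟶ 𝟙_ (Splice C)) (n : Z.dom ⟶ Z.cod),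
      p.fst ≫ ((j.fst ≫ j.snd) ⊗ₘ n) ≫ p.snd =
      (p ≫ j ▷ Z ≫ (λ_ Z).hom).fst ≫ n ≫ (p ≫ j ▷ Z ≫ (λ_ Z).hom).snd := fun j n => by
    simp [MonoidalCategory.tensorHom_def, ← MonoidalCategory.whisker_exchange_assoc]
  exact key j n

theorem spliced_φ₂_unit_right :
    conv.map (𝟙 (spliced C).seq.unit) (spliced C).φ₀ ≫ (spliced C).φ₂ =
      (spliced C).par.rightExt (spliced C).seq.unit := by
  refine psh_ext fun A w => ?_
  induction w using pmk_ind with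
  | @h U Z p n j =>
  rw [comp_app_el, conv_map_pmk, id_app_el, spliced_φ₀_mk,
    spliced_φ₂_mk, par_rightExt_mk]
  have key : ∀ (n : U.dom ⟶ U.cod) (j : Z ⟶ 𝟙_ (Splice C)),
      p.fst ≫ (n ⊗ₘ (j.fst ≫ j.snd)) ≫ p.snd =
      (p ≫ U ◁ j ≫ (ρ_ U).hom).fst ≫ n ≫ (p ≫ U ◁ j ≫ (ρ_ U).hom).snd := fun n j => by
    simp [MonoidalCategory.tensorHom_def', MonoidalCategory.whisker_exchange_assoc]
  exact key n j

variable (C) in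
theorem spliced_isSymProduoidal : (spliced C).IsSymProduoidal where
  par_laws := par_isPromonoidal
  seq_laws := seqData_isPromonoidal
  ψ₂_par_assoc := spliced_ψ₂_par_assoc
  ψ₂_seq_assoc := spliced_ψ₂_seq_assoc
  ψ₂_par_left := spliced_ψ₂_par_left
  ψ₂_par_right := spliced_ψ₂_par_right
  ψ₂_seq_left := spliced_ψ₂_seq_left
  ψ₂_seq_right := spliced_ψ₂_seq_right
  ψ₀_coassoc := spliced_ψ₀_coassoc
  ψ₀_counit_left := spliced_ψ₀_counit_left
  ψ₀_counit_right := spliced_ψ₀_counit_right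
  φ₂_assoc := spliced_φ₂_assoc
  φ₂_unit_left := spliced_φ₂_unit_left
  φ₂_unit_right := spliced_φ₂_unit_right
  symmetry := SeqOver.symmetry _
  hexagon := SeqOver.hexagon

end ProduoidalLaws

end Splice

end Produo

namespace Produo

namespace Lens

section Strict

variable {C : Type u} [SmallCategory C] [MonoidalCategory C] [SymmetricCategory C]

local notation "J" => inclusionFunctor C

theorem inclusion_par_id (X Y : Splice C) :
    inclusionPar (𝟙 (X ⊗ Y)) = 𝟙 ((J).obj X ⊗ (J).obj Y) :=
  pair_id ((J).obj X ⊗ (J).obj Y)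

theorem inclusion_par_assoc {A X Y B D E : Splice C} (p : A ⟶ X ⊗ Y) (q : X ⟶ B ⊗ D) (z : Y ⟶ E) :
    inclusionPar p ≫ (inclusionPar q ⊗ₘ (J).map z) ≫
        (α_ ((J).obj B) ((J).obj D) ((J).obj E)).hom =
      (inclusionPar (X := B) (Y := D ⊗ E) (p ≫ (q ⊗ₘ z) ≫ (α_ B D E).hom) :) :=
  pair_comp₃ (X := (J).obj A) (Y := (J).obj X ⊗ (J).obj Y)
    (Z := ((J).obj B ⊗ (J).obj D) ⊗ (J).obj E) (W := (J).obj B ⊗ ((J).obj D ⊗ (J).obj E)) rfl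
    (pair_tensorHom_pair (A := (J).obj X) (A' := (J).obj Y) (X := (J).obj B ⊗ (J).obj D)
      (X' := (J).obj E) q.fst q.snd z.fst z.snd) rfl

theorem inclusion_par_left {A X Y B : Splice C} (p : A ⟶ X ⊗ Y) (j : X ⟶ 𝟙_ (Splice C))
    (y : Y ⟶ B) :
    inclusionPar p ≫ ((pair j.fst j.snd : (J).obj X ⟶ 𝟙_ (Lens C)) ⊗ₘ (J).map y) ≫
        (λ_ ((J).obj B)).hom = (J).map (p ≫ (j ⊗ₘ y) ≫ (λ_ B).hom) :=
  pair_comp₃ (X := (J).obj A) (Y := (J).obj X ⊗ (J).obj Y)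
    (Z := 𝟙_ (Lens C) ⊗ (J).obj B) (W := (J).obj B) rfl
    (pair_tensorHom_pair (A := (J).obj X) (A' := (J).obj Y) (X := 𝟙_ (Lens C))
      (X' := (J).obj B) j.fst j.snd y.fst y.snd) rfl

theorem inclusion_par_right {A X Y B : Splice C} (p : A ⟶ X ⊗ Y) (x : X ⟶ B)
    (j : Y ⟶ 𝟙_ (Splice C)) :
    inclusionPar p ≫ ((J).map x ⊗ₘ (pair j.fst j.snd : (J).obj Y ⟶ 𝟙_ (Lens C))) ≫
        (ρ_ ((J).obj B)).hom = (J).map (p ≫ (x ⊗ₘ j) ≫ (ρ_ B).hom) :=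
  pair_comp₃ (X := (J).obj A) (Y := (J).obj X ⊗ (J).obj Y)
    (Z := (J).obj B ⊗ 𝟙_ (Lens C)) (W := (J).obj B) rfl
    (pair_tensorHom_pair (A := (J).obj X) (A' := (J).obj Y) (X := (J).obj B)
      (X' := 𝟙_ (Lens C)) x.fst x.snd j.fst j.snd) rfl

theorem inclusion_par_braiding {A X Y : Splice C} (p : A ⟶ X ⊗ Y) :
    inclusionPar p ≫ (β_ ((J).obj X) ((J).obj Y)).hom =
      (inclusionPar (X := Y) (Y := X) (p ≫ (β_ X Y).hom) :) :=
  pair_comp₂ (X := (J).obj A) (Y := (J).obj X ⊗ (J).obj Y) (Z := (J).obj Y ⊗ (J).obj X) rfl rfl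

theorem tensorμ_unit_mid {X X' Y Y' : C} (m : X ⟶ Y) (m' : X' ⟶ Y') :
    (tensorμ (𝟙_ C) (𝟙_ C) X X' ≫ (((λ_ X).hom ≫ m ≫ (λ_ Y).inv) ⊗ₘ
        ((λ_ X').hom ≫ m' ≫ (λ_ Y').inv)) ≫ tensorμ (𝟙_ C) Y (𝟙_ C) Y') ≫
        (λ_ (𝟙_ C)).hom ▷ (Y ⊗ Y') =
      (λ_ (𝟙_ C)).hom ▷ (X ⊗ X') ≫ (λ_ (X ⊗ X')).hom ≫ (m ⊗ₘ m') ≫ (λ_ (Y ⊗ Y')).inv := by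
  have h₁ := tensorμ_unit_dom m m'
  have h₂ := tensorμ_unit_cod (𝟙 X) (𝟙 X')
  rw [MonoidalCategory.id_tensorHom_id, Category.comp_id, Category.comp_id, Category.comp_id] at h₂
  rw [← h₁, ← MonoidalCategory.tensorHom_comp_tensorHom]
  simp only [Category.assoc]
  rw [← reassoc_of% h₂]

theorem inclusion_tensSeq {U X Y W Z T : Splice C} (q : Splice.Seq U X Y) (r : Splice.Seq W Z T) :
    tensSeq (inclusionSeq q) (inclusionSeq r) =
      inclusionSeq (A := U ⊗ W) (X := X ⊗ Z) (Y := Y ⊗ T)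
        ⟨q.fst ⊗ₘ r.fst, q.mid ⊗ₘ r.mid, q.snd ⊗ₘ r.snd⟩ :=
  seq_eq (A := (J).obj U ⊗ (J).obj W) (X := (J).obj X ⊗ (J).obj Z) (Y := (J).obj Y ⊗ (J).obj T)
    (λ_ (𝟙_ C)).hom (λ_ (𝟙_ C)).hom (tensorμ_unit_dom q.fst r.fst) (tensorμ_unit_mid q.mid r.mid)
    (tensorμ_unit_cod q.snd r.snd)

theorem inclusion_assocSeq {A U Z B D E : Splice C} (p : Splice.Seq A U Z) (q : Splice.Seq U B D)
    (z : Z ⟶ E) :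
    assocSeq (actY ((J).map z) (inclusionSeq p)) (inclusionSeq q) =
      conv.mk (X := (J).obj B) (Y := (⟨D.dom, E.cod⟩ : Lens C))
        (inclusionSeq (⟨p.fst ≫ q.fst, q.mid, z.snd ≫ p.snd⟩ : Splice.Seq A B ⟨D.dom, E.cod⟩))
        (𝟙 ((J).obj B)) (inclusionSeq (⟨𝟙 D.dom, q.snd ≫ p.mid ≫ z.fst, 𝟙 E.cod⟩ :
          Splice.Seq ⟨D.dom, E.cod⟩ D E)) := by
  have h := seq_actY_pair z.fst z.snd (A := (J).obj A) (X := (J).obj U) (Y := (J).obj Z)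
    (Y' := (J).obj E) (p.fst ≫ (λ_ U.dom).inv) ((λ_ U.cod).hom ≫ p.mid ≫ (λ_ Z.dom).inv)
    ((λ_ Z.cod).hom ≫ p.snd)
  refine (congrArg (fun t => assocSeq t (inclusionSeq q)) h).trans ?_
  refine assoc_eq (F := yoneda.obj ((J).obj B)) (A := (J).obj A)
    (pair (A := ⟨(𝟙_ C ⊗ 𝟙_ C) ⊗ B.cod, A.cod⟩) (X := (⟨D.dom, E.cod⟩ : Lens C))
      ((λ_ _).hom ▷ B.cod ≫ (λ_ _).hom ≫ q.mid) (z.snd ≫ p.snd)) (𝟙 ((J).obj B)) ?_ ?_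
  · refine (seq_actY_pair _ _ _ _ _).trans ?_
    exact seq_eq (λ_ _).hom (𝟙 _) (by simp) (by simp) (by simp)
  · refine (seq_actA_pair _ _ _ _ _).trans ?_
    exact (seq_eq (λ_ _).hom (𝟙 _) (by simp) (by simp) (by simp)).symm

theorem inclusion_fillX {A X Y B : Splice C} (p : Splice.Seq A X Y) (n : X.dom ⟶ X.cod)
    (y : Y ⟶ B) :
    fillX (inclusionSeq p) n ≫ (J).map y =
      (J).map (Splice.homMk (p.fst ≫ n ≫ p.mid ≫ y.fst) (y.snd ≫ p.snd) : A ⟶ B) :=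
  (lens_comp_pair (A := (J).obj A) (X := (J).obj Y) (Z := (J).obj B) _ _ y.fst y.snd).trans
    (lens_eq (𝟙 _) (by simp) (by simp))

theorem inclusion_fillY {A X Y B : Splice C} (p : Splice.Seq A X Y) (x : X ⟶ B)
    (n : Y.dom ⟶ Y.cod) :
    fillY (inclusionSeq p) n ≫ (J).map x =
      (J).map (Splice.homMk (p.fst ≫ x.fst) (x.snd ≫ p.mid ≫ n ≫ p.snd) : A ⟶ B) :=
  (lens_comp_pair (A := (J).obj A) (X := (J).obj X) (Z := (J).obj B) _ _ x.fst x.snd).trans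
    (lens_eq (𝟙 _) (by simp) (by simp))

end Strict

end Lens

section InclusionLaws

open SeqOver

variable {C : Type u} [SmallCategory C] [MonoidalCategory C] [SymmetricCategory C]

theorem inclusion_par : PreservesPromonoidal (inclusion C).functor (spliced C).par (lenses C).par
    (inclusion C).mapPar (inclusion C).mapI where
  assoc B D E := Sq.eq fun A w => by
    induction w using pmk_ind with
    | @h X Y p q z =>
    have key : ∀ (q : X ⟶ B ⊗ D) (z : Y ⟶ E), _ = _ := fun q z =>
      conv.congr (P := tensSplit (Lens C)) (F := yoneda.obj ((inclusion C).functor.obj B))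
        (G := (tensSplit (Lens C)).psh ((inclusion C).functor.obj D) ((inclusion C).functor.obj E))
        (A := (inclusion C).functor.obj A)
        (Lens.inclusion_par_assoc p q z) (Lens.pair_id _).symm (Lens.inclusion_par_id D E).symm
    exact key q z
  leftUnitor B := Sq.eq fun A w => by
    induction w using pmk_ind with
    | @h X Y p j z => exact Lens.inclusion_par_left p j z
  rightUnitor B := Sq.eq fun A w => by
    induction w using pmk_ind with
    | @h X Y p x j => exact Lens.inclusion_par_right p x j

theorem inclusion_seq : PreservesPromonoidal (inclusion C).functor (spliced C).seq (lenses C).seq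
    (inclusion C).mapSeq (inclusion C).mapN where
  assoc B D E := Sq.eq fun A w => by
    induction w using Splice.sqmk_ind with
    | @h X Y p q z =>
    refine Eq.trans (Lens.inclusion_assocSeq p q z) ?_
    exact conv.congr rfl (Lens.pair_id _).symm rfl
  leftUnitor B := Sq.eq fun A w => by
    induction w using Splice.sqmk_ind with
    | @h X Y p n z => exact Lens.inclusion_fillX p n z
  rightUnitor B := Sq.eq fun A w => by
    induction w using Splice.sqmk_ind with
    | @h X Y p x n => exact Lens.inclusion_fillY p x n

variable (C) in
theorem inclusion_isSymProduoidal : (inclusion C).IsSymProduoidal where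
  par := inclusion_par
  seq := inclusion_seq
  ψ₂ X Y Z T := Sq.eq fun A w => by
    induction w using pmk_ind with
    | @h U W p q r =>
    have key : ∀ (q : Splice.Seq U X Y) (r : Splice.Seq W Z T), _ = _ := fun q r =>
      conv.congr (P := Lens.seqSplit C) (F := (tensSplit (Lens C)).psh ((inclusion C).functor.obj X)
          ((inclusion C).functor.obj Z))
        (G := (tensSplit (Lens C)).psh ((inclusion C).functor.obj Y) ((inclusion C).functor.obj T))
        (A := (inclusion C).functor.obj A)
        (((congrArg (fun t => (Lens.seqSplit C).act (inclusionPar p) (𝟙 _) (𝟙 _) t)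
          (Lens.inclusion_tensSeq q r)).trans
          (congrArg₂ (fun s t => (Lens.seqSplit C).act (inclusionPar p) s t _)
            (Lens.inclusion_par_id X Z).symm (Lens.inclusion_par_id Y T).symm)).trans
          (inclusionSeq_act p (𝟙 (X ⊗ Z)) (𝟙 (Y ⊗ T)) _).symm)
        (Lens.inclusion_par_id X Z).symm (Lens.inclusion_par_id Y T).symm
    exact key q r
  ψ₀ := Sq.eq fun A j => by
    have key : ∀ (j : A ⟶ 𝟙_ (Splice C)), _ = _ := fun j =>
      conv.congr (P := Lens.seqSplit C) (F := yoneda.obj (𝟙_ (Lens C)))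
        (G := yoneda.obj (𝟙_ (Lens C)))
        (A := (inclusion C).functor.obj A) (X := 𝟙_ (Lens C)) (Y := 𝟙_ (Lens C))
        (((congrArg (fun t => (Lens.seqSplit C).act ((inclusionFunctor C).map j) (𝟙 (𝟙_ (Lens C)))
            (𝟙 (𝟙_ (Lens C))) t)
          (show (Lens.seqOver C).tensI = inclusionSeq (A := 𝟙_ (Splice C)) (X := 𝟙_ (Splice C))
            (Y := 𝟙_ (Splice C)) ⟨𝟙 (𝟙_ C), 𝟙 (𝟙_ C), 𝟙 (𝟙_ C)⟩ from
              Lens.seq_eq (A := 𝟙_ (Lens C)) (X := 𝟙_ (Lens C)) (Y := 𝟙_ (Lens C))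
                (𝟙 (𝟙_ C)) (𝟙 (𝟙_ C)) (by simp) (by simp; rfl) (by simp))).trans
          (congrArg₂ (fun s t => (Lens.seqSplit C).act ((inclusionFunctor C).map j) s t _)
            (Lens.pair_id (𝟙_ (Lens C))).symm (Lens.pair_id (𝟙_ (Lens C))).symm)).trans
          (inclusionSeq_act j (𝟙 (𝟙_ (Splice C))) (𝟙 (𝟙_ (Splice C))) _).symm)
        (Lens.pair_id (𝟙_ (Lens C))).symm (Lens.pair_id (𝟙_ (Lens C))).symm
    exact key j
  φ₂ := Sq.eq fun A w => by
    induction w using pmk_ind with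
    | @h U W p m n => exact (inclusionN_act p _).symm
  φ₀ := Sq.eq fun A j => (inclusionN_act (A := 𝟙_ (Splice C)) j (𝟙 (𝟙_ C))).symm
  σ X Y := Sq.eq fun A p => Lens.inclusion_par_braiding p

end InclusionLaws

end Produo

namespace Produo

section Covering

variable {V W : Type u} [SmallCategory V] [SmallCategory W] {𝕍 : SymProduoidalData V}
  {𝕎 : SymProduoidalData W}

/-- A functor through which every expression of the target is covered by the corresponding
expression of the source. -/
structure ProFunctor.Covers (J : ProFunctor 𝕍 𝕎) : Prop where
  obj : Function.Surjective J.functor.obj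
  par {E E' : Psh V} {F F' : Psh W} {s : E ⟶ J.functor.op ⋙ F} {t : E' ⟶ J.functor.op ⋙ F'} :
    Onto s → Onto t → Onto (J.mapPar.conv s t)
  parUnit_left {E : Psh V} {F : Psh W} {s : E ⟶ J.functor.op ⋙ F} :
    Onto s → Onto (J.mapPar.conv J.mapI s)
  parUnit_right {E : Psh V} {F : Psh W} {s : E ⟶ J.functor.op ⋙ F} :
    Onto s → Onto (J.mapPar.conv s J.mapI)
  seq {E E' : Psh V} {F F' : Psh W} {s : E ⟶ J.functor.op ⋙ F} {t : E' ⟶ J.functor.op ⋙ F'} :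
    Onto s → Onto t → Onto (J.mapSeq.conv s t)
  unitN : Onto J.mapN
  unitI (B : W) (j : 𝕎.par.unit.obj (op B)) : ∃ (A : V) (l : B ⟶ J.functor.obj A)
    (x : 𝕍.par.unit.obj (op A)), 𝕎.par.unit.map l.op (J.mapI.app (op A) x) = j

theorem Onto.id {J : V ⥤ W} (F : Psh W) : Onto (𝟙 (J.op ⋙ F)) := fun _ x => ⟨x, rfl⟩

namespace ProFunctor.Covers

variable {J : ProFunctor 𝕍 𝕎}

theorem cancel_unit (c : J.Covers) {E' : Psh V} {F' : Psh W} {a a' : 𝕍.par.unit ⟶ E'}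
    {b b' : 𝕎.par.unit ⟶ F'} {s' : E' ⟶ J.functor.op ⋙ F'} (h : Sq J.functor a b J.mapI s')
    (h' : Sq J.functor a' b' J.mapI s') (e : a = a') : b = b' := by
  refine psh_ext fun B j => ?_
  obtain ⟨A, l, x, rfl⟩ := c.unitI B j
  rw [NatTrans.naturality_apply, NatTrans.naturality_apply, h A x, h' A x, e]

theorem seq_laws (c : J.Covers) (hJ : J.IsSymProduoidal) (h𝕍 : 𝕍.IsSymProduoidal)
    (h₁ : ∀ B C D, IsIso (𝕎.seq.assoc B C D)) (h₂ : ∀ B, IsIso (𝕎.seq.leftUnitor B))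
    (h₃ : ∀ B, IsIso (𝕎.seq.rightUnitor B)) : 𝕎.seq.IsPromonoidal where
  assoc_iso := h₁
  leftUnitor_iso := h₂
  rightUnitor_iso := h₃
  pentagon F G H K := Sq.cancel c.obj
    (c.seq (c.seq (c.seq (.id F) (.id G)) (.id H)) (.id K))
    (((hJ.seq.sq_assoc _ _ _).map J.mapSeq (.id _)).comp
      ((hJ.seq.sq_assoc _ _ _).comp ((Sq.id _).map J.mapSeq (hJ.seq.sq_assoc _ _ _))))
    ((hJ.seq.sq_assoc _ _ _).comp (hJ.seq.sq_assoc _ _ _))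
    (h𝕍.seq_laws.pentagon _ _ _ _)
  triangle F G := Sq.cancel c.obj
    (c.seq (c.seq (.id F) c.unitN) (.id G))
    ((hJ.seq.sq_assoc _ _ _).comp ((Sq.id _).map J.mapSeq (hJ.seq.sq_left _)))
    ((hJ.seq.sq_right _).map J.mapSeq (Sq.id _))
    (h𝕍.seq_laws.triangle _ _)

/-- Laws are transferred along a covering functor. -/
theorem isSymProduoidal (c : J.Covers) (hJ : J.IsSymProduoidal) (h𝕍 : 𝕍.IsSymProduoidal)
    (h_par : 𝕎.par.IsPromonoidal)
    (h₁ : ∀ B C D, IsIso (𝕎.seq.assoc B C D)) (h₂ : ∀ B, IsIso (𝕎.seq.leftUnitor B))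
    (h₃ : ∀ B, IsIso (𝕎.seq.rightUnitor B))
    (h₄ : ∀ B C, 𝕎.σ B C ≫ 𝕎.σ C B = 𝟙 (𝕎.par.split.psh B C)) : 𝕎.IsSymProduoidal where
  par_laws := h_par
  seq_laws := c.seq_laws hJ h𝕍 h₁ h₂ h₃
  ψ₂_par_assoc F G H K L M := Sq.cancel c.obj
    (c.par (c.par (c.seq (.id F) (.id G)) (c.seq (.id H) (.id K))) (c.seq (.id L) (.id M)))
    (((hJ.sq_ψ₂ _ _ _ _).map J.mapPar (.id _)).comp ((hJ.sq_ψ₂ _ _ _ _).comp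
      ((hJ.par.sq_assoc _ _ _).map J.mapSeq (hJ.par.sq_assoc _ _ _))))
    ((hJ.par.sq_assoc _ _ _).comp (((Sq.id _).map J.mapPar (hJ.sq_ψ₂ _ _ _ _)).comp
      (hJ.sq_ψ₂ _ _ _ _)))
    (h𝕍.ψ₂_par_assoc _ _ _ _ _ _)
  ψ₂_seq_assoc F G H K L M := Sq.cancel c.obj
    (c.par (c.seq (c.seq (.id F) (.id G)) (.id H)) (c.seq (c.seq (.id K) (.id L)) (.id M)))
    ((hJ.sq_ψ₂ _ _ _ _).comp (((hJ.sq_ψ₂ _ _ _ _).map J.mapSeq (.id _)).comp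
      (hJ.seq.sq_assoc _ _ _)))
    (((hJ.seq.sq_assoc _ _ _).map J.mapPar (hJ.seq.sq_assoc _ _ _)).comp
      ((hJ.sq_ψ₂ _ _ _ _).comp ((Sq.id _).map J.mapSeq (hJ.sq_ψ₂ _ _ _ _))))
    (h𝕍.ψ₂_seq_assoc _ _ _ _ _ _)
  ψ₂_par_left F G := Sq.cancel c.obj
    (c.parUnit_left (c.seq (.id F) (.id G)))
    ((hJ.sq_ψ₀.map J.mapPar (.id _)).comp ((hJ.sq_ψ₂ _ _ _ _).comp
      ((hJ.par.sq_left _).map J.mapSeq (hJ.par.sq_left _))))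
    (hJ.par.sq_left _)
    (h𝕍.ψ₂_par_left _ _)
  ψ₂_par_right F G := Sq.cancel c.obj
    (c.parUnit_right (c.seq (.id F) (.id G)))
    (((Sq.id _).map J.mapPar hJ.sq_ψ₀).comp ((hJ.sq_ψ₂ _ _ _ _).comp
      ((hJ.par.sq_right _).map J.mapSeq (hJ.par.sq_right _))))
    (hJ.par.sq_right _)
    (h𝕍.ψ₂_par_right _ _)
  ψ₂_seq_left F G := Sq.cancel c.obj
    (c.par (c.seq c.unitN (.id F)) (c.seq c.unitN (.id G)))
    ((hJ.sq_ψ₂ _ _ _ _).comp ((hJ.sq_φ₂.map J.mapSeq (.id _)).comp (hJ.seq.sq_left _)))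
    ((hJ.seq.sq_left _).map J.mapPar (hJ.seq.sq_left _))
    (h𝕍.ψ₂_seq_left _ _)
  ψ₂_seq_right F G := Sq.cancel c.obj
    (c.par (c.seq (.id F) c.unitN) (c.seq (.id G) c.unitN))
    ((hJ.sq_ψ₂ _ _ _ _).comp (((Sq.id _).map J.mapSeq hJ.sq_φ₂).comp (hJ.seq.sq_right _)))
    ((hJ.seq.sq_right _).map J.mapPar (hJ.seq.sq_right _))
    (h𝕍.ψ₂_seq_right _ _)
  ψ₀_coassoc := c.cancel_unit
    (hJ.sq_ψ₀.comp ((hJ.sq_ψ₀.map J.mapSeq (.id _)).comp (hJ.seq.sq_assoc _ _ _)))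
    (hJ.sq_ψ₀.comp ((Sq.id _).map J.mapSeq hJ.sq_ψ₀)) h𝕍.ψ₀_coassoc
  ψ₀_counit_left := c.cancel_unit
    (hJ.sq_ψ₀.comp ((hJ.sq_φ₀.map J.mapSeq (.id _)).comp (hJ.seq.sq_left _)))
    (.id _) h𝕍.ψ₀_counit_left
  ψ₀_counit_right := c.cancel_unit
    (hJ.sq_ψ₀.comp (((Sq.id _).map J.mapSeq hJ.sq_φ₀).comp (hJ.seq.sq_right _)))
    (.id _) h𝕍.ψ₀_counit_right
  φ₂_assoc := Sq.cancel c.obj (c.par (c.par c.unitN c.unitN) c.unitN)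
    ((hJ.sq_φ₂.map J.mapPar (.id _)).comp hJ.sq_φ₂)
    ((hJ.par.sq_assoc _ _ _).comp (((Sq.id _).map J.mapPar hJ.sq_φ₂).comp hJ.sq_φ₂))
    h𝕍.φ₂_assoc
  φ₂_unit_left := Sq.cancel c.obj (c.parUnit_left c.unitN)
    ((hJ.sq_φ₀.map J.mapPar (.id _)).comp hJ.sq_φ₂) (hJ.par.sq_left _) h𝕍.φ₂_unit_left
  φ₂_unit_right := Sq.cancel c.obj (c.parUnit_right c.unitN)
    (((Sq.id _).map J.mapPar hJ.sq_φ₀).comp hJ.sq_φ₂) (hJ.par.sq_right _) h𝕍.φ₂_unit_right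
  symmetry := h₄
  hexagon F G H := Sq.cancel c.obj (c.par (c.par (.id F) (.id G)) (.id H))
    ((hJ.par.sq_assoc _ _ _).comp ((hJ.sq_σ _ _).comp (hJ.par.sq_assoc _ _ _)))
    (((hJ.sq_σ _ _).map J.mapPar (.id _)).comp ((hJ.par.sq_assoc _ _ _).comp
      ((Sq.id _).map J.mapPar (hJ.sq_σ _ _))))
    (h𝕍.hexagon _ _ _)

end ProFunctor.Covers

end Covering

end Produo

namespace Produo

namespace Lens

section Associator

variable {C : Type u} [SmallCategory C] [MonoidalCategory C]

theorem assocInv_eq {A U U' B E D : Lens C} (t : U ⟶ U') {p : Seq A U D} {p' : Seq A U' D}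
    {q : Seq U B E} {q' : Seq U' B E} {F : Psh (Lens C)} (x : F.obj (op D))
    (hp : actX t p = p') (hq : actA t q' = q) :
    (conv.mk (P := seqSplit C) (F := (seqSplit C).psh B E) (G := F) p q x :
      (conv _ _ _).obj (op A)) = conv.mk p' q' x := by
  subst hp hq
  have h := conv.dinat (P := seqSplit C) (F := (seqSplit C).psh B E) (G := F) t (𝟙 D) p q' x
  rw [op_id, F.map_id_apply] at h
  refine Eq.trans (conv.congr rfl ?_ rfl) (h.symm.trans (conv.congr ?_ rfl rfl))
  · exact (act_left t q').symm
  · exact act_mid t p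

/-- The inverse associator on representatives. -/
def assocInvRep {A W B E D : Lens C} (p : SeqRep A B W) (q : SeqRep W E D) :
    (conv (seqSplit C) ((seqSplit C).psh B E) (yoneda.obj D)).obj (op A) :=
  conv.mk (X := (⟨A.dom, (p.N ⊗ q.M) ⊗ E.cod⟩ : Lens C)) (Y := D)
    (seq (X := (⟨A.dom, (p.N ⊗ q.M) ⊗ E.cod⟩ : Lens C)) (λ_ A.dom).inv
      ((λ_ ((p.N ⊗ q.M) ⊗ E.cod)).hom ≫ (α_ p.N q.M E.cod).hom ≫ p.N ◁ q.mid ≫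
        (α_ p.N q.N D.dom).inv)
      ((α_ p.N q.N D.cod).hom ≫ p.N ◁ q.snd ≫ p.snd))
    (seq (A := (⟨A.dom, (p.N ⊗ q.M) ⊗ E.cod⟩ : Lens C)) p.fst
      (p.mid ≫ p.N ◁ q.fst ≫ (α_ p.N q.M E.dom).inv) (𝟙 ((p.N ⊗ q.M) ⊗ E.cod)))
    (𝟙 D)

/-- The inverse associator of sequential splits. -/
def assocInv {A W B E D : Lens C} (p : Seq A B W) (q : Seq W E D) :
    (conv (seqSplit C) ((seqSplit C).psh B E) (yoneda.obj D)).obj (op A) :=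
  Quot.lift₂ assocInvRep
    (by
      rintro p _ _ @⟨P, P', Q, Q', a, b, g, k, r⟩
      refine assocInv_eq (F := yoneda.obj D) (pair (A := (⟨A.dom, (p.N ⊗ P') ⊗ E.cod⟩ : Lens C))
        (X := (⟨A.dom, (p.N ⊗ P) ⊗ E.cod⟩ : Lens C)) (𝟙 _) ((p.N ◁ a) ▷ E.cod)) (𝟙 D) ?_ ?_
      · rw [seq_actX_pair]
        exact (seq_eq (𝟙 _) (p.N ◁ b) (by simp) (by simp) (by simp)).symm
      · rw [seq_actA_pair]
        exact seq_eq (𝟙 _) (p.N ◁ a) (by simp) (by simp) (by simp))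
    (by
      rintro _ _ q @⟨M, M', N, N', a, b, f, m, s⟩
      refine assocInv_eq (F := yoneda.obj D) (pair (A := (⟨A.dom, (N' ⊗ q.M) ⊗ E.cod⟩ : Lens C))
        (X := (⟨A.dom, (N ⊗ q.M) ⊗ E.cod⟩ : Lens C)) (𝟙 _) ((b ▷ q.M) ▷ E.cod)) (𝟙 D) ?_ ?_
      · rw [seq_actX_pair]
        refine (seq_eq (𝟙 _) (b ▷ q.N) ?_ ?_ ?_).symm
        · simp
        · simp only [Category.assoc, ← MonoidalCategory.associator_inv_naturality_left,
            MonoidalCategory.associator_naturality_left_assoc, MonoidalCategory.id_whiskerRight,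
            MonoidalCategory.whisker_exchange_assoc, MonoidalCategory.id_whiskerLeft, 
            Category.id_comp, Iso.inv_hom_id_assoc]
        · simp [MonoidalCategory.whisker_exchange_assoc]
      · rw [seq_actA_pair]
        refine (seq_eq a (b ▷ q.M) ?_ ?_ ?_)
        · simp
        · simp [← MonoidalCategory.whisker_exchange_assoc]
        · simp) p q

theorem assocInv_actY {A B W W' E D : Lens C} (l : W ⟶ W') (p : Seq A B W) (q : Seq W' E D) :
    assocInv (actY l p) q = assocInv p (actA l q) := by
  induction p using seq_ind with
  | @h M N f m s =>
  induction q using seq_ind with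
  | @h P Q g k r =>
  induction l using lens_ind with
  | @h K h h' =>
  refine assocInv_eq (F := yoneda.obj D) (pair (A := (⟨A.dom, ((N ⊗ K) ⊗ P) ⊗ E.cod⟩ : Lens C))
        (X := (⟨A.dom, (N ⊗ (K ⊗ P)) ⊗ E.cod⟩ : Lens C)) (𝟙 _) ((α_ N K P).inv ▷ E.cod)) (𝟙 D) ?_ ?_
  · refine (seq_actX_pair _ _ _ _ _).trans ?_
    exact seq_eq (𝟙 _) (α_ N K Q).hom (by simp) (by simp) (by simp)
  · refine (seq_actA_pair _ _ _ _ _).trans ?_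
    exact (seq_eq (𝟙 _) (α_ N K P).hom (by simp) (by simp) (by simp)).symm

theorem assocSeq_assocInv {A B W E D : Lens C} (p : Seq A B W) (q : Seq W E D) :
    ((seqData C).assoc B E D).app (op A) (assocInv p q) =
      conv.mk (P := seqSplit C) (F := yoneda.obj B) (G := (seqSplit C).psh E D) p (𝟙 B) q := by
  induction p using seq_ind with
  | @h M N f m s =>
  induction q using seq_ind with
  | @h P Q g k r =>
  refine (congrArg (fun t => assocSeq t (seq (A := (⟨A.dom, (N ⊗ P) ⊗ E.cod⟩ : Lens C)) (X := B)
    (Y := E) (f) (m ≫ N ◁ g ≫ (α_ N P E.dom).inv) (𝟙 ((N ⊗ P) ⊗ E.cod)))) (actY_id (seq (A := A)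
    (X := (⟨A.dom, (N ⊗ P) ⊗ E.cod⟩ : Lens C)) (Y := D) (λ_ A.dom).inv
      ((λ_ ((N ⊗ P) ⊗ E.cod)).hom ≫ (α_ N P E.cod).hom ≫ N ◁ k ≫ (α_ N Q D.dom).inv)
      ((α_ N Q D.cod).hom ≫ N ◁ r ≫ s)))).trans ?_
  refine assoc_eq (F := yoneda.obj B) (lens (A := (⟨(𝟙_ C ⊗ M) ⊗ B.cod, A.cod⟩ : Lens C)) (X := W)
    ((λ_ M).hom ▷ B.cod ≫ m) s) (𝟙 B) ?_ ?_
  · exact seq_eq (λ_ M).hom (λ_ N).hom (by simp) (by simp) (by simp)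
  · exact (seq_eq (λ_ (N ⊗ P)).hom (𝟙 _) (by simp) (by simp) (by simp)).symm

/-- The inverse associator on sequential splits of sequential splits. -/
def assocInvDesc (A B E D : Lens C)
    (w : (conv (seqSplit C) (yoneda.obj B) ((seqSplit C).psh E D)).obj (op A)) :
    (conv (seqSplit C) ((seqSplit C).psh B E) (yoneda.obj D)).obj (op A) :=
  Quot.lift (fun r : ConvRep (seqSplit C) (yoneda.obj B) ((seqSplit C).psh E D) A =>
    assocInv (actX r.x r.p) r.y) (by
      rintro _ _ ⟨a, b, p, x, q⟩
      have key : ∀ {X X' W W' : Lens C} (a : X ⟶ X') (b : W ⟶ W') (p : Seq A X W) (x : X' ⟶ B)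
          (q : Seq W' E D), assocInv (actX x (actA (𝟙 A) (actX a (actY b p)))) q =
            assocInv (actX (a ≫ x) p) (actA b (actX (𝟙 E) (actY (𝟙 D) q))) := fun a b p x q => by
        rw [actA_id, actX_id, actY_id, ← actX_comp, ← actY_actX, assocInv_actY]
      exact key a b p x q) w

theorem assocInvDesc_assocSeq {A U B E D : Lens C} (p : Seq A U D) (q : Seq U B E) :
    assocInvDesc A B E D (assocSeq p q) =
      conv.mk (P := seqSplit C) (F := (seqSplit C).psh B E) (G := yoneda.obj D) p q (𝟙 D) := by
  induction p using seq_ind with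
  | @h M N f m s =>
  induction q using seq_ind with
  | @h P Q g k r =>
  refine (congrArg (fun t => assocInv t _) (actX_id _)).trans ?_
  refine (assocInv_eq (F := yoneda.obj D) (p' := seq (X := (⟨P ⊗ B.dom, Q ⊗ E.cod⟩ : Lens C))
    (f ≫ M ◁ g) (M ◁ r ≫ m) s) (q' := seq (A := (⟨P ⊗ B.dom, Q ⊗ E.cod⟩ : Lens C)) (𝟙 _) k (𝟙 _))
    (lens (A := (⟨A.dom, (𝟙_ C ⊗ (M ⊗ Q)) ⊗ E.cod⟩ : Lens C))
      (X := (⟨P ⊗ B.dom, Q ⊗ E.cod⟩ : Lens C)) (f ≫ M ◁ g) ((α_ M Q E.cod).inv ≫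
        (λ_ _).inv ▷ E.cod)) (𝟙 D) ?_ ?_).trans
    (assocInv_eq (F := yoneda.obj D) (pair (A := U) (X := (⟨P ⊗ B.dom, Q ⊗ E.cod⟩ : Lens C)) g r)
      (𝟙 D) ?_ ?_).symm
  · exact seq_eq (λ_ M).hom (λ_ N).hom (by simp) (by simp) (by simp)
  · exact seq_eq (𝟙 _) (λ_ (M ⊗ Q)).inv (by simp) (by simp) (by simp)
  · exact (seq_actX_pair _ _ _ _ _)
  · exact (seq_actA_pair _ _ _ _ _).trans (seq_eq (𝟙 _) (𝟙 _) (by simp) (by simp) (by simp))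

theorem seqData_assoc_bijective (A B E D : Lens C) :
    Function.Bijective (((seqData C).assoc B E D).app (op A)) := by
  refine Function.bijective_iff_has_inverse.2 ⟨assocInvDesc A B E D, ?_, ?_⟩
  · intro w
    induction w using conv.ind with
    | @h U Z p q z =>
    have key : ∀ (p : Seq A U Z) (q : Seq U B E) (z : Z ⟶ D),
        assocInvDesc A B E D (assocSeq (actY z p) q) =
          conv.mk (P := seqSplit C) (F := (seqSplit C).psh B E) (G := yoneda.obj D) p q z :=
      fun p q z => (assocInvDesc_assocSeq _ _).trans
        (conv.mk_eq (P := seqSplit C) (F := (seqSplit C).psh B E) (G := yoneda.obj D) (𝟙 U) z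
          (act_right z p) (((seqSplit C).psh B E).map_id_apply _ q) (Category.comp_id z)).symm
    exact key p q z
  · intro w
    induction w using conv.ind with
    | @h X W p x q =>
    have key : ∀ (p : Seq A X W) (x : X ⟶ B) (q : Seq W E D),
        ((seqData C).assoc B E D).app (op A) (assocInv (actX x p) q) =
          conv.mk (P := seqSplit C) (F := yoneda.obj B) (G := (seqSplit C).psh E D) p x q :=
      fun p x q => (assocSeq_assocInv _ _).trans
        (conv.mk_eq (P := seqSplit C) (F := yoneda.obj B) (G := (seqSplit C).psh E D) x (𝟙 W)
          (act_mid x p) (Category.comp_id x) (((seqSplit C).psh E D).map_id_apply _ q)).symm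
    exact key p x q

theorem unit_eqX {A X Y B : Lens C} {M N : C} (f : A.dom ⟶ M ⊗ X.dom)
    (m : M ⊗ X.cod ⟶ N ⊗ Y.dom) (s : N ⊗ Y.cod ⟶ A.cod) (n : X.dom ⟶ X.cod) (y : Y ⟶ B) :
    conv.mk (P := seqSplit C) (F := unitN C) (G := yoneda.obj B) (A := A)
      (X := (⟨A.dom, A.dom⟩ : Lens C)) (Y := A)
      (seq (λ_ A.dom).inv ((λ_ A.dom).hom ≫ (λ_ A.dom).inv) (λ_ A.cod).hom) (𝟙 A.dom)
      ((lens (f ≫ M ◁ n ≫ m) s : A ⟶ Y) ≫ y) =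
    conv.mk (P := seqSplit C) (F := unitN C) (G := yoneda.obj B) (seq f m s) n y := by
  let Q : Lens C := ⟨A.dom, M ⊗ X.cod⟩
  let q : Seq A Q Y := seq (X := Q) (λ_ A.dom).inv ((λ_ _).hom ≫ m) s
  refine (conv.mk_eq (P := seqSplit C) (F := unitN C) (G := yoneda.obj B)
    (X := (⟨A.dom, A.dom⟩ : Lens C)) (X' := (⟨A.dom, A.dom⟩ : Lens C)) (x' := 𝟙 A.dom) (y' := y)
    (𝟙 _) (lens (f ≫ M ◁ n ≫ m) s : A ⟶ Y) (act_right _ _) ((unitN C).map_id_apply _ _) rfl).trans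
    ((conv.congr ?_ rfl rfl).trans <| Eq.trans (conv.mk_eq (P := seqSplit C) (F := unitN C) (G := yoneda.obj B)
      (p := q) (p' := actX (pair (A := Q) (X := (⟨A.dom, A.dom⟩ : Lens C)) (𝟙 _) (f ≫ M ◁ n)) q)
      (x' := 𝟙 A.dom) (y' := y) (pair (A := Q) (X := (⟨A.dom, A.dom⟩ : Lens C)) (𝟙 _) (f ≫ M ◁ n))
      (𝟙 Y) (act_mid _ _) ?_ (Category.id_comp y)).symm
      ((conv.mk_eq (P := seqSplit C) (F := unitN C) (G := yoneda.obj B)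
        (p := q) (x' := n) (x := f ≫ M ◁ n) (lens (A := Q) (X := X) f (𝟙 _)) (𝟙 Y)
          ((act_mid _ _).trans ?_) ?_ (Category.id_comp y))))
  · refine Eq.trans ?_ (seq_actX_pair (X := Q) (X' := (⟨A.dom, A.dom⟩ : Lens C)) (𝟙 A.dom)
      (f ≫ M ◁ n) _ _ _).symm
    exact seq_eq (A := A) (X := (⟨A.dom, A.dom⟩ : Lens C)) (Y := Y) (𝟙 _) (λ_ N).hom
      (by simp; exact (Category.id_comp _).symm) (by simp [Q]) (by simp)
  · exact (show (𝟙 _ ≫ (λ_ _).inv) ≫ 𝟙_ C ◁ 𝟙 A.dom ≫ (λ_ _).hom ≫ (f ≫ M ◁ n) = f ≫ M ◁ n by simp)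
  · exact seq_eq (λ_ M).hom (𝟙 _) (by simp) (by simp [Q]) (by simp)
  · exact (show f ≫ M ◁ n ≫ 𝟙 _ = f ≫ M ◁ n by simp)

theorem unit_eqY {A X Y B : Lens C} {M N : C} (f : A.dom ⟶ M ⊗ X.dom)
    (m : M ⊗ X.cod ⟶ N ⊗ Y.dom) (s : N ⊗ Y.cod ⟶ A.cod) (x : X ⟶ B) (n : Y.dom ⟶ Y.cod) :
    conv.mk (P := seqSplit C) (F := yoneda.obj B) (G := unitN C) (A := A)
      (X := A) (Y := (⟨A.cod, A.cod⟩ : Lens C))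
      (seq (λ_ A.dom).inv ((λ_ A.cod).hom ≫ (λ_ A.cod).inv) (λ_ A.cod).hom)
      ((lens f (m ≫ N ◁ n ≫ s) : A ⟶ X) ≫ x) (𝟙 A.cod) =
    conv.mk (P := seqSplit C) (F := yoneda.obj B) (G := unitN C) (seq f m s) x n := by
  let Q : Lens C := ⟨N ⊗ Y.dom, A.cod⟩
  let q : Seq A X Q := seq (Y := Q) f (m ≫ (λ_ _).inv) (λ_ A.cod).hom
  refine (conv.mk_eq (P := seqSplit C) (F := yoneda.obj B) (G := unitN C)
    (Y := (⟨A.cod, A.cod⟩ : Lens C)) (Y' := (⟨A.cod, A.cod⟩ : Lens C)) (y' := 𝟙 A.cod) (x' := x)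
    (lens f (m ≫ N ◁ n ≫ s) : A ⟶ X) (𝟙 _) (act_mid _ _) rfl ((unitN C).map_id_apply _ _)).trans
    ((conv.congr ?_ rfl rfl).trans <| Eq.trans (conv.mk_eq (P := seqSplit C) (F := yoneda.obj B) (G := unitN C)
      (p := q) (p' := actY (pair (A := Q) (X := (⟨A.cod, A.cod⟩ : Lens C)) (N ◁ n ≫ s) (𝟙 _)) q)
      (y' := 𝟙 A.cod) (x' := x) (𝟙 X)
      (pair (A := Q) (X := (⟨A.cod, A.cod⟩ : Lens C)) (N ◁ n ≫ s) (𝟙 _))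
      (act_right _ _) (Category.id_comp x) ?_).symm
      ((conv.mk_eq (P := seqSplit C) (F := yoneda.obj B) (G := unitN C)
        (p := q) (y' := n) (y := N ◁ n ≫ s) (𝟙 X) (lens (A := Q) (X := Y) (𝟙 _) s)
          ((act_right _ _).trans ?_) (Category.id_comp x) ?_)))
  · refine (?_ : _ = _).trans (seq_actY_pair _ _ _ _ _).symm
    exact seq_eq (λ_ M).hom (𝟙 _) (by simp) (by simp) (by simp)
  · exact (show ((N ◁ n ≫ s) ≫ (λ_ _).inv) ≫ 𝟙_ C ◁ 𝟙 A.cod ≫ (λ_ _).hom ≫ 𝟙 _ = N ◁ n ≫ s by simp)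
  · exact seq_eq (𝟙 _) (λ_ N).hom (by simp) (by simp [Q]) (by simp)
  · exact (show 𝟙 _ ≫ N ◁ n ≫ s = N ◁ n ≫ s by simp)

theorem seqData_leftUnitor_bijective (A B : Lens C) :
    Function.Bijective (((seqData C).leftUnitor B).app (op A)) := by
  let sec : (A ⟶ B) → (conv (seqSplit C) (unitN C) (yoneda.obj B)).obj (op A) := fun l =>
    conv.mk (P := seqSplit C) (F := unitN C) (G := yoneda.obj B) (X := (⟨A.dom, A.dom⟩ : Lens C))
      (Y := A) (seq (λ_ A.dom).inv ((λ_ A.dom).hom ≫ (λ_ A.dom).inv) (λ_ A.cod).hom) (𝟙 A.dom) l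
  refine Function.bijective_iff_has_inverse.2 ⟨sec, ?_, ?_⟩
  · intro w
    induction w using conv.ind with
    | @h X Y p n y =>
    have key : ∀ (p : Seq A X Y) (n : X.dom ⟶ X.cod) (y : Y ⟶ B), sec (fillX p n ≫ y) =
        conv.mk (P := seqSplit C) (F := unitN C) (G := yoneda.obj B) p n y := fun p n y => by
      induction p using seq_ind with
      | @h M N f m s => exact unit_eqX f m s n y
    exact key p n y
  · have key : ∀ l : A ⟶ B, fillX (seq (λ_ A.dom).inv ((λ_ A.dom).hom ≫ (λ_ A.dom).inv)
      (λ_ A.cod).hom : Seq A (⟨A.dom, A.dom⟩ : Lens C) A) (𝟙 A.dom) ≫ l = l := fun l => by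
      refine Eq.trans (congrArg (· ≫ l) ?_) (Category.id_comp l)
      exact lens_eq (𝟙 _) (by simp) (by simp)
    exact key

theorem seqData_rightUnitor_bijective (A B : Lens C) :
    Function.Bijective (((seqData C).rightUnitor B).app (op A)) := by
  let sec : (A ⟶ B) → (conv (seqSplit C) (yoneda.obj B) (unitN C)).obj (op A) := fun l =>
    conv.mk (P := seqSplit C) (F := yoneda.obj B) (G := unitN C) (X := A)
      (Y := (⟨A.cod, A.cod⟩ : Lens C))
      (seq (λ_ A.dom).inv ((λ_ A.cod).hom ≫ (λ_ A.cod).inv) (λ_ A.cod).hom) l (𝟙 A.cod)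
  refine Function.bijective_iff_has_inverse.2 ⟨sec, ?_, ?_⟩
  · intro w
    induction w using conv.ind with
    | @h X Y p x n =>
    have key : ∀ (p : Seq A X Y) (x : X ⟶ B) (n : Y.dom ⟶ Y.cod), sec (fillY p n ≫ x) =
        conv.mk (P := seqSplit C) (F := yoneda.obj B) (G := unitN C) p x n := fun p x n => by
      induction p using seq_ind with
      | @h M N f m s => exact unit_eqY f m s x n
    exact key p x n
  · have key : ∀ l : A ⟶ B, fillY (seq (λ_ A.dom).inv ((λ_ A.cod).hom ≫ (λ_ A.cod).inv)
      (λ_ A.cod).hom : Seq A A (⟨A.cod, A.cod⟩ : Lens C)) (𝟙 A.cod) ≫ l = l := fun l => by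
      refine Eq.trans (congrArg (· ≫ l) ?_) (Category.id_comp l)
      exact lens_eq (𝟙 _) (by simp) (by simp)
    exact key

end Associator

end Lens

end Produo

namespace Produo

namespace Lens

section Factorization

variable {C : Type u} [SmallCategory C] [MonoidalCategory C] 

/-- The object `(M, M)` of spliced arrows. -/
abbrev hat (M : C) : Splice C := ⟨M, M⟩

variable [SymmetricCategory C]

local notation "J" => inclusionFunctor C

/-- The lens with residual `M` and identity arrows. -/
def eps (M : C) (X : Splice C) : (J).obj (hat M ⊗ X) ⟶ (J).obj X :=
  lens (A := (⟨M ⊗ X.dom, M ⊗ X.cod⟩ : Lens C)) (X := (⟨X.dom, X.cod⟩ : Lens C))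
    (𝟙 (M ⊗ X.dom)) (𝟙 (M ⊗ X.cod))

theorem map_comp_eps {A X : Splice C} {M : C} (f : A.dom ⟶ M ⊗ X.dom) (g : M ⊗ X.cod ⟶ A.cod) :
    (J).map (Splice.homMk f g : A ⟶ hat M ⊗ X) ≫ eps M X =
      lens (A := (J).obj A) (X := (J).obj X) f g :=
  (pair_comp_lens (A := (J).obj A) (X := (J).obj (hat M ⊗ X)) (Z := (J).obj X) f g
    (𝟙 (M ⊗ X.dom)) (𝟙 (M ⊗ X.cod))).trans (lens_eq (𝟙 _) (by simp) (by simp))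

theorem exists_map_comp_eps {A X : Splice C} (l : (J).obj A ⟶ (J).obj X) :
    ∃ (M : C) (a : A ⟶ hat M ⊗ X), l = (J).map a ≫ eps M X := by
  induction l using lens_ind with
  | @h M f g => exact ⟨M, Splice.homMk f g, (map_comp_eps f g).symm⟩

theorem tensorμ_unit_right_dom (M X Y : C) :
    (α_ M X Y).inv ≫ ((𝟙 (M ⊗ X) ⊗ₘ (λ_ Y).inv) ≫ tensorμ M X (𝟙_ C) Y) ≫
      (ρ_ M).hom ▷ (X ⊗ Y) = 𝟙 _ := by
  simp only [tensorμ, braiding_tensorUnit_right]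
  monoidal

theorem tensorμ_unit_right_cod (M X Y : C) :
    tensorμ M (𝟙_ C) X Y ≫ (𝟙 (M ⊗ X) ⊗ₘ (λ_ Y).hom) ≫ (α_ M X Y).hom =
      (ρ_ M).hom ▷ (X ⊗ Y) := by
  simp only [tensorμ, braiding_tensorUnit_left]
  monoidal

theorem inclusionPar_comp_eps {A X Y : Splice C} {M : C} (f : A.dom ⟶ M ⊗ X.dom ⊗ Y.dom)
    (g : M ⊗ X.cod ⊗ Y.cod ⟶ A.cod) :
    inclusionPar (X := hat M ⊗ X) (Y := Y) (Splice.homMk (A := A) (X := (hat M ⊗ X) ⊗ Y)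
      (f ≫ (α_ M X.dom Y.dom).inv) ((α_ M X.cod Y.cod).hom ≫ g)) ≫ (eps M X ⊗ₘ 𝟙 ((J).obj Y)) =
      lens (A := (J).obj A) (X := (J).obj X ⊗ (J).obj Y) f g := by
  refine (congrArg (fun t => _ ≫ (eps M X ⊗ₘ t)) (id_eq ((J).obj Y))).trans ?_
  refine (congrArg (fun t => _ ≫ t) (lens_tensorHom_lens (A := (J).obj (hat M ⊗ X))
    (X := (J).obj X) (A' := (J).obj Y) (X' := (J).obj Y) (𝟙 (M ⊗ X.dom)) (𝟙 (M ⊗ X.cod))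
    (λ_ Y.dom).inv (λ_ Y.cod).hom)).trans ?_
  refine (pair_comp_lens (A := (J).obj A) (X := (J).obj (hat M ⊗ X) ⊗ (J).obj Y)
    (Z := (J).obj X ⊗ (J).obj Y) _ _ _ _).trans ?_
  refine lens_eq (A := (J).obj A) (X := (J).obj X ⊗ (J).obj Y) (ρ_ M).hom ?_ ?_
  · have h := tensorμ_unit_right_dom M X.dom Y.dom
    simp only [Category.assoc] at h ⊢
    exact (congrArg (f ≫ ·) h).trans (Category.comp_id f)
  · have h := tensorμ_unit_right_cod M X.cod Y.cod
    simp only [Category.assoc] at h ⊢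
    exact ((Category.assoc _ _ g).symm.trans ((congrArg (· ≫ g) ((Category.assoc _ _ _).trans h)))
      |>.trans rfl).symm.trans (by simp only [Category.assoc])

theorem exists_inclusionPar {A X Y : Splice C} (p : (J).obj A ⟶ (J).obj X ⊗ (J).obj Y) :
    ∃ (M : C) (a : A ⟶ (hat M ⊗ X) ⊗ Y), p = inclusionPar a ≫ (eps M X ⊗ₘ 𝟙 ((J).obj Y)) := by
  induction p using lens_ind with
  | @h M f g => exact ⟨M, _, (inclusionPar_comp_eps f g).symm⟩

theorem exists_inclusionPar' {A X Y : Splice C} (p : (J).obj A ⟶ (J).obj X ⊗ (J).obj Y) :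
    ∃ (M : C) (a : A ⟶ X ⊗ (hat M ⊗ Y)), p = inclusionPar a ≫ (𝟙 ((J).obj X) ⊗ₘ eps M Y) := by
  obtain ⟨M, a, h⟩ := exists_inclusionPar (p ≫ (β_ ((J).obj X) ((J).obj Y)).hom)
  refine ⟨M, a ≫ (β_ _ _).hom, ?_⟩
  rw [← inclusion_par_braiding a]
  have h' := congrArg (· ≫ (β_ ((J).obj Y) ((J).obj X)).hom) h
  simp only [Category.assoc, SymmetricCategory.symmetry, Category.comp_id] at h'
  rw [h', Category.assoc]
  refine congrArg (CategoryStruct.comp (inclusionPar a)) ?_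
  exact BraidedCategory.braiding_naturality (eps M Y) (𝟙 ((J).obj X))

theorem act_eps_inclusionSeq {A X Y : Splice C} {M N : C} (f : A.dom ⟶ M ⊗ X.dom)
    (m : M ⊗ X.cod ⟶ N ⊗ Y.dom) (s : N ⊗ Y.cod ⟶ A.cod) :
    (seqSplit C).act (𝟙 ((J).obj A)) (eps M X) (eps N Y)
      (inclusionSeq (⟨f, m, s⟩ : Splice.Seq A (hat M ⊗ X) (hat N ⊗ Y))) =
      (seq (A := (J).obj A) (X := (J).obj X) (Y := (J).obj Y) f m s :
        Seq ((J).obj A) ((J).obj X) ((J).obj Y)) := by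
  refine (actA_id (actX (eps M X) (actY (eps N Y)
    (inclusionSeq (⟨f, m, s⟩ : Splice.Seq A (hat M ⊗ X) (hat N ⊗ Y)))))).trans ?_
  exact seq_eq (A := (J).obj A) (X := (J).obj X) (Y := (J).obj Y) (λ_ M).hom (λ_ N).hom (by simp)
    (by simp) (by simp)

theorem exists_inclusionSeq {A X Y : Splice C} (p : Seq ((J).obj A) ((J).obj X) ((J).obj Y)) :
    ∃ (M N : C) (a : Splice.Seq A (hat M ⊗ X) (hat N ⊗ Y)),
      p = (seqSplit C).act (𝟙 ((J).obj A)) (eps M X) (eps N Y) (inclusionSeq a) := by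
  induction p using seq_ind with
  | @h M N f m s => exact ⟨M, N, ⟨f, m, s⟩, (act_eps_inclusionSeq f m s).symm⟩

end Factorization

end Lens

section LensLaws

variable (C : Type u) [SmallCategory C] [MonoidalCategory C] [SymmetricCategory C]

theorem inclusion_covers : (inclusion C).Covers where
  obj B := ⟨⟨B.dom, B.cod⟩, rfl⟩
  par {E E' F F' s t} hs ht A w := by
    induction w using conv.ind with
    | @h X Y p x y =>
    obtain ⟨M, a, rfl⟩ := Lens.exists_inclusionPar (X := ⟨X.dom, X.cod⟩) (Y := ⟨Y.dom, Y.cod⟩) p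
    obtain ⟨x', hx⟩ := hs _ (F.map (Lens.eps M ⟨X.dom, X.cod⟩).op x)
    obtain ⟨y', hy⟩ := ht (⟨Y.dom, Y.cod⟩ : Splice C) y
    refine ⟨conv.mk (P := tensSplit (Splice C)) a x' y', ?_⟩
    exact tmk_eq (Lens.eps M ⟨X.dom, X.cod⟩) (𝟙 Y) rfl hx.symm ((F'.map_id_apply _ y).trans hy.symm)
  parUnit_right {E F s} hs A w := by
    induction w using conv.ind with
    | @h X Y p x y =>
    have key : ∀ y : Y ⟶ 𝟙_ (Lens C), ∃ v, ((inclusion C).mapPar.conv s (inclusion C).mapI).app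
        (op A) v = tmk (F := F) (G := yoneda.obj (𝟙_ (Lens C))) p x y := fun y => by
      obtain ⟨M, a, ha⟩ := Lens.exists_inclusionPar (X := ⟨X.dom, X.cod⟩) (Y := 𝟙_ (Splice C))
        (CategoryStruct.comp (Y := X ⊗ Y) p (X ◁ y))
      obtain ⟨x', hx⟩ := hs _ (F.map (Lens.eps M ⟨X.dom, X.cod⟩).op x)
      refine ⟨conv.mk (P := tensSplit (Splice C)) (G := yoneda.obj (𝟙_ (Splice C))) a x'
        (𝟙 (𝟙_ (Splice C))), ?_⟩
      refine (tmk_eq (F := F) (G := yoneda.obj (𝟙_ (Lens C))) (Lens.eps M ⟨X.dom, X.cod⟩)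
        (𝟙 (𝟙_ (Lens C))) (y' := 𝟙 (𝟙_ (Lens C))) rfl hx.symm
        ((Category.id_comp _).trans (Lens.pair_id (𝟙_ (Lens C))).symm)).trans ?_
      refine (conv.congr (P := tensSplit (Lens C)) (F := F) (G := yoneda.obj (𝟙_ (Lens C)))
        ha.symm rfl rfl).trans (tmk_eq (F := F) (G := yoneda.obj (𝟙_ (Lens C))) (𝟙 X) y ?_
          (F.map_id_apply _ x) (Category.comp_id y)).symm
      rw [MonoidalCategory.id_tensorHom]
    exact key y
  parUnit_left {E F s} hs A w := by
    induction w using conv.ind with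
    | @h X Y p x y =>
    have key : ∀ x : X ⟶ 𝟙_ (Lens C), ∃ v, ((inclusion C).mapPar.conv (inclusion C).mapI s).app
        (op A) v = tmk (F := yoneda.obj (𝟙_ (Lens C))) (G := F) p x y := fun x => by
      obtain ⟨M, a, ha⟩ := Lens.exists_inclusionPar' (Y := ⟨Y.dom, Y.cod⟩) (X := 𝟙_ (Splice C))
        (CategoryStruct.comp (Y := X ⊗ Y) p (x ▷ Y))
      obtain ⟨y', hy⟩ := hs _ (F.map (Lens.eps M ⟨Y.dom, Y.cod⟩).op y)
      refine ⟨conv.mk (P := tensSplit (Splice C)) (F := yoneda.obj (𝟙_ (Splice C))) a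
        (𝟙 (𝟙_ (Splice C))) y', ?_⟩
      refine (tmk_eq (G := F) (F := yoneda.obj (𝟙_ (Lens C))) (𝟙 (𝟙_ (Lens C)))
        (Lens.eps M ⟨Y.dom, Y.cod⟩) (x' := 𝟙 (𝟙_ (Lens C))) rfl
        ((Category.id_comp _).trans (Lens.pair_id (𝟙_ (Lens C))).symm) hy.symm).trans ?_
      refine (conv.congr (P := tensSplit (Lens C)) (G := F) (F := yoneda.obj (𝟙_ (Lens C)))
        ha.symm rfl rfl).trans (tmk_eq (G := F) (F := yoneda.obj (𝟙_ (Lens C))) x (𝟙 Y) ?_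
          (Category.comp_id x) (F.map_id_apply _ y)).symm
      rw [MonoidalCategory.tensorHom_id]
    exact key x
  seq {E E' F F' s t} hs ht A w := by
    induction w using conv.ind with
    | @h X Y p x y =>
    obtain ⟨M, N, a, rfl⟩ := Lens.exists_inclusionSeq (X := ⟨X.dom, X.cod⟩)
      (Y := ⟨Y.dom, Y.cod⟩) p
    obtain ⟨x', hx⟩ := hs _ (F.map (Lens.eps M ⟨X.dom, X.cod⟩).op x)
    obtain ⟨y', hy⟩ := ht _ (F'.map (Lens.eps N ⟨Y.dom, Y.cod⟩).op y)
    refine ⟨conv.mk (P := Splice.seqSplit C) a x' y', ?_⟩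
    exact conv.mk_eq (P := Lens.seqSplit C) (F := F) (G := F') (A := (inclusion C).functor.obj A)
      (Lens.eps M ⟨X.dom, X.cod⟩) (Lens.eps N ⟨Y.dom, Y.cod⟩) rfl hx.symm hy.symm
  unitN A n := ⟨n, rfl⟩
  unitI B j := ⟨𝟙_ (Splice C), j, 𝟙 (𝟙_ (Splice C)),
    (congrArg (CategoryStruct.comp (X := B) (Y := 𝟙_ (Lens C)) j)
      (Lens.pair_id (𝟙_ (Lens C)))).trans (Category.comp_id (Y := 𝟙_ (Lens C)) j)⟩

theorem lenses_isSymProduoidal : (lenses C).IsSymProduoidal :=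
  (inclusion_covers C).isSymProduoidal (inclusion_isSymProduoidal C)
    (Splice.spliced_isSymProduoidal C) parOfMonoidal_isPromonoidal
    (fun B D E => isIso_of_bijective _ fun A => Lens.seqData_assoc_bijective A B D E)
    (fun B => isIso_of_bijective _ fun A => Lens.seqData_leftUnitor_bijective A B)
    (fun B => isIso_of_bijective _ fun A => Lens.seqData_rightUnitor_bijective A B)
    (fun B D => SeqOver.symmetry _ B D)

end LensLaws

end Produo

namespace Produo

theorem inv_app_eq {V : Type u} [SmallCategory V] {F G : Psh V} (s : F ⟶ G) [IsIso s] {A : V}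
    {x : F.obj (op A)} {y : G.obj (op A)} (h : s.app (op A) x = y) :
    (inv s).app (op A) y = x := by
  rw [← h, ← comp_app_el, IsIso.hom_inv_id, id_app_el]

namespace Lens

section Normal

variable {C : Type u} [SmallCategory C] [MonoidalCategory C] [SymmetricCategory C]

local notation "J" => inclusionFunctor C

/-- The element of the parallel unit with residual `M`. -/
def nbar (M : C) : (J).obj (hat M) ⟶ 𝟙_ (Lens C) :=
  lens (A := (⟨M, M⟩ : Lens C)) (X := (⟨𝟙_ C, 𝟙_ C⟩ : Lens C)) (ρ_ M).inv (ρ_ M).hom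

theorem nbar_whiskerRight (M : C) (X : Splice C) :
    nbar M ▷ (J).obj X ≫ (λ_ ((J).obj X)).hom = eps M X := by
  refine (congrArg (fun t => t ≫ (λ_ ((J).obj X)).hom) ((MonoidalCategory.tensorHom_id _ _).symm.trans
    ((congrArg (fun t => nbar M ⊗ₘ t) (id_eq ((J).obj X))).trans
    (lens_tensorHom_lens (A := (J).obj (hat M)) (X := 𝟙_ (Lens C)) (A' := (J).obj X)
      (X' := (J).obj X) (ρ_ M).inv (ρ_ M).hom
    (λ_ X.dom).inv (λ_ X.cod).hom)))).trans ?_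
  refine (lens_comp_pair (A := (J).obj (hat M) ⊗ (J).obj X) (X := 𝟙_ (Lens C) ⊗ (J).obj X)
    (Z := (J).obj X) _ _ (λ_ X.dom).hom (λ_ X.cod).inv).trans ?_
  refine lens_eq (A := (J).obj (hat M ⊗ X)) (X := (J).obj X) (ρ_ M).hom ?_ ?_
  · have h : (((ρ_ M).inv ⊗ₘ (λ_ X.dom).inv) ≫ tensorμ M (𝟙_ C) (𝟙_ C) X.dom) ≫
      (M ⊗ 𝟙_ C) ◁ (λ_ X.dom).hom ≫ (ρ_ M).hom ▷ X.dom = 𝟙 _ := by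
      simp only [tensorμ, braiding_tensorUnit_left]
      monoidal
    simp only [Category.assoc] at h ⊢
    exact h
  · have h : (M ⊗ 𝟙_ C) ◁ (λ_ X.cod).inv ≫ tensorμ M (𝟙_ C) (𝟙_ C) X.cod ≫
      ((ρ_ M).hom ⊗ₘ (λ_ X.cod).hom) = (ρ_ M).hom ▷ X.cod := by
      simp only [tensorμ, braiding_tensorUnit_left]
      monoidal
    exact (Category.comp_id _).trans h.symm

theorem φ₀_lens {A : Lens C} {M : C} (f : A.dom ⟶ M ⊗ 𝟙_ C) (g : M ⊗ 𝟙_ C ⟶ A.cod) :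
    (lenses C).φ₀.app (op A) (lens (A := A) (X := 𝟙_ (Lens C)) f g) = f ≫ g :=
  show f ≫ M ◁ 𝟙 (𝟙_ C) ≫ g = f ≫ g by simp

variable (C) in
theorem lenses_isNormal : IsIso (lenses C).φ₀ := by
  refine isIso_of_bijective _ fun A => Function.bijective_iff_has_inverse.2
    ⟨fun n => lens (A := A) (X := 𝟙_ (Lens C)) (CategoryStruct.comp (X := A.dom) (Y := A.cod) n
      (ρ_ A.cod).inv) (ρ_ A.cod).hom, ?_, ?_⟩
  · intro j
    have key : ∀ j : A ⟶ 𝟙_ (Lens C), lens (A := A) (X := 𝟙_ (Lens C))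
        (CategoryStruct.comp (X := A.dom) (Y := A.cod) ((lenses C).φ₀.app (op A) j)
          (ρ_ A.cod).inv) (ρ_ A.cod).hom = j := fun j => by
      induction j using lens_ind with
      | @h M f g =>
      refine Eq.symm ((lens_eq (A := A) (X := 𝟙_ (Lens C)) ((ρ_ M).inv ≫ g) rfl ?_).trans
        (congrArg (fun t : A.dom ⟶ A.cod ⊗ 𝟙_ C => lens (A := A) (X := 𝟙_ (Lens C)) t
          (ρ_ A.cod).hom) ?_))
      · exact show ((ρ_ M).inv ≫ g) ▷ 𝟙_ C ≫ (ρ_ A.cod).hom = g by simp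
      · refine Eq.trans ?_ (congrArg (fun t : A.dom ⟶ A.cod => t ≫ (ρ_ A.cod).inv)
          (φ₀_lens (A := A) f g).symm)
        exact show f ≫ ((ρ_ M).inv ≫ g) ▷ 𝟙_ C = (f ≫ g) ≫ (ρ_ A.cod).inv by simp
    exact key j
  · intro n
    exact (φ₀_lens (A := A) (M := A.cod) _ _).trans
      ((Category.assoc _ _ _).trans ((congrArg (CategoryStruct.comp (X := A.dom) (Y := A.cod) n)
        (Iso.inv_hom_id _)).trans (Category.comp_id (X := A.dom) (Y := A.cod) n)))

theorem φ₀_nbar (M : C) : (lenses C).φ₀.app (op ((J).obj (hat M))) (nbar M) = 𝟙 M :=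
  (φ₀_lens (A := (⟨M, M⟩ : Lens C)) (ρ_ M).inv (ρ_ M).hom).trans (Iso.inv_hom_id _)

theorem inv_φ₀_app [IsIso (lenses C).φ₀] (M : C) :
    (inv (lenses C).φ₀).app (op ((J).obj (hat M))) (𝟙 M) = nbar M :=
  inv_app_eq _ (φ₀_nbar M)

end Normal

end Lens

section Kleisli

open SeqOver Lens

variable {C : Type u} [SmallCategory C] [MonoidalCategory C] [SymmetricCategory C]

local notation "J" => inclusionFunctor C

/-- The class of `(a ∣ 𝟙 ∣ x)` in `𝓢ℂ(A; N ⊗ F)`. -/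
def normalMk {F : Psh (Splice C)} {A X : Splice C} {M : C} (a : A ⟶ hat M ⊗ X) (x : F.obj (op X)) :
    ((spliced C).T (spliced C).seq.unit F).obj (op A) :=
  (Splice.seqOver C).pmk (F := Splice.unitN C) a (𝟙 M) x

theorem pmk_eq_normalMk {F : Psh (Splice C)} {A X Y : Splice C} (a : A ⟶ X ⊗ Y)
    (n : X.dom ⟶ X.cod) (y : F.obj (op Y)) :
    (Splice.seqOver C).pmk (F := Splice.unitN C) a n y = normalMk (M := X.cod)
      (a ≫ (Splice.homMk n (𝟙 _) : X ⟶ hat X.cod) ▷ Y) y :=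
  pmk_eq (Splice.homMk n (𝟙 _) : X ⟶ hat X.cod) (𝟙 Y) (by rw [MonoidalCategory.tensorHom_id])
    (show n ≫ 𝟙 X.cod ≫ 𝟙 X.cod = n by simp) (F.map_id_apply _ y)

theorem pmk_eq_normalMk' {F : Psh (Splice C)} {A X Y : Splice C} (a : A ⟶ X ⊗ Y)
    (n : X.dom ⟶ X.cod) (y : F.obj (op Y)) :
    (Splice.seqOver C).pmk (F := Splice.unitN C) a n y = normalMk (M := X.dom)
      (a ≫ (Splice.homMk (𝟙 _) n : X ⟶ hat X.dom) ▷ Y) y :=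
  pmk_eq (Splice.homMk (𝟙 _) n : X ⟶ hat X.dom) (𝟙 Y) (by rw [MonoidalCategory.tensorHom_id])
    (show 𝟙 X.dom ≫ 𝟙 X.dom ≫ n = n by simp) (F.map_id_apply _ y)

theorem normalMk_slide {F : Psh (Splice C)} {A X : Splice C} {M M' : C} (a : M ⟶ M')
    (f : A.dom ⟶ M ⊗ X.dom) (g : M' ⊗ X.cod ⟶ A.cod) (x : F.obj (op X)) :
    normalMk (Splice.homMk (f ≫ a ▷ X.dom) g : A ⟶ hat M' ⊗ X) x =
      normalMk (Splice.homMk f (a ▷ X.cod ≫ g) : A ⟶ hat M ⊗ X) x := by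
  have h₁ := pmk_eq_normalMk (X := (⟨M, M'⟩ : Splice C)) (Splice.homMk f g : A ⟶ ⟨M, M'⟩ ⊗ X) a x
  have h₂ := pmk_eq_normalMk' (X := (⟨M, M'⟩ : Splice C)) (Splice.homMk f g : A ⟶ ⟨M, M'⟩ ⊗ X) a x
  refine Eq.trans ?_ (h₁.symm.trans (h₂.trans ?_))
  · exact congrArg (fun t => normalMk t x) (Splice.hom_ext rfl
      (show g = 𝟙 _ ▷ X.cod ≫ g by simp))
  · exact congrArg (fun t => normalMk t x) (Splice.hom_ext 
      (show f ≫ 𝟙 _ ▷ X.dom = f by simp) rfl)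

theorem normalMk_ind {F : Psh (Splice C)} {A : Splice C}
    {motive : ((spliced C).T (spliced C).seq.unit F).obj (op A) → Prop}
    (h : ∀ {M : C} {X : Splice C} (a : A ⟶ hat M ⊗ X) (x : F.obj (op X)), motive (normalMk a x))
    (w : ((spliced C).T (spliced C).seq.unit F).obj (op A)) : motive w := by
  induction w using pmk_ind with
  | @h X Y p n x =>
    have key : ∀ n : X.dom ⟶ X.cod, motive ((Splice.seqOver C).pmk (F := Splice.unitN C) p n x) :=
      fun n => (pmk_eq_normalMk p n x).symm ▸ h _ x
    exact key n

theorem map_normalMk {F : Psh (Splice C)} {A A' X : Splice C} {M : C} (f : A' ⟶ A)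
    (a : A ⟶ hat M ⊗ X) (x : F.obj (op X)) :
    ((spliced C).T (spliced C).seq.unit F).map f.op (normalMk a x) = normalMk (f ≫ a) x :=
  map_pmk _ _ _ _

theorem normalMk_map {F : Psh (Splice C)} {A X X' : Splice C} {M : C} (f : X ⟶ X')
    (a : A ⟶ hat M ⊗ X) (x : F.obj (op X')) :
    normalMk a (F.map f.op x) = normalMk (a ≫ hat M ◁ f) x :=
  pmk_eq (D := Splice.seqOver C) (F := Splice.unitN C) (𝟙 _) f
    (by rw [MonoidalCategory.id_tensorHom]) ((Splice.unitN C).map_id_apply _ _) rfl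

theorem normalize_normalMk [IsIso (lenses C).φ₀] {G : Psh (Splice C)} {H : Psh (Lens C)}
    (s : G ⟶ (inclusion C).functor.op ⋙ H) {A X : Splice C} {M : C} (a : A ⟶ hat M ⊗ X)
    (x : G.obj (op X)) :
    ((inclusion C).normalize s).app (op A) (normalMk a x) =
      H.map ((J).map a ≫ eps M X).op (s.app (op X) x) := by
  refine (par_leftExt_mk (D := Lens.seqOver C) (X := (J).obj (hat M)) (Y := (J).obj X)
    (inclusionPar a) ((inv (lenses C).φ₀).app (op ((J).obj (hat M))) (𝟙 M : _ ⟶ _))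
    (s.app (op X) x)).trans ?_
  refine congrArg (fun t : (J).obj A ⟶ (J).obj X => H.map t.op (s.app (op X) x)) ?_
  refine (congrArg (fun t : (J).obj (hat M) ⟶ 𝟙_ (Lens C) => inclusionPar a ≫ t ▷ (J).obj X ≫
    (λ_ ((J).obj X)).hom) (inv_φ₀_app M)).trans ?_
  exact congrArg (CategoryStruct.comp ((J).map a)) (nbar_whiskerRight M X)

theorem bijective_of_section {α β : Type*} {f : α → β} (g : β → α) (h : ∀ b, f (g b) = b)
    (hg : Function.Surjective g) : Function.Bijective f :=
  ⟨fun a a' e => by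
    obtain ⟨b, rfl⟩ := hg a
    obtain ⟨b', rfl⟩ := hg a'
    rw [h, h] at e
    rw [e], fun b => ⟨g b, h b⟩⟩

/-- A lens as an element of `𝓢ℂ(A; N ⊗ F)`, for an element of `F`. -/
def ofLens {F : Psh (Splice C)} {A X : Splice C} (x : F.obj (op X)) (l : (J).obj A ⟶ (J).obj X) :
    ((spliced C).T (spliced C).seq.unit F).obj (op A) :=
  Quot.lift (fun r : Rep ((J).obj A) ((J).obj X) =>
    normalMk (M := r.M) (Splice.homMk r.fst r.snd : A ⟶ hat r.M ⊗ X) x)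
    (by
      rintro _ _ ⟨a, f, g⟩
      exact normalMk_slide a f g x) l

theorem ofLens_comp {F : Psh (Splice C)} {A X : Splice C} {M : C} (x : F.obj (op X))
    (a : A ⟶ hat M ⊗ X) : ofLens x ((J).map a ≫ eps M X) = normalMk a x :=
  congrArg (ofLens x) (map_comp_eps a.fst a.snd)

theorem normHom_normalMk [IsIso (lenses C).φ₀] {A B : Splice C} {M : C} (a : A ⟶ hat M ⊗ B) :
    ((inclusion C).normHom B).app (op A) (normalMk (F := yoneda.obj B) a (𝟙 B)) =
      (J).map a ≫ eps M B :=
  (normalize_normalMk _ a _).trans ((congrArg _ ((J).map_id B)).trans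
    (Category.comp_id ((J).map a ≫ eps M B)))

theorem normalMk_yoneda {A X B : Splice C} {M : C} (a : A ⟶ hat M ⊗ X) (x : X ⟶ B) :
    normalMk (F := yoneda.obj B) a x = normalMk (F := yoneda.obj B) (a ≫ hat M ◁ x) (𝟙 B) :=
  Eq.trans (congrArg (normalMk (F := yoneda.obj B) a) (Category.comp_id x).symm)
    (normalMk_map (F := yoneda.obj B) x a (𝟙 B))

theorem inclusion_isKleisli_hom [IsIso (lenses C).φ₀] (B : Splice C) :
    IsIso ((inclusion C).normHom B) := by
  refine isIso_of_bijective _ fun A => bijective_of_section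
    (fun l => ofLens (F := yoneda.obj B) (X := B) (𝟙 B) l) (fun l => ?_) (fun w => ?_)
  · obtain ⟨M, a, rfl⟩ := exists_map_comp_eps (A := A) (X := B) l
    exact (congrArg _ (ofLens_comp (F := yoneda.obj B) (𝟙 B) a)).trans (normHom_normalMk a)
  · induction w using normalMk_ind with
    | @h M X a x =>
      exact ⟨(J).map (a ≫ hat M ◁ x) ≫ eps M B, (ofLens_comp _ _).trans (normalMk_yoneda a x).symm⟩

theorem inclusion_isKleisli_par [IsIso (lenses C).φ₀] (B D : Splice C) :
    IsIso ((inclusion C).normPar B D) := by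
  refine isIso_of_bijective _ fun A => bijective_of_section
    (fun l => ofLens (F := (spliced C).par.split.psh B D) (X := B ⊗ D) (𝟙 (B ⊗ D)) l)
    (fun l => ?_) (fun w => ?_)
  · obtain ⟨M, a, rfl⟩ := exists_map_comp_eps (A := A) (X := B ⊗ D) l
    refine (congrArg _ (ofLens_comp (F := (spliced C).par.split.psh B D) (𝟙 (B ⊗ D)) a)).trans
      ((normalize_normalMk _ a _).trans ?_)
    exact (congrArg (fun t => ((lenses C).par.split.psh ((J).obj B) ((J).obj D)).map
      ((J).map a ≫ eps M (B ⊗ D)).op t) (inclusion_par_id B D)).trans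
      (show ((J).map a ≫ eps M (B ⊗ D)) ≫ 𝟙 ((J).obj B ⊗ (J).obj D) ≫ (𝟙 _ ⊗ₘ 𝟙 _) = _ by
        rw [MonoidalCategory.id_tensorHom_id]
        exact (congrArg _ (Category.comp_id _)).trans (Category.comp_id _))
  · induction w using normalMk_ind with
    | @h M X a x =>
      have key : ∀ x : X ⟶ B ⊗ D, ∃ l, ofLens (F := (spliced C).par.split.psh B D) (X := B ⊗ D)
          (𝟙 (B ⊗ D)) l = normalMk (F := (spliced C).par.split.psh B D) a x := fun x => by
        refine ⟨(J).map (a ≫ hat M ◁ x) ≫ eps M (B ⊗ D), ?_⟩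
        refine (ofLens_comp (F := (spliced C).par.split.psh B D) (𝟙 (B ⊗ D)) _).trans
          ((normalMk_map (F := (spliced C).par.split.psh B D) x a (𝟙 (B ⊗ D))).symm.trans ?_)
        exact congrArg (normalMk (F := (spliced C).par.split.psh B D) a)
          (show x ≫ 𝟙 (B ⊗ D) ≫ (𝟙 B ⊗ₘ 𝟙 D) = x by simp)
      exact key x

/-- The class of `(a ∣ 𝟙 ∣ 𝟙)` in `𝓢ℂ(A; (N ⊗ B) ◁ (N ⊗ D))`. -/
def normalSeqMk {A B D : Splice C} {M N : C} (a : Splice.Seq A (hat M ⊗ B) (hat N ⊗ D)) :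
    ((spliced C).S ((spliced C).T (spliced C).seq.unit (yoneda.obj B))
      ((spliced C).T (spliced C).seq.unit (yoneda.obj D))).obj (op A) :=
  Splice.sqmk a (normalMk (F := yoneda.obj B) (𝟙 (hat M ⊗ B)) (𝟙 B))
    (normalMk (F := yoneda.obj D) (𝟙 (hat N ⊗ D)) (𝟙 D))

theorem sqmk_normalMk {A X Y B D : Splice C} {M N : C} (p : Splice.Seq A X Y)
    (a : X ⟶ hat M ⊗ B) (b : Y ⟶ hat N ⊗ D) :
    Splice.sqmk p (normalMk (F := yoneda.obj B) a (𝟙 B)) (normalMk (F := yoneda.obj D) b (𝟙 D)) =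
      normalSeqMk ⟨p.fst ≫ a.fst, a.snd ≫ p.mid ≫ b.fst, b.snd ≫ p.snd⟩ :=
  Splice.sqmk_eq a b rfl rfl rfl ((map_normalMk _ _ _).trans (congrArg (fun t => normalMk (F := yoneda.obj B) t (𝟙 B))
    (Category.comp_id a))) ((map_normalMk _ _ _).trans (congrArg (fun t => normalMk (F := yoneda.obj D) t (𝟙 D))
    (Category.comp_id b)))

theorem normalSeqMk_slide {A B D : Splice C} {M M' N N' : C} (a : M ⟶ M') (b : N ⟶ N')
    (f : A.dom ⟶ M ⊗ B.dom) (m : M' ⊗ B.cod ⟶ N ⊗ D.dom) (s : N' ⊗ D.cod ⟶ A.cod) :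
    normalSeqMk (⟨f ≫ a ▷ B.dom, m ≫ b ▷ D.dom, s⟩ : Splice.Seq A (hat M' ⊗ B) (hat N' ⊗ D)) =
      normalSeqMk (⟨f, a ▷ B.cod ≫ m, b ▷ D.cod ≫ s⟩ : Splice.Seq A (hat M ⊗ B) (hat N ⊗ D)) := by
  have h₁ := normalMk_slide (F := yoneda.obj B) (A := (⟨M ⊗ B.dom, M' ⊗ B.cod⟩ : Splice C)) a
    (𝟙 (M ⊗ B.dom)) (𝟙 (M' ⊗ B.cod)) (𝟙 B)
  have h₂ := normalMk_slide (F := yoneda.obj D) (A := (⟨N ⊗ D.dom, N' ⊗ D.cod⟩ : Splice C)) b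
    (𝟙 (N ⊗ D.dom)) (𝟙 (N' ⊗ D.cod)) (𝟙 D)
  have h₃ := congrArg₂ (Splice.sqmk (⟨f, m, s⟩ : Splice.Seq A (⟨M ⊗ B.dom, M' ⊗ B.cod⟩ : Splice C)
    (⟨N ⊗ D.dom, N' ⊗ D.cod⟩ : Splice C))) h₁ h₂
  rw [sqmk_normalMk, sqmk_normalMk] at h₃
  refine Eq.trans (congrArg normalSeqMk (Splice.Seq.ext ?_ ?_ ?_)) (h₃.trans
    (congrArg normalSeqMk (Splice.Seq.ext ?_ ?_ ?_)))
  · exact show f ≫ a ▷ B.dom = f ≫ 𝟙 _ ≫ a ▷ B.dom by simp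
  · exact show m ≫ b ▷ D.dom = 𝟙 _ ≫ m ≫ 𝟙 _ ≫ b ▷ D.dom by simp
  · exact show s = 𝟙 _ ≫ s by simp
  · exact show f ≫ 𝟙 _ = f by simp
  · exact show (a ▷ B.cod ≫ 𝟙 _) ≫ m ≫ 𝟙 _ = a ▷ B.cod ≫ m by simp
  · exact show (b ▷ D.cod ≫ 𝟙 _) ≫ s = b ▷ D.cod ≫ s by simp

theorem normalSeqMk_surjective {A B D : Splice C}
    (w : ((spliced C).S ((spliced C).T (spliced C).seq.unit (yoneda.obj B))
      ((spliced C).T (spliced C).seq.unit (yoneda.obj D))).obj (op A)) :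
    ∃ (M N : C) (a : Splice.Seq A (hat M ⊗ B) (hat N ⊗ D)), normalSeqMk a = w := by
  induction w using Splice.sqmk_ind with
  | @h X Y p u v =>
  induction u using normalMk_ind with
  | @h M X' a x =>
  induction v using normalMk_ind with
  | @h N Y' b y =>
  have key : ∀ (x : X' ⟶ B) (y : Y' ⟶ D), ∃ (M N : C)
      (c : Splice.Seq A (hat M ⊗ B) (hat N ⊗ D)), normalSeqMk c =
        Splice.sqmk p (normalMk (F := yoneda.obj B) a x) (normalMk (F := yoneda.obj D) b y) :=
    fun x y => by
      rw [normalMk_yoneda a x, normalMk_yoneda b y, sqmk_normalMk]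
      exact ⟨_, _, _, rfl⟩
  exact key x y

theorem inclusion_isKleisli_seq [IsIso (lenses C).φ₀] (B D : Splice C) :
    IsIso ((inclusion C).normSeq B D) := by
  refine isIso_of_bijective _ fun A => bijective_of_section
    (Quot.lift (fun r : SeqRep ((J).obj A) ((J).obj B) ((J).obj D) =>
      normalSeqMk (⟨r.fst, r.mid, r.snd⟩ : Splice.Seq A (hat r.M ⊗ B) (hat r.N ⊗ D)))
      (by
        rintro _ _ ⟨a, b, f, m, s⟩
        exact normalSeqMk_slide a b f m s)) (fun l => ?_) (fun w => ?_)
  · induction l using Lens.seq_ind with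
    | @h M N f m s =>
    refine Eq.trans ?_ (act_eps_inclusionSeq (A := A) (X := B) (Y := D) f m s)
    have h₁ := (normHom_normalMk (𝟙 (hat M ⊗ B))).trans
      ((congrArg (fun t => t ≫ eps M B) ((J).map_id _)).trans (Category.id_comp (eps M B)))
    have h₂ := (normHom_normalMk (𝟙 (hat N ⊗ D))).trans
      ((congrArg (fun t => t ≫ eps N D) ((J).map_id _)).trans (Category.id_comp (eps N D)))
    exact congrArg₂ (fun u v => (seqSplit C).act (𝟙 ((J).obj A)) u v
      (inclusionSeq (⟨f, m, s⟩ : Splice.Seq A (hat M ⊗ B) (hat N ⊗ D)))) h₁ h₂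
  · obtain ⟨M, N, a, rfl⟩ := normalSeqMk_surjective w
    exact ⟨Lens.seq a.fst a.mid a.snd, rfl⟩

variable (C) in
theorem inclusion_isKleisli [IsIso (lenses C).φ₀] : (inclusion C).IsKleisli where
  obj_bijective := Function.bijective_iff_has_inverse.2
    ⟨fun B => ⟨B.dom, B.cod⟩, fun _ => rfl, fun _ => rfl⟩
  hom := inclusion_isKleisli_hom
  par := inclusion_isKleisli_par
  seq := inclusion_isKleisli_seq
  unitI := by
    have : IsIso (inclusion C).mapN := isIso_of_bijective _ fun A => Function.bijective_id
    exact IsIso.comp_isIso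
  unitN := isIso_of_bijective _ fun A => Function.bijective_id

end Kleisli

end Produo

namespace Produo

section SplicedMapLaws

open SeqOver Splice Functor.LaxMonoidal Functor.OplaxMonoidal Functor.Monoidal

variable {C D : Type u} [SmallCategory C] [MonoidalCategory C] [SymmetricCategory C]
  [SmallCategory D] [MonoidalCategory D] [SymmetricCategory D]

section

variable (K : C ⥤ D) [K.Monoidal]

/-- The comparison of tensors of spliced arrows. -/
abbrev spliceδ (X Y : Splice C) : (spliceMap K).functor.obj (X ⊗ Y) ⟶
    (spliceMap K).functor.obj X ⊗ (spliceMap K).functor.obj Y :=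
  Splice.homMk (δ K X.dom Y.dom) (μ K X.cod Y.cod)

/-- The comparison of units of spliced arrows. -/
abbrev spliceη : (spliceMap K).functor.obj (𝟙_ (Splice C)) ⟶ 𝟙_ (Splice D) :=
  Splice.homMk (η K) (ε K)

variable {K}

theorem spliceδ_assoc (X Y Z : Splice C) :
    (spliceMap K).functor.map (α_ X Y Z).hom ≫ spliceδ K X (Y ⊗ Z) ≫
        ((spliceMap K).functor.obj X ◁ spliceδ K Y Z) =
      spliceδ K (X ⊗ Y) Z ≫ spliceδ K X Y ▷ (spliceMap K).functor.obj Z ≫ (α_ _ _ _).hom := by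
  refine Splice.hom_ext ?_ ?_
  · exact Functor.OplaxMonoidal.associativity K X.dom Y.dom Z.dom |>.symm
  · exact (show (K.obj X.cod ◁ μ K Y.cod Z.cod ≫ μ K X.cod (Y.cod ⊗ Z.cod)) ≫
      K.map (α_ X.cod Y.cod Z.cod).inv = ((α_ _ _ _).inv ≫ μ K X.cod Y.cod ▷ K.obj Z.cod) ≫
        μ K (X.cod ⊗ Y.cod) Z.cod by simp)

theorem spliceδ_natural {X X' Y Y' : Splice C} (f : X ⟶ X') (g : Y ⟶ Y') :
    (spliceMap K).functor.map (f ⊗ₘ g) ≫ spliceδ K X' Y' =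
      spliceδ K X Y ≫ ((spliceMap K).functor.map f ⊗ₘ (spliceMap K).functor.map g) := by
  refine Splice.hom_ext ?_ ?_
  · exact (show K.map (f.fst ⊗ₘ g.fst) ≫ δ K _ _ = δ K _ _ ≫ (K.map f.fst ⊗ₘ K.map g.fst) by simp)
  · exact (show μ K _ _ ≫ K.map (f.snd ⊗ₘ g.snd) = (K.map f.snd ⊗ₘ K.map g.snd) ≫ μ K _ _ by simp)

theorem spliceδ_left (X : Splice C) :
    spliceδ K (𝟙_ _) X ≫ spliceη K ▷ (spliceMap K).functor.obj X ≫ (λ_ _).hom =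
      (spliceMap K).functor.map (λ_ X).hom := by
  refine Splice.hom_ext ?_ ?_
  · exact (show δ K (𝟙_ C) X.dom ≫ η K ▷ K.obj X.dom ≫ (λ_ (K.obj X.dom)).hom =
      K.map (λ_ X.dom).hom by simp)
  · exact (show ((λ_ (K.obj X.cod)).inv ≫ ε K ▷ K.obj X.cod) ≫ μ K (𝟙_ C) X.cod  =
      K.map (λ_ X.cod).inv by simp)

theorem spliceδ_right (X : Splice C) :
    spliceδ K X (𝟙_ _) ≫ (spliceMap K).functor.obj X ◁ spliceη K ≫ (ρ_ _).hom =
      (spliceMap K).functor.map (ρ_ X).hom := by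
  refine Splice.hom_ext ?_ ?_
  · exact (show δ K X.dom (𝟙_ C) ≫ K.obj X.dom ◁ η K ≫ (ρ_ (K.obj X.dom)).hom =
      K.map (ρ_ X.dom).hom by simp)
  · exact (show ((ρ_ (K.obj X.cod)).inv ≫ K.obj X.cod ◁ ε K) ≫ μ K X.cod (𝟙_ C)  =
      K.map (ρ_ X.cod).inv by simp)

theorem spliceδ_split (X Y : Splice C) : spliceδ K X Y ≫ 𝟙 _ ≫ (𝟙 _ ⊗ₘ 𝟙 _) =
    (spliceMap K).functor.map (𝟙 (X ⊗ Y)) ≫ spliceδ K X Y := by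
  simp

variable (K) in
theorem spliceη_split : spliceη K ≫ 𝟙 _ =
    (spliceMap K).functor.map (𝟙 (𝟙_ (Splice C))) ≫ spliceη K := by
  simp

variable (K)

theorem map_tensor_δ {A U W X Z : C} (p : A ⟶ U ⊗ W) (q : U ⟶ X) (r : W ⟶ Z) :
    K.map (p ≫ (q ⊗ₘ r) ≫ 𝟙 (X ⊗ Z)) ≫ δ K X Z =
      (K.map p ≫ δ K U W) ≫ (K.map q ⊗ₘ K.map r) ≫ 𝟙 (K.obj X ⊗ K.obj Z) := by
  simp

theorem μ_map_tensor_δ {U W X Z : C} (q : U ⟶ X) (r : W ⟶ Z) :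
    μ K U W ≫ K.map (𝟙 _ ≫ (q ⊗ₘ r) ≫ 𝟙 (X ⊗ Z)) ≫ δ K X Z =
      𝟙 _ ≫ (K.map q ⊗ₘ K.map r) ≫ 𝟙 (K.obj X ⊗ K.obj Z) := by
  simp [← Functor.LaxMonoidal.μ_natural_assoc]

theorem μ_map_tensor {A U W X Z : C} (q : U ⟶ X) (r : W ⟶ Z) (s : X ⊗ Z ⟶ A) :
    μ K U W ≫ K.map (𝟙 (U ⊗ W) ≫ (q ⊗ₘ r) ≫ s) =
      𝟙 (K.obj U ⊗ K.obj W) ≫ (K.map q ⊗ₘ K.map r) ≫ μ K X Z ≫ K.map s := by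
  simp

theorem braiding_inv_μ (K : C ⥤ D) [K.Braided] (X Y : C) :
    (β_ (K.obj X) (K.obj Y)).inv ≫ μ K X Y = μ K Y X ≫ K.map (β_ X Y).inv := by
  rw [Iso.inv_comp_eq, ← Category.assoc, ← Functor.LaxBraided.braided, Category.assoc,
    ← K.map_comp, Iso.hom_inv_id, K.map_id, Category.comp_id]

variable {K}

theorem spliceMap_par : PreservesPromonoidal (spliceMap K).functor (spliced C).par (spliced D).par
    (spliceMap K).mapPar (spliceMap K).mapI where
  assoc B D' E := Sq.eq fun A w => by
    induction w using pmk_ind with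
    | @h X Y p q z =>
    have key : ∀ (q : X ⟶ B ⊗ D') (z : Y ⟶ E),
      tmk (F := yoneda.obj ((spliceMap K).functor.obj B))
        (G := (tensSplit (Splice D)).psh ((spliceMap K).functor.obj D')
          ((spliceMap K).functor.obj E))
        (((spliceMap K).functor.map p ≫ spliceδ K X Y) ≫
          (((spliceMap K).functor.map q ≫ spliceδ K B D') ⊗ₘ
          (spliceMap K).functor.map z) ≫ (α_ _ _ _).hom) (𝟙 _) (𝟙 _) =
      tmk (F := yoneda.obj ((spliceMap K).functor.obj B))
        (G := (tensSplit (Splice D)).psh ((spliceMap K).functor.obj D')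
          ((spliceMap K).functor.obj E))
        ((spliceMap K).functor.map (p ≫ (q ⊗ₘ z) ≫ (α_ _ _ _).hom) ≫ spliceδ K B (D' ⊗ E))
          ((spliceMap K).functor.map (𝟙 B))
          ((spliceMap K).functor.map (𝟙 (D' ⊗ E)) ≫ spliceδ K D' E) := fun q z => by
      refine Eq.symm (tmk_eq (F := yoneda.obj ((spliceMap K).functor.obj B))
        (G := (tensSplit (Splice D)).psh ((spliceMap K).functor.obj D')
          ((spliceMap K).functor.obj E)) (𝟙 _) (spliceδ K D' E) ?_ ?_ ?_)
      · have h := spliceδ_assoc (K := K) B D' E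
        simp only [Functor.map_comp, Category.assoc, MonoidalCategory.id_tensorHom] at h ⊢
        rw [h]
        rw [← MonoidalCategory.tensorHom_id]
        have h' := spliceδ_natural (K := K) q z
        rw [reassoc_of% h', MonoidalCategory.tensorHom_comp_tensorHom_assoc, Category.comp_id]
      · exact (Category.comp_id _).trans ((spliceMap K).functor.map_id B).symm
      · exact (show spliceδ K D' E ≫ 𝟙 _ ≫ (𝟙 _ ⊗ₘ 𝟙 _) =
          (spliceMap K).functor.map (𝟙 (D' ⊗ E)) ≫ spliceδ K D' E by simp)
    exact key q z
  leftUnitor B := Sq.eq fun A w => by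
    induction w using pmk_ind with
    | @h X Y p j z =>
    have key : ∀ (j : X ⟶ 𝟙_ _) (z : Y ⟶ B), 
        ((spliceMap K).functor.map p ≫ spliceδ K X Y) ≫
          (((spliceMap K).functor.map j ≫ spliceη K) ⊗ₘ (spliceMap K).functor.map z) ≫
            (λ_ ((spliceMap K).functor.obj B)).hom =
        (spliceMap K).functor.map (p ≫ (j ⊗ₘ z) ≫ (λ_ B).hom) := fun j z => by
      have h := spliceδ_left (K := K) B
      have h' := spliceδ_natural (K := K) j z
      rw [Functor.map_comp, Functor.map_comp, ← h, reassoc_of% h', comp_tensorHom']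
      simp only [Category.assoc]
    exact key j z
  rightUnitor B := Sq.eq fun A w => by
    induction w using pmk_ind with
    | @h X Y p x j =>
    have key : ∀ (j : Y ⟶ 𝟙_ _) (x : X ⟶ B), 
        ((spliceMap K).functor.map p ≫ spliceδ K X Y) ≫
          ((spliceMap K).functor.map x ⊗ₘ ((spliceMap K).functor.map j ≫ spliceη K)) ≫
            (ρ_ ((spliceMap K).functor.obj B)).hom =
        (spliceMap K).functor.map (p ≫ (x ⊗ₘ j) ≫ (ρ_ B).hom) := fun j x => by
      have h := spliceδ_right (K := K) B
      have h' := spliceδ_natural (K := K) x j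
      rw [Functor.map_comp, Functor.map_comp, ← h, reassoc_of% h', ← MonoidalCategory.id_tensorHom,
        MonoidalCategory.tensorHom_comp_tensorHom_assoc, Category.comp_id]
      simp only [Category.assoc]
    exact key j x

theorem spliceMap_seq : PreservesPromonoidal (spliceMap K).functor (spliced C).seq (spliced D).seq
    (spliceMap K).mapSeq (spliceMap K).mapN where
  assoc B D' E := Sq.eq fun A w => by
    induction w using Splice.sqmk_ind with
    | @h X Y p q z =>
    have key : ∀ (q : Splice.Seq X B D') (z : Y ⟶ E), _ = _ := fun q z => 
      Splice.smk_congr (F := yoneda.obj ((spliceMap K).functor.obj B))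
        (G := (Splice.seqSplit D).psh ((spliceMap K).functor.obj D') ((spliceMap K).functor.obj E))
        (A := (spliceMap K).functor.obj A) (X := (spliceMap K).functor.obj B)
        (Y := (⟨K.obj D'.dom, K.obj E.cod⟩ : Splice D))
        (p := ⟨K.map p.fst ≫ K.map q.fst, K.map q.mid, K.map z.snd ≫ K.map p.snd⟩)
        (p' := ⟨K.map (p.fst ≫ q.fst), K.map q.mid, K.map (z.snd ≫ p.snd)⟩)
        (y := (⟨𝟙 _, K.map q.snd ≫ K.map p.mid ≫ K.map z.fst, 𝟙 _⟩ : Splice.Seq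
          (⟨K.obj D'.dom, K.obj E.cod⟩ : Splice D) ((spliceMap K).functor.obj D')
            ((spliceMap K).functor.obj E)))
        (y' := (⟨K.map (𝟙 _), K.map (q.snd ≫ p.mid ≫ z.fst), K.map (𝟙 _)⟩ : Splice.Seq
          (⟨K.obj D'.dom, K.obj E.cod⟩ : Splice D) ((spliceMap K).functor.obj D')
            ((spliceMap K).functor.obj E)))
        (K.map_comp _ _).symm rfl (K.map_comp _ _).symm ((spliceMap K).functor.map_id B).symm
        (Splice.Seq.ext (K.map_id _).symm (by simp only [Functor.map_comp]; rfl)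
          (K.map_id _).symm)
    exact key q z
  leftUnitor B := Sq.eq fun A w => by
    induction w using Splice.sqmk_ind with
    | @h X Y p n z =>
    have key : ∀ (n : X.dom ⟶ X.cod) (z : Y ⟶ B),
        (Splice.homMk (K.map p.fst ≫ K.map n ≫ K.map p.mid ≫ K.map z.fst)
          (K.map z.snd ≫ K.map p.snd) : (spliceMap K).functor.obj A ⟶ (spliceMap K).functor.obj B) =
        (spliceMap K).functor.map (Splice.homMk (p.fst ≫ n ≫ p.mid ≫ z.fst) (z.snd ≫ p.snd)) :=
      fun n z => Splice.hom_ext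
        (show _ = K.map (p.fst ≫ n ≫ p.mid ≫ z.fst) by simp only [Functor.map_comp]; rfl) (K.map_comp _ _).symm
    exact key n z
  rightUnitor B := Sq.eq fun A w => by
    induction w using Splice.sqmk_ind with
    | @h X Y p x n =>
    have key : ∀ (n : Y.dom ⟶ Y.cod) (z : X ⟶ B),
        (Splice.homMk (K.map p.fst ≫ K.map z.fst)
          (K.map z.snd ≫ K.map p.mid ≫ K.map n ≫ K.map p.snd) :
            (spliceMap K).functor.obj A ⟶ (spliceMap K).functor.obj B) =
        (spliceMap K).functor.map (Splice.homMk (p.fst ≫ z.fst) (z.snd ≫ p.mid ≫ n ≫ p.snd)) :=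
      fun n z => Splice.hom_ext (K.map_comp _ _).symm
        (show _ = K.map (z.snd ≫ p.mid ≫ n ≫ p.snd) by simp only [Functor.map_comp]; rfl)
    exact key n x

end

theorem spliceMap_isSymProduoidal (K : C ⥤ D) [K.Braided] : (spliceMap K).IsSymProduoidal where
  par := spliceMap_par
  seq := spliceMap_seq
  ψ₂ X Y Z T := Sq.eq fun A w => by
    induction w using pmk_ind with
    | @h U W p q r =>
    have key : ∀ (q : Splice.Seq U X Y) (r : Splice.Seq W Z T), _ = _ := fun q r => 
      sqmk_eq (F := (tensSplit (Splice D)).psh ((spliceMap K).functor.obj X)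
          ((spliceMap K).functor.obj Z))
        (G := (tensSplit (Splice D)).psh ((spliceMap K).functor.obj Y)
          ((spliceMap K).functor.obj T))
        (A := (spliceMap K).functor.obj A)
        (p := ⟨K.map (p.fst ≫ (q.fst ⊗ₘ r.fst) ≫ 𝟙 (X.dom ⊗ Z.dom)),
          K.map (𝟙 (X.cod ⊗ Z.cod) ≫ (q.mid ⊗ₘ r.mid) ≫ 𝟙 (Y.dom ⊗ T.dom)),
          K.map (𝟙 (Y.cod ⊗ T.cod) ≫ (q.snd ⊗ₘ r.snd) ≫ p.snd)⟩)
        (p' := ⟨(K.map p.fst ≫ δ K _ _) ≫ (K.map q.fst ⊗ₘ K.map r.fst) ≫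
            𝟙 (K.obj X.dom ⊗ K.obj Z.dom), 𝟙 (K.obj X.cod ⊗ K.obj Z.cod) ≫
            (K.map q.mid ⊗ₘ K.map r.mid) ≫ 𝟙 (K.obj Y.dom ⊗ K.obj T.dom),
            𝟙 (K.obj Y.cod ⊗ K.obj T.cod) ≫
            (K.map q.snd ⊗ₘ K.map r.snd) ≫ μ K _ _ ≫ K.map p.snd⟩)
        (x := (spliceMap K).functor.map (𝟙 (X ⊗ Z)) ≫ spliceδ K X Z)
        (y := (spliceMap K).functor.map (𝟙 (Y ⊗ T)) ≫ spliceδ K Y T)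
        (x' := 𝟙 _) (y' := 𝟙 _) (spliceδ K X Z) (spliceδ K Y T) (map_tensor_δ K _ _ _)
        (μ_map_tensor_δ K _ _) (μ_map_tensor K _ _ _)
        (spliceδ_split X Z) (spliceδ_split Y T)
    exact (key q r).symm
  ψ₀ := Sq.eq fun A j => by
    have key : ∀ (j : A ⟶ 𝟙_ (Splice C)), _ = _ := fun j =>
      sqmk_eq (F := yoneda.obj (𝟙_ (Splice D))) (G := yoneda.obj (𝟙_ (Splice D)))
        (A := (spliceMap K).functor.obj A)
        (p := ⟨K.map (j.fst ≫ 𝟙 (𝟙_ C) ≫ 𝟙 (𝟙_ C)),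
          K.map (𝟙 (𝟙_ C) ≫ 𝟙 (𝟙_ C) ≫ 𝟙 (𝟙_ C)),
          K.map (𝟙 (𝟙_ C) ≫ 𝟙 (𝟙_ C) ≫ j.snd)⟩)
        (p' := ⟨(K.map j.fst ≫ η K) ≫ 𝟙 (𝟙_ D) ≫ 𝟙 (𝟙_ D), 𝟙 (𝟙_ D) ≫ 𝟙 (𝟙_ D) ≫ 𝟙 (𝟙_ D),
          𝟙 (𝟙_ D) ≫ 𝟙 (𝟙_ D) ≫ (ε K ≫ K.map j.snd)⟩)
        (x := (spliceMap K).functor.map (𝟙 (𝟙_ (Splice C))) ≫ spliceη K)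
        (y := (spliceMap K).functor.map (𝟙 (𝟙_ (Splice C))) ≫ spliceη K)
        (x' := 𝟙 (𝟙_ (Splice D))) (y' := 𝟙 (𝟙_ (Splice D))) (spliceη K) (spliceη K)
        (show K.map (j.fst ≫ 𝟙 (𝟙_ C) ≫ 𝟙 (𝟙_ C)) ≫ η K = (K.map j.fst ≫ η K) ≫ 𝟙 (𝟙_ D) ≫ 𝟙 (𝟙_ D) by
          simp only [Category.comp_id]
          exact congrArg (fun t => K.map t ≫ η K) (Category.comp_id j.fst))
        (show ε K ≫ K.map (𝟙 (𝟙_ C) ≫ 𝟙 (𝟙_ C) ≫ 𝟙 (𝟙_ C)) ≫ η K =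
          𝟙 (𝟙_ D) ≫ 𝟙 (𝟙_ D) ≫ 𝟙 (𝟙_ D) by simp)
        (show ε K ≫ K.map (𝟙 (𝟙_ C) ≫ 𝟙 (𝟙_ C) ≫ j.snd) =
          𝟙 (𝟙_ D) ≫ 𝟙 (𝟙_ D) ≫ (ε K ≫ K.map j.snd) by simp only [Category.id_comp])
        (spliceη_split K) (spliceη_split K)
    exact (key j).symm
  φ₂ := Sq.eq fun A w => by
    induction w using pmk_ind with
    | @h U W p m n =>
    have key : ∀ (m : U.dom ⟶ U.cod) (n : W.dom ⟶ W.cod),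
      (K.map p.fst ≫ δ K _ _) ≫ (K.map m ⊗ₘ K.map n) ≫ (μ K _ _ ≫ K.map p.snd) =
        K.map (p.fst ≫ (m ⊗ₘ n) ≫ p.snd) := fun m n => by simp
    exact key m n
  φ₀ := Sq.eq fun A j => by
    have key : ∀ j : A ⟶ 𝟙_ (Splice C), (K.map j.fst ≫ η K) ≫ 𝟙 (𝟙_ D) ≫ (ε K ≫ K.map j.snd) =
      K.map (j.fst ≫ 𝟙 (𝟙_ C) ≫ j.snd) := fun j => by simp
    exact key j
  σ X Y := Sq.eq fun A p => by
    have key : ∀ p : A ⟶ X ⊗ Y, ((spliceMap K).functor.map p ≫ spliceδ K X Y) ≫ (β_ _ _).hom =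
      (spliceMap K).functor.map (p ≫ (β_ X Y).hom) ≫ spliceδ K Y X := fun p => by
        rw [Functor.map_comp, Category.assoc, Category.assoc]
        refine congrArg (CategoryStruct.comp ((spliceMap K).functor.map p)) (Splice.hom_ext ?_ ?_)
        · exact show δ K X.dom Y.dom ≫ (β_ _ _).hom = K.map (β_ _ _).hom ≫ δ K Y.dom X.dom by simp
        · exact braiding_inv_μ K X.cod Y.cod
    exact key p

end SplicedMapLaws

end Produo

namespace Produo

/-- The objects of the monoidal contour. -/
inductive Contour {V : Type u} [SmallCategory V] (𝕍 : SymProduoidalData V) : Type u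
  | left (A : V)
  | right (A : V)
  | unit
  | tensor (X Y : Contour 𝕍)

namespace Contour

variable {V : Type u} [SmallCategory V] {𝕍 : SymProduoidalData V}

/-- Formal morphisms of the monoidal contour. -/
inductive Pre : Contour 𝕍 → Contour 𝕍 → Type u
  | id (X) : Pre X X
  | comp {X Y Z} (f : Pre X Y) (g : Pre Y Z) : Pre X Z
  | tensor {X Y X' Y'} (f : Pre X Y) (g : Pre X' Y') : Pre (.tensor X X') (.tensor Y Y')
  | assoc (X Y Z) : Pre (.tensor (.tensor X Y) Z) (.tensor X (.tensor Y Z))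
  | assocInv (X Y Z) : Pre (.tensor X (.tensor Y Z)) (.tensor (.tensor X Y) Z)
  | leftUnitor (X) : Pre (.tensor .unit X) X
  | leftUnitorInv (X) : Pre X (.tensor .unit X)
  | rightUnitor (X) : Pre (.tensor X .unit) X
  | rightUnitorInv (X) : Pre X (.tensor X .unit)
  | braiding (X Y) : Pre (.tensor X Y) (.tensor Y X)
  | mapL {A B : V} (f : A ⟶ B) : Pre (.left A) (.left B)
  | mapR {A B : V} (f : A ⟶ B) : Pre (.right B) (.right A)
  | parL {A B D : V} (p : 𝕍.par.split.el A B D) : Pre (.left A) (.tensor (.left B) (.left D))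
  | parR {A B D : V} (p : 𝕍.par.split.el A B D) : Pre (.tensor (.right B) (.right D)) (.right A)
  | seqL {A B D : V} (p : 𝕍.seq.split.el A B D) : Pre (.left A) (.left B)
  | seqM {A B D : V} (p : 𝕍.seq.split.el A B D) : Pre (.right B) (.left D)
  | seqR {A B D : V} (p : 𝕍.seq.split.el A B D) : Pre (.right D) (.right A)
  | unitN {A : V} (n : 𝕍.seq.unit.obj (op A)) : Pre (.left A) (.right A)
  | unitL {A : V} (j : 𝕍.par.unit.obj (op A)) : Pre (.left A) .unit
  | unitR {A : V} (j : 𝕍.par.unit.obj (op A)) : Pre .unit (.right A)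

section Evaluation

variable {C : Type u} [SmallCategory C] [MonoidalCategory C] [SymmetricCategory C]

theorem leftUnitor_nat {X Y : C} (f : X ⟶ Y) :
    (𝟙 (𝟙_ C) ⊗ₘ f) ≫ (λ_ Y).hom = (λ_ X).hom ≫ f := by simp

theorem rightUnitor_nat {X Y : C} (f : X ⟶ Y) :
    (f ⊗ₘ 𝟙 (𝟙_ C)) ≫ (ρ_ Y).hom = (ρ_ X).hom ≫ f := by simp

theorem pentagon_tensorHom (W X Y Z : C) :
    ((α_ W X Y).hom ⊗ₘ 𝟙 Z) ≫ (α_ W (X ⊗ Y) Z).hom ≫ (𝟙 W ⊗ₘ (α_ X Y Z).hom) =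
      (α_ (W ⊗ X) Y Z).hom ≫ (α_ W X (Y ⊗ Z)).hom := by simp

theorem triangle_tensorHom (X Y : C) :
    (α_ X (𝟙_ C) Y).hom ≫ (𝟙 X ⊗ₘ (λ_ Y).hom) = ((ρ_ X).hom ⊗ₘ 𝟙 Y) := by simp

theorem braiding_nat_right (X : C) {Y Z : C} (f : Y ⟶ Z) :
    (𝟙 X ⊗ₘ f) ≫ (β_ X Z).hom = (β_ X Y).hom ≫ (f ⊗ₘ 𝟙 X) := by simp

theorem braiding_nat_left {X Y : C} (f : X ⟶ Y) (Z : C) :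
    (f ⊗ₘ 𝟙 Z) ≫ (β_ Y Z).hom = (β_ X Z).hom ≫ (𝟙 Z ⊗ₘ f) := by simp

theorem hexagon_tensorHom (X Y Z : C) :
    (α_ X Y Z).hom ≫ (β_ X (Y ⊗ Z)).hom ≫ (α_ Y Z X).hom =
      ((β_ X Y).hom ⊗ₘ 𝟙 Z) ≫ (α_ Y X Z).hom ≫ (𝟙 Y ⊗ₘ (β_ X Z).hom) := by simp

theorem hexagon_tensorHom_inv (X Y Z : C) :
    (α_ X Y Z).inv ≫ (β_ (X ⊗ Y) Z).hom ≫ (α_ Z X Y).inv =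
      (𝟙 X ⊗ₘ (β_ Y Z).hom) ≫ (α_ X Z Y).inv ≫ ((β_ X Z).hom ⊗ₘ 𝟙 Y) := by
  simpa using BraidedCategory.hexagon_reverse X Y Z

/-- A parallel split of spliced arrows as a morphism. -/
def parHom {A X Y : Splice C} (p : (spliced C).par.split.el A X Y) : A ⟶ X ⊗ Y := p

/-- A sequential split of spliced arrows as a triple of arrows. -/
def seqHom {A X Y : Splice C} (p : (spliced C).seq.split.el A X Y) : Splice.Seq A X Y := p

/-- The object of `C` denoted by an object of the contour. -/
def evalObj (F : ProFunctor 𝕍 (spliced C)) : Contour 𝕍 → C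
  | .left A => (F.functor.obj A).dom
  | .right A => (F.functor.obj A).cod
  | .unit => 𝟙_ C
  | .tensor X Y => evalObj F X ⊗ evalObj F Y

/-- The morphism of `C` denoted by a formal morphism of the contour. -/
def evalPre (F : ProFunctor 𝕍 (spliced C)) : {X Y : Contour 𝕍} → Pre X Y →
    (evalObj F X ⟶ evalObj F Y)
  | _, _, .id X => 𝟙 (evalObj F X)
  | _, _, .comp f g => evalPre F f ≫ evalPre F g
  | _, _, .tensor f g => evalPre F f ⊗ₘ evalPre F g
  | _, _, .assoc X Y Z => (α_ (evalObj F X) (evalObj F Y) (evalObj F Z)).hom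
  | _, _, .assocInv X Y Z => (α_ (evalObj F X) (evalObj F Y) (evalObj F Z)).inv
  | _, _, .leftUnitor X => (λ_ (evalObj F X)).hom
  | _, _, .leftUnitorInv X => (λ_ (evalObj F X)).inv
  | _, _, .rightUnitor X => (ρ_ (evalObj F X)).hom
  | _, _, .rightUnitorInv X => (ρ_ (evalObj F X)).inv
  | _, _, .braiding X Y => (β_ (evalObj F X) (evalObj F Y)).hom
  | _, _, .mapL f => (F.functor.map f).fst
  | _, _, .mapR f => (F.functor.map f).snd
  | _, _, .parL p => (parHom (F.mapPar.app p)).fst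
  | _, _, .parR p => (parHom (F.mapPar.app p)).snd
  | _, _, .seqL p => (seqHom (F.mapSeq.app p)).fst
  | _, _, .seqM p => (seqHom (F.mapSeq.app p)).mid
  | _, _, .seqR p => (seqHom (F.mapSeq.app p)).snd
  | _, _, @Pre.unitN _ _ _ A n => Splice.arrow (F.mapN.app (op A) n)
  | _, _, @Pre.unitL _ _ _ A j => (SeqOver.unitHom (D := Splice.seqOver C) (F.mapI.app (op A) j)).fst
  | _, _, @Pre.unitR _ _ _ A j => (SeqOver.unitHom (D := Splice.seqOver C) (F.mapI.app (op A) j)).snd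

end Evaluation

/-- Two formal morphisms are identified when every symmetric produoidal functor into spliced
arrows identifies them. -/
def Rel {X Y : Contour 𝕍} (f g : Pre X Y) : Prop :=
  ∀ (C : Type u) [SmallCategory C] [MonoidalCategory C] [SymmetricCategory C]
    (F : ProFunctor 𝕍 (spliced C)), F.IsSymProduoidal → evalPre F f = evalPre F g

instance : Category.{u} (Contour 𝕍) where
  Hom X Y := Quot (Rel (X := X) (Y := Y))
  id X := Quot.mk _ (Pre.id X)
  comp f g := Quot.map₂ Pre.comp
    (fun f _ _ h C _ _ _ F hF => congrArg (evalPre F f ≫ ·) (h C F hF))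
    (fun _ _ g h C _ _ _ F hF => congrArg (· ≫ evalPre F g) (h C F hF)) f g
  id_comp f := by
    induction f using Quot.ind
    exact Quot.sound fun C _ _ _ F _ => Category.id_comp (evalPre F _)
  comp_id f := by
    induction f using Quot.ind
    exact Quot.sound fun C _ _ _ F _ => Category.comp_id (evalPre F _)
  assoc f g h := by
    induction f using Quot.ind
    induction g using Quot.ind
    induction h using Quot.ind
    exact Quot.sound fun C _ _ _ F _ => Category.assoc (evalPre F _) (evalPre F _) (evalPre F _)

/-- The class of a formal morphism. -/
def cls {X Y : Contour 𝕍} (f : Pre X Y) : X ⟶ Y := Quot.mk _ f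

theorem cls_ind {X Y : Contour 𝕍} {motive : (X ⟶ Y) → Prop} (h : ∀ f, motive (cls f)) (f : X ⟶ Y) :
    motive f := Quot.ind h f

theorem cls_eq {X Y : Contour 𝕍} {f g : Pre X Y} (h : Rel f g) : cls f = cls g := Quot.sound h

/-- The tensor of morphisms of the contour. -/
def tens {X Y X' Y' : Contour 𝕍} (f : X ⟶ Y) (g : X' ⟶ Y') : tensor X X' ⟶ tensor Y Y' :=
  Quot.map₂ Pre.tensor
    (fun f _ _ h C _ _ _ F hF => congrArg (evalPre F f ⊗ₘ ·) (h C F hF))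
    (fun _ _ g h C _ _ _ F hF => congrArg (· ⊗ₘ evalPre F g) (h C F hF)) f g

instance : MonoidalCategoryStruct (Contour 𝕍) where
  tensorObj := tensor
  tensorUnit := unit
  tensorHom f g := tens f g
  whiskerLeft X _ _ f := tens (𝟙 X) f
  whiskerRight f X := tens f (𝟙 X)
  associator X Y Z :=
    { hom := cls (.assoc X Y Z)
      inv := cls (.assocInv X Y Z)
      hom_inv_id := cls_eq fun C _ _ _ F _ => Iso.hom_inv_id (α_ (evalObj F X) (evalObj F Y) (evalObj F Z))
      inv_hom_id := cls_eq fun C _ _ _ F _ => Iso.inv_hom_id (α_ (evalObj F X) (evalObj F Y) (evalObj F Z)) }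
  leftUnitor X :=
    { hom := cls (.leftUnitor X)
      inv := cls (.leftUnitorInv X)
      hom_inv_id := cls_eq fun C _ _ _ F _ => Iso.hom_inv_id (λ_ (evalObj F X))
      inv_hom_id := cls_eq fun C _ _ _ F _ => Iso.inv_hom_id (λ_ (evalObj F X)) }
  rightUnitor X :=
    { hom := cls (.rightUnitor X)
      inv := cls (.rightUnitorInv X)
      hom_inv_id := cls_eq fun C _ _ _ F _ => Iso.hom_inv_id (ρ_ (evalObj F X))
      inv_hom_id := cls_eq fun C _ _ _ F _ => Iso.inv_hom_id (ρ_ (evalObj F X)) }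

instance : MonoidalCategory (Contour 𝕍) := MonoidalCategory.ofTensorHom
  (id_tensorHom_id := fun _ _ => cls_eq fun C _ _ _ F _ => MonoidalCategory.id_tensorHom_id (evalObj F _) (evalObj F _))
  (id_tensorHom := fun _ _ _ _ => rfl)
  (tensorHom_id := fun _ _ => rfl)
  (tensorHom_comp_tensorHom := fun f₁ f₂ g₁ g₂ => by
    induction f₁ using cls_ind
    induction f₂ using cls_ind
    induction g₁ using cls_ind
    induction g₂ using cls_ind
    exact cls_eq fun C _ _ _ F _ => MonoidalCategory.tensorHom_comp_tensorHom (evalPre F _) (evalPre F _)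
      (evalPre F _) (evalPre F _))
  (associator_naturality := fun f g h => by
    induction f using cls_ind
    induction g using cls_ind
    induction h using cls_ind
    exact cls_eq fun C _ _ _ F _ => MonoidalCategory.associator_naturality (evalPre F _) (evalPre F _)
      (evalPre F _))
  (leftUnitor_naturality := fun f => by
    induction f using cls_ind
    exact cls_eq fun C _ _ _ F _ => leftUnitor_nat (evalPre F _))
  (rightUnitor_naturality := fun f => by
    induction f using cls_ind
    exact cls_eq fun C _ _ _ F _ => rightUnitor_nat (evalPre F _))
  (pentagon := fun W X Y Z => cls_eq fun C _ _ _ F _ =>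
    pentagon_tensorHom (evalObj F W) (evalObj F X) (evalObj F Y) (evalObj F Z))
  (triangle := fun X Y => cls_eq fun C _ _ _ F _ => triangle_tensorHom (evalObj F X) (evalObj F Y))

instance : SymmetricCategory (Contour 𝕍) where
  braiding X Y :=
    { hom := cls (.braiding X Y)
      inv := cls (.braiding Y X)
      hom_inv_id := cls_eq fun C _ _ _ F _ => SymmetricCategory.symmetry (evalObj F _) (evalObj F _)
      inv_hom_id := cls_eq fun C _ _ _ F _ => SymmetricCategory.symmetry (evalObj F _) (evalObj F _) }
  braiding_naturality_right X Y Z f := by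
    induction f using cls_ind
    exact cls_eq fun C _ _ _ F _ => braiding_nat_right (evalObj F X) (evalPre F _)
  braiding_naturality_left f Z := by
    induction f using cls_ind
    exact cls_eq fun C _ _ _ F _ => braiding_nat_left (evalPre F _) (evalObj F Z)
  hexagon_forward X Y Z := cls_eq fun C _ _ _ F _ =>
    hexagon_tensorHom (evalObj F X) (evalObj F Y) (evalObj F Z)
  hexagon_reverse X Y Z := cls_eq fun C _ _ _ F _ =>
    hexagon_tensorHom_inv (evalObj F X) (evalObj F Y) (evalObj F Z)
  symmetry X Y := cls_eq fun C _ _ _ F _ => SymmetricCategory.symmetry (evalObj F _) (evalObj F _)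

end Contour

end Produo

namespace Produo

theorem conv.mk_eq_iff {V : Type u} [SmallCategory V] {P : Split V} {F G : Psh V} {B D : V}
    (s : F ≅ yoneda.obj B) (t : G ≅ yoneda.obj D) {A X Y X' Y' : V} {p : P.el A X Y}
    {x : F.obj (op X)} {y : G.obj (op Y)} {p' : P.el A X' Y'} {x' : F.obj (op X')}
    {y' : G.obj (op Y')} :
    (conv.mk p x y : (conv P F G).obj (op A)) = conv.mk p' x' y' ↔
      P.act (𝟙 A) (s.hom.app (op X) x) (t.hom.app (op Y) y) p =
        P.act (𝟙 A) (s.hom.app (op X') x') (t.hom.app (op Y') y') p' := by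
  have h : ∀ {X Y : V} (p : P.el A X Y) (x : F.obj (op X)) (y : G.obj (op Y)),
      (conv.map s.hom t.hom ≫ conv.collapse P B D).app (op A) (conv.mk p x y) =
        P.act (𝟙 A) (s.hom.app (op X) x) (t.hom.app (op Y) y) p := fun _ _ _ => rfl
  have h' : ∀ {X Y : V} (p : P.el A X Y) (x : F.obj (op X)) (y : G.obj (op Y)),
      (conv.mk p x y : (conv P F G).obj (op A)) = conv.mk
        (P.act (𝟙 A) (s.hom.app (op X) x) (t.hom.app (op Y) y) p)
        (s.inv.app (op B) (𝟙 B)) (t.inv.app (op D) (𝟙 D)) := by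
    intro X Y p x y
    refine conv.mk_eq _ _ rfl ?_ ?_
    · refine ((NatTrans.naturality_apply s.inv (Quiver.Hom.op _) (𝟙 B)).symm.trans
        (congrArg (s.inv.app (op X)) (Category.comp_id _))).trans ?_
      exact app_congr s.hom_inv_id x
    · refine ((NatTrans.naturality_apply t.inv (Quiver.Hom.op _) (𝟙 D)).symm.trans
        (congrArg (t.inv.app (op Y)) (Category.comp_id _))).trans ?_
      exact app_congr t.hom_inv_id y
  constructor
  · intro e
    rw [← h, ← h, e]
  · intro e
    rw [h', h' p', e]

/-- The parallel splits of a monoidal category are represented by the tensor. -/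
def tensSplitIso {V : Type u} [SmallCategory V] [MonoidalCategory V] (B D : V) :
    (tensSplit V).psh B D ≅ yoneda.obj (B ⊗ D) :=
  NatIso.ofComponents (fun _ => Iso.refl _) (fun {A A'} f => by
    ext p
    have : ∀ p : A.unop ⟶ B ⊗ D, f.unop ≫ p ≫ (𝟙 B ⊗ₘ 𝟙 D) = f.unop ≫ p := by simp
    exact this p)

namespace Splice

variable {C : Type u} [SmallCategory C]

theorem smk_nested_eq_iff {A B D E X X' Y Y' : Splice C} {p : Seq A X Y} {x : X ⟶ B} {q : Seq Y D E}
    {p' : Seq A X' Y'} {x' : X' ⟶ B} {q' : Seq Y' D E} :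
    smk (F := yoneda.obj B) (G := (seqSplit C).psh D E) p x q = smk p' x' q' ↔
      (p.fst ≫ x.fst = p'.fst ≫ x'.fst ∧ x.snd ≫ p.mid ≫ q.fst = x'.snd ≫ p'.mid ≫ q'.fst) ∧
      q.mid = q'.mid ∧ q.snd ≫ p.snd = q'.snd ≫ p'.snd := by
  constructor
  · let n : (conv (seqSplit C) (yoneda.obj B) ((seqSplit C).psh D E)).obj (op A) →
        ((A.dom ⟶ B.dom) × (B.cod ⟶ D.dom)) × (D.cod ⟶ E.dom) × (E.cod ⟶ A.cod) :=
      Quot.lift (fun r =>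
        have q : Seq r.Y D E := r.y
        have x : r.X ⟶ B := r.x
        ((r.p.fst ≫ x.fst, x.snd ≫ r.p.mid ≫ q.fst), (q.mid, q.snd ≫ r.p.snd))) (by
          rintro _ _ ⟨a, b, p, x, y⟩
          have key : ∀ {X X' Y Y' : Splice C} (a : X ⟶ X') (b : Y ⟶ Y') (p : Seq A X Y) (x : X' ⟶ B)
              (y : Seq Y' D E),
              (((𝟙 _ ≫ p.fst ≫ a.fst) ≫ x.fst, x.snd ≫ (a.snd ≫ p.mid ≫ b.fst) ≫ y.fst),
                (y.mid, y.snd ≫ b.snd ≫ p.snd ≫ 𝟙 _)) =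
              ((p.fst ≫ a.fst ≫ x.fst, (x.snd ≫ a.snd) ≫ p.mid ≫ b.fst ≫ y.fst ≫ 𝟙 _),
                (𝟙 _ ≫ y.mid ≫ 𝟙 _, (𝟙 _ ≫ y.snd ≫ b.snd) ≫ p.snd)) := by
            intros; simp
          exact key a b p x y)
    intro h
    have := congrArg n h
    rw [Prod.ext_iff, Prod.ext_iff, Prod.ext_iff] at this
    exact this
  · rintro ⟨⟨h₁, h₂⟩, h₃, h₄⟩
    have key : ∀ {X Y : Splice C} (p : Seq A X Y) (x : X ⟶ B) (q : Seq Y D E),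
        smk (F := yoneda.obj B) (G := (seqSplit C).psh D E) p x q =
        smk (X := B) (Y := ⟨D.dom, E.cod⟩) ⟨p.fst ≫ x.fst, x.snd ≫ p.mid ≫ q.fst, q.snd ≫ p.snd⟩ (𝟙 B)
          (⟨𝟙 D.dom, q.mid, 𝟙 E.cod⟩ : Seq ⟨D.dom, E.cod⟩ D E) := fun p x q =>
      smk_eq x (homMk (A := _) (X := ⟨D.dom, E.cod⟩) q.fst q.snd) rfl rfl rfl (Category.comp_id x)
        (Seq.ext (show q.fst ≫ 𝟙 _ ≫ 𝟙 _ = _ by simp) (show 𝟙 _ ≫ q.mid ≫ 𝟙 _ = _ by simp)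
          (show 𝟙 _ ≫ 𝟙 _ ≫ q.snd = _ by simp))
    rw [key, key p', h₁, h₂, h₃, h₄]

end Splice

namespace Contour

variable {V : Type u} [SmallCategory V] {𝕍 : SymProduoidalData V}
variable {C : Type u} [SmallCategory C] [MonoidalCategory C] [SymmetricCategory C]

/-- A parallel unit of spliced arrows as a morphism. -/
def unitIHom {A : Splice C} (j : (spliced C).par.unit.obj (op A)) : A ⟶ 𝟙_ (Splice C) := j

/-- The laws of a symmetric produoidal functor into spliced arrows, on representatives. -/
structure Elementary (F : ProFunctor 𝕍 (spliced C)) : Prop where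
  par_assoc {A U Z B D E X Y : V} (p : 𝕍.par.split.el A U Z) (q : 𝕍.par.split.el U B D) (z : Z ⟶ E)
    (p' : 𝕍.par.split.el A X Y) (x : X ⟶ B) (q' : 𝕍.par.split.el Y D E) :
    (𝕍.par.assoc B D E).app (op A) (conv.mk p q z) = conv.mk p' x q' →
    parHom (F.mapPar.app p) ≫ (parHom (F.mapPar.app q) ⊗ₘ F.functor.map z) ≫ (α_ _ _ _).hom =
      parHom (F.mapPar.app p') ≫ (F.functor.map x ⊗ₘ parHom (F.mapPar.app q'))
  par_leftUnitor {A X Y B : V} (p : 𝕍.par.split.el A X Y) (j : 𝕍.par.unit.obj (op X)) (y : Y ⟶ B) :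
    F.functor.map ((𝕍.par.leftUnitor B).app (op A) (conv.mk p j y)) =
      parHom (F.mapPar.app p) ≫ (unitIHom (F.mapI.app (op X) j) ⊗ₘ F.functor.map y) ≫ (λ_ _).hom
  par_rightUnitor {A X Y B : V} (p : 𝕍.par.split.el A X Y) (x : X ⟶ B) (j : 𝕍.par.unit.obj (op Y)) :
    F.functor.map ((𝕍.par.rightUnitor B).app (op A) (conv.mk p x j)) =
      parHom (F.mapPar.app p) ≫ (F.functor.map x ⊗ₘ unitIHom (F.mapI.app (op Y) j)) ≫ (ρ_ _).hom
  seq_assoc {A U Z B D E X Y : V} (p : 𝕍.seq.split.el A U Z) (q : 𝕍.seq.split.el U B D) (z : Z ⟶ E)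
    (p' : 𝕍.seq.split.el A X Y) (x : X ⟶ B) (q' : 𝕍.seq.split.el Y D E) :
    (𝕍.seq.assoc B D E).app (op A) (conv.mk p q z) = conv.mk p' x q' →
    ((seqHom (F.mapSeq.app p)).fst ≫ (seqHom (F.mapSeq.app q)).fst =
      (seqHom (F.mapSeq.app p')).fst ≫ (F.functor.map x).fst ∧
    (seqHom (F.mapSeq.app q)).mid =
      (F.functor.map x).snd ≫ (seqHom (F.mapSeq.app p')).mid ≫ (seqHom (F.mapSeq.app q')).fst) ∧
    (seqHom (F.mapSeq.app q)).snd ≫ (seqHom (F.mapSeq.app p)).mid ≫ (F.functor.map z).fst =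
      (seqHom (F.mapSeq.app q')).mid ∧
    (F.functor.map z).snd ≫ (seqHom (F.mapSeq.app p)).snd =
      (seqHom (F.mapSeq.app q')).snd ≫ (seqHom (F.mapSeq.app p')).snd
  seq_leftUnitor {A X Y B : V} (p : 𝕍.seq.split.el A X Y) (n : 𝕍.seq.unit.obj (op X)) (y : Y ⟶ B) :
    F.functor.map ((𝕍.seq.leftUnitor B).app (op A) (conv.mk p n y)) =
      Splice.homMk ((seqHom (F.mapSeq.app p)).fst ≫ Splice.arrow (F.mapN.app (op X) n) ≫
        (seqHom (F.mapSeq.app p)).mid ≫ (F.functor.map y).fst)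
        ((F.functor.map y).snd ≫ (seqHom (F.mapSeq.app p)).snd)
  seq_rightUnitor {A X Y B : V} (p : 𝕍.seq.split.el A X Y) (x : X ⟶ B) (n : 𝕍.seq.unit.obj (op Y)) :
    F.functor.map ((𝕍.seq.rightUnitor B).app (op A) (conv.mk p x n)) =
      Splice.homMk ((seqHom (F.mapSeq.app p)).fst ≫ (F.functor.map x).fst)
        ((F.functor.map x).snd ≫ (seqHom (F.mapSeq.app p)).mid ≫
          Splice.arrow (F.mapN.app (op Y) n) ≫ (seqHom (F.mapSeq.app p)).snd)
  ψ₂ {A U T X Y Z W M N : V} (p : 𝕍.par.split.el A U T) (q : 𝕍.seq.split.el U X Y)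
    (r : 𝕍.seq.split.el T Z W) (p' : 𝕍.seq.split.el A M N) (x : 𝕍.par.split.el M X Z)
    (y : 𝕍.par.split.el N Y W) :
    (𝕍.ψ₂ X Y Z W).app (op A) (conv.mk p q r) = conv.mk p' x y →
    (⟨(parHom (F.mapPar.app p)).fst ≫
        ((seqHom (F.mapSeq.app q)).fst ⊗ₘ (seqHom (F.mapSeq.app r)).fst),
      (seqHom (F.mapSeq.app q)).mid ⊗ₘ (seqHom (F.mapSeq.app r)).mid,
      ((seqHom (F.mapSeq.app q)).snd ⊗ₘ (seqHom (F.mapSeq.app r)).snd) ≫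
        (parHom (F.mapPar.app p)).snd⟩ : Splice.Seq (F.functor.obj A)
          (F.functor.obj X ⊗ F.functor.obj Z) (F.functor.obj Y ⊗ F.functor.obj W)) =
      ⟨(seqHom (F.mapSeq.app p')).fst ≫ (parHom (F.mapPar.app x)).fst,
        (parHom (F.mapPar.app x)).snd ≫ (seqHom (F.mapSeq.app p')).mid ≫
          (parHom (F.mapPar.app y)).fst,
        (parHom (F.mapPar.app y)).snd ≫ (seqHom (F.mapSeq.app p')).snd⟩
  ψ₀ {A X Y : V} (j : 𝕍.par.unit.obj (op A)) (p : 𝕍.seq.split.el A X Y) (x : 𝕍.par.unit.obj (op X))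
    (y : 𝕍.par.unit.obj (op Y)) : 𝕍.ψ₀.app (op A) j = conv.mk p x y →
    (⟨(unitIHom (F.mapI.app (op A) j)).fst, 𝟙 (𝟙_ C), (unitIHom (F.mapI.app (op A) j)).snd⟩ :
        Splice.Seq (F.functor.obj A) (𝟙_ (Splice C)) (𝟙_ (Splice C))) =
      ⟨(seqHom (F.mapSeq.app p)).fst ≫ (unitIHom (F.mapI.app (op X) x)).fst,
        (unitIHom (F.mapI.app (op X) x)).snd ≫ (seqHom (F.mapSeq.app p)).mid ≫
          (unitIHom (F.mapI.app (op Y) y)).fst,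
        (unitIHom (F.mapI.app (op Y) y)).snd ≫ (seqHom (F.mapSeq.app p)).snd⟩
  φ₂ {A U T : V} (p : 𝕍.par.split.el A U T) (m : 𝕍.seq.unit.obj (op U)) (n : 𝕍.seq.unit.obj (op T)) :
    Splice.arrow (F.mapN.app (op A) (𝕍.φ₂.app (op A) (conv.mk p m n))) =
      (parHom (F.mapPar.app p)).fst ≫
        (Splice.arrow (F.mapN.app (op U) m) ⊗ₘ Splice.arrow (F.mapN.app (op T) n)) ≫
        (parHom (F.mapPar.app p)).snd
  φ₀ {A : V} (j : 𝕍.par.unit.obj (op A)) :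
    Splice.arrow (F.mapN.app (op A) (𝕍.φ₀.app (op A) j)) =
      (unitIHom (F.mapI.app (op A) j)).fst ≫ (unitIHom (F.mapI.app (op A) j)).snd
  σ {A B D : V} (p : 𝕍.par.split.el A B D) :
    parHom (F.mapPar.app ((𝕍.σ B D).app (op A) p)) = parHom (F.mapPar.app p) ≫ (β_ _ _).hom

theorem par_mk_eq_iff {A B D E X X' Y Y' : Splice C} {p : A ⟶ X ⊗ Y} {x : X ⟶ B} {q : Y ⟶ D ⊗ E}
    {p' : A ⟶ X' ⊗ Y'} {x' : X' ⟶ B} {q' : Y' ⟶ D ⊗ E} :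
    tmk (F := yoneda.obj B) (G := (tensSplit (Splice C)).psh D E) p x q = tmk p' x' q' ↔
      p ≫ (x ⊗ₘ q) = p' ≫ (x' ⊗ₘ q') :=
  (conv.mk_eq_iff (P := tensSplit (Splice C)) (Iso.refl _) (tensSplitIso D E)).trans
    (Eq.congr (Category.id_comp (p ≫ (x ⊗ₘ q))) (Category.id_comp (p' ≫ (x' ⊗ₘ q'))))

theorem seq_par_mk_eq_iff {A X X' Y Y' B D E G : Splice C} {p : Splice.Seq A X Y} {x : X ⟶ B ⊗ D}
    {y : Y ⟶ E ⊗ G} {p' : Splice.Seq A X' Y'} {x' : X' ⟶ B ⊗ D} {y' : Y' ⟶ E ⊗ G} :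
    Splice.smk (F := (tensSplit (Splice C)).psh B D) (G := (tensSplit (Splice C)).psh E G) p x y =
        Splice.smk p' x' y' ↔
      (⟨p.fst ≫ x.fst, x.snd ≫ p.mid ≫ y.fst, y.snd ≫ p.snd⟩ : Splice.Seq A (B ⊗ D) (E ⊗ G)) =
        ⟨p'.fst ≫ x'.fst, x'.snd ≫ p'.mid ≫ y'.fst, y'.snd ≫ p'.snd⟩ :=
  (conv.mk_eq_iff (P := Splice.seqSplit C) (tensSplitIso B D) (tensSplitIso E G)).trans
    (Eq.congr
      (Splice.Seq.ext (Category.id_comp (p.fst ≫ x.fst)) rfl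
        (show y.snd ≫ p.snd ≫ 𝟙 _ = y.snd ≫ p.snd by simp))
      (Splice.Seq.ext (Category.id_comp (p'.fst ≫ x'.fst)) rfl
        (show y'.snd ≫ p'.snd ≫ 𝟙 _ = y'.snd ≫ p'.snd by simp)))

theorem seq_unit_mk_eq_iff {A X X' Y Y' B D : Splice C} {p : Splice.Seq A X Y} {x : X ⟶ B}
    {y : Y ⟶ D} {p' : Splice.Seq A X' Y'} {x' : X' ⟶ B} {y' : Y' ⟶ D} :
    Splice.smk (F := yoneda.obj B) (G := yoneda.obj D) p x y = Splice.smk p' x' y' ↔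
      (⟨p.fst ≫ x.fst, x.snd ≫ p.mid ≫ y.fst, y.snd ≫ p.snd⟩ : Splice.Seq A B D) =
        ⟨p'.fst ≫ x'.fst, x'.snd ≫ p'.mid ≫ y'.fst, y'.snd ≫ p'.snd⟩ :=
  (conv.mk_eq_iff (P := Splice.seqSplit C) (Iso.refl _) (Iso.refl _)).trans
    (Eq.congr
      (Splice.Seq.ext (Category.id_comp (p.fst ≫ x.fst)) rfl
        (show y.snd ≫ p.snd ≫ 𝟙 _ = y.snd ≫ p.snd by simp))
      (Splice.Seq.ext (Category.id_comp (p'.fst ≫ x'.fst)) rfl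
        (show y'.snd ≫ p'.snd ≫ 𝟙 _ = y'.snd ≫ p'.snd by simp)))

end Contour

end Produo

namespace Produo

theorem conv.exists_rep {V : Type u} [SmallCategory V] {P : Split V} {F G : Psh V} {A : V}
    (w : (conv P F G).obj (op A)) :
    ∃ (X Y : V) (p : P.el A X Y) (x : F.obj (op X)) (y : G.obj (op Y)), w = conv.mk p x y := by
  induction w using conv.ind with
  | @h X Y p x y => exact ⟨X, Y, p, x, y, rfl⟩

namespace Contour

variable {V : Type u} [SmallCategory V] {𝕍 : SymProduoidalData V}
variable {C : Type u} [SmallCategory C] [MonoidalCategory C] [SymmetricCategory C]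

theorem par_assoc_eq_iff {A B D E X Y : Splice C} {p : A ⟶ X ⊗ Y} {x : X ⟶ B} {q : Y ⟶ D ⊗ E}
    {t : A ⟶ B ⊗ (D ⊗ E)} :
    tmk (F := yoneda.obj B) (G := (tensSplit (Splice C)).psh D E) p x q =
        tmk t (𝟙 B) (𝟙 (D ⊗ E)) ↔ t = p ≫ (x ⊗ₘ q) := by
  rw [eq_comm]
  exact par_mk_eq_iff.trans (by
    rw [MonoidalCategory.id_tensorHom_id, Category.comp_id])

theorem seq_assoc_eq_iff {A B D E X U Y Z : Splice C} {p : Splice.Seq A U Z}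
    {q : Splice.Seq U B D} {z : Z ⟶ E} {p' : Splice.Seq A X Y} {x : X ⟶ B} {q' : Splice.Seq Y D E} :
    Splice.smk (F := yoneda.obj B) (G := (Splice.seqSplit C).psh D E) p' x q' =
        Splice.smk (X := B) (Y := ⟨D.dom, E.cod⟩) ⟨p.fst ≫ q.fst, q.mid, z.snd ≫ p.snd⟩
        (𝟙 B) (⟨𝟙 D.dom, q.snd ≫ p.mid ≫ z.fst, 𝟙 E.cod⟩ : Splice.Seq ⟨D.dom, E.cod⟩ D E) ↔
      (p.fst ≫ q.fst = p'.fst ≫ x.fst ∧ q.mid = x.snd ≫ p'.mid ≫ q'.fst) ∧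
      q.snd ≫ p.mid ≫ z.fst = q'.mid ∧ z.snd ≫ p.snd = q'.snd ≫ p'.snd := by
  rw [eq_comm]
  exact Splice.smk_nested_eq_iff.trans (by simp)

theorem ψ₂_eq_iff {A U T X Y Z W M N : Splice C} {p : A ⟶ U ⊗ T} {q : Splice.Seq U X Y}
    {r : Splice.Seq T Z W} {p' : Splice.Seq A M N} {x : M ⟶ X ⊗ Z} {y : N ⟶ Y ⊗ W} :
    Splice.smk (F := (tensSplit (Splice C)).psh X Z) (G := (tensSplit (Splice C)).psh Y W) p' x y =
        Splice.smk ((Splice.seqSplit C).act p (𝟙 (X ⊗ Z)) (𝟙 (Y ⊗ W))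
          (⟨q.fst ⊗ₘ r.fst, q.mid ⊗ₘ r.mid, q.snd ⊗ₘ r.snd⟩ :
            Splice.Seq (U ⊗ T) (X ⊗ Z) (Y ⊗ W))) (𝟙 (X ⊗ Z)) (𝟙 (Y ⊗ W)) ↔
      (⟨p.fst ≫ (q.fst ⊗ₘ r.fst), q.mid ⊗ₘ r.mid, (q.snd ⊗ₘ r.snd) ≫ p.snd⟩ :
        Splice.Seq A (X ⊗ Z) (Y ⊗ W)) =
      ⟨p'.fst ≫ x.fst, x.snd ≫ p'.mid ≫ y.fst, y.snd ≫ p'.snd⟩ := by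
  rw [eq_comm]
  refine seq_par_mk_eq_iff.trans (Eq.congr (Splice.Seq.ext ?_ ?_ ?_) rfl)
  · show (p.fst ≫ (q.fst ⊗ₘ r.fst) ≫ 𝟙 _) ≫ 𝟙 _ = _
    rw [Category.comp_id, Category.comp_id]
  · show 𝟙 _ ≫ (𝟙 _ ≫ (q.mid ⊗ₘ r.mid) ≫ 𝟙 _) ≫ 𝟙 _ = _
    rw [Category.comp_id, Category.comp_id, Category.id_comp, Category.id_comp]
  · show 𝟙 _ ≫ 𝟙 _ ≫ (q.snd ⊗ₘ r.snd) ≫ p.snd = _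
    rw [Category.id_comp, Category.id_comp]

theorem ψ₀_eq_iff {A X Y : Splice C} {j : A ⟶ 𝟙_ (Splice C)} {p : Splice.Seq A X Y}
    {x : X ⟶ 𝟙_ (Splice C)} {y : Y ⟶ 𝟙_ (Splice C)} :
    Splice.smk (F := yoneda.obj (𝟙_ (Splice C))) (G := yoneda.obj (𝟙_ (Splice C))) p x y =
        Splice.smk ((Splice.seqSplit C).act j (𝟙 (𝟙_ (Splice C))) (𝟙 (𝟙_ (Splice C)))
          (⟨𝟙 (𝟙_ C), 𝟙 (𝟙_ C), 𝟙 (𝟙_ C)⟩ :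
            Splice.Seq (𝟙_ (Splice C)) (𝟙_ (Splice C)) (𝟙_ (Splice C))))
          (𝟙 (𝟙_ (Splice C))) (𝟙 (𝟙_ (Splice C))) ↔
      (⟨j.fst, 𝟙 (𝟙_ C), j.snd⟩ : Splice.Seq A (𝟙_ (Splice C)) (𝟙_ (Splice C))) =
      ⟨p.fst ≫ x.fst, x.snd ≫ p.mid ≫ y.fst, y.snd ≫ p.snd⟩ := by
  rw [eq_comm]
  refine seq_unit_mk_eq_iff.trans (Eq.congr (Splice.Seq.ext ?_ ?_ ?_) rfl)
  · show (j.fst ≫ 𝟙 (𝟙_ C) ≫ 𝟙 _) ≫ 𝟙 _ = _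
    rw [Category.comp_id, Category.comp_id]
    exact Category.comp_id _
  · show 𝟙 _ ≫ (𝟙 _ ≫ 𝟙 (𝟙_ C) ≫ 𝟙 _) ≫ 𝟙 _ = _
    rw [Category.comp_id, Category.comp_id, Category.id_comp, Category.id_comp]
  · show 𝟙 _ ≫ 𝟙 _ ≫ 𝟙 (𝟙_ C) ≫ j.snd = _
    rw [Category.id_comp, Category.id_comp]
    exact Category.id_comp _

theorem elementary_of_isSymProduoidal {F : ProFunctor 𝕍 (spliced C)} (hF : F.IsSymProduoidal) :
    Elementary F where
  par_assoc {A U Z B D E X Y} p q z p' x q' h := by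
    have := app_congr (hF.par.assoc B D E) (conv.mk p q z)
    exact par_assoc_eq_iff.1 ((congrArg ((F.mapPar.conv (yonedaMap F.functor B)
      (F.mapPar.psh D E)).app (op A)) h).symm.trans this)
  par_leftUnitor {A X Y B} p j y := app_congr (hF.par.leftUnitor B) (conv.mk p j y)
  par_rightUnitor {A X Y B} p x j := app_congr (hF.par.rightUnitor B) (conv.mk p x j)
  seq_assoc {A U Z B D E X Y} p q z p' x q' h := by
    have := app_congr (hF.seq.assoc B D E) (conv.mk p q z)
    exact seq_assoc_eq_iff.1 ((congrArg ((F.mapSeq.conv (yonedaMap F.functor B)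
      (F.mapSeq.psh D E)).app (op A)) h).symm.trans this)
  seq_leftUnitor {A X Y B} p j y := app_congr (hF.seq.leftUnitor B) (conv.mk p j y)
  seq_rightUnitor {A X Y B} p x j := app_congr (hF.seq.rightUnitor B) (conv.mk p x j)
  ψ₂ {A U T X Y Z W M N} p q r p' x y h := by
    have := app_congr (hF.ψ₂ X Y Z W) (conv.mk p q r)
    exact ψ₂_eq_iff.1 ((congrArg ((F.mapSeq.conv (F.mapPar.psh X Z)
      (F.mapPar.psh Y W)).app (op A)) h).symm.trans this)
  ψ₀ {A X Y} j p x y h := by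
    have := app_congr hF.ψ₀ j
    exact ψ₀_eq_iff.1 ((congrArg ((F.mapSeq.conv F.mapI F.mapI).app (op A)) h).symm.trans this)
  φ₂ {A U T} p m n := app_congr hF.φ₂ (conv.mk p m n)
  φ₀ {A} j := (app_congr hF.φ₀ j).trans
    (show (unitIHom (F.mapI.app (op A) j)).fst ≫ 𝟙 (𝟙_ C) ≫ _ = _ from
      congrArg (CategoryStruct.comp _) (Category.id_comp _))
  σ {A B D} p := app_congr (hF.σ B D) p

theorem Elementary.isSymProduoidal {F : ProFunctor 𝕍 (spliced C)} (hF : Elementary F) :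
    F.IsSymProduoidal where
  par :=
    { assoc := fun B D E => by
        refine psh_ext fun A w => ?_
        induction w using conv.ind with
        | @h U Z p q z =>
        obtain ⟨X, Y, p', x, q', h⟩ := conv.exists_rep ((𝕍.par.assoc B D E).app (op A) (conv.mk p q z))
        exact (congrArg ((F.mapPar.conv (yonedaMap F.functor B)
          (F.mapPar.psh D E)).app (op A)) h).trans (par_assoc_eq_iff.2 (hF.par_assoc p q z p' x q' h))
      leftUnitor := fun B => by
        refine psh_ext fun A w => ?_
        induction w using conv.ind with
        | @h X Y p j y => exact hF.par_leftUnitor p j y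
      rightUnitor := fun B => by
        refine psh_ext fun A w => ?_
        induction w using conv.ind with
        | @h X Y p x j => exact hF.par_rightUnitor p x j }
  seq :=
    { assoc := fun B D E => by
        refine psh_ext fun A w => ?_
        induction w using conv.ind with
        | @h U Z p q z =>
        obtain ⟨X, Y, p', x, q', h⟩ := conv.exists_rep ((𝕍.seq.assoc B D E).app (op A) (conv.mk p q z))
        exact (congrArg ((F.mapSeq.conv (yonedaMap F.functor B)
          (F.mapSeq.psh D E)).app (op A)) h).trans (seq_assoc_eq_iff.2 (hF.seq_assoc p q z p' x q' h))
      leftUnitor := fun B => by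
        refine psh_ext fun A w => ?_
        induction w using conv.ind with
        | @h X Y p j y => exact hF.seq_leftUnitor p j y
      rightUnitor := fun B => by
        refine psh_ext fun A w => ?_
        induction w using conv.ind with
        | @h X Y p x j => exact hF.seq_rightUnitor p x j }
  ψ₂ X Y Z W := by
    refine psh_ext fun A w => ?_
    induction w using conv.ind with
    | @h U T p q r =>
    obtain ⟨M, N, p', x, y, h⟩ := conv.exists_rep ((𝕍.ψ₂ X Y Z W).app (op A) (conv.mk p q r))
    exact (congrArg ((F.mapSeq.conv (F.mapPar.psh X Z)
      (F.mapPar.psh Y W)).app (op A)) h).trans (ψ₂_eq_iff.2 (hF.ψ₂ p q r p' x y h))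
  ψ₀ := by
    refine psh_ext fun A j => ?_
    obtain ⟨X, Y, p, x, y, h⟩ := conv.exists_rep (𝕍.ψ₀.app (op A) j)
    exact (congrArg ((F.mapSeq.conv F.mapI F.mapI).app (op A)) h).trans
      (ψ₀_eq_iff.2 (hF.ψ₀ j p x y h))
  φ₂ := by
    refine psh_ext fun A w => ?_
    induction w using conv.ind with
    | @h U T p m n => exact hF.φ₂ p m n
  φ₀ := by
    refine psh_ext fun A j => ?_
    exact (hF.φ₀ j).trans
      (show _ = (unitIHom (F.mapI.app (op A) j)).fst ≫ 𝟙 (𝟙_ C) ≫ _ from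
        congrArg (CategoryStruct.comp _) (Category.id_comp _).symm)
  σ B D := psh_ext fun A p => hF.σ p

end Contour

end Produo

namespace Produo

namespace Contour

variable {V : Type u} [SmallCategory V] (𝕍 : SymProduoidalData V)

/-- The universal functor from `𝕍` into the spliced arrows of its monoidal contour. -/
def univ : ProFunctor 𝕍 (spliced (Contour 𝕍)) where
  functor :=
    { obj := fun A => ⟨left A, right A⟩
      map := fun f => Splice.homMk (cls (.mapL f)) (cls (.mapR f))
      map_id := fun A => Splice.hom_ext
        (cls_eq fun _ _ _ _ F _ => congrArg Splice.Hom'.fst (F.functor.map_id A))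
        (cls_eq fun _ _ _ _ F _ => congrArg Splice.Hom'.snd (F.functor.map_id A))
      map_comp := fun f g => Splice.hom_ext
        (cls_eq fun _ _ _ _ F _ => congrArg Splice.Hom'.fst (F.functor.map_comp f g))
        (cls_eq fun _ _ _ _ F _ => congrArg Splice.Hom'.snd (F.functor.map_comp f g)) }
  mapPar :=
    { app := fun {A B D} p => (Splice.homMk (cls (.parL p)) (cls (.parR p)) :
        (⟨left A, right A⟩ : Splice (Contour 𝕍)) ⟶ ⟨left B, right B⟩ ⊗ ⟨left D, right D⟩)
      naturality := fun f g h p => Splice.hom_ext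
        (cls_eq (g := .comp (.mapL f) (.comp (.parL p) (.tensor (.mapL g) (.mapL h))))
          fun _ _ _ _ F _ => congrArg (fun t => (parHom t).fst) (F.mapPar.naturality f g h p))
        (cls_eq (g := .comp (.comp (.tensor (.mapR g) (.mapR h)) (.parR p)) (.mapR f))
          fun _ _ _ _ F _ => congrArg (fun t => (parHom t).snd) (F.mapPar.naturality f g h p)) }
  mapSeq :=
    { app := fun {A B D} p => (⟨cls (.seqL p), cls (.seqM p), cls (.seqR p)⟩ :
        Splice.Seq (⟨left A, right A⟩ : Splice (Contour 𝕍)) ⟨left B, right B⟩ ⟨left D, right D⟩)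
      naturality := fun f g h p => Splice.Seq.ext
        (cls_eq (g := .comp (.mapL f) (.comp (.seqL p) (.mapL g)))
          fun _ _ _ _ F _ => congrArg (fun t => (seqHom t).fst) (F.mapSeq.naturality f g h p))
        (cls_eq (g := .comp (.mapR g) (.comp (.seqM p) (.mapL h)))
          fun _ _ _ _ F _ => congrArg (fun t => (seqHom t).mid) (F.mapSeq.naturality f g h p))
        (cls_eq (g := .comp (.mapR h) (.comp (.seqR p) (.mapR f)))
          fun _ _ _ _ F _ => congrArg (fun t => (seqHom t).snd) (F.mapSeq.naturality f g h p)) }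
  mapI :=
    { app := fun A => ↾fun j => (Splice.homMk (cls (.unitL j)) (cls (.unitR j)) :
        (⟨left A.unop, right A.unop⟩ : Splice (Contour 𝕍)) ⟶ 𝟙_ _)
      naturality := fun A A' f => by
        ext j
        exact Splice.hom_ext
          (cls_eq (f := .unitL (𝕍.par.unit.map f j)) (g := .comp (.mapL f.unop) (.unitL j))
            fun _ _ _ _ F _ => congrArg Splice.Hom'.fst
              (show unitIHom _ = F.functor.map f.unop ≫ unitIHom (F.mapI.app A j) from
                NatTrans.naturality_apply F.mapI f j))
          (cls_eq (f := .unitR (𝕍.par.unit.map f j)) (g := .comp (.unitR j) (.mapR f.unop))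
            fun _ _ _ _ F _ => congrArg Splice.Hom'.snd
              (show unitIHom _ = F.functor.map f.unop ≫ unitIHom (F.mapI.app A j) from
                NatTrans.naturality_apply F.mapI f j)) }
  mapN :=
    { app := fun A => ↾fun n => (cls (.unitN n) : left A.unop ⟶ right A.unop)
      naturality := fun A A' f => by
        ext n
        exact cls_eq (f := .unitN (𝕍.seq.unit.map f n))
          (g := .comp (.mapL f.unop) (.comp (.unitN n) (.mapR f.unop)))
          fun _ _ _ _ F _ => congrArg Splice.arrow (NatTrans.naturality_apply F.mapN f n) }

theorem univ_elementary : Elementary (univ 𝕍) where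
  par_assoc p q z p' x q' h := Splice.hom_ext
    (cls_eq (f := .comp (.parL p) (.comp (.tensor (.parL q) (.mapL z)) (.assoc _ _ _)))
      (g := .comp (.parL p') (.tensor (.mapL x) (.parL q')))
      fun _ _ _ _ _ hF => congrArg Splice.Hom'.fst
        ((elementary_of_isSymProduoidal hF).par_assoc p q z p' x q' h))
    (cls_eq (f := .comp (.comp (.assocInv _ _ _) (.tensor (.parR q) (.mapR z))) (.parR p))
      (g := .comp (.tensor (.mapR x) (.parR q')) (.parR p'))
      fun _ _ _ _ _ hF => congrArg Splice.Hom'.snd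
        ((elementary_of_isSymProduoidal hF).par_assoc p q z p' x q' h))
  par_leftUnitor p j y := Splice.hom_ext
    (cls_eq (f := .mapL _) (g := .comp (.parL p) (.comp (.tensor (.unitL j) (.mapL y)) (.leftUnitor _)))
      fun _ _ _ _ _ hF => congrArg Splice.Hom'.fst
        ((elementary_of_isSymProduoidal hF).par_leftUnitor p j y))
    (cls_eq (f := .mapR _)
      (g := .comp (.comp (.leftUnitorInv _) (.tensor (.unitR j) (.mapR y))) (.parR p))
      fun _ _ _ _ _ hF => congrArg Splice.Hom'.snd
        ((elementary_of_isSymProduoidal hF).par_leftUnitor p j y))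
  par_rightUnitor p x j := Splice.hom_ext
    (cls_eq (f := .mapL _) (g := .comp (.parL p) (.comp (.tensor (.mapL x) (.unitL j)) (.rightUnitor _)))
      fun _ _ _ _ _ hF => congrArg Splice.Hom'.fst
        ((elementary_of_isSymProduoidal hF).par_rightUnitor p x j))
    (cls_eq (f := .mapR _)
      (g := .comp (.comp (.rightUnitorInv _) (.tensor (.mapR x) (.unitR j))) (.parR p))
      fun _ _ _ _ _ hF => congrArg Splice.Hom'.snd
        ((elementary_of_isSymProduoidal hF).par_rightUnitor p x j))
  seq_assoc p q z p' x q' h :=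
    ⟨⟨cls_eq (f := .comp (.seqL p) (.seqL q)) (g := .comp (.seqL p') (.mapL x))
        fun _ _ _ _ _ hF => ((elementary_of_isSymProduoidal hF).seq_assoc p q z p' x q' h).1.1,
      cls_eq (f := .seqM q) (g := .comp (.mapR x) (.comp (.seqM p') (.seqL q')))
        fun _ _ _ _ _ hF => ((elementary_of_isSymProduoidal hF).seq_assoc p q z p' x q' h).1.2⟩,
      cls_eq (f := .comp (.seqR q) (.comp (.seqM p) (.mapL z))) (g := .seqM q')
        fun _ _ _ _ _ hF => ((elementary_of_isSymProduoidal hF).seq_assoc p q z p' x q' h).2.1,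
      cls_eq (f := .comp (.mapR z) (.seqR p)) (g := .comp (.seqR q') (.seqR p'))
        fun _ _ _ _ _ hF => ((elementary_of_isSymProduoidal hF).seq_assoc p q z p' x q' h).2.2⟩
  seq_leftUnitor p n y := Splice.hom_ext
    (cls_eq (f := .mapL _) (g := .comp (.seqL p) (.comp (.unitN n) (.comp (.seqM p) (.mapL y))))
      fun _ _ _ _ _ hF => congrArg Splice.Hom'.fst
        ((elementary_of_isSymProduoidal hF).seq_leftUnitor p n y))
    (cls_eq (f := .mapR _) (g := .comp (.mapR y) (.seqR p))
      fun _ _ _ _ _ hF => congrArg Splice.Hom'.snd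
        ((elementary_of_isSymProduoidal hF).seq_leftUnitor p n y))
  seq_rightUnitor p x n := Splice.hom_ext
    (cls_eq (f := .mapL _) (g := .comp (.seqL p) (.mapL x))
      fun _ _ _ _ _ hF => congrArg Splice.Hom'.fst
        ((elementary_of_isSymProduoidal hF).seq_rightUnitor p x n))
    (cls_eq (f := .mapR _) (g := .comp (.mapR x) (.comp (.seqM p) (.comp (.unitN n) (.seqR p))))
      fun _ _ _ _ _ hF => congrArg Splice.Hom'.snd
        ((elementary_of_isSymProduoidal hF).seq_rightUnitor p x n))
  ψ₂ p q r p' x y h := Splice.Seq.ext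
    (cls_eq (f := .comp (.parL p) (.tensor (.seqL q) (.seqL r))) (g := .comp (.seqL p') (.parL x))
      fun _ _ _ _ _ hF => congrArg Splice.Seq.fst
        ((elementary_of_isSymProduoidal hF).ψ₂ p q r p' x y h))
    (cls_eq (f := .tensor (.seqM q) (.seqM r)) (g := .comp (.parR x) (.comp (.seqM p') (.parL y)))
      fun _ _ _ _ _ hF => congrArg Splice.Seq.mid
        ((elementary_of_isSymProduoidal hF).ψ₂ p q r p' x y h))
    (cls_eq (f := .comp (.tensor (.seqR q) (.seqR r)) (.parR p)) (g := .comp (.parR y) (.seqR p'))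
      fun _ _ _ _ _ hF => congrArg Splice.Seq.snd
        ((elementary_of_isSymProduoidal hF).ψ₂ p q r p' x y h))
  ψ₀ j p x y h := Splice.Seq.ext
    (cls_eq (f := .unitL j) (g := .comp (.seqL p) (.unitL x))
      fun _ _ _ _ _ hF => congrArg Splice.Seq.fst
        ((elementary_of_isSymProduoidal hF).ψ₀ j p x y h))
    (cls_eq (f := .id .unit) (g := .comp (.unitR x) (.comp (.seqM p) (.unitL y)))
      fun _ _ _ _ _ hF => congrArg Splice.Seq.mid
        ((elementary_of_isSymProduoidal hF).ψ₀ j p x y h))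
    (cls_eq (f := .unitR j) (g := .comp (.unitR y) (.seqR p))
      fun _ _ _ _ _ hF => congrArg Splice.Seq.snd
        ((elementary_of_isSymProduoidal hF).ψ₀ j p x y h))
  φ₂ p m n := cls_eq (f := .unitN _)
    (g := .comp (.parL p) (.comp (.tensor (.unitN m) (.unitN n)) (.parR p)))
    fun _ _ _ _ _ hF => (elementary_of_isSymProduoidal hF).φ₂ p m n
  φ₀ j := cls_eq (f := .unitN _) (g := .comp (.unitL j) (.unitR j))
    fun _ _ _ _ _ hF => (elementary_of_isSymProduoidal hF).φ₀ j
  σ p := Splice.hom_ext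
    (cls_eq (f := .parL _) (g := .comp (.parL p) (.braiding _ _))
      fun _ _ _ _ _ hF => congrArg Splice.Hom'.fst ((elementary_of_isSymProduoidal hF).σ p))
    (cls_eq (f := .parR _) (g := .comp (.braiding _ _) (.parR p))
      fun _ _ _ _ F hF => (congrArg Splice.Hom'.snd ((elementary_of_isSymProduoidal hF).σ p)).trans
        (congrArg (· ≫ (parHom (F.mapPar.app p)).snd)
          (SymmetricCategory.braiding_swap_eq_inv_braiding _ _).symm))

theorem univ_isSymProduoidal : (univ 𝕍).IsSymProduoidal := (univ_elementary 𝕍).isSymProduoidal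

end Contour

end Produo

namespace Produo

section Strict

open Functor.LaxMonoidal Functor.OplaxMonoidal

variable {D C : Type u} [SmallCategory C] [MonoidalCategory C] [SymmetricCategory C]
  [SmallCategory D] [MonoidalCategory D] [SymmetricCategory D] {K : D ⥤ C}

theorem heq_of_comp_eqToHom_eq {X Y X' Y' : C} {f : X ⟶ Y} {g : X' ⟶ Y'} {h : Y = Y'} {h' : X = X'}
    (e : f ≫ eqToHom h = eqToHom h' ≫ g) : f ≍ g :=
  (comp_eqToHom_heq f h).symm.trans ((heq_of_eq e).trans (eqToHom_comp_heq g h'))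

theorem tensorHom_heq {X X' Y Y' Z Z' W W' : C} (h₁ : X = X') (h₂ : Y = Y') (h₃ : Z = Z')
    (h₄ : W = W') {f : X ⟶ Y} {f' : X' ⟶ Y'} {g : Z ⟶ W} {g' : Z' ⟶ W'} (hf : f ≍ f')
    (hg : g ≍ g') : (f ⊗ₘ g) ≍ (f' ⊗ₘ g') := by
  subst h₁ h₂ h₃ h₄ hf hg
  rfl

theorem iso_inv_heq {X X' Y Y' : C} (h₁ : X = X') (h₂ : Y = Y') {f : X ≅ Y} {f' : X' ≅ Y'}
    (hf : f.hom ≍ f'.hom) : f.inv ≍ f'.inv := by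
  subst h₁ h₂
  rw [Iso.ext (eq_of_heq hf)]

theorem IsStrict.map_tensorHom [K.Monoidal] (hK : IsStrict K) {X Y X' Y' : D} (f : X ⟶ Y)
    (g : X' ⟶ Y') : K.map (f ⊗ₘ g) ≍ (K.map f ⊗ₘ K.map g) := by
  have h := μ_natural K f g
  rw [hK.μ_eq, hK.μ_eq] at h
  exact (heq_of_comp_eqToHom_eq h).symm

theorem IsStrict.map_associator [K.Monoidal] (hK : IsStrict K) (X Y Z : D) :
    K.map (α_ X Y Z).hom ≍ (α_ (K.obj X) (K.obj Y) (K.obj Z)).hom := by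
  have h := Functor.LaxMonoidal.associativity K X Y Z
  rw [hK.μ_eq, hK.μ_eq, hK.μ_eq, hK.μ_eq, eqToHom_whiskerRight, whiskerLeft_eqToHom,
    eqToHom_trans_assoc, eqToHom_trans] at h
  exact (heq_of_comp_eqToHom_eq h.symm).symm

theorem IsStrict.map_leftUnitor [K.Monoidal] (hK : IsStrict K) (X : D) :
    K.map (λ_ X).hom ≍ (λ_ (K.obj X)).hom := by
  have h := Functor.LaxMonoidal.left_unitality K X
  rw [hK.μ_eq, hK.ε_eq, eqToHom_whiskerRight, eqToHom_trans_assoc] at h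
  exact (eqToHom_comp_heq _ _).symm.trans (heq_of_eq h.symm)

theorem IsStrict.map_rightUnitor [K.Monoidal] (hK : IsStrict K) (X : D) :
    K.map (ρ_ X).hom ≍ (ρ_ (K.obj X)).hom := by
  have h := Functor.LaxMonoidal.right_unitality K X
  rw [hK.μ_eq, hK.ε_eq, whiskerLeft_eqToHom, eqToHom_trans_assoc] at h
  exact (eqToHom_comp_heq _ _).symm.trans (heq_of_eq h.symm)

theorem IsStrict.map_braiding [K.Braided] (hK : IsStrict K) (X Y : D) :
    K.map (β_ X Y).hom ≍ (β_ (K.obj X) (K.obj Y)).hom := by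
  have h := Functor.LaxBraided.braided (F := K) X Y
  rw [hK.μ_eq, hK.μ_eq] at h
  exact (heq_of_comp_eqToHom_eq h.symm).symm

theorem IsStrict.δ_eq [K.Monoidal] (hK : IsStrict K) (X Y : D) :
    δ K X Y = eqToHom (hK.obj_tensor X Y).symm := by
  have h := Functor.Monoidal.μ_δ K X Y
  rw [hK.μ_eq, eqToHom_comp_iff] at h
  simpa using h

theorem IsStrict.η_eq [K.Monoidal] (hK : IsStrict K) : η K = eqToHom hK.obj_unit.symm := by
  have h := Functor.Monoidal.ε_η K
  rw [hK.ε_eq, eqToHom_comp_iff] at h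
  simpa using h

end Strict

namespace Contour

variable {V : Type u} [SmallCategory V] {𝕍 : SymProduoidalData V}
variable {C : Type u} [SmallCategory C] [MonoidalCategory C] [SymmetricCategory C]

section Existence

variable (F : ProFunctor 𝕍 (spliced C)) (hF : F.IsSymProduoidal)

/-- The functor out of the monoidal contour that evaluates formal morphisms. -/
def eval : Contour 𝕍 ⥤ C where
  obj := evalObj F
  map := Quot.lift (evalPre F) fun _ _ h => h C F hF
  map_id _ := rfl
  map_comp f g := by
    induction f using cls_ind
    induction g using cls_ind
    rfl

/-- Evaluation is strictly monoidal. -/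
def evalCore : (eval F hF).CoreMonoidal where
  εIso := Iso.refl _
  μIso _ _ := Iso.refl _
  μIso_hom_natural_left f X := by
    induction f using cls_ind with
    | h f =>
    exact ((Category.comp_id _).trans (MonoidalCategory.tensorHom_id (evalPre F f) (evalObj F X)).symm).trans
      (Category.id_comp (evalPre F f ⊗ₘ 𝟙 (evalObj F X))).symm
  μIso_hom_natural_right X f := by
    induction f using cls_ind with
    | h f =>
    exact ((Category.comp_id _).trans (MonoidalCategory.id_tensorHom (evalObj F X) (evalPre F f)).symm).trans
      (Category.id_comp (𝟙 (evalObj F X) ⊗ₘ evalPre F f)).symm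
  associativity X Y Z := by
    have h : ∀ X Y Z : C, 𝟙 (X ⊗ Y) ▷ Z ≫ 𝟙 _ ≫ (α_ X Y Z).hom =
      (α_ X Y Z).hom ≫ X ◁ 𝟙 (Y ⊗ Z) ≫ 𝟙 _ := by simp
    exact h (evalObj F X) (evalObj F Y) (evalObj F Z)
  left_unitality X := by
    have h : ∀ X : C, (λ_ X).hom = 𝟙 (𝟙_ C) ▷ X ≫ 𝟙 _ ≫ (λ_ X).hom := by simp
    exact h (evalObj F X)
  right_unitality X := by
    have h : ∀ X : C, (ρ_ X).hom = X ◁ 𝟙 (𝟙_ C) ≫ 𝟙 _ ≫ (ρ_ X).hom := by simp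
    exact h (evalObj F X)

/-- Evaluation is braided. -/
@[reducible] def evalBraided : (eval F hF).Braided where
  toMonoidal := (evalCore F hF).toMonoidal
  braided X Y := (Category.id_comp _).trans (Category.comp_id _).symm

theorem eval_isStrict :
    letI := (evalCore F hF).toMonoidal
    IsStrict (eval F hF) :=
  letI := (evalCore F hF).toMonoidal
  { obj_tensor := fun _ _ => rfl
    obj_unit := rfl
    μ_eq := fun _ _ => rfl
    ε_eq := rfl }

theorem proFunctor_congr {W : Type u} [SmallCategory W] {𝕎 : SymProduoidalData W} {G : V ⥤ W}
    {a a' : SplitMap G 𝕍.par.split 𝕎.par.split} {b b' : SplitMap G 𝕍.seq.split 𝕎.seq.split}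
    {c c' : 𝕍.par.unit ⟶ G.op ⋙ 𝕎.par.unit} {d d' : 𝕍.seq.unit ⟶ G.op ⋙ 𝕎.seq.unit}
    (ha : ∀ {A B D : V} (p : 𝕍.par.split.el A B D), a.app p = a'.app p)
    (hb : ∀ {A B D : V} (p : 𝕍.seq.split.el A B D), b.app p = b'.app p)
    (hc : ∀ {A : V} (j : 𝕍.par.unit.obj (op A)), c.app (op A) j = c'.app (op A) j)
    (hd : ∀ {A : V} (n : 𝕍.seq.unit.obj (op A)), d.app (op A) n = d'.app (op A) n) :
    ProFunctor.mk G a b c d = ProFunctor.mk G a' b' c' d' := by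
  obtain rfl : a = a' := SplitMap.ext (by funext A B D p; exact ha p)
  obtain rfl : b = b' := SplitMap.ext (by funext A B D p; exact hb p)
  obtain rfl : c = c' := psh_ext fun A j => hc j
  obtain rfl : d = d' := NatTrans.ext (by funext ⟨A⟩; ext n; exact hd n)
  rfl

theorem univ_comp_eval :
    letI := (evalCore F hF).toMonoidal
    (univ 𝕍).comp (spliceMap (eval F hF)) = F :=
  letI := (evalCore F hF).toMonoidal
  proFunctor_congr (G := F.functor)
    (fun p => Splice.hom_ext (Category.comp_id _) (Category.id_comp _))
    (fun p => rfl)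
    (fun j => Splice.hom_ext (Category.comp_id _) (Category.id_comp _))
    (fun n => rfl)

end Existence

section Uniqueness

variable {K L : Contour 𝕍 ⥤ C}

theorem univ_comp_par_heq [K.Monoidal] (hK : IsStrict K) {A B D : V} (p : 𝕍.par.split.el A B D) :
    K.map (cls (.parL p)) ≍ (parHom (((univ 𝕍).comp (spliceMap K)).mapPar.app p)).fst ∧
      K.map (cls (.parR p)) ≍ (parHom (((univ 𝕍).comp (spliceMap K)).mapPar.app p)).snd := by
  refine ⟨?_, ?_⟩
  · show _ ≍ K.map (cls (.parL p)) ≫ Functor.OplaxMonoidal.δ K (left B) (left D)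
    rw [hK.δ_eq]
    exact (comp_eqToHom_heq _ _).symm
  · show _ ≍ Functor.LaxMonoidal.μ K (right B) (right D) ≫ K.map (cls (.parR p))
    rw [hK.μ_eq]
    exact (eqToHom_comp_heq _ _).symm

theorem univ_comp_unit_heq [K.Monoidal] (hK : IsStrict K) {A : V} (j : 𝕍.par.unit.obj (op A)) :
    K.map (cls (.unitL j)) ≍ (unitIHom (((univ 𝕍).comp (spliceMap K)).mapI.app (op A) j)).fst ∧
      K.map (cls (.unitR j)) ≍ (unitIHom (((univ 𝕍).comp (spliceMap K)).mapI.app (op A) j)).snd := by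
  refine ⟨?_, ?_⟩
  · show _ ≍ K.map (cls (.unitL j)) ≫ Functor.OplaxMonoidal.η K
    rw [hK.η_eq]
    exact (comp_eqToHom_heq _ _).symm
  · show _ ≍ Functor.LaxMonoidal.ε K ≫ K.map (cls (.unitR j))
    rw [hK.ε_eq]
    exact (eqToHom_comp_heq _ _).symm

theorem obj_unique [K.Monoidal] [L.Monoidal] (hK : IsStrict K) (hL : IsStrict L)
    (h : (univ 𝕍).comp (spliceMap K) = (univ 𝕍).comp (spliceMap L)) (X : Contour 𝕍) :
    K.obj X = L.obj X := by
  induction X with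
  | left A => exact congrArg (fun G : ProFunctor 𝕍 (spliced C) => (G.functor.obj A).dom) h
  | right A => exact congrArg (fun G : ProFunctor 𝕍 (spliced C) => (G.functor.obj A).cod) h
  | unit => exact hK.obj_unit.symm.trans hL.obj_unit
  | tensor X Y hX hY =>
    exact (hK.obj_tensor X Y).symm.trans ((congrArg₂ tensorObj hX hY).trans (hL.obj_tensor X Y))

theorem map_unique [K.Braided] [L.Braided] (hK : IsStrict K) (hL : IsStrict L)
    (h : (univ 𝕍).comp (spliceMap K) = (univ 𝕍).comp (spliceMap L)) {X Y : Contour 𝕍} (f : Pre X Y) :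
    K.map (cls f) ≍ L.map (cls f) := by
  have ho := obj_unique hK hL h
  have gen : ∀ {A B : V} (G G' : ProFunctor 𝕍 (spliced C)) (_ : G = G') (f : A ⟶ B),
      (G.functor.map f).fst ≍ (G'.functor.map f).fst ∧
      (G.functor.map f).snd ≍ (G'.functor.map f).snd := by
    rintro A B G _ rfl f
    exact ⟨HEq.rfl, HEq.rfl⟩
  have genP : ∀ {A B D : V} (G G' : ProFunctor 𝕍 (spliced C)) (_ : G = G')
      (p : 𝕍.par.split.el A B D),
      (parHom (G.mapPar.app p)).fst ≍ (parHom (G'.mapPar.app p)).fst ∧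
      (parHom (G.mapPar.app p)).snd ≍ (parHom (G'.mapPar.app p)).snd := by
    rintro A B D G _ rfl f
    exact ⟨HEq.rfl, HEq.rfl⟩
  have genS : ∀ {A B D : V} (G G' : ProFunctor 𝕍 (spliced C)) (_ : G = G')
      (p : 𝕍.seq.split.el A B D),
      (seqHom (G.mapSeq.app p)).fst ≍ (seqHom (G'.mapSeq.app p)).fst ∧
      (seqHom (G.mapSeq.app p)).mid ≍ (seqHom (G'.mapSeq.app p)).mid ∧
      (seqHom (G.mapSeq.app p)).snd ≍ (seqHom (G'.mapSeq.app p)).snd := by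
    rintro A B D G _ rfl f
    exact ⟨HEq.rfl, HEq.rfl, HEq.rfl⟩
  have genI : ∀ {A : V} (G G' : ProFunctor 𝕍 (spliced C)) (_ : G = G')
      (j : 𝕍.par.unit.obj (op A)),
      (unitIHom (G.mapI.app (op A) j)).fst ≍ (unitIHom (G'.mapI.app (op A) j)).fst ∧
      (unitIHom (G.mapI.app (op A) j)).snd ≍ (unitIHom (G'.mapI.app (op A) j)).snd := by
    rintro A G _ rfl f
    exact ⟨HEq.rfl, HEq.rfl⟩
  have genN : ∀ {A : V} (G G' : ProFunctor 𝕍 (spliced C)) (_ : G = G')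
      (n : 𝕍.seq.unit.obj (op A)),
      Splice.arrow (G.mapN.app (op A) n) ≍ Splice.arrow (G'.mapN.app (op A) n) := by
    rintro A G _ rfl f
    rfl
  have assoc_heq : ∀ {X Y Z X' Y' Z' : C}, X = X' → Y = Y' → Z = Z' →
      (α_ X Y Z).hom ≍ (α_ X' Y' Z').hom := by
    rintro X Y Z _ _ _ rfl rfl rfl
    rfl
  have left_heq : ∀ {X X' : C}, X = X' → (λ_ X).hom ≍ (λ_ X').hom := by
    rintro X _ rfl
    rfl
  have right_heq : ∀ {X X' : C}, X = X' → (ρ_ X).hom ≍ (ρ_ X').hom := by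
    rintro X _ rfl
    rfl
  have assoc_map : ∀ X Y Z : Contour 𝕍, K.map (α_ X Y Z).hom ≍ L.map (α_ X Y Z).hom :=
    fun X Y Z => (hK.map_associator X Y Z).trans
      ((assoc_heq (ho X) (ho Y) (ho Z)).trans (hL.map_associator X Y Z).symm)
  have left_map : ∀ X : Contour 𝕍, K.map (λ_ X).hom ≍ L.map (λ_ X).hom :=
    fun X => (hK.map_leftUnitor X).trans ((left_heq (ho X)).trans (hL.map_leftUnitor X).symm)
  have right_map : ∀ X : Contour 𝕍, K.map (ρ_ X).hom ≍ L.map (ρ_ X).hom :=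
    fun X => (hK.map_rightUnitor X).trans ((right_heq (ho X)).trans (hL.map_rightUnitor X).symm)
  have inv_map : ∀ {X Y : Contour 𝕍} (e : X ≅ Y), K.map e.hom ≍ L.map e.hom →
      K.map e.inv ≍ L.map e.inv := fun {X Y} e he =>
    iso_inv_heq (f := K.mapIso e) (f' := L.mapIso e) (ho X) (ho Y) he
  induction f with
  | id X =>
    have : ∀ {X X' : C}, X = X' → 𝟙 X ≍ 𝟙 X' := by
      rintro X _ rfl
      rfl
    exact (heq_of_eq (K.map_id X)).trans ((this (ho X)).trans (heq_of_eq (L.map_id X).symm))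
  | @comp X Y Z f g hf hg =>
    exact (heq_of_eq (K.map_comp (cls f) (cls g))).trans
      ((heq_comp (ho X) (ho Y) (ho Z) hf hg).trans (heq_of_eq (L.map_comp (cls f) (cls g)).symm))
  | @tensor X Y X' Y' f g hf hg =>
    exact (hK.map_tensorHom (cls f) (cls g)).trans
      ((tensorHom_heq (ho X) (ho Y) (ho X') (ho Y') hf hg).trans
        (hL.map_tensorHom (cls f) (cls g)).symm)
  | assoc X Y Z => exact assoc_map X Y Z
  | assocInv X Y Z => exact inv_map (α_ X Y Z) (assoc_map X Y Z)
  | leftUnitor X => exact left_map X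
  | leftUnitorInv X => exact inv_map (λ_ X) (left_map X)
  | rightUnitor X => exact right_map X
  | rightUnitorInv X => exact inv_map (ρ_ X) (right_map X)
  | braiding X Y =>
    have : ∀ {X Y X' Y' : C}, X = X' → Y = Y' → (β_ X Y).hom ≍ (β_ X' Y').hom := by
      rintro X Y _ _ rfl rfl
      rfl
    exact (hK.map_braiding X Y).trans ((this (ho X) (ho Y)).trans (hL.map_braiding X Y).symm)
  | mapL f => exact (gen _ _ h f).1
  | mapR f => exact (gen _ _ h f).2
  | parL p =>
    exact (univ_comp_par_heq hK p).1.trans ((genP _ _ h p).1.trans (univ_comp_par_heq hL p).1.symm)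
  | parR p =>
    exact (univ_comp_par_heq hK p).2.trans ((genP _ _ h p).2.trans (univ_comp_par_heq hL p).2.symm)
  | seqL p => exact (genS _ _ h p).1
  | seqM p => exact (genS _ _ h p).2.1
  | seqR p => exact (genS _ _ h p).2.2
  | unitN n => exact genN _ _ h n
  | unitL j =>
    exact (univ_comp_unit_heq hK j).1.trans ((genI _ _ h j).1.trans (univ_comp_unit_heq hL j).1.symm)
  | unitR j =>
    exact (univ_comp_unit_heq hK j).2.trans ((genI _ _ h j).2.trans (univ_comp_unit_heq hL j).2.symm)

theorem functor_unique [K.Braided] [L.Braided] (hK : IsStrict K) (hL : IsStrict L)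
    (h : (univ 𝕍).comp (spliceMap K) = (univ 𝕍).comp (spliceMap L)) : K = L :=
  Functor.hext (obj_unique hK hL h) fun X Y f => by
    induction f using cls_ind with
    | h f => exact map_unique hK hL h f

end Uniqueness

variable (𝕍) in
theorem univ_isContour : IsContour 𝕍 (univ 𝕍) where
  functor_laws := univ_isSymProduoidal 𝕍
  universal F hF :=
    ⟨eval F hF, ⟨evalBraided F hF, eval_isStrict F hF, univ_comp_eval F hF⟩, by
      rintro K ⟨_, hK, h⟩
      letI := evalBraided F hF
      exact functor_unique hK (eval_isStrict F hF) (h.trans (univ_comp_eval F hF).symm)⟩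

end Contour

end Produo

namespace Produo

section PresheafAlgebra

variable {V : Type u} [SmallCategory V]

theorem pt_comp {F G : Psh V} {X : V} (x : F.obj (op X)) (s : F ⟶ G) :
    pt x ≫ s = pt (s.app (op X) x) :=
  psh_ext fun _ f => NatTrans.naturality_apply s (Quiver.Hom.op f) x

theorem pt₂_comp {P : Split V} {F G F' G' : Psh V} {X Y : V} (x : F.obj (op X)) (y : G.obj (op Y))
    (s : F ⟶ F') (t : G ⟶ G') :
    pt₂ P x y ≫ conv.map s t = pt₂ P (s.app (op X) x) (t.app (op Y) y) := rfl

theorem pt_eq {F : Psh V} {X : V} {x : F.obj (op X)} {s : yoneda.obj X ⟶ F}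
    (h : s.app (op X) (𝟙 X) = x) : s = pt x := by
  rw [← h]
  refine psh_ext fun A f => ?_
  refine Eq.trans (congrArg (s.app (op A)) (Category.comp_id f).symm) ?_
  exact NatTrans.naturality_apply s f.op (𝟙 X)

theorem conv.map_id {P : Split V} (F G : Psh V) :
    (conv.map (𝟙 F) (𝟙 G) : conv P F G ⟶ _) = 𝟙 (conv P F G) :=
  psh_ext fun A w => by
    induction w using conv.ind with
    | h p x y => rfl

theorem conv.map_comp_assoc {P : Split V} {F F' F'' G G' G'' H : Psh V} (s : F ⟶ F') (s' : F' ⟶ F'')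
    (t : G ⟶ G') (t' : G' ⟶ G'') (h : conv P F'' G'' ⟶ H) :
    conv.map s t ≫ conv.map s' t' ≫ h = conv.map (s ≫ s') (t ≫ t') ≫ h := by
  rw [conv.map_comp, Category.assoc]

namespace PromonoidalData

variable (P : PromonoidalData V)

theorem assocExt_naturality {F F' G G' H H' : Psh V} (s : F ⟶ F') (t : G ⟶ G') (r : H ⟶ H') :
    conv.map (conv.map s t) r ≫ P.assocExt F' G' H' =
      P.assocExt F G H ≫ conv.map s (conv.map t r) :=
  psh_ext fun A w => by
    induction w using conv.ind with
    | @h U Z p w z =>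
    induction w using conv.ind with
    | @h X Y q x y =>
    have h := app_congr (conv.map_comp (P := P.split) (pt x) s (pt₂ P.split y z) (conv.map t r))
      ((P.assoc X Y Z).app (op A) (conv.mk p q (𝟙 Z)))
    rw [pt_comp, pt₂_comp] at h
    exact h

theorem leftExt_naturality {F G : Psh V} (s : F ⟶ G) :
    conv.map (𝟙 P.unit) s ≫ P.leftExt G = P.leftExt F ≫ s :=
  psh_ext fun A w => by
    induction w using conv.ind with
    | @h X Y p j y =>
    exact (NatTrans.naturality_apply s
      ((P.leftUnitor Y).app (op A) (conv.mk p j (𝟙 Y))).op y).symm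

variable {P}

theorem assocExt_surjective (hP : P.IsPromonoidal) (F G H : Psh V) (A : V) :
    Function.Surjective ((P.assocExt F G H).app (op A)) := by
  intro w
  induction w using conv.ind with
  | @h X U p x w =>
  induction w using conv.ind with
  | @h Y Z q y z =>
  have := hP.assoc_iso X Y Z
  obtain ⟨v, hv⟩ := (bijective_of_isIso (P.assoc X Y Z) A).2 (conv.mk p (𝟙 X) q)
  induction v using conv.ind with
  | @h U' Z' p' q' c =>
  refine ⟨conv.mk p' (conv.mk q' x y) (H.map (Quiver.Hom.op c) z), ?_⟩
  have h := P.assoc_el (F := F) (G := G) (H := H) (𝟙 X) (𝟙 Y) c p' q' x y z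
  rw [P.split.act_id, op_id, F.map_id_apply, op_id, G.map_id_apply] at h
  exact h.symm.trans ((congrArg _ hv).trans (conv.congr rfl (F.map_id_apply _ x) rfl))

theorem leftExt_bijective (hP : P.IsPromonoidal) (F : Psh V) (A : V) :
    Function.Bijective ((P.leftExt F).app (op A)) := by
  have := hP.leftUnitor_iso
  let u : (B : V) → (conv P.split P.unit (yoneda.obj B)).obj (op B) := fun B =>
    (inv (P.leftUnitor B)).app (op B) (𝟙 B)
  have hu : ∀ {A B : V} (t : A ⟶ B),
      (conv.map (𝟙 P.unit) (yoneda.map t)).app (op A) (u A) = (inv (P.leftUnitor B)).app (op A) t := by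
    intro A B t
    refine (bijective_of_isIso (P.leftUnitor B) A).1 ?_
    refine (app_congr (P.leftUnitor_naturality t) (u A)).trans ?_
    refine (congrArg ((yoneda.map t).app (op A))
      (app_congr (IsIso.inv_hom_id (P.leftUnitor A)) (𝟙 A))).trans ?_
    refine Eq.trans ?_ (app_congr (IsIso.inv_hom_id (P.leftUnitor B)) t).symm
    exact Category.id_comp t
  have h₁ : ∀ {B : V} (x : F.obj (op B)) (w : (conv P.split P.unit (yoneda.obj B)).obj (op A)),
      (P.leftExt F).app (op A) ((conv.map (𝟙 P.unit) (pt x)).app (op A) w) =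
        (pt x).app (op A) ((P.leftUnitor B).app (op A) w) := by
    intro B x w
    induction w using conv.ind with
    | @h X Y p j c => exact (P.leftUnitor_el c p j x).symm
  refine Function.bijective_iff_has_inverse.2
    ⟨fun x => (conv.map (𝟙 P.unit) (pt x)).app (op A) (u A), ?_, ?_⟩
  · intro w
    induction w using conv.ind with
    | @h X Y p j x =>
    have e : pt ((P.leftExt F).app (op A) (conv.mk p j x)) =
        yoneda.map ((P.leftUnitor Y).app (op A) (conv.mk p j (𝟙 Y))) ≫ pt x :=
      (map_comp_pt _ x).symm
    show (conv.map (𝟙 P.unit) (pt ((P.leftExt F).app (op A) (conv.mk p j x)))).app (op A) (u A) = _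
    rw [e]
    have h := app_congr (conv.map_comp (P := P.split) (𝟙 P.unit) (𝟙 P.unit)
      (yoneda.map ((P.leftUnitor Y).app (op A) (conv.mk p j (𝟙 Y)))) (pt x)) (u A)
    refine h.trans ((congrArg ((conv.map (𝟙 P.unit) (pt x)).app (op A)) ((hu _).trans
      (inv_app_eq _ rfl))).trans ?_)
    exact conv.congr rfl rfl (F.map_id_apply _ x)
  · intro x
    refine (h₁ x (u A)).trans ((congrArg ((pt x).app (op A))
      (app_congr (IsIso.inv_hom_id (P.leftUnitor A)) (𝟙 A))).trans ?_)
    exact F.map_id_apply _ x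

theorem epi_of_surjective {F G : Psh V} (s : F ⟶ G)
    (h : ∀ A, Function.Surjective (s.app (op A))) {H : Psh V} {t t' : G ⟶ H} (e : s ≫ t = s ≫ t') :
    t = t' :=
  psh_ext fun A y => by
    obtain ⟨x, rfl⟩ := h A y
    exact app_congr e x

theorem mono_of_injective {F G : Psh V} (s : F ⟶ G)
    (h : ∀ A, Function.Injective (s.app (op A))) {H : Psh V} {t t' : H ⟶ F} (e : t ≫ s = t' ≫ s) :
    t = t' :=
  psh_ext fun A y => h A (app_congr e y)

theorem conv_map_surjective {Q : Split V} {F G H : Psh V} (s : F ⟶ G)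
    (h : ∀ A, Function.Surjective (s.app (op A))) (A : V) :
    Function.Surjective ((conv.map s (𝟙 H) : conv Q F H ⟶ _).app (op A)) := by
  intro w
  induction w using conv.ind with
  | @h X Y p x y =>
  obtain ⟨x, rfl⟩ := h X x
  exact ⟨conv.mk p x y, rfl⟩

/-- The left unitor of a product is the product with the left unitor. -/
theorem assocExt_leftExt (hP : P.IsPromonoidal) (F G : Psh V) :
    P.assocExt P.unit F G ≫ P.leftExt (conv P.split F G) = conv.map (P.leftExt F) (𝟙 G) := by
  have cancel : ∀ {K L : Psh V} {s t : K ⟶ L},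
      (conv.map (𝟙 P.unit) s : conv P.split _ _ ⟶ _) = conv.map (𝟙 P.unit) t → s = t := by
    intro K L s t e
    refine epi_of_surjective (P.leftExt K) (fun A => (leftExt_bijective hP K A).2) ?_
    rw [← P.leftExt_naturality, ← P.leftExt_naturality, e]
  refine cancel ?_
  refine epi_of_surjective (P.assocExt P.unit (conv P.split P.unit F) G)
    (assocExt_surjective hP _ _ _) ?_
  refine epi_of_surjective (conv.map (P.assocExt P.unit P.unit F) (𝟙 G))
    (conv_map_surjective _ (assocExt_surjective hP _ _ _)) ?_
  have h₁ : (conv.map (𝟙 P.unit) (P.assocExt P.unit F G ≫ P.leftExt (conv P.split F G)) :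
      conv P.split _ _ ⟶ _) = conv.map (𝟙 P.unit) (P.assocExt P.unit F G) ≫
        conv.map (𝟙 P.unit) (P.leftExt (conv P.split F G)) := by
    rw [← conv.map_comp, Category.comp_id]
  have h₂ := congrArg (· ≫ conv.map (𝟙 P.unit) (P.leftExt (conv P.split F G)))
    (hP.pentagon P.unit P.unit F G)
  simp only [Category.assoc] at h₂
  rw [h₁, h₂, hP.triangle, ← P.assocExt_naturality, conv.map_comp_assoc, hP.triangle,
    Category.comp_id, ← conv.map_id, P.assocExt_naturality]

end PromonoidalData

end PresheafAlgebra

namespace SymProduoidalData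

variable {V : Type u} [SmallCategory V] (P : SymProduoidalData V)

theorem ψ₂Ext_naturality {F F' G G' H H' K K' : Psh V} (s : F ⟶ F') (t : G ⟶ G') (r : H ⟶ H')
    (k : K ⟶ K') :
    conv.map (conv.map s t) (conv.map r k) ≫ P.ψ₂Ext F' G' H' K' =
      P.ψ₂Ext F G H K ≫ conv.map (conv.map s r) (conv.map t k) :=
  psh_ext fun A w => by
    induction w using conv.ind with
    | @h U Z p w w' =>
    induction w using conv.ind with
    | @h X Y q x y =>
    induction w' using conv.ind with
    | @h X' Y' q' x' y' =>
    exact app_congr (conv.map_comp (P := P.seq.split) (pt₂ P.par.split x x') (conv.map s r)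
      (pt₂ P.par.split y y') (conv.map t k)) ((P.ψ₂ X Y X' Y').app (op A) (conv.mk p q q'))

theorem σExt_naturality {F F' G G' : Psh V} (s : F ⟶ F') (t : G ⟶ G') :
    conv.map s t ≫ P.σExt F' G' = P.σExt F G ≫ conv.map t s :=
  psh_ext fun A w => by
    induction w using conv.ind with
    | @h U Z p x y => rfl

theorem σExt_symmetry (h : P.IsSymProduoidal) (F G : Psh V) : P.σExt F G ≫ P.σExt G F = 𝟙 _ :=
  psh_ext fun A w => by
    induction w using conv.ind with
    | @h U Z p x y =>
    exact congrArg ((pt₂ P.par.split x y).app (op A)) (app_congr (h.symmetry U Z) p)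

end SymProduoidalData

end Produo

namespace Produo

theorem pt_map {V : Type u} [SmallCategory V] {F : Psh V} {A X : V} (f : A ⟶ X)
    (x : F.obj (op X)) : pt (F.map f.op x) = yoneda.map f ≫ pt x := (map_comp_pt f x).symm

section SplitMorphisms

variable {W : Type u} [SmallCategory W] (Q : Split W)

/-- A split as a map of presheaves. -/
def Split.mor {A X Y : W} (p : Q.el A X Y) :
    yoneda.obj A ⟶ conv Q (yoneda.obj X) (yoneda.obj Y) :=
  pt (conv.mk p (𝟙 X) (𝟙 Y))

theorem Split.mor_act {A A' X X' Y Y' : W} (f : A' ⟶ A) (g : X ⟶ X') (h : Y ⟶ Y')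
    (p : Q.el A X Y) :
    Q.mor (Q.act f g h p) = yoneda.map f ≫ Q.mor p ≫ conv.map (yoneda.map g) (yoneda.map h) := by
  rw [mor, mor, pt_comp, ← pt_map]
  refine congrArg pt ?_
  exact (conv.mk_eq (F := yoneda.obj X') (G := yoneda.obj Y')
    (p := Q.act f (𝟙 _) (𝟙 _) p) g h
    (by rw [Q.act_act, Category.id_comp, Category.id_comp, Category.id_comp])
    ((Category.comp_id _).trans (Category.id_comp _).symm)
    ((Category.comp_id _).trans (Category.id_comp _).symm)).symm

theorem Split.mor_injective {A X Y : W} {p p' : Q.el A X Y} (h : Q.mor p = Q.mor p') : p = p' := by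
  have h₁ := congrArg (fun t => (conv.collapse Q _ _).app (op A) (t.app (op A) (𝟙 _))) h
  have h₂ : ∀ p : Q.el A X Y, (conv.collapse Q _ _).app (op A) ((Q.mor p).app (op A) (𝟙 _)) = p :=
    fun p => by
    show Q.act (𝟙 _) (𝟙 _) (𝟙 _) (Q.act (𝟙 _) (𝟙 _) (𝟙 _) p) = _
    rw [Q.act_id, Q.act_id]
  rwa [h₂, h₂] at h₁

end SplitMorphisms

section Generic

variable {V W : Type u} [SmallCategory V] [SmallCategory W]

/-- An element over a functor as a map of presheaves. -/
def ptOver {J : V ⥤ W} {F : Psh W} {A : V} (x : (J.op ⋙ F).obj (op A)) :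
    yoneda.obj (J.obj A) ⟶ F :=
  pt (F := F) (X := J.obj A) x

theorem Sq.ptOver {J : V ⥤ W} {E E' : Psh V} {F F' : Psh W} {a : E ⟶ E'} {b : F ⟶ F'}
    {s : E ⟶ J.op ⋙ F} {s' : E' ⟶ J.op ⋙ F'} (h : Sq J a b s s') {A : V} (x : E.obj (op A)) :
    Produo.ptOver (s.app (op A) x) ≫ b = Produo.ptOver (s'.app (op A) (a.app (op A) x)) := by
  rw [Produo.ptOver, pt_comp]
  exact congrArg (pt (F := F') (X := J.obj A)) (h A x)

namespace SplitMap

variable {F : V ⥤ W} {P : Split V} {Q : Split W} (m : SplitMap F P Q)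

/-- The image of a split as a map of presheaves. -/
def mor {A X Y : V} (p : P.el A X Y) :
    yoneda.obj (F.obj A) ⟶ Produo.conv Q (yoneda.obj (F.obj X)) (yoneda.obj (F.obj Y)) :=
  Q.mor (m.app p)

theorem pt_mk {A X Y : V} (p : P.el A X Y) {G H : Psh W} (x : G.obj (op (F.obj X)))
    (y : H.obj (op (F.obj Y))) :
    pt (conv.mk (m.app p) x y) = m.mor p ≫ conv.map (pt x) (pt y) := by
  rw [mor, Split.mor, pt_comp]
  exact congrArg pt (conv.congr rfl (G.map_id_apply _ x).symm (H.map_id_apply _ y).symm)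

theorem mor_act {A A' X X' Y Y' : V} (f : A' ⟶ A) (g : X ⟶ X') (h : Y ⟶ Y') (p : P.el A X Y) :
    m.mor (P.act f g h p) = yoneda.map (F.map f) ≫ m.mor p ≫
      conv.map (yoneda.map (F.map g)) (yoneda.map (F.map h)) := by
  rw [mor, m.naturality, Split.mor_act, mor]

theorem ptOver_conv {A X Y : V} (p : P.el A X Y) {G H : Psh V} {G' H' : Psh W} (s : G ⟶ F.op ⋙ G')
    (t : H ⟶ F.op ⋙ H') (x : G.obj (op X)) (y : H.obj (op Y)) :
    ptOver ((m.conv s t).app (op A) (conv.mk p x y)) =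
      m.mor p ≫ conv.map (ptOver (s.app (op X) x)) (ptOver (t.app (op Y) y)) :=
  m.pt_mk p (G := G') (H := H') _ _

end SplitMap

theorem ptOver_yonedaMap (J : V ⥤ W) {A X : V} (f : A ⟶ X) :
    ptOver ((yonedaMap J X).app (op A) f) = yoneda.map (J.map f) := by
  rw [pt_eq (s := yoneda.map (J.map f)) rfl]
  exact congrArg pt (Category.id_comp _).symm

end Generic

section Residuals

open Splice SeqOver

variable {C : Type u} [SmallCategory C] [MonoidalCategory C] [SymmetricCategory C]
  {X : Type u} [SmallCategory X] {𝕏 : SymProduoidalData X} (G : ProFunctor (spliced C) 𝕏)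

namespace ProFunctor

/-- The image of the parallel splits `A ⟶ B ⊗ D`. -/
abbrev parMor {A B D : Splice C} (p : A ⟶ B ⊗ D) :
    yoneda.obj (G.functor.obj A) ⟶ 𝕏.T (yoneda.obj (G.functor.obj B)) (yoneda.obj (G.functor.obj D)) :=
  G.mapPar.mor p

/-- The image of a sequential split. -/
abbrev seqMor {A B D : Splice C} (p : Seq A B D) :
    yoneda.obj (G.functor.obj A) ⟶ 𝕏.S (yoneda.obj (G.functor.obj B)) (yoneda.obj (G.functor.obj D)) :=
  G.mapSeq.mor p

/-- The image of an arrow, as an element of the sequential unit. -/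
def unitMor {A : Splice C} (n : A.dom ⟶ A.cod) : yoneda.obj (G.functor.obj A) ⟶ 𝕏.seq.unit :=
  pt (G.mapN.app (op A) (ofArrow n))

/-- The image of the parallel unit. -/
def unitIMor {A : Splice C} (j : A ⟶ 𝟙_ (Splice C)) : yoneda.obj (G.functor.obj A) ⟶ 𝕏.par.unit :=
  pt (G.mapI.app (op A) (ofUnitHom (D := Splice.seqOver C) j))

theorem ptOver_pmk {A B D : Splice C} {F H : Psh (Splice C)} {F' H' : Psh X}
    (s : F ⟶ G.functor.op ⋙ F') (t : H ⟶ G.functor.op ⋙ H') (p : A ⟶ B ⊗ D) (x : F.obj (op B))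
    (y : H.obj (op D)) :
    ptOver ((G.mapPar.conv s t).app (op A) ((Splice.seqOver C).pmk p x y)) =
      G.parMor p ≫ conv.map (ptOver (s.app (op B) x)) (ptOver (t.app (op D) y)) :=
  G.mapPar.ptOver_conv p s t x y

theorem ptOver_qmk {A B D : Splice C} {F H : Psh (Splice C)} {F' H' : Psh X}
    (s : F ⟶ G.functor.op ⋙ F') (t : H ⟶ G.functor.op ⋙ H') (p : Seq A B D) (x : F.obj (op B))
    (y : H.obj (op D)) :
    ptOver ((G.mapSeq.conv s t).app (op A) ((Splice.seqOver C).qmk p x y)) =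
      G.seqMor p ≫ conv.map (ptOver (s.app (op B) x)) (ptOver (t.app (op D) y)) :=
  G.mapSeq.ptOver_conv p s t x y

theorem parMor_act {A A' B B' D D' : Splice C} (f : A' ⟶ A) (p : A ⟶ B ⊗ D) (g : B ⟶ B')
    (h : D ⟶ D') : G.parMor (f ≫ p ≫ (g ⊗ₘ h)) = yoneda.map (G.functor.map f) ≫ G.parMor p ≫
      conv.map (yoneda.map (G.functor.map g)) (yoneda.map (G.functor.map h)) :=
  G.mapPar.mor_act f g h p

theorem parMor_eq {A B D : Splice C} (p : A ⟶ B ⊗ D) :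
    G.parMor p = yoneda.map (G.functor.map p) ≫ G.parMor (𝟙 (B ⊗ D)) := by
  have h := G.parMor_act p (𝟙 (B ⊗ D)) (𝟙 B) (𝟙 D)
  simp only [G.functor.map_id, yoneda.map_id, conv.map_id, Category.comp_id,
    MonoidalCategory.id_tensorHom_id] at h
  exact h

theorem comul_naturality {B B' D D' : Splice C} (g : B ⟶ B') (h : D ⟶ D') :
    yoneda.map (G.functor.map (g ⊗ₘ h)) ≫ G.parMor (𝟙 (B' ⊗ D')) =
      G.parMor (𝟙 (B ⊗ D)) ≫
        conv.map (yoneda.map (G.functor.map g)) (yoneda.map (G.functor.map h)) := by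
  have h₁ := G.parMor_act (𝟙 _) (𝟙 (B ⊗ D)) g h
  rw [G.functor.map_id, yoneda.map_id, Category.id_comp, Category.id_comp, Category.id_comp] at h₁
  rw [← parMor_eq, h₁]

theorem unitMor_act {A A' : Splice C} (f : A' ⟶ A) (n : A.dom ⟶ A.cod) :
    G.unitMor (f.fst ≫ n ≫ f.snd) = yoneda.map (G.functor.map f) ≫ G.unitMor n := by
  rw [unitMor, unitMor, ← pt_map]
  exact congrArg pt (NatTrans.naturality_apply G.mapN f.op (ofArrow n))

variable {G} (hG : G.IsSymProduoidal)
include hG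

theorem comul_assoc (A B D : Splice C) :
    G.parMor (𝟙 ((A ⊗ B) ⊗ D)) ≫ conv.map (G.parMor (𝟙 (A ⊗ B))) (𝟙 _) ≫ 𝕏.par.assocExt _ _ _ =
      yoneda.map (G.functor.map (α_ A B D).hom) ≫ G.parMor (𝟙 (A ⊗ (B ⊗ D))) ≫
        conv.map (𝟙 _) (G.parMor (𝟙 (B ⊗ D))) := by
  have h := (hG.par.sq_assoc (yonedaMap G.functor A) (yonedaMap G.functor B)
    (yonedaMap G.functor D)).ptOver (A := (A ⊗ B) ⊗ D)
    ((Splice.seqOver C).pmk (𝟙 _) ((Splice.seqOver C).pmk (F := yoneda.obj A) (G := yoneda.obj B)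
      (𝟙 (A ⊗ B)) (𝟙 A) (𝟙 B)) (𝟙 D))
  rw [par_assocExt_mk] at h
  rw [G.ptOver_pmk, G.ptOver_pmk, G.ptOver_pmk, G.ptOver_pmk,
    ptOver_yonedaMap, ptOver_yonedaMap, ptOver_yonedaMap] at h
  simp only [G.functor.map_id, yoneda.map_id, conv.map_id, Category.comp_id, Category.assoc,
    Category.id_comp, MonoidalCategory.id_whiskerRight] at h
  refine h.trans ?_
  rw [← Category.assoc, ← parMor_eq]

theorem comul_left (A : Splice C) :
    G.parMor (𝟙 (𝟙_ (Splice C) ⊗ A)) ≫ conv.map (G.unitIMor (𝟙 _)) (𝟙 _) ≫ 𝕏.par.leftExt _ =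
      yoneda.map (G.functor.map (λ_ A).hom) := by
  have h := (hG.par.sq_left (yonedaMap G.functor A)).ptOver (A := 𝟙_ (Splice C) ⊗ A)
    ((Splice.seqOver C).pmk (F := (spliced C).par.unit) (G := yoneda.obj A) (𝟙 _)
      (ofUnitHom (𝟙 _)) (𝟙 A))
  rw [par_leftExt_mk, unitHom_ofUnitHom] at h
  rw [G.ptOver_pmk, ptOver_yonedaMap] at h
  simp only [G.functor.map_id, yoneda.map_id, Category.assoc] at h
  refine h.trans ((ptOver_yonedaMap _ _).trans (congrArg (fun t => yoneda.map (G.functor.map t)) ?_))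
  show ((𝟙 _ ≫ 𝟙 _ ▷ A ≫ (λ_ A).hom) ≫ 𝟙 A) = _
  simp

theorem comul_braiding (A B : Splice C) :
    G.parMor (𝟙 (A ⊗ B)) ≫ 𝕏.σExt _ _ =
      yoneda.map (G.functor.map (β_ A B).hom) ≫ G.parMor (𝟙 (B ⊗ A)) := by
  have h := (hG.sq_σ (yonedaMap G.functor A) (yonedaMap G.functor B)).ptOver (A := A ⊗ B)
    ((Splice.seqOver C).pmk (F := yoneda.obj A) (G := yoneda.obj B) (𝟙 _) (𝟙 A) (𝟙 B))
  rw [σExt_mk, G.ptOver_pmk, G.ptOver_pmk, ptOver_yonedaMap, ptOver_yonedaMap] at h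
  simp only [G.functor.map_id, yoneda.map_id, conv.map_id, Category.comp_id,
    Category.id_comp] at h
  rw [← parMor_eq]
  exact h

theorem comul_seqMor {A B D A' B' D' : Splice C} (p : Seq A B D) (p' : Seq A' B' D') :
    G.parMor (𝟙 (A ⊗ A')) ≫ conv.map (G.seqMor p) (G.seqMor p') ≫ 𝕏.ψ₂Ext _ _ _ _ =
      G.seqMor ((Splice.seqOver C).tens p p') ≫
        conv.map (G.parMor (𝟙 (B ⊗ B'))) (G.parMor (𝟙 (D ⊗ D'))) := by
  have h₁ : (seqSplit C).act (𝟙 (A ⊗ A')) (𝟙 (B ⊗ B')) (𝟙 (D ⊗ D'))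
      ((Splice.seqOver C).tens p p') = (Splice.seqOver C).tens p p' := Split.act_id _ _
  have h : _ = ptOver ((G.mapSeq.conv (G.mapPar.conv (yonedaMap G.functor B) (yonedaMap G.functor B'))
      (G.mapPar.conv (yonedaMap G.functor D) (yonedaMap G.functor D'))).app (op (A ⊗ A'))
      ((Splice.seqOver C).qmk ((seqSplit C).act (𝟙 (A ⊗ A')) (𝟙 (B ⊗ B')) (𝟙 (D ⊗ D'))
        ((Splice.seqOver C).tens p p'))
        ((Splice.seqOver C).pmk (F := yoneda.obj B) (G := yoneda.obj B') (𝟙 (B ⊗ B')) (𝟙 B) (𝟙 B'))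
        ((Splice.seqOver C).pmk (F := yoneda.obj D) (G := yoneda.obj D') (𝟙 (D ⊗ D')) (𝟙 D) (𝟙 D')))) :=
    (hG.sq_ψ₂ (yonedaMap G.functor B) (yonedaMap G.functor D) (yonedaMap G.functor B')
      (yonedaMap G.functor D')).ptOver (A := A ⊗ A')
      ((Splice.seqOver C).pmk (𝟙 _)
        ((Splice.seqOver C).qmk (F := yoneda.obj B) (G := yoneda.obj D) p (𝟙 B) (𝟙 D))
        ((Splice.seqOver C).qmk (F := yoneda.obj B') (G := yoneda.obj D') p' (𝟙 B') (𝟙 D')))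
  rw [h₁] at h
  have h₂ := G.ptOver_qmk (G.mapPar.conv (yonedaMap G.functor B) (yonedaMap G.functor B'))
    (G.mapPar.conv (yonedaMap G.functor D) (yonedaMap G.functor D'))
    ((Splice.seqOver C).tens p p' : Seq (A ⊗ A') (B ⊗ B') (D ⊗ D'))
    ((Splice.seqOver C).pmk (F := yoneda.obj B) (G := yoneda.obj B') (𝟙 (B ⊗ B')) (𝟙 B) (𝟙 B'))
    ((Splice.seqOver C).pmk (F := yoneda.obj D) (G := yoneda.obj D') (𝟙 (D ⊗ D')) (𝟙 D) (𝟙 D'))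
  have h₃ := h.trans h₂
  rw [G.ptOver_pmk, G.ptOver_qmk, G.ptOver_qmk, G.ptOver_pmk, G.ptOver_pmk, ptOver_yonedaMap,
    ptOver_yonedaMap, ptOver_yonedaMap, ptOver_yonedaMap] at h₃
  simp only [G.functor.map_id, yoneda.map_id, conv.map_id, Category.comp_id,
    Category.assoc] at h₃
  exact h₃

theorem comul_unitMor {A B : Splice C} (m : A.dom ⟶ A.cod) (n : B.dom ⟶ B.cod) :
    G.parMor (𝟙 (A ⊗ B)) ≫ conv.map (G.unitMor m) (G.unitMor n) ≫ 𝕏.φ₂ =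
      G.unitMor (A := A ⊗ B) (m ⊗ₘ n) := by
  have h := hG.sq_φ₂.ptOver (A := A ⊗ B)
    ((Splice.seqOver C).pmk (F := (spliced C).seq.unit) (G := (spliced C).seq.unit) (𝟙 _)
      (ofArrow m) (ofArrow n))
  rw [G.ptOver_pmk] at h
  simp only [Category.assoc] at h
  refine h.trans (congrArg (fun t => Produo.ptOver (J := G.functor) (F := 𝕏.seq.unit) (A := A ⊗ B)
    (G.mapN.app (op (A ⊗ B)) t))
    (?_ : _ = ofArrow (A := A ⊗ B) (m ⊗ₘ n)))
  exact show 𝟙 _ ≫ (m ⊗ₘ n) ≫ 𝟙 _ = m ⊗ₘ n by simp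

theorem unitIMor_φ₀ : G.unitIMor (𝟙 (𝟙_ (Splice C))) ≫ 𝕏.φ₀ =
    G.unitMor (A := 𝟙_ (Splice C)) (𝟙 (𝟙_ C)) := by
  have h := hG.sq_φ₀.ptOver (A := 𝟙_ (Splice C)) (ofUnitHom (𝟙 _))
  refine h.trans (congrArg (fun t => Produo.ptOver (J := G.functor) (F := 𝕏.seq.unit)
    (A := 𝟙_ (Splice C)) (G.mapN.app (op (𝟙_ (Splice C))) t))
    (?_ : _ = ofArrow (A := 𝟙_ (Splice C)) (𝟙 (𝟙_ C))))
  exact show 𝟙 (𝟙_ C) ≫ 𝟙 (𝟙_ C) ≫ 𝟙 (𝟙_ C) = 𝟙 _ by simp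

theorem seqMor_left (M : C) :
    G.seqMor (⟨𝟙 M, 𝟙 M, 𝟙 M⟩ : Seq ⟨M, M⟩ ⟨M, M⟩ ⟨M, M⟩) ≫
      conv.map (G.unitMor (A := ⟨M, M⟩) (𝟙 M)) (𝟙 _) ≫ 𝕏.seq.leftExt _ = 𝟙 _ := by
  have h := (hG.seq.sq_left (yonedaMap G.functor ⟨M, M⟩)).ptOver (A := ⟨M, M⟩)
    ((Splice.seqOver C).qmk (F := (spliced C).seq.unit) (G := yoneda.obj ⟨M, M⟩)
      (⟨𝟙 M, 𝟙 M, 𝟙 M⟩ : Seq ⟨M, M⟩ ⟨M, M⟩ ⟨M, M⟩) (ofArrow (A := ⟨M, M⟩) (𝟙 M)) (𝟙 _))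
  rw [G.ptOver_qmk, ptOver_yonedaMap] at h
  simp only [G.functor.map_id, yoneda.map_id, Category.assoc] at h
  refine h.trans ((congrArg ptOver (congrArg ((yonedaMap G.functor ⟨M, M⟩).app (op ⟨M, M⟩))
    ?_)).trans ((ptOver_yonedaMap _ _).trans ((congrArg yoneda.map (G.functor.map_id _)).trans
      (yoneda.map_id _))))
  refine (seq_leftExt_mk (F := yoneda.obj ⟨M, M⟩) _ _ _).trans ?_
  exact hom_ext (show (𝟙 M ≫ 𝟙 M ≫ 𝟙 M) ≫ 𝟙 M = 𝟙 M by simp) (show 𝟙 M ≫ 𝟙 M = 𝟙 M by simp)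

end ProFunctor

end Residuals

end Produo

namespace Produo

namespace PromonoidalData

variable {V : Type u} [SmallCategory V] (P : PromonoidalData V)

/-- Absorb an element of the unit on the left of a split. -/
def absorb {F : Psh V} (j : F ⟶ P.unit) (G : Psh V) : conv P.split F G ⟶ G :=
  conv.map j (𝟙 G) ≫ P.leftExt G

theorem map_absorb {F F' G G' : Psh V} (s : F ⟶ F') (t : G ⟶ G') (j : F' ⟶ P.unit) :
    conv.map s t ≫ P.absorb j G' = P.absorb (s ≫ j) G ≫ t := by
  rw [absorb, absorb, conv.map_comp_assoc, Category.comp_id, Category.assoc,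
    ← P.leftExt_naturality, conv.map_comp_assoc, Category.comp_id, Category.id_comp]

variable {P}

theorem map_absorb_id (hP : P.IsPromonoidal) {F : Psh V} (j : F ⟶ P.unit) (G H : Psh V) :
    conv.map (P.absorb j G) (𝟙 H) = P.assocExt F G H ≫ P.absorb j (conv P.split G H) := by
  have h : (conv.map (P.absorb j G) (𝟙 H) : conv P.split _ H ⟶ _) =
      conv.map (conv.map j (𝟙 G)) (𝟙 H) ≫ conv.map (P.leftExt G) (𝟙 H) := by
    rw [← conv.map_comp, Category.comp_id, absorb]
  rw [h, ← assocExt_leftExt hP, ← Category.assoc, P.assocExt_naturality, conv.map_id, absorb,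
    Category.assoc]

end PromonoidalData

namespace ProFunctor

open Splice SeqOver Lens

variable {C : Type u} [SmallCategory C] [MonoidalCategory C] [SymmetricCategory C]
  {X : Type u} [SmallCategory X] {𝕏 : SymProduoidalData X} (G : ProFunctor (spliced C) 𝕏)
  [IsIso 𝕏.φ₀]

/-- The image of an arrow in the parallel unit of a normal produoidal category. -/
noncomputable def resid {P : Splice C} (n : P.dom ⟶ P.cod) :
    yoneda.obj (G.functor.obj P) ⟶ 𝕏.par.unit :=
  G.unitMor n ≫ inv 𝕏.φ₀

/-- The morphism `G (P ⊗ A) ⟶ G A` discarding an arrow. -/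
noncomputable def discard {P : Splice C} (n : P.dom ⟶ P.cod) (A : Splice C) :
    G.functor.obj (P ⊗ A) ⟶ G.functor.obj A :=
  yoneda.preimage (G.parMor (𝟙 (P ⊗ A)) ≫ 𝕏.par.absorb (G.resid n) _)

theorem yoneda_discard {P : Splice C} (n : P.dom ⟶ P.cod) (A : Splice C) :
    yoneda.map (G.discard n A) = G.parMor (𝟙 (P ⊗ A)) ≫ 𝕏.par.absorb (G.resid n) _ :=
  yoneda.map_preimage _

theorem resid_φ₀ {P : Splice C} (n : P.dom ⟶ P.cod) : G.resid n ≫ 𝕏.φ₀ = G.unitMor n := by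
  rw [resid, Category.assoc, IsIso.inv_hom_id, Category.comp_id]

theorem map_resid {P P' : Splice C} (h : P' ⟶ P) (n : P.dom ⟶ P.cod) :
    yoneda.map (G.functor.map h) ≫ G.resid n = G.resid (h.fst ≫ n ≫ h.snd) := by
  rw [resid, resid, G.unitMor_act, Category.assoc]

theorem map_tensorHom_discard {P P' A A' : Splice C} (h : P' ⟶ P) (f : A' ⟶ A)
    (n : P.dom ⟶ P.cod) :
    G.functor.map (h ⊗ₘ f) ≫ G.discard n A =
      G.discard (h.fst ≫ n ≫ h.snd) A' ≫ G.functor.map f := by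
  apply yoneda.map_injective
  rw [yoneda.map_comp, yoneda.map_comp, yoneda_discard, yoneda_discard, ← Category.assoc,
    comul_naturality, Category.assoc, Category.assoc, 𝕏.par.map_absorb, map_resid]

theorem map_whiskerRight_discard {P P' : Splice C} (h : P' ⟶ P) (A : Splice C)
    (n : P.dom ⟶ P.cod) :
    G.functor.map (h ▷ A) ≫ G.discard n A = G.discard (h.fst ≫ n ≫ h.snd) A := by
  rw [← MonoidalCategory.tensorHom_id, map_tensorHom_discard, G.functor.map_id, Category.comp_id]

theorem map_whiskerLeft_discard {P A A' : Splice C} (f : A' ⟶ A) (n : P.dom ⟶ P.cod) :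
    G.functor.map (P ◁ f) ≫ G.discard n A = G.discard n A' ≫ G.functor.map f := by
  rw [← MonoidalCategory.id_tensorHom, map_tensorHom_discard]
  exact congrArg (fun t => G.discard t A' ≫ G.functor.map f) (by simp)

variable {G} (h𝕏 : 𝕏.IsSymProduoidal) (hG : G.IsSymProduoidal)
include h𝕏 hG

theorem discard_unitMor {P A : Splice C} (n : P.dom ⟶ P.cod) (m : A.dom ⟶ A.cod) :
    yoneda.map (G.discard n A) ≫ G.unitMor m = G.unitMor (A := P ⊗ A) (n ⊗ₘ m) := by
  rw [← comul_unitMor hG, yoneda_discard, Category.assoc, ← resid_φ₀ G n]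
  have h : (conv.map (G.resid n ≫ 𝕏.φ₀) (G.unitMor m) : 𝕏.T _ _ ⟶ _) =
      conv.map (G.resid n) (G.unitMor m) ≫ conv.map 𝕏.φ₀ (𝟙 _) := by
    rw [← conv.map_comp, Category.comp_id]
  rw [h, Category.assoc, h𝕏.φ₂_unit_left]
  have h₂ := 𝕏.par.map_absorb (𝟙 _) (G.unitMor m) (G.resid n)
  rw [Category.id_comp, PromonoidalData.absorb, conv.map_comp_assoc, Category.comp_id,
    Category.id_comp] at h₂
  rw [h₂]

theorem discard_resid {P A : Splice C} (n : P.dom ⟶ P.cod) (m : A.dom ⟶ A.cod) :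
    yoneda.map (G.discard n A) ≫ G.resid m = G.resid (P := P ⊗ A) (n ⊗ₘ m) := by
  rw [resid, resid, ← discard_unitMor h𝕏 hG, Category.assoc]

omit h𝕏 in
theorem discard_unit (A : Splice C) :
    G.discard (P := 𝟙_ (Splice C)) (𝟙 (𝟙_ C)) A = G.functor.map (λ_ A).hom := by
  apply yoneda.map_injective
  have h : G.resid (P := 𝟙_ (Splice C)) (𝟙 (𝟙_ C)) = G.unitIMor (𝟙 _) := by
    rw [resid, ← unitIMor_φ₀ hG, Category.assoc, IsIso.hom_inv_id, Category.comp_id]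
  rw [yoneda_discard, h, ← comul_left hG, PromonoidalData.absorb]

theorem discard_comul {P : Splice C} (n : P.dom ⟶ P.cod) (A B : Splice C) :
    yoneda.map (G.functor.map (α_ P A B).hom) ≫ yoneda.map (G.discard n (A ⊗ B)) ≫
        G.parMor (𝟙 (A ⊗ B)) =
      G.parMor (𝟙 ((P ⊗ A) ⊗ B)) ≫ conv.map (yoneda.map (G.discard n A)) (𝟙 _) := by
  have h₁ : yoneda.map (G.discard n (A ⊗ B)) ≫ G.parMor (𝟙 (A ⊗ B)) =
      G.parMor (𝟙 (P ⊗ (A ⊗ B))) ≫ conv.map (𝟙 _) (G.parMor (𝟙 (A ⊗ B))) ≫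
        𝕏.par.absorb (G.resid n) _ := by
    rw [yoneda_discard, Category.assoc, 𝕏.par.map_absorb, Category.id_comp]
  have h₂ := congrArg (· ≫ 𝕏.par.absorb (G.resid n) _) (comul_assoc hG P A B)
  simp only [Category.assoc] at h₂
  have h₃ : (conv.map (yoneda.map (G.discard n A)) (𝟙 _) : 𝕏.T _ (yoneda.obj (G.functor.obj B)) ⟶ _) =
      conv.map (G.parMor (𝟙 (P ⊗ A))) (𝟙 _) ≫ conv.map (𝕏.par.absorb (G.resid n) _) (𝟙 _) := by
    rw [← conv.map_comp, Category.comp_id, yoneda_discard]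
  rw [h₁, ← h₂, h₃, PromonoidalData.map_absorb_id h𝕏.par_laws]

theorem discard_discard {P Q : Splice C} (n : P.dom ⟶ P.cod) (m : Q.dom ⟶ Q.cod) (A : Splice C) :
    G.functor.map (α_ P Q A).hom ≫ G.discard n (Q ⊗ A) ≫ G.discard m A =
      G.discard (P := P ⊗ Q) (n ⊗ₘ m) A := by
  apply yoneda.map_injective
  have h := congrArg (· ≫ 𝕏.par.absorb (G.resid m) _) (discard_comul h𝕏 hG n Q A)
  simp only [Category.assoc] at h
  rw [yoneda.map_comp, yoneda.map_comp, yoneda_discard G m, h, 𝕏.par.map_absorb, Category.comp_id,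
    discard_resid h𝕏 hG, yoneda_discard]

theorem seqMor_resid (M : C) :
    G.seqMor (⟨𝟙 M, 𝟙 M, 𝟙 M⟩ : Seq (hat M) (hat M) (hat M)) ≫
        conv.map (G.resid (P := hat M) (𝟙 M)) (G.resid (P := hat M) (𝟙 M)) =
      G.resid (P := hat M) (𝟙 M) ≫ 𝕏.ψ₀ := by
  refine PromonoidalData.mono_of_injective
    (conv.map 𝕏.φ₀ (𝟙 _) ≫ 𝕏.seq.leftExt 𝕏.par.unit) (fun A => ?_) ?_
  · refine Function.Injective.comp (g := (𝕏.seq.leftExt 𝕏.par.unit).app (op A))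
      (PromonoidalData.leftExt_bijective h𝕏.seq_laws _ A).1 (Function.LeftInverse.injective
        (g := (conv.map (inv 𝕏.φ₀) (𝟙 _) : 𝕏.S _ _ ⟶ _).app (op A)) fun w => ?_)
    refine app_congr (s := conv.map 𝕏.φ₀ (𝟙 _) ≫ conv.map (inv 𝕏.φ₀) (𝟙 _)) (t := 𝟙 _) ?_ w
    rw [← conv.map_comp, IsIso.hom_inv_id, Category.comp_id, conv.map_id]
  · have h₁ : (conv.map (G.unitMor (A := hat M) (𝟙 M)) (G.resid (P := hat M) (𝟙 M)) : 𝕏.S _ _ ⟶ _) =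
        conv.map (G.unitMor (A := hat M) (𝟙 M)) (𝟙 _) ≫
          conv.map (𝟙 _) (G.resid (P := hat M) (𝟙 M)) := by
      rw [← conv.map_comp, Category.comp_id, Category.id_comp]
    have h₂ := congrArg (· ≫ G.resid (P := hat M) (𝟙 M)) (seqMor_left hG M)
    simp only [Category.assoc, Category.id_comp] at h₂
    rw [Category.assoc, Category.assoc, h𝕏.ψ₀_counit_left, Category.comp_id, conv.map_comp_assoc,
      resid_φ₀, Category.comp_id, h₁, Category.assoc, 𝕏.seq.leftExt_naturality]
    exact h₂

theorem discard_seqMor {A B D : Splice C} (M : C) (p : Seq A B D) :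
    yoneda.map (G.discard (P := hat M) (𝟙 M) A) ≫ G.seqMor p =
      G.seqMor ((Splice.seqOver C).tens (⟨𝟙 M, 𝟙 M, 𝟙 M⟩ : Seq (hat M) (hat M) (hat M)) p) ≫
        conv.map (yoneda.map (G.discard (P := hat M) (𝟙 M) B))
          (yoneda.map (G.discard (P := hat M) (𝟙 M) D)) := by
  have h₁ := congrArg (· ≫ conv.map (𝕏.par.absorb (G.resid (P := hat M) (𝟙 M)) _)
    (𝕏.par.absorb (G.resid (P := hat M) (𝟙 M)) _))
    (comul_seqMor hG (⟨𝟙 M, 𝟙 M, 𝟙 M⟩ : Seq (hat M) (hat M) (hat M)) p)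
  simp only [Category.assoc] at h₁
  rw [← conv.map_comp, ← yoneda_discard, ← yoneda_discard] at h₁
  refine Eq.trans ?_ h₁
  have h₂ := congrArg (conv.map (G.resid (P := hat M) (𝟙 M)) (G.seqMor p) ≫ ·)
    (h𝕏.ψ₂_par_left (yoneda.obj (G.functor.obj B)) (yoneda.obj (G.functor.obj D)))
  beta_reduce at h₂
  rw [conv.map_comp_assoc, Category.comp_id, ← seqMor_resid h𝕏 hG] at h₂
  have h₃ : (conv.map (G.seqMor (⟨𝟙 M, 𝟙 M, 𝟙 M⟩ : Seq (hat M) (hat M) (hat M)) ≫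
        conv.map (G.resid (P := hat M) (𝟙 M)) (G.resid (P := hat M) (𝟙 M))) (G.seqMor p) :
        𝕏.T _ _ ⟶ _) =
      conv.map (G.seqMor (⟨𝟙 M, 𝟙 M, 𝟙 M⟩ : Seq (hat M) (hat M) (hat M))) (G.seqMor p) ≫
        conv.map (conv.map (G.resid (P := hat M) (𝟙 M)) (G.resid (P := hat M) (𝟙 M)))
          (conv.map (𝟙 _) (𝟙 _)) := by
    rw [← conv.map_comp, conv.map_id, Category.comp_id]
  have h₄ : (conv.map (G.resid (P := hat M) (𝟙 M)) (G.seqMor p) : 𝕏.T _ _ ⟶ _) ≫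
      𝕏.par.leftExt _ = 𝕏.par.absorb (G.resid (P := hat M) (𝟙 M)) _ ≫ G.seqMor p := by
    have h := 𝕏.par.map_absorb (𝟙 _) (G.seqMor p) (G.resid (P := hat M) (𝟙 M))
    rw [Category.id_comp, PromonoidalData.absorb, conv.map_comp_assoc, Category.comp_id,
      Category.id_comp] at h
    exact h
  rw [h₃, h₄, Category.assoc, ← Category.assoc (conv.map (conv.map _ _) _), 𝕏.ψ₂Ext_naturality,
    Category.assoc, ← conv.map_comp] at h₂
  rw [yoneda_discard, Category.assoc, ← h₂]
  rfl

end ProFunctor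

end Produo

namespace Produo

section Collapse

variable {V W : Type u} [SmallCategory V] [SmallCategory W]

theorem collapse_surjective (P : Split V) (B D A : V) :
    Function.Surjective ((conv.collapse P B D).app (op A)) := fun p =>
  ⟨conv.mk (F := yoneda.obj B) (G := yoneda.obj D) p (𝟙 B) (𝟙 D), P.act_id p⟩

theorem PromonoidalData.assocExt_collapse (P : PromonoidalData V) (B D E : V) :
    P.assocExt (yoneda.obj B) (yoneda.obj D) (yoneda.obj E) ≫
        conv.map (𝟙 _) (conv.collapse P.split D E) =
      conv.map (conv.collapse P.split B D) (𝟙 _) ≫ P.assoc B D E :=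
  psh_ext fun A w => by
    induction w using conv.ind with
    | @h U Z p w z =>
    induction w using conv.ind with
    | @h X Y q x y =>
    have h := app_congr (P.assoc_naturality (B := X) (B' := B) (C := Y) (C' := D) (D := Z) (D' := E)
      x y z) (conv.mk p q (𝟙 Z))
    refine Eq.trans ?_ (h.symm.trans (congrArg ((P.assoc B D E).app (op A))
      (conv.congr (P := P.split) (F := P.split.psh B D) (G := yoneda.obj E) rfl rfl
        (Category.id_comp _))))
    have h₁ := app_congr (conv.map_comp (P := P.split) (pt x) (𝟙 (yoneda.obj B))
      (pt₂ (F := yoneda.obj D) (G := yoneda.obj E) P.split y z) (conv.collapse P.split D E))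
      ((P.assoc X Y Z).app (op A) (conv.mk p q (𝟙 Z)))
    exact h₁.symm

theorem PromonoidalData.leftExt_yoneda (P : PromonoidalData V) (B : V) :
    P.leftExt (yoneda.obj B) = P.leftUnitor B :=
  psh_ext fun A w => by
    induction w using conv.ind with
    | @h X Y p j y =>
    refine (app_congr (P.leftUnitor_naturality (B := Y) (B' := B) y)
      (conv.mk p j (𝟙 Y))).symm.trans (congrArg ((P.leftUnitor B).app (op A)) ?_)
    exact conv.congr (P := P.split) (G := yoneda.obj B) rfl rfl (Category.id_comp _)

theorem PromonoidalData.rightExt_yoneda (P : PromonoidalData V) (B : V) :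
    P.rightExt (yoneda.obj B) = P.rightUnitor B :=
  psh_ext fun A w => by
    induction w using conv.ind with
    | @h X Y p x j =>
    refine (app_congr (P.rightUnitor_naturality (B := X) (B' := B) x)
      (conv.mk p (𝟙 X) j)).symm.trans (congrArg ((P.rightUnitor B).app (op A)) ?_)
    exact conv.congr (P := P.split) (F := yoneda.obj B) rfl (Category.id_comp _) rfl

theorem SymProduoidalData.ψ₂Ext_collapse (P : SymProduoidalData V) (X Y Z T : V) :
    P.ψ₂Ext (yoneda.obj X) (yoneda.obj Y) (yoneda.obj Z) (yoneda.obj T) ≫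
        conv.map (conv.collapse P.par.split X Z) (conv.collapse P.par.split Y T) =
      conv.map (conv.collapse P.seq.split X Y) (conv.collapse P.seq.split Z T) ≫ P.ψ₂ X Y Z T :=
  psh_ext fun A w => by
    induction w using conv.ind with
    | @h U W p w w' =>
    induction w using conv.ind with
    | @h X' Y' q x y =>
    induction w' using conv.ind with
    | @h Z' T' r z t =>
    refine Eq.trans ?_ (app_congr (P.ψ₂_naturality (X := X') (X' := X) (Y := Y') (Y' := Y) (Z := Z')
      (Z' := Z) (W := T') (W' := T) x y z t) (conv.mk p q r)).symm
    have h₁ := app_congr (conv.map_comp (P := P.seq.split)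
      (pt₂ (F := yoneda.obj X) (G := yoneda.obj Z) P.par.split x z) (conv.collapse P.par.split X Z)
      (pt₂ (F := yoneda.obj Y) (G := yoneda.obj T) P.par.split y t) (conv.collapse P.par.split Y T))
      ((P.ψ₂ X' Y' Z' T').app (op A) (conv.mk p q r))
    exact h₁.symm

theorem SymProduoidalData.σExt_collapse (P : SymProduoidalData V) (X Y : V) :
    P.σExt (yoneda.obj X) (yoneda.obj Y) ≫ conv.collapse P.par.split Y X =
      conv.collapse P.par.split X Y ≫ P.σ X Y :=
  psh_ext fun A w => by
    induction w using conv.ind with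
    | @h X' Y' p x y =>
    exact (app_congr (P.σ_naturality (B := X') (B' := X) (C := Y') (C' := Y) x y) p).symm

theorem sq_collapse {H : V ⥤ W} {P : Split V} {Q : Split W} (m : SplitMap H P Q) (B D : V) :
    Sq H (conv.collapse P B D) (conv.collapse Q (H.obj B) (H.obj D))
      (m.conv (yonedaMap H B) (yonedaMap H D)) (m.psh B D) := fun A w => by
  induction w using conv.ind with
  | @h X Y p x y =>
  refine Eq.trans ?_ (m.naturality (𝟙 A) x y p).symm
  exact congrArg (fun t => Q.act t (H.map x) (H.map y) (m.app p)) (H.map_id A).symm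

theorem Sq.of_comp {J : V ⥤ W} {E E' E'' : Psh V} {F F' F'' : Psh W} {a : E ⟶ E'} {b : F ⟶ F'}
    {a' : E' ⟶ E''} {b' : F' ⟶ F''} {s : E ⟶ J.op ⋙ F} {s' : E' ⟶ J.op ⋙ F'}
    {s'' : E'' ⟶ J.op ⋙ F''} (ha : ∀ A, Function.Surjective (a.app (op A))) (h : Sq J a b s s')
    (h' : Sq J (a ≫ a') (b ≫ b') s s'') : Sq J a' b' s' s'' := fun A x => by
  obtain ⟨x, rfl⟩ := ha A x
  exact (congrArg (b'.app _) (h A x)).symm.trans (h' A x)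

theorem conv_map_surjective₂ {Q : Split V} {F F' G G' : Psh V} {s : F ⟶ F'} {t : G ⟶ G'}
    (hs : ∀ A, Function.Surjective (s.app (op A))) (ht : ∀ A, Function.Surjective (t.app (op A)))
    (A : V) : Function.Surjective ((conv.map s t : conv Q F G ⟶ _).app (op A)) := by
  intro w
  induction w using conv.ind with
  | @h X Y p x y =>
  obtain ⟨x, rfl⟩ := hs X x
  obtain ⟨y, rfl⟩ := ht Y y
  exact ⟨conv.mk p x y, rfl⟩

theorem surjective_id {F : Psh V} (A : V) : Function.Surjective ((𝟙 F : F ⟶ F).app (op A)) :=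
  fun x => ⟨x, rfl⟩

theorem PreservesPromonoidal.of_sq {H : V ⥤ W} {P : PromonoidalData V} {Q : PromonoidalData W}
    {m : SplitMap H P.split Q.split} {e : P.unit ⟶ H.op ⋙ Q.unit}
    (h₁ : ∀ (F G K : Psh V) (F' G' K' : Psh W) (s : F ⟶ H.op ⋙ F') (t : G ⟶ H.op ⋙ G')
      (r : K ⟶ H.op ⋙ K'), Sq H (P.assocExt F G K) (Q.assocExt F' G' K')
        (m.conv (m.conv s t) r) (m.conv s (m.conv t r)))
    (h₂ : ∀ (F : Psh V) (F' : Psh W) (s : F ⟶ H.op ⋙ F'),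
      Sq H (P.leftExt F) (Q.leftExt F') (m.conv e s) s)
    (h₃ : ∀ (F : Psh V) (F' : Psh W) (s : F ⟶ H.op ⋙ F'),
      Sq H (P.rightExt F) (Q.rightExt F') (m.conv s e) s) : PreservesPromonoidal H P Q m e where
  assoc B D E := by
    refine (Sq.of_comp (a := conv.map (conv.collapse P.split B D) (𝟙 _))
      (b := conv.map (conv.collapse Q.split (H.obj B) (H.obj D)) (𝟙 _))
      (s := m.conv (m.conv (yonedaMap H B) (yonedaMap H D)) (yonedaMap H E))
      (conv_map_surjective₂ (collapse_surjective P.split B D) surjective_id)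
      ((sq_collapse m B D).map m (.id _)) ?_).eq
    rw [← P.assocExt_collapse, ← Q.assocExt_collapse]
    exact (h₁ _ _ _ _ _ _ _ _ _).comp ((Sq.id _).map m (sq_collapse m D E))
  leftUnitor B := by
    have h := h₂ _ _ (yonedaMap H B)
    rw [P.leftExt_yoneda, Q.leftExt_yoneda] at h
    exact h.eq
  rightUnitor B := by
    have h := h₃ _ _ (yonedaMap H B)
    rw [P.rightExt_yoneda, Q.rightExt_yoneda] at h
    exact h.eq

end Collapse

section Descent

variable {U V W : Type u} [SmallCategory U] [SmallCategory V] [SmallCategory W]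

/-- Squares descend along a componentwise surjective map of expressions. -/
theorem Sq.descend {J : U ⥤ V} {H : V ⥤ W} {E E' : Psh U} {F F' : Psh V} {K K' : Psh W}
    {a : E ⟶ E'} {b : F ⟶ F'} {k : K ⟶ K'} {s : E ⟶ J.op ⋙ F} {s' : E' ⟶ J.op ⋙ F'}
    {t : F ⟶ H.op ⋙ K} {t' : F' ⟶ H.op ⋙ K'} {r : E ⟶ (J ⋙ H).op ⋙ K}
    {r' : E' ⟶ (J ⋙ H).op ⋙ K'} (hJ : Function.Surjective J.obj) (hs : Onto s)
    (h : Sq J a b s s') (h' : Sq (J ⋙ H) a k r r')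
    (hr : ∀ A x, r.app (op A) x = t.app (op (J.obj A)) (s.app (op A) x))
    (hr' : ∀ A x, r'.app (op A) x = t'.app (op (J.obj A)) (s'.app (op A) x)) : Sq H b k t t' := by
  intro B y
  obtain ⟨A, rfl⟩ := hJ B
  obtain ⟨x, rfl⟩ := hs A y
  exact (congrArg (k.app _) (hr A x)).symm.trans ((h' A x).trans ((hr' A _).trans
    (congrArg (t'.app _) (h A x).symm)))

variable {𝕌 : SymProduoidalData U} {𝕍 : SymProduoidalData V} {𝕎 : SymProduoidalData W}
  {J : ProFunctor 𝕌 𝕍} {H : ProFunctor 𝕍 𝕎}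

/-- The restriction of a map of expressions along a functor. -/
abbrev ProFunctor.restrict (J : ProFunctor 𝕌 𝕍) (H : ProFunctor 𝕍 𝕎) {F : Psh V} {F' : Psh W}
    (s : F ⟶ H.functor.op ⋙ F') :
    (J.functor.op ⋙ F) ⟶ (J.comp H).functor.op ⋙ F' :=
  Functor.whiskerLeft J.functor.op s

theorem SplitMap.comp_conv {J : U ⥤ V} {H : V ⥤ W} {P : Split U} {Q : Split V} {R : Split W}
    (m : SplitMap J P Q) (n : SplitMap H Q R) {F G : Psh U} {F' G' : Psh V} {F'' G'' : Psh W}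
    {s : F ⟶ J.op ⋙ F'} {t : G ⟶ J.op ⋙ G'} {s' : F' ⟶ H.op ⋙ F''} {t' : G' ⟶ H.op ⋙ G''}
    {r : F ⟶ (J ⋙ H).op ⋙ F''} {r' : G ⟶ (J ⋙ H).op ⋙ G''}
    (hr : ∀ A x, r.app (op A) x = s'.app (op (J.obj A)) (s.app (op A) x))
    (hr' : ∀ A x, r'.app (op A) x = t'.app (op (J.obj A)) (t.app (op A) x)) (A : U)
    (x : (Produo.conv P F G).obj (op A)) :
    ((m.comp n).conv r r').app (op A) x = (n.conv s' t').app (op (J.obj A))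
      ((m.conv s t).app (op A) x) := by
  induction x using conv.ind with
  | @h X Y p x y => exact conv.congr rfl (hr X x) (hr' Y y)

namespace ProFunctor.Covers

/-- A functor out of the target of a covering functor is lawful when its restriction is. -/
theorem isSymProduoidal_of_comp (c : J.Covers) (hJ : J.IsSymProduoidal)
    (h : (J.comp H).IsSymProduoidal) : H.IsSymProduoidal where
  par := .of_sq
    (fun F G K F' G' K' s t r => Sq.descend c.obj (c.par (c.par (.id F) (.id G)) (.id K))
      (hJ.par.sq_assoc _ _ _)
      (h.par.sq_assoc (J.restrict H s) (J.restrict H t) (J.restrict H r))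
      (SplitMap.comp_conv _ _ (SplitMap.comp_conv _ _ (fun _ _ => rfl) fun _ _ => rfl)
        fun _ _ => rfl)
      (SplitMap.comp_conv _ _ (fun _ _ => rfl) (SplitMap.comp_conv _ _ (fun _ _ => rfl)
        fun _ _ => rfl)))
    (fun F F' s => Sq.descend c.obj (c.parUnit_left (.id F)) (hJ.par.sq_left _)
      (h.par.sq_left (J.restrict H s))
      (SplitMap.comp_conv _ _ (fun _ _ => rfl) fun _ _ => rfl) fun _ _ => rfl)
    (fun F F' s => Sq.descend c.obj (c.parUnit_right (.id F)) (hJ.par.sq_right _)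
      (h.par.sq_right (J.restrict H s))
      (SplitMap.comp_conv _ _ (fun _ _ => rfl) fun _ _ => rfl) fun _ _ => rfl)
  seq := .of_sq
    (fun F G K F' G' K' s t r => Sq.descend c.obj (c.seq (c.seq (.id F) (.id G)) (.id K))
      (hJ.seq.sq_assoc _ _ _)
      (h.seq.sq_assoc (J.restrict H s) (J.restrict H t) (J.restrict H r))
      (SplitMap.comp_conv _ _ (SplitMap.comp_conv _ _ (fun _ _ => rfl) fun _ _ => rfl)
        fun _ _ => rfl)
      (SplitMap.comp_conv _ _ (fun _ _ => rfl) (SplitMap.comp_conv _ _ (fun _ _ => rfl)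
        fun _ _ => rfl)))
    (fun F F' s => Sq.descend c.obj (c.seq c.unitN (.id F)) (hJ.seq.sq_left _)
      (h.seq.sq_left (J.restrict H s))
      (SplitMap.comp_conv _ _ (fun _ _ => rfl) fun _ _ => rfl) fun _ _ => rfl)
    (fun F F' s => Sq.descend c.obj (c.seq (.id F) c.unitN) (hJ.seq.sq_right _)
      (h.seq.sq_right (J.restrict H s))
      (SplitMap.comp_conv _ _ (fun _ _ => rfl) fun _ _ => rfl) fun _ _ => rfl)
  ψ₂ X Y Z T := by
    refine (Sq.of_comp
      (a := conv.map (conv.collapse 𝕍.seq.split X Y) (conv.collapse 𝕍.seq.split Z T))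
      (b := conv.map (conv.collapse 𝕎.seq.split _ _) (conv.collapse 𝕎.seq.split _ _))
      (conv_map_surjective₂ (collapse_surjective 𝕍.seq.split X Y)
        (collapse_surjective 𝕍.seq.split Z T))
      ((sq_collapse H.mapSeq X Y).map H.mapPar (sq_collapse H.mapSeq Z T)) ?_).eq
    rw [← 𝕍.ψ₂Ext_collapse, ← 𝕎.ψ₂Ext_collapse]
    refine Sq.comp ?_ ((sq_collapse H.mapPar X Z).map H.mapSeq (sq_collapse H.mapPar Y T))
    exact Sq.descend c.obj (c.par (c.seq (.id _) (.id _)) (c.seq (.id _) (.id _)))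
      (hJ.sq_ψ₂ _ _ _ _)
      (h.sq_ψ₂ (J.restrict H (yonedaMap H.functor X)) (J.restrict H (yonedaMap H.functor Y))
        (J.restrict H (yonedaMap H.functor Z)) (J.restrict H (yonedaMap H.functor T)))
      (SplitMap.comp_conv _ _ (SplitMap.comp_conv _ _ (fun _ _ => rfl) fun _ _ => rfl)
        (SplitMap.comp_conv _ _ (fun _ _ => rfl) fun _ _ => rfl))
      (SplitMap.comp_conv _ _ (SplitMap.comp_conv _ _ (fun _ _ => rfl) fun _ _ => rfl)
        (SplitMap.comp_conv _ _ (fun _ _ => rfl) fun _ _ => rfl))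
  ψ₀ := psh_ext fun B j => by
    obtain ⟨A, l, x, rfl⟩ := c.unitI B j
    rw [NatTrans.naturality_apply, NatTrans.naturality_apply]
    refine congrArg _ ?_
    refine Eq.trans ?_ (h.sq_ψ₀ A x).symm
    refine (congrArg ((H.mapSeq.conv H.mapI H.mapI).app _) (hJ.sq_ψ₀ A x)).trans ?_
    exact (SplitMap.comp_conv J.mapSeq H.mapSeq (fun _ _ => rfl) (fun _ _ => rfl) A _).symm
  φ₂ := (Sq.descend c.obj (c.par c.unitN c.unitN) hJ.sq_φ₂ h.sq_φ₂
    (SplitMap.comp_conv _ _ (fun _ _ => rfl) fun _ _ => rfl) fun _ _ => rfl).eq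
  φ₀ := psh_ext fun B j => by
    obtain ⟨A, l, x, rfl⟩ := c.unitI B j
    rw [NatTrans.naturality_apply, NatTrans.naturality_apply]
    refine congrArg _ ?_
    refine Eq.trans ?_ (h.sq_φ₀ A x).symm
    exact congrArg (H.mapN.app _) (hJ.sq_φ₀ A x)
  σ B D := by
    refine (Sq.of_comp (a := conv.collapse 𝕍.par.split B D) (b := conv.collapse 𝕎.par.split _ _)
      (collapse_surjective 𝕍.par.split B D) (sq_collapse H.mapPar B D) ?_).eq
    rw [← 𝕍.σExt_collapse, ← 𝕎.σExt_collapse]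
    refine Sq.comp ?_ (sq_collapse H.mapPar D B)
    exact Sq.descend c.obj (c.par (.id _) (.id _)) (hJ.sq_σ _ _)
      (h.sq_σ (J.restrict H (yonedaMap H.functor B)) (J.restrict H (yonedaMap H.functor D)))
      (SplitMap.comp_conv _ _ (fun _ _ => rfl) fun _ _ => rfl)
      (SplitMap.comp_conv _ _ (fun _ _ => rfl) fun _ _ => rfl)

end ProFunctor.Covers

end Descent

end Produo

namespace Produo

theorem pt_injective {V : Type u} [SmallCategory V] {F : Psh V} {X : V} {x y : F.obj (op X)}
    (h : pt x = pt y) : x = y :=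
  yonedaEquiv.symm.injective h

theorem SplitMap.act_app {V W : Type u} [SmallCategory V] [SmallCategory W] {F : V ⥤ W} {P : Split V}
    {Q : Split W} (m : SplitMap F P Q) {A X X' Y Y' : V} {B Z T : W} (f : B ⟶ F.obj A) (u : X ⟶ X')
    (v : Y ⟶ Y') (z : F.obj X' ⟶ Z) (t : F.obj Y' ⟶ T) (p : P.el A X Y) :
    Q.act f z t (m.app (P.act (𝟙 A) u v p)) = Q.act f (F.map u ≫ z) (F.map v ≫ t) (m.app p) := by
  rw [m.naturality, Q.act_act, F.map_id, Category.comp_id]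

namespace ProFunctor

open Splice SeqOver Lens

variable {C : Type u} [SmallCategory C] [MonoidalCategory C] [SymmetricCategory C]
  {X : Type u} [SmallCategory X] {𝕏 : SymProduoidalData X} (G : ProFunctor (spliced C) 𝕏)
  [IsIso 𝕏.φ₀]

local notation "J" => inclusionFunctor C

/-- The morphism `G (M̂ ⊗ A) ⟶ G A` discarding the residual `M`. -/
noncomputable abbrev drop (M : C) (A : Splice C) :
    G.functor.obj (hat M ⊗ A) ⟶ G.functor.obj A :=
  G.discard (P := hat M) (𝟙 M) A

theorem map_homMk_drop {M M' : C} (a : M ⟶ M') (A : Splice C) :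
    G.functor.map ((homMk a (𝟙 M') : (⟨M, M'⟩ : Splice C) ⟶ hat M') ▷ A) ≫ G.drop M' A =
      G.discard (P := ⟨M, M'⟩) a A := by
  rw [map_whiskerRight_discard]
  exact congrArg (fun t => G.discard (P := ⟨M, M'⟩) t A) (show a ≫ 𝟙 _ ≫ 𝟙 _ = a by simp)

theorem map_homMk_drop' {M M' : C} (a : M ⟶ M') (A : Splice C) :
    G.functor.map ((homMk (𝟙 M) a : (⟨M, M'⟩ : Splice C) ⟶ hat M) ▷ A) ≫ G.drop M A =
      G.discard (P := ⟨M, M'⟩) a A := by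
  rw [map_whiskerRight_discard]
  exact congrArg (fun t => G.discard (P := ⟨M, M'⟩) t A) (show 𝟙 _ ≫ 𝟙 _ ≫ a = a by simp)

/-- The image of a lens. -/
noncomputable def lensMap {A B : Splice C} (l : (J).obj A ⟶ (J).obj B) :
    G.functor.obj A ⟶ G.functor.obj B :=
  Quot.lift (fun r : Rep ((J).obj A) ((J).obj B) =>
      G.functor.map (homMk r.fst r.snd : A ⟶ hat r.M ⊗ B) ≫ G.drop r.M B)
    (by
      rintro _ _ ⟨a, f, g⟩
      rename_i M M'
      have h₁ : (homMk (f ≫ a ▷ B.dom) g : A ⟶ hat M' ⊗ B) =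
          (homMk f g : A ⟶ (⟨M, M'⟩ : Splice C) ⊗ B) ≫ homMk a (𝟙 M') ▷ B :=
        Splice.hom_ext rfl (show g = 𝟙 _ ▷ B.cod ≫ g by simp)
      have h₂ : (homMk f (a ▷ B.cod ≫ g) : A ⟶ hat M ⊗ B) =
          (homMk f g : A ⟶ (⟨M, M'⟩ : Splice C) ⊗ B) ≫ homMk (𝟙 M) a ▷ B :=
        Splice.hom_ext (show f = f ≫ 𝟙 _ ▷ B.dom by simp) rfl
      refine (congrArg (fun t => G.functor.map t ≫ G.drop M' B) h₁).trans (Eq.trans ?_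
        (congrArg (fun t => G.functor.map t ≫ G.drop M B) h₂).symm)
      rw [G.functor.map_comp, G.functor.map_comp, Category.assoc, Category.assoc, map_homMk_drop,
        map_homMk_drop']) l

theorem lensMap_lens {A B : Splice C} {M : C} (f : A.dom ⟶ M ⊗ B.dom) (g : M ⊗ B.cod ⟶ A.cod) :
    G.lensMap (lens (A := (J).obj A) (X := (J).obj B) f g) =
      G.functor.map (homMk f g : A ⟶ hat M ⊗ B) ≫ G.drop M B := rfl

/-- The image of a sequential split of lenses. -/
noncomputable def lensSeq {A B D : Splice C} (p : Lens.Seq ((J).obj A) ((J).obj B) ((J).obj D)) :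
    𝕏.seq.split.el (G.functor.obj A) (G.functor.obj B) (G.functor.obj D) :=
  Quot.lift (fun r : SeqRep ((J).obj A) ((J).obj B) ((J).obj D) =>
      𝕏.seq.split.act (𝟙 _) (G.drop r.M B) (G.drop r.N D)
        (G.mapSeq.app (⟨r.fst, r.mid, r.snd⟩ : Splice.Seq A (hat r.M ⊗ B) (hat r.N ⊗ D))))
    (by
      rintro _ _ ⟨a, b, f, m, s⟩
      rename_i M M' N N'
      have h₁ : (⟨f ≫ a ▷ B.dom, m ≫ b ▷ D.dom, s⟩ : Splice.Seq A (hat M' ⊗ B) (hat N' ⊗ D)) =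
          (Splice.seqSplit C).act (𝟙 A) (homMk a (𝟙 M') ▷ B) (homMk b (𝟙 N') ▷ D)
            (⟨f, m, s⟩ : Splice.Seq A ((⟨M, M'⟩ : Splice C) ⊗ B) ((⟨N, N'⟩ : Splice C) ⊗ D)) :=
        Splice.Seq.ext (show f ≫ a ▷ B.dom = 𝟙 _ ≫ f ≫ a ▷ B.dom by simp)
          (show m ≫ b ▷ D.dom = 𝟙 _ ▷ B.cod ≫ m ≫ b ▷ D.dom by simp)
          (show s = 𝟙 _ ▷ D.cod ≫ s ≫ 𝟙 _ by simp)
      have h₂ : (⟨f, a ▷ B.cod ≫ m, b ▷ D.cod ≫ s⟩ : Splice.Seq A (hat M ⊗ B) (hat N ⊗ D)) =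
          (Splice.seqSplit C).act (𝟙 A) (homMk (𝟙 M) a ▷ B) (homMk (𝟙 N) b ▷ D)
            (⟨f, m, s⟩ : Splice.Seq A ((⟨M, M'⟩ : Splice C) ⊗ B) ((⟨N, N'⟩ : Splice C) ⊗ D)) :=
        Splice.Seq.ext (show f = 𝟙 _ ≫ f ≫ 𝟙 _ ▷ B.dom by simp)
          (show a ▷ B.cod ≫ m = a ▷ B.cod ≫ m ≫ 𝟙 _ ▷ D.dom by simp)
          (show b ▷ D.cod ≫ s = b ▷ D.cod ≫ s ≫ 𝟙 _ by simp)
      refine (congrArg (fun t => 𝕏.seq.split.act (𝟙 _) (G.drop M' B) (G.drop N' D)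
        (G.mapSeq.app t)) h₁).trans (Eq.trans ?_ (congrArg (fun t => 𝕏.seq.split.act (𝟙 _)
          (G.drop M B) (G.drop N D) (G.mapSeq.app t)) h₂).symm)
      refine (G.mapSeq.act_app (𝟙 _) _ _ _ _ _).trans (Eq.trans ?_
        (G.mapSeq.act_app (𝟙 _) _ _ _ _ _).symm)
      rw [map_homMk_drop, map_homMk_drop, map_homMk_drop', map_homMk_drop']) p

theorem lensSeq_seq {A B D : Splice C} {M N : C} (f : A.dom ⟶ M ⊗ B.dom)
    (m : M ⊗ B.cod ⟶ N ⊗ D.dom) (s : N ⊗ D.cod ⟶ A.cod) :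
    G.lensSeq (seq (A := (J).obj A) (X := (J).obj B) (Y := (J).obj D) f m s) =
      𝕏.seq.split.act (𝟙 _) (G.drop M B) (G.drop N D)
        (G.mapSeq.app (⟨f, m, s⟩ : Splice.Seq A (hat M ⊗ B) (hat N ⊗ D))) := rfl

theorem map_lensMap {A B D : Splice C} (f : A ⟶ B) (l : (J).obj B ⟶ (J).obj D) :
    G.lensMap ((J).map f ≫ l) = G.functor.map f ≫ G.lensMap l := by
  induction l using lens_ind with
  | @h M g h =>
  refine (congrArg G.lensMap (pair_comp_lens (A := (J).obj A) (X := (J).obj B) (Z := (J).obj D)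
    f.fst f.snd g h)).trans ?_
  rw [lensMap_lens, lensMap_lens, ← Category.assoc, ← G.functor.map_comp]
  rfl

variable {G} (h𝕏 : 𝕏.IsSymProduoidal) (hG : G.IsSymProduoidal)
include h𝕏 hG

theorem drop_drop (M N : C) (A : Splice C) :
    G.drop M (hat N ⊗ A) ≫ G.drop N A =
      G.functor.map (α_ (hat M) (hat N) A).inv ≫ G.drop (M ⊗ N) A := by
  have h := discard_discard h𝕏 hG (P := hat M) (Q := hat N) (𝟙 M) (𝟙 N) A
  have h₂ : (𝟙 M ⊗ₘ 𝟙 N) = 𝟙 (M ⊗ N) := by simp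
  rw [show G.drop (M ⊗ N) A = G.discard (P := hat M ⊗ hat N) (𝟙 M ⊗ₘ 𝟙 N) A from
    congrArg (fun t => G.discard (P := hat (M ⊗ N)) t A) h₂.symm, ← h, ← Category.assoc,
    ← G.functor.map_comp, Iso.inv_hom_id, G.functor.map_id, Category.id_comp]

omit h𝕏 in
theorem drop_unit (A : Splice C) : G.drop (𝟙_ C) A = G.functor.map (λ_ A).hom :=
  discard_unit hG A

theorem drop_lensMap {A B : Splice C} (M : C) {N : C} (f : A.dom ⟶ N ⊗ B.dom)
    (g : N ⊗ B.cod ⟶ A.cod) :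
    G.drop M A ≫ G.lensMap (lens (A := (J).obj A) (X := (J).obj B) f g) =
      G.functor.map (hat M ◁ (homMk f g : A ⟶ hat N ⊗ B) ≫ (α_ (hat M) (hat N) B).inv) ≫
        G.drop (M ⊗ N) B := by
  rw [lensMap_lens, ← Category.assoc, ← map_whiskerLeft_discard, Category.assoc,
    drop_drop h𝕏 hG, G.functor.map_comp, Category.assoc]

theorem lensMap_comp {A B D : Splice C} (l : (J).obj A ⟶ (J).obj B) (m : (J).obj B ⟶ (J).obj D) :
    G.lensMap (l ≫ m) = G.lensMap l ≫ G.lensMap m := by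
  induction l using lens_ind with
  | @h M f g =>
  induction m using lens_ind with
  | @h N f' g' =>
  refine Eq.trans ?_ (Eq.trans (congrArg (G.functor.map (homMk f g : A ⟶ hat M ⊗ B) ≫ ·)
    (drop_lensMap h𝕏 hG M f' g').symm) (Category.assoc _ _ _).symm)
  rw [← Category.assoc, ← G.functor.map_comp]
  refine congrArg (fun t => G.functor.map t ≫ G.drop (M ⊗ N) D)
    (Splice.hom_ext rfl (?_ : _ = ((α_ M N D.cod).hom ≫ M ◁ g') ≫ g))
  exact (Category.assoc _ _ _).symm

omit h𝕏 in
theorem lensMap_map {A B : Splice C} (f : A ⟶ B) : G.lensMap ((J).map f) = G.functor.map f := by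
  refine (G.lensMap_lens (A := A) (B := B) (f.fst ≫ (λ_ B.dom).inv) ((λ_ B.cod).hom ≫ f.snd)).trans ?_
  rw [drop_unit hG, ← G.functor.map_comp]
  refine congrArg G.functor.map (Splice.hom_ext ?_ ?_)
  · exact show (f.fst ≫ (λ_ B.dom).inv) ≫ (λ_ B.dom).hom = f.fst by simp
  · exact show (λ_ B.cod).inv ≫ (λ_ B.cod).hom ≫ f.snd = f.snd by simp

omit h𝕏 in
theorem lensMap_id (A : Splice C) : G.lensMap (𝟙 ((J).obj A)) = 𝟙 _ := by
  have h := lensMap_map hG (𝟙 A)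
  rwa [(J).map_id, G.functor.map_id] at h

omit h𝕏 hG in
theorem lensMap_eps (M : C) (A : Splice C) : G.lensMap (eps M A) = G.drop M A := by
  refine (G.lensMap_lens (A := hat M ⊗ A) (B := A) (M := M) (𝟙 _) (𝟙 _)).trans ?_
  exact (congrArg (· ≫ G.drop M A) (G.functor.map_id (hat M ⊗ A))).trans (Category.id_comp _)

omit h𝕏 hG in
theorem eps_tensorHom_id (M : C) (A B : Splice C) :
    eps M A ⊗ₘ 𝟙 ((J).obj B) = (J).map (α_ (hat M) A B).hom ≫ eps M (A ⊗ B) := by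
  have h := inclusionPar_comp_eps (A := (hat M ⊗ A) ⊗ B) (X := A) (Y := B) (M := M)
    (α_ M A.dom B.dom).hom (α_ M A.cod B.cod).inv
  have h₂ : (Splice.homMk (A := (hat M ⊗ A) ⊗ B) (X := (hat M ⊗ A) ⊗ B)
      ((α_ M A.dom B.dom).hom ≫ (α_ M A.dom B.dom).inv)
      ((α_ M A.cod B.cod).hom ≫ (α_ M A.cod B.cod).inv)) = 𝟙 _ :=
    Splice.hom_ext (Iso.hom_inv_id _) (Iso.hom_inv_id _)
  rw [h₂, inclusion_par_id] at h
  refine ((Category.id_comp _).symm.trans h).trans ?_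
  exact (map_comp_eps (A := (hat M ⊗ A) ⊗ B) (X := A ⊗ B) (α_ M A.dom B.dom).hom
    (α_ M A.cod B.cod).inv).symm

theorem lensMap_comul_left {A A' : Splice C} (l : (J).obj A ⟶ (J).obj A') (B : Splice C) :
    yoneda.map (G.lensMap (A := A ⊗ B) (B := A' ⊗ B) (l ⊗ₘ 𝟙 ((J).obj B))) ≫
        G.parMor (𝟙 (A' ⊗ B)) =
      G.parMor (𝟙 (A ⊗ B)) ≫ conv.map (yoneda.map (G.lensMap l)) (𝟙 _) := by
  obtain ⟨M, a, rfl⟩ := exists_map_comp_eps l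
  have h₁ : ((J).map a ≫ eps M A') ⊗ₘ 𝟙 ((J).obj B) =
      (J).map (a ⊗ₘ 𝟙 B) ≫ (J).map (α_ (hat M) A' B).hom ≫ eps M (A' ⊗ B) := by
    rw [← eps_tensorHom_id]
    refine Eq.trans ?_ (congrArg (· ≫ (eps M A' ⊗ₘ 𝟙 ((J).obj B))) (pair_tensorHom_pair
      (A := (J).obj A) (A' := (J).obj B) (X := (J).obj (hat M ⊗ A')) (X' := (J).obj B)
      a.fst a.snd (𝟙 B.dom) (𝟙 B.cod)))
    refine Eq.trans ?_ (congrArg (fun t => (_ ⊗ₘ t) ≫ (eps M A' ⊗ₘ 𝟙 ((J).obj B)))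
      (pair_id ((J).obj B)).symm)
    rw [MonoidalCategory.tensorHom_comp_tensorHom, Category.comp_id]
  have h₂ := congrArg (G.lensMap (A := A ⊗ B) (B := A' ⊗ B)) h₁
  have h₃ : G.lensMap (A := A ⊗ B) (B := A' ⊗ B)
      ((J).map (a ⊗ₘ 𝟙 B) ≫ (J).map (α_ (hat M) A' B).hom ≫ eps M (A' ⊗ B)) =
      G.functor.map (a ⊗ₘ 𝟙 B) ≫ G.functor.map (α_ (hat M) A' B).hom ≫ G.drop M (A' ⊗ B) := by
    rw [map_lensMap, map_lensMap, lensMap_eps]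
  rw [h₂, h₃, yoneda.map_comp, yoneda.map_comp, Category.assoc, Category.assoc,
    discard_comul h𝕏 hG, map_lensMap, lensMap_eps, yoneda.map_comp, ← Category.assoc,
    comul_naturality, Category.assoc, ← conv.map_comp, G.functor.map_id, yoneda.map_id,
    Category.comp_id]

theorem lensMap_comul_right (A : Splice C) {B B' : Splice C} (l : (J).obj B ⟶ (J).obj B') :
    yoneda.map (G.lensMap (A := A ⊗ B) (B := A ⊗ B') (𝟙 ((J).obj A) ⊗ₘ l)) ≫
        G.parMor (𝟙 (A ⊗ B')) =
      G.parMor (𝟙 (A ⊗ B)) ≫ conv.map (𝟙 _) (yoneda.map (G.lensMap l)) := by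
  have h₁ : 𝟙 ((J).obj A) ⊗ₘ l = (J).map (β_ A B).hom ≫ (l ⊗ₘ 𝟙 ((J).obj A)) ≫
      (J).map (β_ B' A).hom := by
    have h := BraidedCategory.braiding_naturality (𝟙 ((J).obj A)) l
    have h' := congrArg (· ≫ (β_ ((J).obj B') ((J).obj A)).hom) h
    simp only [Category.assoc, SymmetricCategory.symmetry, Category.comp_id] at h'
    exact h'
  have h₂ := congrArg (G.lensMap (A := A ⊗ B) (B := A ⊗ B')) h₁
  have h₃ : G.lensMap (A := A ⊗ B) (B := A ⊗ B') ((J).map (β_ A B).hom ≫ (l ⊗ₘ 𝟙 ((J).obj A)) ≫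
      (J).map (β_ B' A).hom) = G.functor.map (β_ A B).hom ≫
        G.lensMap (A := B ⊗ A) (B := B' ⊗ A) (l ⊗ₘ 𝟙 ((J).obj A)) ≫
          G.functor.map (β_ B' A).hom := by
    rw [map_lensMap]
    refine congrArg _ ?_
    refine (lensMap_comp h𝕏 hG (A := B ⊗ A) (B := B' ⊗ A) (D := A ⊗ B') _ _).trans ?_
    rw [lensMap_map hG]
  rw [h₂, h₃, yoneda.map_comp, yoneda.map_comp, Category.assoc, Category.assoc,
    ← comul_braiding hG, ← Category.assoc (yoneda.map (G.lensMap _)), lensMap_comul_left h𝕏 hG,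
    Category.assoc, 𝕏.σExt_naturality, ← Category.assoc, ← comul_braiding hG, Category.assoc,
    ← Category.assoc (𝕏.σExt _ _), 𝕏.σExt_symmetry h𝕏, Category.id_comp]

theorem lensMap_comul {A A' B B' : Splice C} (l : (J).obj A ⟶ (J).obj A')
    (m : (J).obj B ⟶ (J).obj B') :
    yoneda.map (G.lensMap (A := A ⊗ B) (B := A' ⊗ B') (l ⊗ₘ m)) ≫ G.parMor (𝟙 (A' ⊗ B')) =
      G.parMor (𝟙 (A ⊗ B)) ≫ conv.map (yoneda.map (G.lensMap l)) (yoneda.map (G.lensMap m)) := by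
  have h₁ : l ⊗ₘ m = (l ⊗ₘ 𝟙 ((J).obj B)) ≫ (𝟙 ((J).obj A') ⊗ₘ m) := by
    rw [MonoidalCategory.tensorHom_comp_tensorHom, Category.comp_id, Category.id_comp]
  have h₂ := (congrArg (G.lensMap (A := A ⊗ B) (B := A' ⊗ B')) h₁).trans
    (lensMap_comp h𝕏 hG (A := A ⊗ B) (B := A' ⊗ B) (D := A' ⊗ B') _ _)
  rw [h₂, yoneda.map_comp, Category.assoc, lensMap_comul_right h𝕏 hG, ← Category.assoc,
    lensMap_comul_left h𝕏 hG, Category.assoc, ← conv.map_comp, Category.comp_id, Category.id_comp]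

end ProFunctor

end Produo

namespace Produo

namespace ProFunctor

open Splice SeqOver Lens

variable {C : Type u} [SmallCategory C] [MonoidalCategory C] [SymmetricCategory C]
  {X : Type u} [SmallCategory X] {𝕏 : SymProduoidalData X} {G : ProFunctor (spliced C) 𝕏}
  [IsIso 𝕏.φ₀] (h𝕏 : 𝕏.IsSymProduoidal) (hG : G.IsSymProduoidal)

local notation "J" => inclusionFunctor C

include h𝕏 hG

theorem lensSeq_actY {A B D D' : Splice C} (l : (J).obj D ⟶ (J).obj D')
    (p : Lens.Seq ((J).obj A) ((J).obj B) ((J).obj D)) :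
    G.lensSeq (actY l p) = 𝕏.seq.split.act (𝟙 _) (𝟙 _) (G.lensMap l) (G.lensSeq p) := by
  induction p using seq_ind with
  | @h M N f m s =>
  induction l using lens_ind with
  | @h R g h =>
  refine Eq.trans ?_ (𝕏.seq.split.act_act _ _ _ _ _ _ _).symm
  rw [drop_lensMap h𝕏 hG, Category.comp_id, Category.comp_id]
  refine Eq.trans ?_ ((G.mapSeq.act_app (A := A) (X := hat M ⊗ B) (Y := hat N ⊗ D) (𝟙 _) (𝟙 _)
    (hat N ◁ (homMk g h : D ⟶ hat R ⊗ D') ≫ (α_ (hat N) (hat R) D').inv)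
    (G.drop M B) (G.drop (N ⊗ R) D')
    (⟨f, m, s⟩ : Splice.Seq A (hat M ⊗ B) (hat N ⊗ D))).trans ?_)
  · refine congrArg (fun t => 𝕏.seq.split.act (𝟙 _) (G.drop M B) (G.drop (N ⊗ R) D')
      (G.mapSeq.app t)) (Splice.Seq.ext (A := A) (X := hat M ⊗ B) (Y := hat (N ⊗ R) ⊗ D') ?_ ?_ ?_)
    · exact show f = 𝟙 _ ≫ f ≫ 𝟙 _ by simp
    · exact show m ≫ N ◁ g ≫ (α_ N R D'.dom).inv = 𝟙 _ ≫ m ≫ N ◁ g ≫ (α_ N R D'.dom).inv by simp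
    · exact show (α_ N R D'.cod).hom ≫ N ◁ h ≫ s = ((α_ N R D'.cod).hom ≫ N ◁ h) ≫ s ≫ 𝟙 _ by simp
  · rw [G.functor.map_id, Category.id_comp]

theorem lensSeq_actX {A B B' D : Splice C} (l : (J).obj B ⟶ (J).obj B')
    (p : Lens.Seq ((J).obj A) ((J).obj B) ((J).obj D)) :
    G.lensSeq (actX l p) = 𝕏.seq.split.act (𝟙 _) (G.lensMap l) (𝟙 _) (G.lensSeq p) := by
  induction p using seq_ind with
  | @h M N f m s =>
  induction l using lens_ind with
  | @h R g h =>
  refine Eq.trans ?_ (𝕏.seq.split.act_act _ _ _ _ _ _ _).symm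
  rw [drop_lensMap h𝕏 hG, Category.comp_id, Category.comp_id]
  refine Eq.trans ?_ ((G.mapSeq.act_app (A := A) (X := hat M ⊗ B) (Y := hat N ⊗ D) (𝟙 _)
    (hat M ◁ (homMk g h : B ⟶ hat R ⊗ B') ≫ (α_ (hat M) (hat R) B').inv) (𝟙 _)
    (G.drop (M ⊗ R) B') (G.drop N D)
    (⟨f, m, s⟩ : Splice.Seq A (hat M ⊗ B) (hat N ⊗ D))).trans ?_)
  · refine congrArg (fun t => 𝕏.seq.split.act (𝟙 _) (G.drop (M ⊗ R) B') (G.drop N D)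
      (G.mapSeq.app t)) (Splice.Seq.ext (A := A) (X := hat (M ⊗ R) ⊗ B') (Y := hat N ⊗ D) ?_ ?_ ?_)
    · exact show f ≫ M ◁ g ≫ (α_ M R B'.dom).inv = 𝟙 _ ≫ f ≫ M ◁ g ≫ (α_ M R B'.dom).inv by simp
    · exact show (α_ M R B'.cod).hom ≫ M ◁ h ≫ m = ((α_ M R B'.cod).hom ≫ M ◁ h) ≫ m ≫ 𝟙 _ by simp
    · exact show s = 𝟙 _ ≫ s ≫ 𝟙 _ by simp
  · rw [G.functor.map_id, Category.id_comp]

theorem lensSeq_actA {A A' B D : Splice C} (l : (J).obj A' ⟶ (J).obj A)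
    (p : Lens.Seq ((J).obj A) ((J).obj B) ((J).obj D)) :
    G.lensSeq (actA l p) = 𝕏.seq.split.act (G.lensMap l) (𝟙 _) (𝟙 _) (G.lensSeq p) := by
  induction p using seq_ind with
  | @h M N f m s =>
  induction l using lens_ind with
  | @h R g h =>
  refine Split.mor_injective _ ?_
  have h₁ := discard_seqMor h𝕏 hG R (⟨f, m, s⟩ : Splice.Seq A (hat M ⊗ B) (hat N ⊗ D))
  have h₂ : 𝕏.seq.split.mor (𝕏.seq.split.act (G.lensMap (lens (A := (J).obj A') (X := (J).obj A) g h))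
      (𝟙 _) (𝟙 _) (G.lensSeq (seq (A := (J).obj A) (X := (J).obj B) (Y := (J).obj D) f m s))) =
      yoneda.map (G.functor.map (homMk g h : A' ⟶ hat R ⊗ A)) ≫ yoneda.map (G.drop R A) ≫
        G.seqMor (⟨f, m, s⟩ : Splice.Seq A (hat M ⊗ B) (hat N ⊗ D)) ≫
          conv.map (yoneda.map (G.drop M B)) (yoneda.map (G.drop N D)) := by
    refine (congrArg 𝕏.seq.split.mor (𝕏.seq.split.act_act _ _ _ _ _ _ _)).trans
      ((Split.mor_act _ _ _ _ _).trans ?_)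
    rw [lensMap_lens, Category.comp_id, Category.comp_id, Category.comp_id, yoneda.map_comp,
      Category.assoc]
    rfl
  refine Eq.trans ?_ h₂.symm
  rw [← Category.assoc (yoneda.map (G.drop R A)), h₁, Category.assoc, ← conv.map_comp,
    ← yoneda.map_comp, ← yoneda.map_comp, drop_drop h𝕏 hG, drop_drop h𝕏 hG]
  refine (Split.mor_act _ _ _ _ _).trans ?_
  have h₃ : (⟨g ≫ R ◁ f ≫ (α_ R M B.dom).inv, (α_ R M B.cod).hom ≫ R ◁ m ≫ (α_ R N D.dom).inv,
      (α_ R N D.cod).hom ≫ R ◁ s ≫ h⟩ : Splice.Seq A' (hat (R ⊗ M) ⊗ B) (hat (R ⊗ N) ⊗ D)) =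
      (Splice.seqSplit C).act (homMk g h : A' ⟶ hat R ⊗ A) (α_ (hat R) (hat M) B).inv
        (α_ (hat R) (hat N) D).inv
        ((Splice.seqOver C).tens (⟨𝟙 R, 𝟙 R, 𝟙 R⟩ : Splice.Seq (hat R) (hat R) (hat R))
          (⟨f, m, s⟩ : Splice.Seq A (hat M ⊗ B) (hat N ⊗ D))) := by
    refine Splice.Seq.ext ?_ ?_ ?_
    · exact show g ≫ R ◁ f ≫ (α_ R M B.dom).inv = g ≫ (𝟙 R ⊗ₘ f) ≫ (α_ R M B.dom).inv by simp
    · exact show (α_ R M B.cod).hom ≫ R ◁ m ≫ (α_ R N D.dom).inv =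
        (α_ R M B.cod).hom ≫ (𝟙 R ⊗ₘ m) ≫ (α_ R N D.dom).inv by simp
    · exact show (α_ R N D.cod).hom ≫ R ◁ s ≫ h = (α_ R N D.cod).hom ≫ (𝟙 R ⊗ₘ s) ≫ h by simp
  have h₄ := (congrArg G.seqMor h₃).trans (G.mapSeq.mor_act _ _ _ _)
  have h₅ : 𝕏.seq.split.mor (G.mapSeq.app (⟨g ≫ R ◁ f ≫ (α_ R M B.dom).inv,
      (α_ R M B.cod).hom ≫ R ◁ m ≫ (α_ R N D.dom).inv,
      (α_ R N D.cod).hom ≫ R ◁ s ≫ h⟩ : Splice.Seq A' (hat (R ⊗ M) ⊗ B) (hat (R ⊗ N) ⊗ D))) = _ := h₄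
  refine (congrArg (fun t => yoneda.map (𝟙 _) ≫ t ≫ conv.map (yoneda.map (G.drop (R ⊗ M) B))
    (yoneda.map (G.drop (R ⊗ N) D))) h₅).trans ?_
  rw [yoneda.map_id, Category.id_comp, Category.assoc, Category.assoc, yoneda.map_comp,
    yoneda.map_comp, conv.map_comp]

theorem lensMap_unit {A B : Splice C} (l : (J).obj A ⟶ (J).obj B) (n : B.dom ⟶ B.cod) :
    G.mapN.app (op A) (ofArrow (A := A) (actN C l n)) =
      𝕏.seq.unit.map (G.lensMap l).op (G.mapN.app (op B) (ofArrow n)) := by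
  induction l using lens_ind with
  | @h M f g =>
  refine pt_injective (X := G.functor.obj A) (Eq.trans ?_ (map_comp_pt _ _))
  have h₁ : G.unitMor (A := A) (f ≫ (𝟙 M ⊗ₘ n) ≫ g) =
      yoneda.map (G.functor.map (homMk f g : A ⟶ hat M ⊗ B)) ≫
        G.unitMor (A := hat M ⊗ B) (𝟙 M ⊗ₘ n) :=
    G.unitMor_act (homMk f g : A ⟶ hat M ⊗ B) (𝟙 M ⊗ₘ n)
  have h₂ := discard_unitMor h𝕏 hG (P := hat M) (𝟙 M) n
  refine (show _ = G.unitMor (A := A) (f ≫ (𝟙 M ⊗ₘ n) ≫ g) from congrArg G.unitMor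
    (show f ≫ M ◁ n ≫ g = f ≫ (𝟙 M ⊗ₘ n) ≫ g by simp)).trans ?_
  rw [h₁, ← h₂, lensMap_lens, yoneda.map_comp, Category.assoc]
  rfl

omit h𝕏 hG in
variable (G) in
/-- The image of a parallel split of lenses. -/
noncomputable def lensPar {A B D : Splice C} (p : (J).obj A ⟶ (J).obj B ⊗ (J).obj D) :
    𝕏.par.split.el (G.functor.obj A) (G.functor.obj B) (G.functor.obj D) :=
  𝕏.par.split.act (G.lensMap (A := A) (B := B ⊗ D) p) (𝟙 _) (𝟙 _) (G.mapPar.app (𝟙 (B ⊗ D)))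

omit h𝕏 hG in
theorem mor_lensPar {A B D : Splice C} (p : (J).obj A ⟶ (J).obj B ⊗ (J).obj D) :
    𝕏.par.split.mor (G.lensPar p) =
      yoneda.map (G.lensMap (A := A) (B := B ⊗ D) p) ≫ G.parMor (𝟙 (B ⊗ D)) := by
  refine (Split.mor_act _ _ _ _ _).trans ?_
  rw [yoneda.map_id, yoneda.map_id, conv.map_id, Category.comp_id]
  rfl

theorem lensPar_act {A A' B B' D D' : Splice C} (f : (J).obj A' ⟶ (J).obj A)
    (g : (J).obj B ⟶ (J).obj B') (h : (J).obj D ⟶ (J).obj D')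
    (p : (J).obj A ⟶ (J).obj B ⊗ (J).obj D) :
    G.lensPar (f ≫ p ≫ (g ⊗ₘ h)) =
      𝕏.par.split.act (G.lensMap f) (G.lensMap g) (G.lensMap h) (G.lensPar p) := by
  refine Split.mor_injective _ ?_
  rw [Split.mor_act, mor_lensPar, mor_lensPar]
  have h₁ : G.lensMap (A := A') (B := B' ⊗ D') (f ≫ p ≫ (g ⊗ₘ h)) =
      G.lensMap f ≫ G.lensMap (A := A) (B := B ⊗ D) p ≫
        G.lensMap (A := B ⊗ D) (B := B' ⊗ D') (g ⊗ₘ h) :=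
    (lensMap_comp h𝕏 hG (A := A') (B := A) (D := B' ⊗ D') f _).trans
      (congrArg (G.lensMap f ≫ ·) (lensMap_comp h𝕏 hG (A := A) (B := B ⊗ D) (D := B' ⊗ D') p _))
  rw [h₁, yoneda.map_comp, yoneda.map_comp, Category.assoc, Category.assoc, Category.assoc,
    lensMap_comul h𝕏 hG]

theorem lensSeq_act {A A' B B' D D' : Splice C} (f : (J).obj A' ⟶ (J).obj A)
    (g : (J).obj B ⟶ (J).obj B') (h : (J).obj D ⟶ (J).obj D')
    (p : Lens.Seq ((J).obj A) ((J).obj B) ((J).obj D)) :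
    G.lensSeq (actA f (actX g (actY h p))) =
      𝕏.seq.split.act (G.lensMap f) (G.lensMap g) (G.lensMap h) (G.lensSeq p) := by
  rw [lensSeq_actA h𝕏 hG, lensSeq_actX h𝕏 hG, lensSeq_actY h𝕏 hG, Split.act_act, Split.act_act]
  simp only [Category.comp_id, Category.id_comp]

omit h𝕏 hG in
variable (G) in
/-- The image of an element of the parallel unit of lenses. -/
noncomputable def lensUnit {A : Splice C} (j : (J).obj A ⟶ 𝟙_ (Lens C)) :
    𝕏.par.unit.obj (op (G.functor.obj A)) :=
  𝕏.par.unit.map (G.lensMap (A := A) (B := 𝟙_ (Splice C)) j).op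
    (G.mapI.app (op (𝟙_ (Splice C))) (ofUnitHom (D := Splice.seqOver C) (𝟙 _)))

theorem lensUnit_comp {A A' : Splice C} (f : (J).obj A' ⟶ (J).obj A)
    (j : (J).obj A ⟶ 𝟙_ (Lens C)) :
    G.lensUnit (f ≫ j) = 𝕏.par.unit.map (G.lensMap f).op (G.lensUnit j) := by
  rw [lensUnit, lensUnit, ← 𝕏.par.unit.map_comp_apply, ← op_comp]
  exact congrArg (fun t => 𝕏.par.unit.map (Quiver.Hom.op t) (G.mapI.app (op (𝟙_ (Splice C)))
    (ofUnitHom (D := Splice.seqOver C) (𝟙 _))))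
    (lensMap_comp h𝕏 hG (A := A') (B := A) (D := 𝟙_ (Splice C)) f j)

/-- The extension of a functor on spliced arrows to lenses, by discarding residuals. -/
noncomputable def extend : ProFunctor (lenses C) 𝕏 where
  functor :=
    { obj := fun A => G.functor.obj ⟨A.dom, A.cod⟩
      map := fun {A B} l => G.lensMap (A := ⟨A.dom, A.cod⟩) (B := ⟨B.dom, B.cod⟩) l
      map_id := fun A => lensMap_id hG ⟨A.dom, A.cod⟩
      map_comp := fun {A B D} l m => lensMap_comp h𝕏 hG (A := ⟨A.dom, A.cod⟩) (B := ⟨B.dom, B.cod⟩)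
        (D := ⟨D.dom, D.cod⟩) l m }
  mapPar :=
    { app := fun {A B D} p => G.lensPar (A := ⟨A.dom, A.cod⟩) (B := ⟨B.dom, B.cod⟩)
        (D := ⟨D.dom, D.cod⟩) p
      naturality := fun {A A' B B' D D'} f g h p => lensPar_act h𝕏 hG (A := ⟨A.dom, A.cod⟩)
        (A' := ⟨A'.dom, A'.cod⟩) (B := ⟨B.dom, B.cod⟩) (B' := ⟨B'.dom, B'.cod⟩)
        (D := ⟨D.dom, D.cod⟩) (D' := ⟨D'.dom, D'.cod⟩) f g h p }
  mapSeq :=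
    { app := fun {A B D} p =>
        G.lensSeq (A := ⟨A.dom, A.cod⟩) (B := ⟨B.dom, B.cod⟩) (D := ⟨D.dom, D.cod⟩) p
      naturality := fun {A A' B B' D D'} f g h p => lensSeq_act h𝕏 hG (A := ⟨A.dom, A.cod⟩)
        (A' := ⟨A'.dom, A'.cod⟩) (B := ⟨B.dom, B.cod⟩) (B' := ⟨B'.dom, B'.cod⟩)
        (D := ⟨D.dom, D.cod⟩) (D' := ⟨D'.dom, D'.cod⟩) f g h p }
  mapI :=
    { app := fun A => ↾fun j => G.lensUnit (A := ⟨A.unop.dom, A.unop.cod⟩) j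
      naturality := fun A A' f => by
        ext j
        exact lensUnit_comp h𝕏 hG (A := ⟨A.unop.dom, A.unop.cod⟩)
          (A' := ⟨A'.unop.dom, A'.unop.cod⟩) f.unop j }
  mapN :=
    { app := fun A => ↾fun n => G.mapN.app (op (⟨A.unop.dom, A.unop.cod⟩ : Splice C)) n
      naturality := fun A A' f => by
        ext n
        exact lensMap_unit h𝕏 hG (A := ⟨A'.unop.dom, A'.unop.cod⟩)
          (B := ⟨A.unop.dom, A.unop.cod⟩) f.unop n }

end ProFunctor

end Produo

namespace Produo

namespace ProFunctor

section Ext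

variable {V W : Type u} [SmallCategory V] [SmallCategory W] {𝕍 : SymProduoidalData V}
  {𝕎 : SymProduoidalData W}

theorem hext {F F' : ProFunctor 𝕍 𝕎} (obj : ∀ A, F.functor.obj A = F'.functor.obj A)
    (map : ∀ {A B : V} (f : A ⟶ B), F.functor.map f ≍ F'.functor.map f)
    (par : ∀ {A B D : V} (p : 𝕍.par.split.el A B D), F.mapPar.app p ≍ F'.mapPar.app p)
    (seq : ∀ {A B D : V} (p : 𝕍.seq.split.el A B D), F.mapSeq.app p ≍ F'.mapSeq.app p)
    (unitI : ∀ {A : V} (j : 𝕍.par.unit.obj (op A)), F.mapI.app (op A) j ≍ F'.mapI.app (op A) j)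
    (unitN : ∀ {A : V} (n : 𝕍.seq.unit.obj (op A)), F.mapN.app (op A) n ≍ F'.mapN.app (op A) n) :
    F = F' := by
  obtain ⟨G, a, b, c, d⟩ := F
  obtain ⟨G', a', b', c', d'⟩ := F'
  obtain rfl : G = G' := Functor.hext obj fun _ _ f => map f
  exact Contour.proFunctor_congr (fun p => eq_of_heq (par p)) (fun p => eq_of_heq (seq p))
    (fun j => eq_of_heq (unitI j)) (fun n => eq_of_heq (unitN n))

end Ext

open Splice SeqOver Lens

variable {C : Type u} [SmallCategory C] [MonoidalCategory C] [SymmetricCategory C]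
  {X : Type u} [SmallCategory X] {𝕏 : SymProduoidalData X} [IsIso 𝕏.φ₀]

local notation "J" => inclusionFunctor C

section Restriction

variable {G : ProFunctor (spliced C) 𝕏} (h𝕏 : 𝕏.IsSymProduoidal) (hG : G.IsSymProduoidal)
include hG

theorem lensPar_inclusionPar {A B D : Splice C} (p : A ⟶ B ⊗ D) :
    G.lensPar (inclusionPar p) = G.mapPar.app p := by
  have h₁ : G.lensMap (A := A) (B := B ⊗ D) (inclusionPar p) = G.functor.map p :=
    lensMap_map hG (B := B ⊗ D) p
  refine Split.mor_injective _ ?_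
  rw [mor_lensPar, h₁, ← parMor_eq]
  rfl

theorem lensSeq_inclusionSeq {A B D : Splice C} (p : Splice.Seq A B D) :
    G.lensSeq (inclusionSeq p) = G.mapSeq.app p := by
  refine (G.lensSeq_seq (A := A) (B := B) (D := D) _ _ _).trans ?_
  rw [drop_unit hG, drop_unit hG]
  have h := G.mapSeq.naturality (𝟙 A) (λ_ B).hom (λ_ D).hom (⟨p.fst ≫ (λ_ B.dom).inv,
    (λ_ B.cod).hom ≫ p.mid ≫ (λ_ D.dom).inv, (λ_ D.cod).hom ≫ p.snd⟩ :
      Splice.Seq A (𝟙_ (Splice C) ⊗ B) (𝟙_ (Splice C) ⊗ D))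
  rw [G.functor.map_id] at h
  refine h.symm.trans (congrArg G.mapSeq.app (Splice.Seq.ext ?_ ?_ ?_))
  · exact show 𝟙 _ ≫ (p.fst ≫ (λ_ B.dom).inv) ≫ (λ_ B.dom).hom = p.fst by simp
  · exact show (λ_ B.cod).inv ≫ ((λ_ B.cod).hom ≫ p.mid ≫ (λ_ D.dom).inv) ≫ (λ_ D.dom).hom =
      p.mid by simp
  · exact show (λ_ D.cod).inv ≫ ((λ_ D.cod).hom ≫ p.snd) ≫ 𝟙 _ = p.snd by simp

theorem lensUnit_inclusion {A : Splice C} (j : A ⟶ 𝟙_ (Splice C)) :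
    G.lensUnit ((J).map j) = G.mapI.app (op A) (ofUnitHom (D := Splice.seqOver C) j) := by
  rw [lensUnit, lensMap_map hG]
  refine (NatTrans.naturality_apply G.mapI j.op _).symm.trans (congrArg (G.mapI.app (op A)) ?_)
  exact Category.comp_id j

theorem inclusion_comp_extend : (inclusion C).comp (extend h𝕏 hG) = G :=
  hext (fun _ => rfl) (fun f => heq_of_eq (lensMap_map hG f))
    (fun p => heq_of_eq (lensPar_inclusionPar hG p))
    (fun p => heq_of_eq (lensSeq_inclusionSeq hG p))
    (fun j => heq_of_eq (lensUnit_inclusion hG j)) (fun _ => HEq.rfl)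

theorem extend_isSymProduoidal : (extend h𝕏 hG).IsSymProduoidal :=
  (inclusion_covers C).isSymProduoidal_of_comp (inclusion_isSymProduoidal C)
    ((inclusion_comp_extend h𝕏 hG).symm ▸ hG)

end Restriction

section Uniqueness

variable {H : ProFunctor (lenses C) 𝕏} (hH : H.IsSymProduoidal)

omit [IsIso 𝕏.φ₀] in
theorem comp_parMor (A B : Splice C) :
    ((inclusion C).comp H).parMor (𝟙 (A ⊗ B)) =
      𝕏.par.split.mor (H.mapPar.app (𝟙 ((J).obj A ⊗ (J).obj B))) :=
  congrArg (fun t => 𝕏.par.split.mor (H.mapPar.app (A := (J).obj (A ⊗ B)) (B := (J).obj A)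
    (C := (J).obj B) t)) (inclusion_par_id A B)

include hH

theorem pt_mapI_nbar (M : C) :
    pt (F := 𝕏.par.unit) (X := H.functor.obj ((J).obj (hat M)))
      (H.mapI.app (op ((J).obj (hat M))) (nbar M)) =
      ((inclusion C).comp H).resid (P := hat M) (𝟙 M) := by
  have h := hH.sq_φ₀.ptOver (A := (J).obj (hat M)) (nbar M)
  rw [φ₀_nbar] at h
  have key : ∀ {F : Psh X} {s : F ⟶ 𝕏.par.unit} {t : F ⟶ 𝕏.seq.unit}, s ≫ 𝕏.φ₀ = t →
      s = t ≫ inv 𝕏.φ₀ := fun e => (IsIso.eq_comp_inv _).2 e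
  exact key h

theorem map_eps (M : C) (A : Splice C) :
    H.functor.map (eps M A) = ((inclusion C).comp H).drop M A := by
  apply yoneda.map_injective
  refine Eq.trans ?_ (yoneda_discard ((inclusion C).comp H) (P := hat M) (𝟙 M) A).symm
  refine Eq.trans ?_ ((congrArg (· ≫ 𝕏.par.absorb (((inclusion C).comp H).resid (P := hat M) (𝟙 M))
    (yoneda.obj (H.functor.obj ((J).obj A)))) (comp_parMor (H := H) (hat M) A)).trans
    (congrArg (fun t => 𝕏.par.split.mor (H.mapPar.app (𝟙 ((J).obj (hat M) ⊗ (J).obj A))) ≫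
      𝕏.par.absorb t (yoneda.obj (H.functor.obj ((J).obj A)))) (pt_mapI_nbar hH M).symm)).symm
  have h := (hH.par.sq_left (yonedaMap H.functor ((J).obj A))).ptOver (A := (J).obj (hat M ⊗ A))
    ((Lens.seqOver C).pmk (F := (lenses C).par.unit) (G := yoneda.obj ((J).obj A))
      (𝟙 ((J).obj (hat M) ⊗ (J).obj A)) (nbar M) (𝟙 ((J).obj A)))
  have h₁ : nbar M ▷ (J).obj A ≫ (λ_ ((J).obj A)).hom = eps M A := nbar_whiskerRight M A
  have h₂ : ((lenses C).par.leftExt (yoneda.obj ((J).obj A))).app (op ((J).obj (hat M ⊗ A)))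
      ((Lens.seqOver C).pmk (F := (lenses C).par.unit) (G := yoneda.obj ((J).obj A))
      (𝟙 ((J).obj (hat M) ⊗ (J).obj A)) (nbar M) (𝟙 ((J).obj A))) = eps M A := by
    refine Eq.trans (?_ : _ = (𝟙 ((J).obj (hat M) ⊗ (J).obj A) ≫ (nbar M ⊗ₘ 𝟙 ((J).obj A)) ≫
      (λ_ ((J).obj A)).hom) ≫ 𝟙 ((J).obj A)) ?_
    · rfl
    · rw [Category.id_comp, Category.comp_id, MonoidalCategory.tensorHom_id, h₁]
  rw [h₂] at h
  refine (ptOver_yonedaMap H.functor (eps M A)).symm.trans (h.symm.trans ?_)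
  have h₃ := H.mapPar.ptOver_conv (P := (lenses C).par.split) (𝟙 ((J).obj (hat M) ⊗ (J).obj A))
    H.mapI (yonedaMap H.functor ((J).obj A)) (nbar M) (𝟙 ((J).obj A))
  refine (congrArg (· ≫ 𝕏.par.leftExt _) h₃).trans ?_
  rw [Category.assoc, ptOver_yonedaMap, H.functor.map_id, yoneda.map_id]
  rfl

theorem map_eq_lensMap {A B : Splice C} (l : (J).obj A ⟶ (J).obj B) :
    H.functor.map l = ((inclusion C).comp H).lensMap l := by
  obtain ⟨M, a, rfl⟩ := exists_map_comp_eps l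
  rw [map_lensMap, lensMap_eps, H.functor.map_comp, map_eps hH]
  rfl

theorem mapPar_eq_lensPar {A B D : Splice C} (p : (J).obj A ⟶ (J).obj B ⊗ (J).obj D) :
    H.mapPar.app p = ((inclusion C).comp H).lensPar p := by
  refine Split.mor_injective _ ?_
  refine Eq.trans ?_ (mor_lensPar (G := (inclusion C).comp H) p).symm
  refine Eq.trans ?_ (congrArg₂ (fun s t => yoneda.map s ≫ t)
    (map_eq_lensMap hH (A := A) (B := B ⊗ D) p) (comp_parMor B D).symm)
  have h := (congrArg 𝕏.par.split.mor (H.mapPar.naturality p (𝟙 ((J).obj B)) (𝟙 ((J).obj D))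
    (𝟙 ((J).obj B ⊗ (J).obj D)))).trans (Split.mor_act _ _ _ _ _)
  rw [H.functor.map_id, H.functor.map_id, yoneda.map_id, yoneda.map_id, conv.map_id,
    Category.comp_id] at h
  refine Eq.trans (congrArg (fun t => 𝕏.par.split.mor (H.mapPar.app (A := (J).obj A)
    (B := (J).obj B) (C := (J).obj D) t)) (?_ : _ = p ≫ 𝟙 ((J).obj B ⊗ (J).obj D) ≫
      (𝟙 ((J).obj B) ⊗ₘ 𝟙 ((J).obj D)))) h
  simp

theorem mapSeq_eq_lensSeq {A B D : Splice C}
    (p : Lens.Seq ((J).obj A) ((J).obj B) ((J).obj D)) :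
    H.mapSeq.app p = ((inclusion C).comp H).lensSeq p := by
  induction p using seq_ind with
  | @h M N f m s =>
  refine (congrArg H.mapSeq.app (act_eps_inclusionSeq (A := A) (X := B) (Y := D) f m s).symm).trans
    ((H.mapSeq.naturality _ _ _ _).trans ?_)
  rw [H.functor.map_id, map_eps hH, map_eps hH]
  rfl

theorem mapI_eq_lensUnit {A : Splice C} (j : (J).obj A ⟶ 𝟙_ (Lens C)) :
    H.mapI.app (op ((J).obj A)) j = ((inclusion C).comp H).lensUnit j := by
  have h := NatTrans.naturality_apply H.mapI (Quiver.Hom.op j) (𝟙 (𝟙_ (Lens C)))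
  refine (congrArg (H.mapI.app (op ((J).obj A))) (Category.comp_id j).symm).trans (h.trans ?_)
  refine (congrArg (fun t => 𝕏.par.unit.map (Quiver.Hom.op t) _)
    (map_eq_lensMap hH (A := A) (B := 𝟙_ (Splice C)) j)).trans ?_
  exact congrArg (fun t => 𝕏.par.unit.map
    (((inclusion C).comp H).lensMap (A := A) (B := 𝟙_ (Splice C)) j).op
      (H.mapI.app (op (𝟙_ (Lens C))) t)) (pair_id (𝟙_ (Lens C))).symm

end Uniqueness

theorem eq_extend {G : ProFunctor (spliced C) 𝕏} (h𝕏 : 𝕏.IsSymProduoidal)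
    (hG : G.IsSymProduoidal) {H : ProFunctor (lenses C) 𝕏} (hH : H.IsSymProduoidal)
    (h : (inclusion C).comp H = G) : H = extend h𝕏 hG := by
  subst h
  exact hext (fun _ => rfl)
    (fun {A B} f => heq_of_eq
      (map_eq_lensMap hH (A := ⟨A.dom, A.cod⟩) (B := ⟨B.dom, B.cod⟩) f))
    (fun {A B D} p => heq_of_eq (mapPar_eq_lensPar hH (A := ⟨A.dom, A.cod⟩)
      (B := ⟨B.dom, B.cod⟩) (D := ⟨D.dom, D.cod⟩) p))
    (fun {A B D} p => heq_of_eq (mapSeq_eq_lensSeq hH (A := ⟨A.dom, A.cod⟩)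
      (B := ⟨B.dom, B.cod⟩) (D := ⟨D.dom, D.cod⟩) p))
    (fun {A} j => heq_of_eq (mapI_eq_lensUnit hH (A := ⟨A.dom, A.cod⟩) j))
    (fun _ => HEq.rfl)

end ProFunctor

/-- Monoidal lenses are the free symmetric normalization of spliced monoidal arrows. -/
theorem inclusion_isFreeNormalization (C : Type u) [SmallCategory C] [MonoidalCategory C]
    [SymmetricCategory C] : IsFreeNormalization (inclusion C) where
  laws := lenses_isSymProduoidal C
  normal := Lens.lenses_isNormal C
  functor_laws := inclusion_isSymProduoidal C
  universal 𝕏 h𝕏 hn G hG := by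
    have : IsIso 𝕏.φ₀ := hn
    exact ⟨ProFunctor.extend h𝕏 hG, ⟨ProFunctor.extend_isSymProduoidal h𝕏 hG,
      ProFunctor.inclusion_comp_extend h𝕏 hG⟩, fun H hH => ProFunctor.eq_extend h𝕏 hG hH.1 hH.2⟩

end Produo

theorem mainTheorem2 (C : Type u) [SmallCategory C] [MonoidalCategory C] [SymmetricCategory C] :
    -- spliced monoidal arrows are the cofree symmetric produoidal category
    ((Produo.spliced C).IsSymProduoidal ∧
      (∀ (D : Type u) [SmallCategory D] [MonoidalCategory D] [SymmetricCategory D]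
        (K : D ⥤ C) [K.Braided], Produo.IsStrict K → (Produo.spliceMap K).IsSymProduoidal) ∧
      ∀ (V : Type u) [SmallCategory V] (𝕍 : Produo.SymProduoidalData V), 𝕍.IsSymProduoidal →
        ∃ (D : Type u) (_ : SmallCategory D) (_ : MonoidalCategory D) (_ : SymmetricCategory D)
          (η : Produo.ProFunctor 𝕍 (Produo.spliced D)), Produo.IsContour 𝕍 η) ∧
    -- monoidal lenses are its free symmetric normalization
    Produo.IsFreeNormalization (Produo.inclusion C) ∧
    -- and they are computed by the symmetric normalization of spliced monoidal arrows
    ∃ _ : IsIso (Produo.lenses C).φ₀, (Produo.inclusion C).IsKleisli := by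
  have : IsIso (Produo.lenses C).φ₀ := Produo.Lens.lenses_isNormal C
  exact ⟨⟨Produo.Splice.spliced_isSymProduoidal C,
    fun D _ _ _ K _ _ => Produo.spliceMap_isSymProduoidal K,
    fun V _ 𝕍 _ => ⟨Produo.Contour 𝕍, inferInstance, inferInstance, inferInstance,
      Produo.Contour.univ 𝕍, Produo.Contour.univ_isContour 𝕍⟩⟩,
    Produo.inclusion_isFreeNormalization C, this, Produo.inclusion_isKleisli C⟩
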